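/- **Setting.** For $N\ge 1$ let $H=(h_{ij})$ be a random real symmetric $N\times N$ matrix whose entries $h_{ij}$, $i\le j$, are independent, with $$\mathbb E h_{ij}=0,\qquad \mathbb E|h_{ij}|^2=\frac1N,\qquad \mathbb E|h_{ij}|^p\le \frac{C_m^p}{Nq^{p-2}}\quad\text{for all integers } 3\le p\le(\log N)^{A_0\log\log N},$$ where $$(\log N)^{3\xi}\le q\le C_qN^{1/2},\qquad 1+a_0\le \xi\le A_0\log\log N .$$ Here $C_m,C_q,a_0>0$ and $A_0\ge 10$ are constants, while $q$, $\xi$ and $f$ below may depend on $N$. Put $\mathbf e=N^{-1/2}(1,\dots,1)^T$ and $A=H+f\,|\mathbf e\rangle\langle\mathbf e|$, where $f$ is deterministic with $$1+\varepsilon_0\le f\le N^{C_f}$$ for constants $\varepsilon_0,C_f>0$. Let $\mu_{\max}$ be the largest eigenvalue of $A$ and $\mathbf v_{\max}$ a corresponding real eigenvector with $\|\mathbf v_{\max}\|_2=1$. An event $\Omega$ is said to hold with high probability if $\mathbb P(\Omega^c)\le e^{-\nu(\log N)^\xi}$ for all $N\ge N_0$. Here $\nu>0$ depends only on $C_m,C_q$.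 The number $N_0$, the constants in $O(\cdot)$, the rate in $o(1)$ (as $N\to\infty$) and the constant $C_0>0$ below depend only on $C_m,C_q,a_0,A_0,C_f,\varepsilon_0$. **Theorem.** The following hold. 1. With high probability, $\mu_{\max}=f+\frac1f+o(1)$. 2. There is a constant $c>0$, depending only on $\varepsilon_0$, such that $\mu_{\max}\ge 2+c$ with high probability. 3. For $N\ge N_0$, $\mu_{\max}$ is integrable and $$\mathbb E\mu_{\max}=f+\frac1f+O\Big(\frac1{f^3}+\frac1{f^2q}+\frac1{fN}\Big).$$ 4. With high probability, $$\mu_{\max}=f+\frac1f+O\Big(\frac1{f^3}+\frac1{f^2q}+\frac{(\log N)^\xi}{\sqrt N}\Big).$$ 5. With high probability, every $\mathbf v_{\max}$ satisfies, after multiplication by a suitable sign $\pm1$, $$\langle\mathbf v_{\max},\mathbf e\rangle=1-\frac1{2f^2}+O\Big(\frac1{f^3}+\frac{(\log N)^{2\xi}}{f\sqrt N}\Big).$$ 6. There is a constant $C_0>0$ such that if $f\ge C_0(\log N)^{2\xi}$ and $\xi\ge2$, then with high probability $$\mu_{\max}=\mathbb E\mu_{\max}+\frac1N\sum_{i,j}h_{ij}+O\Big(\frac{(\log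 N)^{2\xi}}{f\sqrt N}\Big).$$ 7. Along any sequence of such matrices with the same constants, with $N\to\infty$, $f\ge C_0(\log N)^{2\xi}$ and $\xi\ge2$ ($C_0$ as in 6), the random variable $\sqrt{N/2}\,(\mu_{\max}-\mathbb E\mu_{\max})$ converges in distribution to a standard normal random variable. -/

import Mathlib

open MeasureTheory ProbabilityTheory Filter Topology

namespace SparseRM

/-- The largest eigenvalue of a real square matrix: the largest element of its (finite) real
spectrum. It is used for symmetric matrices of positive size, whose spectrum is nonempty. -/
noncomputable def maxEigenvalue {N : ℕ} (A : Matrix (Fin N) (Fin N) ℝ) : ℝ :=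
  sSup (spectrum ℝ A)

/-- The unit vector `e = N^{-1/2} (1, …, 1)`. -/
noncomputable def unitVec (N : ℕ) : Fin N → ℝ := fun _ => 1 / Real.sqrt N

/-- The rank-one perturbation `A = H + f |e⟩⟨e|`; all entries of `|e⟩⟨e|` equal `e_i e_j = 1 / N`. -/
noncomputable def perturbed {N : ℕ} (f : ℝ) (H : Matrix (Fin N) (Fin N) ℝ) :
    Matrix (Fin N) (Fin N) ℝ :=
  H + f • Matrix.vecMulVec (unitVec N) (unitVec N)

/-- The bounds `1 + a₀ ≤ ξ ≤ A₀ log log N` on the exponent `ξ`. -/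
def XiBounds (a₀ A₀ : ℝ) (N : ℕ) (ξ : ℝ) : Prop :=
  1 + a₀ ≤ ξ ∧ ξ ≤ A₀ * Real.log (Real.log N)

/-- The event `E` satisfies the `(ξ, ν)`-high probability bound at size `N`:
`P(Eᶜ) ≤ exp (-ν (log N)^ξ)`. -/
def HighProb {Ω : Type*} [MeasurableSpace Ω] (P : Measure Ω) (N : ℕ) (ξ ν : ℝ) (E : Set Ω) :
    Prop :=
  P.real Eᶜ ≤ Real.exp (-ν * (Real.log N) ^ ξ)

/-- The class of sparse random matrices `H`: real symmetric `N × N` matrices with independent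
entries (up to symmetry), mean zero, variance `1 / N`, and
`E |h_ij|^p ≤ Cm^p / (N q^(p-2))` for `3 ≤ p ≤ (log N)^(A₀ log log N)`, where
`(log N)^(3ξ) ≤ q ≤ Cq N^(1/2)`. -/
structure IsSparseMatrix {Ω : Type*} [MeasurableSpace Ω] (P : Measure Ω) (A₀ Cm Cq : ℝ)
    (N : ℕ) (ξ q : ℝ) (H : Ω → Matrix (Fin N) (Fin N) ℝ) : Prop where
  measurable : ∀ i j, Measurable fun ω => H ω i j
  symm : ∀ ω i j, H ω i j = H ω j i
  indep : iIndepFun (fun (s : {s : Fin N × Fin N // s.1 ≤ s.2}) ω => H ω s.1.1 s.1.2) P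
  memLp_two : ∀ i j, MemLp (fun ω => H ω i j) 2 P
  mean : ∀ i j, ∫ ω, H ω i j ∂P = 0
  variance : ∀ i j, ∫ ω, |H ω i j| ^ 2 ∂P = 1 / N
  integrable_pow : ∀ p : ℕ, 3 ≤ p → (p : ℝ) ≤ (Real.log N) ^ (A₀ * Real.log (Real.log N)) →
    ∀ i j, Integrable (fun ω => |H ω i j| ^ p) P
  moment : ∀ p : ℕ, 3 ≤ p → (p : ℝ) ≤ (Real.log N) ^ (A₀ * Real.log (Real.log N)) →
    ∀ i j, ∫ ω, |H ω i j| ^ p ∂P ≤ Cm ^ p / (N * q ^ (p - 2))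
  q_lower : (Real.log N) ^ (3 * ξ) ≤ q
  q_upper : q ≤ Cq * Real.sqrt N

/-- The standing assumptions at size `N`: `ξ` obeys its bounds, `H` is a sparse random matrix, and
the strength `f` of the perturbation satisfies `1 + ε₀ ≤ f ≤ N^Cf`. -/
structure Admissible {Ω : Type*} [MeasurableSpace Ω] (P : Measure Ω) (a₀ A₀ Cm Cq Cf ε₀ : ℝ)
    (N : ℕ) (ξ q f : ℝ) (H : Ω → Matrix (Fin N) (Fin N) ℝ) : Prop where
  xi : XiBounds a₀ A₀ N ξ
  sparse : IsSparseMatrix P A₀ Cm Cq N ξ q H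
  f_lower : 1 + ε₀ ≤ f
  f_upper : f ≤ (N : ℝ) ^ Cf

end SparseRM

/-! Put `L = (log N) ^ ξ`. The bounds on `ξ` make `L` much larger than `log N` but smaller than
every power of `N`, so that powers of `N` are negligible against `exp L`. All estimates are proved
for such pairs `(N, L)`, along the filter `regime`. Truncating the entries at a level `θ` of order
`1 / q` and recentring them costs only `exp (-L)` (`eventually_isApproximation`), so the entries may
be taken bounded by `θ`.

The perturbation enters through the secular equation `⟨e, (μ - H)⁻¹ e⟩ = 1 / f`, valid once `μ >
‖H‖` (`isSecular_of_top`). For large `f` and `‖H‖ ≤ 3` the resolvent is a Neumann series, and with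
`h_k = ⟨e, H ^ k e⟩` one gets `μ = f + h_1 + h_2 / f + h_3 / f ^ 2 + O(1 / f ^ 3 + h_1 ^ 2 / f)`
(`strong_expansion`). The means of `h_1`, `h_2`, `h_3` are `0`, `1 + O(1 / N)` and `O(1 / q)`; the
norm of the solution of the secular equation gives the overlap with `e` (`strong_overlap`). The
`n`-th central moment of `h_k` is a sum over `n`-tuples of walks in which every walk must share an
edge with another one. Their union then has at most `n / 2` components, so it has at most `n / 2`
more vertices than edges, and the moment is of order `N ^ (-n / 2)`
(`CenteredEnsemble.abs_integral_eMoment_sub_pow_le`).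

The norm of `H` is bounded through walks that do not backtrack. As the row sums of `h_ij ^ 2` are
close to `1`, the sums over such walks nearly satisfy the Chebyshev recursion, and the sum of length
`l` is nearly `U_l(H)` (`norm_nbVec_sub_cheb_le`). If `‖H‖ ≥ a + 1 / a` with `a > 1`, then `U_l(H)`
has norm at least `a ^ l`, whereas the second moment of the nonbacktracking sums is at most a power
of `N` times `(1 + o(1)) ^ (2 l)` (`CenteredEnsemble.sum_integral_nbSum_sq_le`). Taking `l` of order
`L` leaves an exponentially small probability. The moment count follows a walk step by step with a
potential that pays for every ambiguous choice of an edge to be used a second time (`nbBound_le`).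

For `f` close to `1` powers of `H` are useless, since `f + 1 / f` is barely larger than `‖H‖`, which
is about `2`. Instead `(s + 1 / s - H)⁻¹ = ∑ s ^ (-k-1) U_k(H)`, and `⟨e, U_k(H) e⟩` is small for `k
≥ 1`, again by comparison with nonbacktracking walks. Hence `⟨e, (s + 1 / s - H)⁻¹ e⟩` is nearly `1
/ s`, and the secular equation forces `s` to be close to `f` (`weak_expansion`).

For the fluctuations, the secular equations at two sample points are subtracted
(`secular_difference`) and one point is averaged out. This shows that `μ - E μ - h_1` is small,
pointwise and in `L¹` (`eventually_nonlinearPart_le`). The linear statistic `h_1` is a sum of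
independent variables, and its characteristic function is computed directly. -/

namespace SparseRM

/-! ### The equation for the top eigenvalue of a rank-one perturbation -/

section Operator

variable {E : Type*} [NormedAddCommGroup E] [InnerProductSpace ℝ E]

/-- `(μ, w)` solves the secular equation `(μ - T) w = e`, `⟨e, w⟩ = 1 / f`, of the perturbation
of `T` by `f |e⟩⟨e|`. -/
structure IsSecular (T : E →L[ℝ] E) (e : E) (f μ : ℝ) (w : E) : Prop where
  eq : μ • w = T w + e
  inner_eq : inner ℝ e w = 1 / f

theorem IsSecular.norm_le {T : E →L[ℝ] E} {e w : E} {f μ ρ : ℝ} (h : IsSecular T e f μ w)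
    (he : ‖e‖ = 1) (hT : ‖T‖ ≤ ρ) (hμ : ρ < μ) : ‖w‖ ≤ 1 / (μ - ρ) := by
  have h0 : 0 ≤ ρ := (norm_nonneg _).trans hT
  have h1 : ‖μ • w‖ ≤ ρ * ‖w‖ + 1 := by
    rw [h.eq]
    refine (norm_add_le _ _).trans ?_
    rw [he]
    gcongr
    exact (T.le_opNorm w).trans (by gcongr)
  rw [norm_smul, Real.norm_of_nonneg (h0.trans hμ.le)] at h1
  rw [le_div_iff₀ (by linarith)]
  linarith

theorem norm_pow_apply_le {T : E →L[ℝ] E} {ρ : ℝ} (hT : ‖T‖ ≤ ρ) (k : ℕ) (x : E) :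
    ‖(T ^ k) x‖ ≤ ρ ^ k * ‖x‖ := by
  induction k with
  | zero => simp
  | succ k ih =>
    rw [pow_succ', mul_apply_eq_comp, pow_succ', mul_assoc]
    exact (T.le_opNorm _).trans (mul_le_mul hT ih (norm_nonneg _) ((norm_nonneg _).trans hT))

theorem abs_inner_pow_le {T : E →L[ℝ] E} {ρ : ℝ} (hT : ‖T‖ ≤ ρ) {e : E} (he : ‖e‖ = 1) (k : ℕ) :
    |inner ℝ e ((T ^ k) e)| ≤ ρ ^ k := by
  refine (abs_real_inner_le_norm _ _).trans ?_
  have := norm_pow_apply_le hT k e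
  rw [he] at this ⊢
  linarith

/-- Iterating `w = μ⁻¹ (T w + e)` gives the Neumann series with an exact remainder, so `μ - T` never
has to be inverted. -/
theorem IsSecular.expand {T : E →L[ℝ] E} {e w : E} {f μ : ℝ} (h : IsSecular T e f μ w)
    (hμ : μ ≠ 0) (k : ℕ) :
    w = ∑ j ∈ Finset.range k, (μ⁻¹) ^ (j + 1) • (T ^ j) e + (μ⁻¹) ^ k • (T ^ k) w := by
  induction k with
  | zero => simp
  | succ k ih =>
    have h1 : w = μ⁻¹ • (T w + e) := by rw [← h.eq, smul_smul, inv_mul_cancel₀ hμ, one_smul]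
    have h2 : (T ^ k) w = μ⁻¹ • ((T ^ (k + 1)) w + (T ^ k) e) := by
      conv_lhs => rw [h1]
      rw [map_smul, map_add, pow_succ]
      rfl
    rw [Finset.sum_range_succ]
    nth_rewrite 1 [ih]
    rw [h2, smul_smul, smul_add, ← pow_succ]
    abel

theorem IsSecular.norm_sub_sum_le {T : E →L[ℝ] E} {e w : E} {f μ ρ : ℝ} (h : IsSecular T e f μ w)
    (he : ‖e‖ = 1) (hT : ‖T‖ ≤ ρ) (hμ : ρ < μ) (k : ℕ) :
    ‖w - ∑ j ∈ Finset.range k, (μ⁻¹) ^ (j + 1) • (T ^ j) e‖ ≤ (ρ / μ) ^ k / (μ - ρ) := by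
  have h0 : 0 ≤ ρ := (norm_nonneg _).trans hT
  have hμ0 : 0 < μ := h0.trans_lt hμ
  have h1 : w - ∑ j ∈ Finset.range k, (μ⁻¹) ^ (j + 1) • (T ^ j) e = (μ⁻¹) ^ k • (T ^ k) w := by
    rw [sub_eq_iff_eq_add, add_comm]; exact h.expand hμ0.ne' k
  rw [h1, norm_smul, Real.norm_of_nonneg (by positivity)]
  calc (μ⁻¹) ^ k * ‖(T ^ k) w‖ ≤ (μ⁻¹) ^ k * (ρ ^ k * (1 / (μ - ρ))) := by
        gcongr
        exact (norm_pow_apply_le hT k w).trans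
          (mul_le_mul_of_nonneg_left (h.norm_le he hT hμ) (by positivity))
    _ = _ := by rw [div_pow, inv_pow]; field_simp

theorem IsSecular.abs_sub_sum_le {T : E →L[ℝ] E} {e w : E} {f μ ρ : ℝ} (h : IsSecular T e f μ w)
    (he : ‖e‖ = 1) (hT : ‖T‖ ≤ ρ) (hμ : ρ < μ) (k : ℕ) :
    |1 / f - ∑ j ∈ Finset.range k, inner ℝ e ((T ^ j) e) * (μ⁻¹) ^ (j + 1)| ≤
      (ρ / μ) ^ k / (μ - ρ) := by
  have h1 : 1 / f - ∑ j ∈ Finset.range k, inner ℝ e ((T ^ j) e) * (μ⁻¹) ^ (j + 1) =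
      inner ℝ e (w - ∑ j ∈ Finset.range k, (μ⁻¹) ^ (j + 1) • (T ^ j) e) := by
    rw [inner_sub_right, h.inner_eq, inner_sum]
    simp only [inner_smul_right, mul_comm]
  rw [h1]
  refine (abs_real_inner_le_norm _ _).trans ?_
  rw [he, one_mul]
  exact h.norm_sub_sum_le he hT hμ k

end Operator

/-! ### Expansion for a strong perturbation -/

theorem abs_div_sub_one_div_le {f d h1 : ℝ} {μ : ℝ} (hf : 20 ≤ f) (hμ : μ = f + d) (hd3 : |d| ≤ 3)
    (hd : |d| ≤ 2 * |h1| + 30 / f) :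
    |f / μ ^ 2 - 1 / f| ≤ 6 * |h1| / f ^ 2 + 90 / f ^ 3 := by
  have hμ0 : 17 / 20 * f ≤ μ := by rw [hμ]; have := (abs_le.1 hd3).1; linarith
  have hμp : 0 < μ := by linarith
  have hμu : μ ≤ 23 / 20 * f := by rw [hμ]; have := (abs_le.1 hd3).2; linarith
  have e1 : f / μ ^ 2 - 1 / f = -(d * ((f + μ) / (f * μ ^ 2))) := by
    field_simp; rw [hμ]; ring
  rw [e1, abs_neg, abs_mul, abs_of_nonneg (show 0 ≤ (f + μ) / (f * μ ^ 2) by positivity)]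
  have e2 : (f + μ) / (f * μ ^ 2) ≤ 3 / f ^ 2 := by
    rw [div_le_div_iff₀ (by positivity) (by positivity)]
    have : (17 / 20 * f) ^ 2 ≤ μ ^ 2 := by gcongr
    nlinarith [mul_le_mul_of_nonneg_left this (show 0 ≤ f by linarith), sq_nonneg f]
  calc |d| * ((f + μ) / (f * μ ^ 2)) ≤ (2 * |h1| + 30 / f) * (3 / f ^ 2) := by gcongr
    _ = _ := by field_simp; ring

/-- Here `h1`, `h2`, `h3` stand for `⟨e, H ^ k e⟩`. Multiplied by `f * μ`, the truncated secular
equation expresses `μ - f` through `h1 * (f / μ)`, `h2 * (f / μ ^ 2)` and `h3 * (f / μ ^ 3)`. This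
first yields the crude location of `μ`, which is then fed back to replace `μ` by `f` in these
coefficients. The error `h1 ^ 2 / f` comes from `h1 * (f / μ)`. -/
theorem abs_sub_expansion_le {f μ h1 h2 h3 : ℝ} (hf : 20 ≤ f) (hμl : f - 3 ≤ μ) (hμu : μ ≤ f + 3)
    (hh2 : |h2| ≤ 9) (hh3 : |h3| ≤ 27)
    (h : |1 / f - (μ⁻¹ + h1 * μ⁻¹ ^ 2 + h2 * μ⁻¹ ^ 3 + h3 * μ⁻¹ ^ 4)| ≤ (3 / μ) ^ 4 / (μ - 3)) :
    |μ - f| ≤ 2 * |h1| + 30 / f ∧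
    |μ - (f + h1 + h2 / f + h3 / f ^ 2)| ≤ 10000 * (1 / f ^ 3 + h1 ^ 2 / f) := by
  have hμ0 : 17 / 20 * f ≤ μ := by linarith
  have hμp : 0 < μ := by linarith
  have hf0 : 0 < f := by linarith
  set d := μ - f with hd
  have hd3 : |d| ≤ 3 := abs_le.2 ⟨by linarith, by linarith⟩
  obtain ⟨r, hr⟩ : ∃ r, r = f * μ * (1 / f - (μ⁻¹ + h1 * μ⁻¹ ^ 2 + h2 * μ⁻¹ ^ 3 + h3 * μ⁻¹ ^ 4)) :=
    ⟨_, rfl⟩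
  have key : d = h1 * (f / μ) + h2 * (f / μ ^ 2) + h3 * (f / μ ^ 3) + r := by
    rw [hr, hd]; field_simp; ring
  have i1 : f / μ ≤ 20 / 17 := by rw [div_le_div_iff₀ hμp (by norm_num)]; linarith
  have i2 : f / μ ^ 2 ≤ (20 / 17) ^ 2 / f := by
    have : f / μ ^ 2 = (f / μ) ^ 2 / f := by field_simp
    rw [this]; gcongr
  have i3 : f / μ ^ 3 ≤ (20 / 17) ^ 3 / f ^ 2 := by
    have : f / μ ^ 3 = (f / μ) ^ 3 / f ^ 2 := by field_simp
    rw [this]; gcongr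
  have hrb : |r| ≤ 200 / f ^ 3 := by
    rw [hr, abs_mul, abs_of_nonneg (by positivity)]
    calc f * μ * |_| ≤ f * μ * ((3 / μ) ^ 4 / (μ - 3)) := by gcongr
      _ = 81 * ((f / μ) ^ 3 * (f / (μ - 3))) / f ^ 3 := by
          have : μ - 3 ≠ 0 := by linarith
          field_simp; norm_num
      _ ≤ 81 * ((20 / 17) ^ 3 * (20 / 14)) / f ^ 3 := by
          have : f / (μ - 3) ≤ 20 / 14 := by
            rw [div_le_div_iff₀ (by linarith) (by norm_num)]; linarith
          have : 0 ≤ f / (μ - 3) := div_nonneg hf0.le (by linarith)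
          gcongr
      _ ≤ 200 / f ^ 3 := by gcongr; norm_num
  have hfi : 1 / f ≤ 1 / 20 := one_div_le_one_div_of_le (by norm_num) hf
  have hfi2 : 1 / f ^ 2 ≤ 1 / 20 * (1 / f) := by
    have : 1 / f ^ 2 = 1 / f * (1 / f) := by field_simp
    rw [this]; gcongr
  have hfi3 : 1 / f ^ 3 ≤ 1 / 20 * (1 / f ^ 2) := by
    have : 1 / f ^ 3 = 1 / f * (1 / f ^ 2) := by field_simp
    rw [this]; gcongr
  have hfp : 0 < 1 / f := by positivity
  have b1 : |h1 * (f / μ)| ≤ 2 * |h1| := by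
    rw [abs_mul, abs_of_nonneg (show 0 ≤ f / μ by positivity)]
    nlinarith [abs_nonneg h1]
  have b2 : |h2 * (f / μ ^ 2)| ≤ 9 * ((20 / 17) ^ 2 / f) := by
    rw [abs_mul, abs_of_nonneg (show 0 ≤ f / μ ^ 2 by positivity)]; gcongr
  have b3 : |h3 * (f / μ ^ 3)| ≤ 27 * ((20 / 17) ^ 3 / f ^ 2) := by
    rw [abs_mul, abs_of_nonneg (show 0 ≤ f / μ ^ 3 by positivity)]; gcongr
  have tri : ∀ a b c e : ℝ, |a + b + c + e| ≤ |a| + |b| + |c| + |e| := fun a b c e => by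
    have := abs_add_three a b c
    have := abs_add_le (a + b + c) e
    linarith
  have c30 : 30 / f = 30 * (1 / f) := by ring
  have hdd : |d| ≤ 2 * |h1| + 30 / f := by
    rw [key]
    have := tri (h1 * (f / μ)) (h2 * (f / μ ^ 2)) (h3 * (f / μ ^ 3)) r
    have c1 : 9 * ((20 / 17) ^ 2 / f) = 3600 / 289 * (1 / f) := by ring
    have c2 : 27 * ((20 / 17) ^ 3 / f ^ 2) = 216000 / 4913 * (1 / f ^ 2) := by ring
    have c3 : 200 / f ^ 3 = 200 * (1 / f ^ 3) := by ring
    rw [c1] at b2; rw [c2] at b3; rw [c3] at hrb; rw [c30]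
    linarith
  refine ⟨hdd, ?_⟩
  have hq := abs_div_sub_one_div_le (μ := μ) (d := d) hf (by rw [hd]; ring) hd3 hdd
  have hq3 : |f / μ ^ 3 - 1 / f ^ 2| ≤ 20 / f ^ 3 := by
    have e1 : f / μ ^ 3 - 1 / f ^ 2 = -(d * ((f ^ 2 + f * μ + μ ^ 2) / (f ^ 2 * μ ^ 3))) := by
      rw [hd]; field_simp; ring
    rw [e1, abs_neg, abs_mul,
      abs_of_nonneg (show 0 ≤ (f ^ 2 + f * μ + μ ^ 2) / (f ^ 2 * μ ^ 3) by positivity)]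
    have e2 : (f ^ 2 + f * μ + μ ^ 2) / (f ^ 2 * μ ^ 3) =
        (f / μ + (f / μ) ^ 2 + (f / μ) ^ 3) / f ^ 3 := by field_simp; ring
    have e3 : f / μ + (f / μ) ^ 2 + (f / μ) ^ 3 ≤ 20 / 17 + (20 / 17) ^ 2 + (20 / 17) ^ 3 := by
      gcongr
    rw [e2, ← mul_div_assoc]
    gcongr
    calc |d| * (f / μ + (f / μ) ^ 2 + (f / μ) ^ 3)
        ≤ 3 * (20 / 17 + (20 / 17) ^ 2 + (20 / 17) ^ 3) := by gcongr
      _ ≤ 20 := by norm_num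
  have e : μ - (f + h1 + h2 / f + h3 / f ^ 2) = -(h1 * d / μ) + h2 * (f / μ ^ 2 - 1 / f) +
      h3 * (f / μ ^ 3 - 1 / f ^ 2) + r := by
    have : f / μ = 1 - d / μ := by rw [hd]; field_simp; ring
    have h5 : μ = f + d := by rw [hd]; ring
    rw [this] at key
    linear_combination h5 + key
  rw [e]
  refine (tri _ _ _ _).trans ?_
  have t1 : |(-(h1 * d / μ))| ≤ |h1| * (2 * |h1| + 30 / f) * (20 / 17 * (1 / f)) := by
    rw [abs_neg, abs_div, abs_mul, abs_of_pos hμp, div_eq_mul_one_div]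
    gcongr
    rw [div_mul_div_comm, div_le_div_iff₀ hμp (by positivity)]
    linarith
  have t2 : |h2 * (f / μ ^ 2 - 1 / f)| ≤ 9 * (6 * |h1| / f ^ 2 + 90 / f ^ 3) := by
    rw [abs_mul]; gcongr
  have t3 : |h3 * (f / μ ^ 3 - 1 / f ^ 2)| ≤ 27 * (20 / f ^ 3) := by
    rw [abs_mul]; gcongr
  -- Completing the square absorbs the mixed term `|h1| / f ^ 2` into the two errors allowed by the
  -- statement.
  have t4 : |h1| / f ^ 2 ≤ h1 ^ 2 / f + 1 / f ^ 3 := by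
    have : h1 ^ 2 / f + 1 / f ^ 3 - |h1| / f ^ 2 =
        ((|h1| - 1 / f / 2) ^ 2 + 3 / 4 * (1 / f) ^ 2) / f := by
      rw [← sq_abs h1]; field_simp; ring
    have : 0 ≤ h1 ^ 2 / f + 1 / f ^ 3 - |h1| / f ^ 2 := by rw [this]; positivity
    linarith
  have t5 : |h1| * (2 * |h1| + 30 / f) * (20 / 17 * (1 / f)) =
      40 / 17 * (h1 ^ 2 / f) + 600 / 17 * (|h1| / f ^ 2) := by
    rw [← sq_abs h1]; field_simp; ring
  have t6 : 9 * (6 * |h1| / f ^ 2 + 90 / f ^ 3) = 54 * (|h1| / f ^ 2) + 810 * (1 / f ^ 3) := by ring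
  have t7 : 27 * (20 / f ^ 3) = 540 * (1 / f ^ 3) := by ring
  have t8 : 200 / f ^ 3 = 200 * (1 / f ^ 3) := by ring
  have : 0 ≤ h1 ^ 2 / f := by positivity
  have : 0 ≤ 1 / f ^ 3 := by positivity
  linarith

/-- With `u = 1 / f`, `s ^ 2` is nearly `(1 + 2 u ^ 2) / (1 + 3 u ^ 2) = 1 - u ^ 2 + O(u ^ 4)`,
which is `(1 - u ^ 2 / 2) ^ 2` to this order. Factoring the difference of squares as `(s - t) * (s +
t)` avoids expanding a square root. -/
theorem overlap_scalar {u X Y s E A B : ℝ} (hu0 : 0 < u) (hu : u ≤ 1 / 20) 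
    (hX : |X - (1 + 3 * u ^ 2)| ≤ A * E) (hY : |Y - (1 + 2 * u ^ 2)| ≤ B * E) (hX4 : 1 / 4 ≤ X)
    (hE : u ^ 3 ≤ E) (hs : 0 ≤ s) (hsq : s ^ 2 = Y / X) :
    |s - (1 - u ^ 2 / 2)| ≤ 8 * (A + B + 1) * E := by
  have hE0 : 0 < E := (by positivity : 0 < u ^ 3).trans_le hE
  have hu2 : u ^ 2 ≤ 1 / 400 := by nlinarith
  have hX0 : 0 < X := by linarith
  set t := 1 - u ^ 2 / 2 with ht
  have ht2 : 1 / 2 ≤ t := by linarith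
  have ht1 : t ^ 2 ≤ 1 := by nlinarith
  have h4 : u ^ 4 ≤ E := by nlinarith [pow_pos hu0 3]
  have e1 : (s - t) * (s + t) * X = (Y - (1 + 2 * u ^ 2)) - t ^ 2 * (X - (1 + 3 * u ^ 2)) +
      (11 / 4 * u ^ 4 - 3 / 4 * u ^ 6) := by
    have : Y = s ^ 2 * X := by rw [hsq]; field_simp
    rw [this, ht]; ring
  have h6 : |11 / 4 * u ^ 4 - 3 / 4 * u ^ 6| ≤ E := by
    have h64 : u ^ 6 = u ^ 4 * u ^ 2 := by ring
    have h43 : u ^ 4 ≤ 1 / 20 * u ^ 3 := by nlinarith [pow_pos hu0 3]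
    have := pow_pos hu0 4
    rw [abs_le]; constructor <;> nlinarith
  have e2 : |(s - t) * (s + t) * X| ≤ (A + B + 1) * E := by
    rw [e1]
    have := abs_add_le ((Y - (1 + 2 * u ^ 2)) - t ^ 2 * (X - (1 + 3 * u ^ 2)))
      (11 / 4 * u ^ 4 - 3 / 4 * u ^ 6)
    have := abs_sub (Y - (1 + 2 * u ^ 2)) (t ^ 2 * (X - (1 + 3 * u ^ 2)))
    have h3 : |t ^ 2 * (X - (1 + 3 * u ^ 2))| ≤ 1 * (A * E) := by
      rw [abs_mul, abs_of_nonneg (sq_nonneg t)]; gcongr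
    linarith
  rw [abs_mul, abs_mul, abs_of_pos hX0, abs_of_pos (by linarith : 0 < s + t)] at e2
  have : |s - t| * (1 / 2) * (1 / 4) ≤ |s - t| * (s + t) * X := by
    gcongr; linarith
  linarith

set_option maxHeartbeats 1000000 in
/-- If the quantities `a k`, `b k` bounded by `3 ^ k` both nearly satisfy the secular equation, at
`x = 1 / μ` and `y = 1 / μ'` respectively, then `μ - μ'` is close to `a 1 - b 1`. -/
theorem secular_difference {a b : ℕ → ℝ} {f μ μ' : ℝ} {K : ℕ} (hK : 2 ≤ K) (hf : 200 ≤ f)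
    (ha : ∀ k, |a k| ≤ 3 ^ k) (ha0 : a 0 = 1) (hb0 : b 0 = 1)
    (hμl : f - 3 ≤ μ) (hμu : μ ≤ f + 3) (hμl' : f - 3 ≤ μ') (hμu' : μ' ≤ f + 3)
    (h : |1 / f - ∑ k ∈ Finset.range (K + 1), a k * μ⁻¹ ^ (k + 1)| ≤ (3 / μ) ^ (K + 1) / (μ - 3))
    (h' : |1 / f - ∑ k ∈ Finset.range (K + 1), b k * μ'⁻¹ ^ (k + 1)| ≤
      (3 / μ') ^ (K + 1) / (μ' - 3)) :
    |(μ - μ') - (a 1 - b 1)| ≤ 100 * (|a 1 - b 1| / f +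
      ∑ k ∈ Finset.Icc 2 K, (2 / f) ^ (k - 1) * |a k - b k| + f * (6 / f) ^ (K + 1)) := by
  have hf0 : 0 < f := by linarith
  have hμ0 : 0 < μ := by linarith
  have hμ0' : 0 < μ' := by linarith
  set x := μ⁻¹ with hx
  set y := μ'⁻¹ with hy
  have hx0 : 0 < x := inv_pos.2 hμ0
  have hy0 : 0 < y := inv_pos.2 hμ0'
  have hxf : x ≤ 11 / 10 / f := by
    rw [hx, inv_eq_one_div, div_le_div_iff₀ hμ0 hf0]; linarith
  have hyf : y ≤ 11 / 10 / f := by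
    rw [hy, inv_eq_one_div, div_le_div_iff₀ hμ0' hf0]; linarith
  have tail : ∀ m : ℝ, f - 3 ≤ m → (3 / m) ^ (K + 1) / (m - 3) ≤ 2 / f * (6 / f) ^ (K + 1) := by
    intro m hm
    have h1 : 3 / m ≤ 6 / f := by rw [div_le_div_iff₀ (by linarith) hf0]; linarith
    have h2 : 1 / (m - 3) ≤ 2 / f := by rw [div_le_div_iff₀ (by linarith) hf0]; linarith
    have h3 : 0 < m := by linarith
    have h4 : 0 < m - 3 := by linarith
    rw [div_eq_mul_one_div, mul_comm]
    gcongr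
  have t1 := h.trans (tail μ hμl)
  have t2 := h'.trans (tail μ' hμl')
  set c := a 1 - b 1 with hc
  set Δ := μ - μ' with hΔ
  set D := ∑ k ∈ Finset.Icc 1 K, a k * (x ^ (k + 1) - y ^ (k + 1)) with hD
  set R := ∑ k ∈ Finset.Icc 2 K, (a k - b k) * y ^ (k + 1) with hR
  have split1 : ∀ g : ℕ → ℝ, ∑ k ∈ Finset.range (K + 1), g k = g 0 + ∑ k ∈ Finset.Icc 1 K, g k := by
    intro g
    rw [Finset.range_eq_Ico, Finset.sum_eq_sum_Ico_succ_bot (by omega)]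
    rfl
  have split2 : ∀ g : ℕ → ℝ, ∑ k ∈ Finset.Icc 1 K, g k = g 1 + ∑ k ∈ Finset.Icc 2 K, g k := by
    intro g
    have : Finset.Icc 1 K = Finset.Ico 1 (K + 1) := rfl
    rw [this, Finset.sum_eq_sum_Ico_succ_bot (by omega)]
    rfl
  -- The difference of the two truncated equations: `x - y` is the term `k = 0`, `D` varies the
  -- argument with the coefficients `a` fixed, and `c * y ^ 2 + R` varies the coefficients at the
  -- argument `y`.
  obtain ⟨r, hr⟩ : ∃ r, r = (x - y) + D + c * y ^ 2 + R := ⟨_, rfl⟩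
  have hrb : |r| ≤ 4 / f * (6 / f) ^ (K + 1) := by
    have e1 : r = (1 / f - ∑ k ∈ Finset.range (K + 1), b k * y ^ (k + 1)) -
        (1 / f - ∑ k ∈ Finset.range (K + 1), a k * x ^ (k + 1)) := by
      rw [hr, hD, hR, split1, split1, ha0, hb0]
      have e2 := split2 (fun k => (a k - b k) * y ^ (k + 1))
      have e3 : ∑ k ∈ Finset.Icc 1 K, a k * (x ^ (k + 1) - y ^ (k + 1)) =
          ∑ k ∈ Finset.Icc 1 K, a k * x ^ (k + 1) - ∑ k ∈ Finset.Icc 1 K, b k * y ^ (k + 1) -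
          ∑ k ∈ Finset.Icc 1 K, (a k - b k) * y ^ (k + 1) := by
        rw [← Finset.sum_sub_distrib, ← Finset.sum_sub_distrib]
        exact Finset.sum_congr rfl fun k _ => by ring
      rw [e3, e2, hc]; ring
    rw [e1]
    refine (abs_sub _ _).trans ?_
    have : 4 / f * (6 / f) ^ (K + 1) = 2 / f * (6 / f) ^ (K + 1) + 2 / f * (6 / f) ^ (K + 1) := by
      ring
    rw [this]
    exact add_le_add t2 t1
  have hDb : |D| ≤ 8 / f * |x - y| := by
    calc |D| ≤ ∑ k ∈ Finset.Icc 1 K, |a k * (x ^ (k + 1) - y ^ (k + 1))| :=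
          Finset.abs_sum_le_sum_abs _ _
      _ ≤ ∑ k ∈ Finset.Icc 1 K, |x - y| * (33 / 5 / f) ^ k := by
          refine Finset.sum_le_sum fun k _ => ?_
          rw [abs_mul]
          have h1 := abs_pow_sub_pow_le x y (k + 1)
          rw [abs_of_pos hx0, abs_of_pos hy0, Nat.add_sub_cancel] at h1
          have h2 : max x y ^ k ≤ (11 / 10 / f) ^ k := by
            gcongr; exact max_le hxf hyf
          -- The factor `k + 1` from differentiating the power is absorbed by doubling the geometric
          -- ratio.
          have h3 : ((k + 1 : ℕ) : ℝ) ≤ 2 ^ k := by exact_mod_cast Nat.lt_two_pow_self (n := k)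
          calc |a k| * |x ^ (k + 1) - y ^ (k + 1)|
              ≤ 3 ^ k * (|x - y| * 2 ^ k * (11 / 10 / f) ^ k) := by
                refine mul_le_mul (ha k) (h1.trans ?_) (abs_nonneg _) (by positivity)
                gcongr
            _ = |x - y| * (3 * 2 * (11 / 10 / f)) ^ k := by rw [mul_pow, mul_pow]; ring
            _ = _ := by congr 2; ring
      _ = |x - y| * ∑ k ∈ Finset.Icc 1 K, (33 / 5 / f) ^ k := by rw [Finset.mul_sum]
      _ ≤ |x - y| * (8 / f) := by
          gcongr
          set z := 33 / 5 / f with hz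
          have hz0 : 0 < z := by positivity
          have hz1 : z ≤ 33 / 1000 := by
            rw [hz, div_le_iff₀ hf0]; linarith
          have e1 := split1 (fun k => z ^ k)
          have e2 := geom_sum_eq (x := z) (by linarith) (K + 1)
          have e3 : (z ^ (K + 1) - 1) / (z - 1) ≤ 1 / (1 - z) := by
            rw [← neg_div_neg_eq, neg_sub, neg_sub]
            have : 0 < 1 - z := by linarith
            gcongr
            have := pow_pos hz0 (K + 1)
            linarith
          have e4 : 1 / (1 - z) ≤ 1 + 40 / 33 * z := by
            rw [div_le_iff₀ (by linarith)]
            nlinarith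
          have e5 : 40 / 33 * z = 8 / f := by rw [hz]; field_simp; norm_num
          simp only [pow_zero] at e1
          linarith
      _ = _ := mul_comm _ _
  have hPle : μ * μ' ≤ 11 / 10 * f ^ 2 := by
    calc μ * μ' ≤ (f + 3) * (f + 3) := by gcongr
      _ ≤ _ := by nlinarith
  have hΔx : x - y = -Δ / (μ * μ') := by rw [hx, hy, hΔ]; field_simp; ring
  have hRb : μ * μ' * |R| ≤ 2 * ∑ k ∈ Finset.Icc 2 K, (2 / f) ^ (k - 1) * |a k - b k| := by
    calc μ * μ' * |R| ≤ 11 / 10 * f ^ 2 * ∑ k ∈ Finset.Icc 2 K, |(a k - b k) * y ^ (k + 1)| := by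
          gcongr
          exact Finset.abs_sum_le_sum_abs _ _
      _ ≤ _ := by
          rw [Finset.mul_sum, Finset.mul_sum]
          refine Finset.sum_le_sum fun k hk => ?_
          obtain ⟨j, rfl⟩ : ∃ j, k = j + 1 := ⟨k - 1, by have := (Finset.mem_Icc.1 hk).1; omega⟩
          rw [abs_mul, abs_of_pos (pow_pos hy0 _), Nat.add_sub_cancel]
          have h1 : y ^ j ≤ (2 / f) ^ j := by
            gcongr
            exact hyf.trans (by gcongr; norm_num)
          have h2 : f ^ 2 * y ^ 2 ≤ 121 / 100 := by
            calc f ^ 2 * y ^ 2 ≤ f ^ 2 * (11 / 10 / f) ^ 2 := by gcongr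
              _ = _ := by field_simp; norm_num
          calc 11 / 10 * f ^ 2 * (|a (j + 1) - b (j + 1)| * y ^ (j + 1 + 1))
              = 11 / 10 * (f ^ 2 * y ^ 2) * (y ^ j * |a (j + 1) - b (j + 1)|) := by ring
            _ ≤ 11 / 10 * (121 / 100) * ((2 / f) ^ j * |a (j + 1) - b (j + 1)|) := by gcongr
            _ ≤ _ := by
              have : 0 ≤ (2 / f) ^ j * |a (j + 1) - b (j + 1)| := by positivity
              linarith
  have hPr : μ * μ' * |r| ≤ 5 * (f * (6 / f) ^ (K + 1)) := by
    calc μ * μ' * |r| ≤ 11 / 10 * f ^ 2 * (4 / f * (6 / f) ^ (K + 1)) := by gcongr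
      _ = 44 / 10 * (f * (6 / f) ^ (K + 1)) := by field_simp; norm_num
      _ ≤ _ := by gcongr; norm_num
  have hPD : μ * μ' * |D| ≤ 8 / f * |Δ| := by
    calc μ * μ' * |D| ≤ μ * μ' * (8 / f * |x - y|) := by gcongr
      _ = 8 / f * |Δ| := by
          rw [hΔx, abs_div, abs_neg, abs_of_pos (mul_pos hμ0 hμ0')]; field_simp
  have hratio : |μ / μ' - 1| ≤ 7 / f := by
    have : μ / μ' - 1 = (μ - μ') / μ' := by field_simp
    rw [this, abs_div, abs_of_pos hμ0', div_le_div_iff₀ hμ0' hf0]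
    have : |μ - μ'| ≤ 6 := abs_le.2 ⟨by linarith, by linarith⟩
    nlinarith
  -- Multiplication by `μ * μ'` turns `x - y` into `-Δ` and `c * y ^ 2` into `c * (μ / μ')`.
  have hmain : Δ - c = μ * μ' * D + c * (μ / μ' - 1) + μ * μ' * R - μ * μ' * r := by
    have : μ * μ' * (x - y) = -Δ := by rw [hΔx]; field_simp
    have h2 : μ * μ' * y ^ 2 = μ / μ' := by rw [hy]; field_simp
    linear_combination (μ * μ') * hr + this + c * h2
  have hfin : |Δ - c| ≤ 8 / f * |Δ| + |c| * (7 / f) +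
      2 * ∑ k ∈ Finset.Icc 2 K, (2 / f) ^ (k - 1) * |a k - b k| +
      5 * (f * (6 / f) ^ (K + 1)) := by
    have hP : 0 ≤ μ * μ' := by positivity
    have q1 : |μ * μ' * D| ≤ 8 / f * |Δ| := by rwa [abs_mul, abs_of_nonneg hP]
    have q2 : |c * (μ / μ' - 1)| ≤ |c| * (7 / f) := by rw [abs_mul]; gcongr
    have q3 := hRb
    rw [← abs_of_nonneg hP, ← abs_mul] at q3
    have q4 := hPr
    rw [← abs_of_nonneg hP, ← abs_mul] at q4
    have p1 := abs_sub (μ * μ' * D + c * (μ / μ' - 1) + μ * μ' * R) (μ * μ' * r)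
    have p2 := abs_add_three (μ * μ' * D) (c * (μ / μ' - 1)) (μ * μ' * R)
    rw [← hmain] at p1
    linarith
  -- Since `f ≥ 200`, the multiple of `|Δ - c|` on the right is small enough to be absorbed on the
  -- left.
  have h8 : 8 / f * |Δ| ≤ 1 / 25 * |Δ - c| + 8 * (|c| / f) := by
    have : |Δ| ≤ |Δ - c| + |c| := by have := abs_sub_abs_le_abs_sub Δ c; linarith
    have h9 : 8 / f ≤ 1 / 25 := by rw [div_le_div_iff₀ hf0 (by norm_num)]; linarith
    calc 8 / f * |Δ| ≤ 8 / f * (|Δ - c| + |c|) := by gcongr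
      _ = 8 / f * |Δ - c| + 8 * (|c| / f) := by ring
      _ ≤ _ := by gcongr
  have h10 : |c| * (7 / f) = 7 * (|c| / f) := by ring
  have n1 : 0 ≤ |c| / f := by positivity
  have n2 : 0 ≤ ∑ k ∈ Finset.Icc 2 K, (2 / f) ^ (k - 1) * |a k - b k| :=
    Finset.sum_nonneg fun k _ => by positivity
  have n3 : 0 ≤ f * (6 / f) ^ (K + 1) := by positivity
  linarith


/-! ### Overlap of the top eigenvector with `e` -/

section Operator

variable {E : Type*} [NormedAddCommGroup E] [InnerProductSpace ℝ E]

/-- Up to `O(μ⁻³)`, `μ w` equals `e + T e / μ + T ^ 2 e / μ ^ 2`. In its squared norm the order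
`μ⁻²` collects `2 ⟨e, T ^ 2 e⟩` and, by symmetry, `⟨T e, T e⟩ = ⟨e, T ^ 2 e⟩`; hence the coefficient
`3`. -/
theorem IsSecular.abs_norm_sq_sub_le {T : E →L[ℝ] E} {e w : E} {f μ : ℝ}
    (h : IsSecular T e f μ w) (hsymm : ∀ x y, inner ℝ (T x) y = inner ℝ x (T y))
    (he : ‖e‖ = 1) (hT : ‖T‖ ≤ 3) (hμ : 17 ≤ μ) :
    |μ ^ 2 * ‖w‖ ^ 2 - (1 + 2 * inner ℝ e ((T ^ 1) e) / μ + 3 * inner ℝ e ((T ^ 2) e) / μ ^ 2)| ≤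
      500 / μ ^ 3 := by
  have hμ0 : 0 < μ := by linarith
  have h3 := h.norm_sub_sum_le he hT (by linarith) 3
  set t1 := T e with ht1
  set t2 := T (T e) with ht2
  obtain ⟨b, hb⟩ : ∃ b, b = μ • (w - ∑ j ∈ Finset.range 3, (μ⁻¹) ^ (j + 1) • (T ^ j) e) := ⟨_, rfl⟩
  set a := e + μ⁻¹ • t1 + μ⁻¹ ^ 2 • t2 with ha
  have hwab : μ • w = a + b := by
    rw [hb, ha, smul_sub]
    simp only [Finset.sum_range_succ, Finset.sum_range_zero, pow_zero, pow_one,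
      one_apply_eq_self, zero_add, smul_add, smul_smul]
    have e1 : μ * μ⁻¹ = 1 := mul_inv_cancel₀ hμ0.ne'
    have e2 : μ * μ⁻¹ ^ (1 + 1) = μ⁻¹ := by
      calc _ = (μ * μ⁻¹) * μ⁻¹ := by ring
        _ = _ := by rw [e1, one_mul]
    have e3 : μ * μ⁻¹ ^ (2 + 1) = μ⁻¹ ^ 2 := by
      calc _ = (μ * μ⁻¹) * μ⁻¹ ^ 2 := by ring
        _ = _ := by rw [e1, one_mul]
    rw [e1, e2, e3, one_smul]
    have : (T ^ 2) e = t2 := by rw [pow_two]; rfl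
    rw [this]
    abel
  have n1 : ‖t1‖ ≤ 3 := by
    have := T.le_opNorm e; rw [he] at this; linarith
  have n2 : ‖t2‖ ≤ 9 := by
    have := T.le_opNorm (T e)
    calc ‖t2‖ ≤ ‖T‖ * ‖T e‖ := this
      _ ≤ 3 * 3 := by gcongr
      _ = 9 := by norm_num
  have nb : ‖b‖ ≤ 34 / μ ^ 3 * 1 := by
    rw [hb, norm_smul, Real.norm_of_nonneg hμ0.le]
    calc μ * _ ≤ μ * ((3 / μ) ^ 3 / (μ - 3)) := by gcongr
      _ = 27 / (μ ^ 2 * (μ - 3)) := by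
        have : μ - 3 ≠ 0 := by linarith
        field_simp; norm_num
      _ ≤ 34 / μ ^ 3 * 1 := by
        rw [mul_one, div_le_div_iff₀ (mul_pos (by positivity) (by linarith)) (by positivity)]
        nlinarith [pow_pos hμ0 2]
  have na : ‖a‖ ≤ 2 := by
    calc ‖a‖ ≤ ‖e‖ + ‖μ⁻¹ • t1‖ + ‖μ⁻¹ ^ 2 • t2‖ := norm_add₃_le
      _ = 1 + μ⁻¹ * ‖t1‖ + μ⁻¹ ^ 2 * ‖t2‖ := by
        rw [norm_smul, norm_smul, he, Real.norm_of_nonneg (by positivity),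
          Real.norm_of_nonneg (by positivity)]
      _ ≤ 1 + 17⁻¹ * 3 + 17⁻¹ ^ 2 * 9 := by gcongr
      _ ≤ 2 := by norm_num
  have i11 : inner ℝ e t1 = inner ℝ e ((T ^ 1) e) := by rw [pow_one]
  have i02 : inner ℝ e t2 = inner ℝ e ((T ^ 2) e) := by rw [pow_two]; rfl
  have i2 : inner ℝ t1 t1 = inner ℝ e ((T ^ 2) e) := by rw [← i02, ht1, hsymm]
  have i12 : |inner ℝ t1 t2| ≤ 27 := by
    refine (abs_real_inner_le_norm _ _).trans ?_
    calc ‖t1‖ * ‖t2‖ ≤ 3 * 9 := by gcongr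
      _ = _ := by norm_num
  have i22 : |inner ℝ t2 t2| ≤ 81 := by
    refine (abs_real_inner_le_norm _ _).trans ?_
    calc ‖t2‖ * ‖t2‖ ≤ 9 * 9 := by gcongr
      _ = _ := by norm_num
  have iab : |inner ℝ a b| ≤ 68 / μ ^ 3 := by
    refine (abs_real_inner_le_norm _ _).trans ?_
    calc ‖a‖ * ‖b‖ ≤ 2 * (34 / μ ^ 3 * 1) := by gcongr
      _ = _ := by ring
  have ibb : |inner ℝ b b| ≤ 1 / μ ^ 3 := by
    refine (abs_real_inner_le_norm _ _).trans ?_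
    calc ‖b‖ * ‖b‖ ≤ (34 / μ ^ 3 * 1) * (34 / μ ^ 3 * 1) := by gcongr
      _ = 1156 / μ ^ 3 * (1 / μ ^ 3) := by ring
      _ ≤ 1 * (1 / μ ^ 3) := by
        gcongr
        rw [div_le_one (by positivity)]
        calc (1156 : ℝ) ≤ 17 ^ 3 := by norm_num
          _ ≤ μ ^ 3 := by gcongr
      _ = _ := one_mul _
  have iee : inner ℝ e e = (1 : ℝ) := by rw [real_inner_self_eq_norm_sq, he]; norm_num
  have key : μ ^ 2 * ‖w‖ ^ 2 - (1 + 2 * inner ℝ e ((T ^ 1) e) / μ +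
      3 * inner ℝ e ((T ^ 2) e) / μ ^ 2) =
      2 * inner ℝ t1 t2 / μ ^ 3 + inner ℝ t2 t2 / μ ^ 4 + 2 * inner ℝ a b + inner ℝ b b := by
    have e1 : μ ^ 2 * ‖w‖ ^ 2 = inner ℝ (a + b) (a + b) := by
      rw [← hwab, real_inner_self_eq_norm_sq, norm_smul, Real.norm_of_nonneg hμ0.le, mul_pow]
    have e2 : inner ℝ a a = 1 + 2 * inner ℝ e t1 / μ + (inner ℝ t1 t1 + 2 * inner ℝ e t2) / μ ^ 2 +
        2 * inner ℝ t1 t2 / μ ^ 3 + inner ℝ t2 t2 / μ ^ 4 := by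
      rw [ha]
      simp only [inner_add_left, inner_add_right, real_inner_smul_left, real_inner_smul_right, iee]
      rw [real_inner_comm e t1, real_inner_comm e t2, real_inner_comm t1 t2]
      field_simp
      ring
    rw [e1, real_inner_add_add_self, e2, i11, i2, i02]
    ring
  rw [key]
  have q1 : |2 * inner ℝ t1 t2 / μ ^ 3| ≤ 54 / μ ^ 3 := by
    rw [abs_div, abs_mul, abs_of_pos (pow_pos hμ0 3), abs_of_pos (two_pos : (0:ℝ) < 2)]
    gcongr; linarith
  have q2 : |inner ℝ t2 t2 / μ ^ 4| ≤ 81 / μ ^ 3 := by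
    rw [abs_div, abs_of_pos (pow_pos hμ0 4)]
    gcongr <;> [linarith; norm_num]
  have q3 : |2 * inner ℝ a b| ≤ 136 / μ ^ 3 := by
    rw [abs_mul, abs_of_pos (two_pos : (0:ℝ) < 2)]
    calc 2 * |inner ℝ a b| ≤ 2 * (68 / μ ^ 3) := by gcongr
      _ = _ := by ring
  have p1 := abs_add_three (2 * inner ℝ t1 t2 / μ ^ 3) (inner ℝ t2 t2 / μ ^ 4) (2 * inner ℝ a b)
  have p2 := abs_add_le (2 * inner ℝ t1 t2 / μ ^ 3 + inner ℝ t2 t2 / μ ^ 4 + 2 * inner ℝ a b)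
    (inner ℝ b b)
  have : 54 / μ ^ 3 + 81 / μ ^ 3 + 136 / μ ^ 3 + 1 / μ ^ 3 ≤ 500 / μ ^ 3 := by
    rw [← add_div, ← add_div, ← add_div]; gcongr; norm_num
  linarith

end Operator

/-! ### The largest eigenvalue -/

section Matrix

variable {N : ℕ} {A : Matrix (Fin N) (Fin N) ℝ}

theorem exists_eigenvector_maxEigenvalue [NeZero N] (hA : A.IsHermitian) :
    ∃ v : EuclideanSpace ℝ (Fin N), ‖v‖ = 1 ∧ A.mulVec v.ofLp = maxEigenvalue A • v.ofLp := by
  have h1 : maxEigenvalue A ∈ Set.range hA.eigenvalues := by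
    rw [maxEigenvalue, hA.spectrum_real_eq_range_eigenvalues]
    exact (Set.range_nonempty _).csSup_mem (Set.finite_range _)
  obtain ⟨i, hi⟩ := h1
  exact ⟨hA.eigenvectorBasis i, hA.eigenvectorBasis.orthonormal.1 i, by
    rw [← hi]; exact hA.mulVec_eigenvectorBasis i⟩

theorem inner_mulVec_eq_sum (hA : A.IsHermitian) (x : EuclideanSpace ℝ (Fin N)) :
    inner ℝ x (Matrix.toEuclideanCLM (𝕜 := ℝ) A x) =
      ∑ i, hA.eigenvalues i * inner ℝ (hA.eigenvectorBasis i) x ^ 2 := by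
  set b := hA.eigenvectorBasis
  rw [← b.sum_inner_mul_inner]
  refine Finset.sum_congr rfl fun i _ => ?_
  have h1 : inner ℝ (b i) (Matrix.toEuclideanCLM (𝕜 := ℝ) A x) =
      hA.eigenvalues i * inner ℝ (b i) x := by
    rw [Matrix.inner_toEuclideanCLM, Matrix.dotProduct_mulVec, ← Matrix.mulVec_transpose,
      ← Matrix.conjTranspose_eq_transpose_of_trivial, hA.eq, hA.mulVec_eigenvectorBasis,
      smul_dotProduct, smul_eq_mul]
    congr 1
    rw [EuclideanSpace.inner_eq_star_dotProduct, dotProduct_comm]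
    rfl
  rw [h1, real_inner_comm]
  ring

theorem inner_mulVec_le_maxEigenvalue (hA : A.IsHermitian) (x : EuclideanSpace ℝ (Fin N)) :
    inner ℝ x (Matrix.toEuclideanCLM (𝕜 := ℝ) A x) ≤ maxEigenvalue A * ‖x‖ ^ 2 := by
  have h1 : ∀ i, hA.eigenvalues i ≤ maxEigenvalue A := fun i => by
    rw [maxEigenvalue, hA.spectrum_real_eq_range_eigenvalues]
    exact le_csSup (Set.finite_range _).bddAbove ⟨i, rfl⟩
  rw [inner_mulVec_eq_sum hA, ← hA.eigenvectorBasis.sum_sq_norm_inner_right x, Finset.mul_sum]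
  refine Finset.sum_le_sum fun i _ => ?_
  rw [Real.norm_eq_abs, sq_abs]
  exact mul_le_mul_of_nonneg_right (h1 i) (sq_nonneg _)

end Matrix

/-! ### The perturbed matrix as an operator -/

/-- The operator on Euclidean space given by a real square matrix. -/
noncomputable abbrev op {N : ℕ} (H : Matrix (Fin N) (Fin N) ℝ) :
    EuclideanSpace ℝ (Fin N) →L[ℝ] EuclideanSpace ℝ (Fin N) :=
  Matrix.toEuclideanCLM (𝕜 := ℝ) H

/-- `unitVec` as an element of Euclidean space. -/
noncomputable def eVec (N : ℕ) : EuclideanSpace ℝ (Fin N) := WithLp.toLp 2 (unitVec N)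

/-- The quadratic form `⟨e, H ^ k e⟩`. -/
noncomputable def eMoment {N : ℕ} (H : Matrix (Fin N) (Fin N) ℝ) (k : ℕ) : ℝ :=
  inner ℝ (eVec N) ((op H ^ k) (eVec N))

section

variable {N : ℕ} {A B H : Matrix (Fin N) (Fin N) ℝ} {f ρ : ℝ}

theorem norm_eVec [NeZero N] : ‖eVec N‖ = 1 := by
  have h : (N : ℝ) ≠ 0 := Nat.cast_ne_zero.2 (NeZero.ne N)
  rw [EuclideanSpace.norm_eq]
  simp [eVec, unitVec, h]

theorem eMoment_zero [NeZero N] : eMoment H 0 = 1 := by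
  simp [eMoment, norm_eVec]

theorem abs_eMoment_le [NeZero N] (h : ‖op H‖ ≤ ρ) (k : ℕ) : |eMoment H k| ≤ ρ ^ k :=
  abs_inner_pow_le h norm_eVec k

theorem op_symm (hH : H.IsHermitian) (x y : EuclideanSpace ℝ (Fin N)) :
    inner ℝ (op H x) y = inner ℝ x (op H y) := by
  rw [real_inner_comm, Matrix.inner_toEuclideanCLM, Matrix.inner_toEuclideanCLM,
    Matrix.dotProduct_mulVec x.ofLp, ← Matrix.mulVec_transpose,
    ← Matrix.conjTranspose_eq_transpose_of_trivial, hH.eq, dotProduct_comm]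

theorem op_perturbed (f : ℝ) (H : Matrix (Fin N) (Fin N) ℝ) (x : EuclideanSpace ℝ (Fin N)) :
    op (perturbed f H) x = op H x + (f * inner ℝ (eVec N) x) • eVec N := by
  ext i
  simp only [Matrix.ofLp_toEuclideanCLM, perturbed, Matrix.add_mulVec, Pi.add_apply,
    PiLp.add_apply, PiLp.smul_apply, Matrix.smul_mulVec, Pi.smul_apply, smul_eq_mul,
    Matrix.vecMulVec_mulVec]
  rw [EuclideanSpace.inner_eq_star_dotProduct, dotProduct_comm]
  simp [eVec]
  ring

theorem perturbed_isHermitian (hH : H.IsHermitian) (f : ℝ) : (perturbed f H).IsHermitian := by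
  refine hH.add ?_
  ext i j
  simp [Matrix.vecMulVec_apply, mul_comm]

theorem top_rayleigh (hH : H.IsHermitian) (f : ℝ) (x : EuclideanSpace ℝ (Fin N)) :
    inner ℝ x (op H x) + f * inner ℝ (eVec N) x ^ 2 ≤ maxEigenvalue (perturbed f H) * ‖x‖ ^ 2 := by
  have h := inner_mulVec_le_maxEigenvalue (perturbed_isHermitian hH f) x
  have h2 := op_perturbed f H x
  rw [h2, inner_add_right, real_inner_smul_right, real_inner_comm] at h
  rw [real_inner_comm]
  rw [real_inner_comm x (eVec N)] at *
  linarith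

theorem exists_top_vector [NeZero N] (hH : H.IsHermitian) (f : ℝ) :
    ∃ v : EuclideanSpace ℝ (Fin N), ‖v‖ = 1 ∧
      op H v + (f * inner ℝ (eVec N) v) • eVec N = maxEigenvalue (perturbed f H) • v := by
  obtain ⟨v, hv, h⟩ := exists_eigenvector_maxEigenvalue (perturbed_isHermitian hH f)
  refine ⟨v, hv, ?_⟩
  rw [← op_perturbed]
  ext i
  exact congrFun h i

theorem le_maxEigenvalue_perturbed [NeZero N] (hH : H.IsHermitian) (h : ‖op H‖ ≤ ρ) :
    f - ρ ≤ maxEigenvalue (perturbed f H) := by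
  have h1 := top_rayleigh hH f (eVec N)
  rw [norm_eVec, real_inner_self_eq_norm_sq, norm_eVec] at h1
  have h2 := abs_real_inner_le_norm (eVec N) (op H (eVec N))
  have h3 := (op H).le_opNorm (eVec N)
  rw [norm_eVec] at h2 h3
  have := (abs_le.1 h2).1
  linarith

theorem maxEigenvalue_perturbed_le [NeZero N] (hH : H.IsHermitian) (h : ‖op H‖ ≤ ρ) (hf : 0 ≤ f) :
    maxEigenvalue (perturbed f H) ≤ f + ρ := by
  obtain ⟨v, hv, h1⟩ := exists_top_vector hH f
  have h2 : inner ℝ v (op H v) + f * inner ℝ (eVec N) v ^ 2 = maxEigenvalue (perturbed f H) := by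
    have := congrArg (fun x => inner ℝ v x) h1
    simp only [inner_add_right, real_inner_smul_right, real_inner_self_eq_norm_sq, hv] at this
    rw [real_inner_comm v (eVec N)] at *
    linarith
  have h3 := abs_real_inner_le_norm v (op H v)
  have h4 := (op H).le_opNorm v
  have h5 := abs_real_inner_le_norm (eVec N) v
  rw [hv] at h3 h4
  rw [hv, norm_eVec] at h5
  have h6 := (abs_le.1 h3).2
  have h7 : inner ℝ (eVec N) v ^ 2 ≤ 1 := by
    rw [← sq_abs]; nlinarith [abs_nonneg (inner ℝ (eVec N) v)]
  nlinarith

/-- The solution is `v / (f ⟨e, v⟩)`. The pairing cannot vanish, because `v` would then be an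
eigenvector of `H` with eigenvalue `μ > ‖H‖`. The overlap of a unit top vector with `e` can be read
off from `‖w‖`. -/
theorem isSecular_of_top [NeZero N] {μ : ℝ} (h : ‖op H‖ ≤ ρ) (hf : 0 < f) (hμ : ρ < μ)
    {v : EuclideanSpace ℝ (Fin N)} (hv : ‖v‖ = 1)
    (hv' : op H v + (f * inner ℝ (eVec N) v) • eVec N = μ • v) :
    ∃ w, IsSecular (op H) (eVec N) f μ w ∧ |inner ℝ (eVec N) v| = 1 / (f * ‖w‖) := by
  set s := inner ℝ (eVec N) v with hs
  have hs0 : s ≠ 0 := by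
    intro h0
    rw [h0] at hv'
    have h1 : ‖op H v‖ = |μ| := by
      have : op H v = μ • v := by simpa using hv'
      rw [this, norm_smul, hv, mul_one, Real.norm_eq_abs]
    have h2 := (op H).le_opNorm v
    rw [h1, hv] at h2
    have := le_abs_self μ
    linarith
  have hfs : f * s ≠ 0 := mul_ne_zero hf.ne' hs0
  refine ⟨(f * s)⁻¹ • v, ⟨?_, ?_⟩, ?_⟩
  · rw [smul_comm, ← hv', smul_add, smul_smul, inv_mul_cancel₀ hfs, one_smul, map_smul]
  · rw [real_inner_smul_right, ← hs]
    field_simp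
  · rw [norm_smul, hv, norm_inv, Real.norm_eq_abs, abs_mul, abs_of_pos hf]
    have := abs_pos.2 hs0
    field_simp

theorem exists_isSecular [NeZero N] (hH : H.IsHermitian) (h : ‖op H‖ ≤ ρ) (hf : 0 < f)
    (hμ : ρ < maxEigenvalue (perturbed f H)) :
    ∃ w, IsSecular (op H) (eVec N) f (maxEigenvalue (perturbed f H)) w := by
  obtain ⟨v, hv, h1⟩ := exists_top_vector hH f
  obtain ⟨w, hw, -⟩ := isSecular_of_top h hf hμ hv h1
  exact ⟨w, hw⟩

theorem maxEigenvalue_sub_le [NeZero N] (hA : A.IsHermitian) (hB : B.IsHermitian) :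
    maxEigenvalue A - maxEigenvalue B ≤ ‖op (A - B)‖ := by
  obtain ⟨v, hv, h1⟩ := exists_eigenvector_maxEigenvalue hA
  have h2 := inner_mulVec_le_maxEigenvalue hB v
  have h3 : op A v = maxEigenvalue A • v := by ext i; exact congrFun h1 i
  have h4 : op A v = op B v + op (A - B) v := by
    rw [op, op, op, map_sub]; simp
  have h5 : inner ℝ v (op A v) = maxEigenvalue A := by
    rw [h3, real_inner_smul_right, real_inner_self_eq_norm_sq, hv]; norm_num
  rw [h4, inner_add_right] at h5
  have h6 := abs_real_inner_le_norm v (op (A - B) v)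
  have h7 := (op (A - B)).le_opNorm v
  rw [hv] at h2 h6 h7
  have := (abs_le.1 h6).2
  linarith

theorem abs_maxEigenvalue_perturbed_sub_le [NeZero N] (hA : A.IsHermitian) (hB : B.IsHermitian)
    (f : ℝ) :
    |maxEigenvalue (perturbed f A) - maxEigenvalue (perturbed f B)| ≤ ‖op (A - B)‖ := by
  have h1 : perturbed f A - perturbed f B = A - B := by simp [perturbed]
  have h2 : perturbed f B - perturbed f A = -(A - B) := by simp [perturbed]
  have := maxEigenvalue_sub_le (perturbed_isHermitian hA f) (perturbed_isHermitian hB f)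
  have h3 := maxEigenvalue_sub_le (perturbed_isHermitian hB f) (perturbed_isHermitian hA f)
  rw [h1] at this
  rw [h2, op, map_neg, norm_neg] at h3
  rw [abs_le]
  constructor <;> linarith

/-- Crude, but the entrywise `ℓ¹` norm is easy to integrate, and for the truncation error it is
exponentially small, so nothing sharper is needed. -/
theorem norm_op_le_sum (H : Matrix (Fin N) (Fin N) ℝ) : ‖op H‖ ≤ ∑ i, ∑ j, |H i j| := by
  refine ContinuousLinearMap.opNorm_le_bound _
    (Finset.sum_nonneg fun i _ => Finset.sum_nonneg fun j _ => abs_nonneg _) fun x => ?_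
  have h1 : ∀ j, |x j| ≤ ‖x‖ := fun j => by
    have := PiLp.norm_apply_le x j
    rwa [Real.norm_eq_abs] at this
  have h2 : op H x = ∑ i, EuclideanSpace.single i ((op H x) i) := by
    ext j
    simp
  rw [h2, Finset.sum_mul]
  refine (norm_sum_le _ _).trans (Finset.sum_le_sum fun i _ => ?_)
  rw [PiLp.norm_single, Real.norm_eq_abs, Finset.sum_mul]
  have : (op H x) i = ∑ j, H i j * x j := rfl
  rw [this]
  refine (Finset.abs_sum_le_sum_abs _ _).trans (Finset.sum_le_sum fun j _ => ?_)
  rw [abs_mul]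
  gcongr
  exact h1 j

theorem norm_op_le_of_abs_le {c : ℝ} (h : ∀ i j, |H i j| ≤ c) : ‖op H‖ ≤ N ^ 2 * c := by
  refine (norm_op_le_sum H).trans ?_
  calc ∑ i, ∑ j, |H i j| ≤ ∑ i : Fin N, ∑ j : Fin N, c :=
        Finset.sum_le_sum fun i _ => Finset.sum_le_sum fun j _ => h i j
    _ = _ := by simp; ring

theorem strong_expansion [NeZero N] (hH : H.IsHermitian) (h : ‖op H‖ ≤ 3) (hf : 20 ≤ f) :
    |maxEigenvalue (perturbed f H) - f| ≤ 2 * |eMoment H 1| + 30 / f ∧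
    |maxEigenvalue (perturbed f H) - (f + eMoment H 1 + eMoment H 2 / f + eMoment H 3 / f ^ 2)| ≤
      10000 * (1 / f ^ 3 + eMoment H 1 ^ 2 / f) := by
  have l1 := le_maxEigenvalue_perturbed (f := f) hH h
  have l2 := maxEigenvalue_perturbed_le hH h (by linarith : (0 : ℝ) ≤ f)
  obtain ⟨w, hw⟩ := exists_isSecular hH h (by linarith : (0 : ℝ) < f) (by linarith)
  have h4 := hw.abs_sub_sum_le norm_eVec h (by linarith) 4
  have m2 := abs_eMoment_le h 2
  have m3 := abs_eMoment_le h 3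
  have m0 : eMoment H 0 = 1 := eMoment_zero
  norm_num at m2 m3
  refine abs_sub_expansion_le hf l1 l2 m2 m3 ?_
  change |1 / f - ∑ j ∈ Finset.range 4, eMoment H j * _| ≤ _ at h4
  simp only [Finset.sum_range_succ, Finset.sum_range_zero, m0] at h4
  convert h4 using 3
  norm_num

theorem strong_difference [NeZero N] (hA : A.IsHermitian) (hB : B.IsHermitian) (hA3 : ‖op A‖ ≤ 3)
    (hB3 : ‖op B‖ ≤ 3) (hf : 200 ≤ f) {K : ℕ} (hK : 2 ≤ K) :
    |(maxEigenvalue (perturbed f A) - maxEigenvalue (perturbed f B)) -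
      (eMoment A 1 - eMoment B 1)| ≤ 100 * (|eMoment A 1 - eMoment B 1| / f +
      ∑ k ∈ Finset.Icc 2 K, (2 / f) ^ (k - 1) * |eMoment A k - eMoment B k| +
      f * (6 / f) ^ (K + 1)) := by
  have l1 := le_maxEigenvalue_perturbed (f := f) hA hA3
  have l2 := maxEigenvalue_perturbed_le hA hA3 (by linarith : (0 : ℝ) ≤ f)
  have l1' := le_maxEigenvalue_perturbed (f := f) hB hB3
  have l2' := maxEigenvalue_perturbed_le hB hB3 (by linarith : (0 : ℝ) ≤ f)
  obtain ⟨w, hw⟩ := exists_isSecular hA hA3 (by linarith : (0 : ℝ) < f) (by linarith)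
  obtain ⟨w', hw'⟩ := exists_isSecular hB hB3 (by linarith : (0 : ℝ) < f) (by linarith)
  exact secular_difference hK hf (abs_eMoment_le hA3) eMoment_zero eMoment_zero
    l1 l2 l1' l2' (hw.abs_sub_sum_le norm_eVec hA3 (by linarith) (K + 1))
    (hw'.abs_sub_sum_le norm_eVec hB3 (by linarith) (K + 1))

-- The overlap squared is `(μ / f) ^ 2 / (μ ^ 2 * ‖w‖ ^ 2)`. The numerator is `1 + 2 / f ^ 2` by the
-- eigenvalue expansion and the denominator `1 + 3 / f ^ 2` by the expansion of the norm of the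
-- secular solution, both up to the common error `Er`; `overlap_scalar` takes the quotient.
set_option maxHeartbeats 1000000 in
theorem strong_overlap [NeZero N] (hH : H.IsHermitian) (h : ‖op H‖ ≤ 3) (hf : 20 ≤ f)
    {v : EuclideanSpace ℝ (Fin N)} (hv : ‖v‖ = 1)
    (hv' : op H v + (f * inner ℝ (eVec N) v) • eVec N = maxEigenvalue (perturbed f H) • v) :
    |(|inner ℝ (eVec N) v|) - (1 - 1 / (2 * f ^ 2))| ≤
      10 ^ 7 * (1 / f ^ 3 + |eMoment H 1| / f + |eMoment H 2 - 1| / f ^ 2) := by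
  have l1 := le_maxEigenvalue_perturbed (f := f) hH h
  have l2 := maxEigenvalue_perturbed_le hH h (by linarith : (0 : ℝ) ≤ f)
  obtain ⟨d1, d2⟩ := strong_expansion hH h hf
  have m1 := abs_eMoment_le h 1
  have m2 := abs_eMoment_le h 2
  have m3 := abs_eMoment_le h 3
  have hf0 : 0 < f := by linarith
  obtain ⟨w, hw, hsw⟩ := isSecular_of_top h hf0 (by linarith) hv hv'
  set μ := maxEigenvalue (perturbed f H) with hμ
  have hμ17 : 17 ≤ μ := by linarith
  have hμ0 : 0 < μ := by linarith
  have hX := hw.abs_norm_sq_sub_le (op_symm hH) norm_eVec h hμ17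
  rw [← eMoment, ← eMoment] at hX
  set h1 := eMoment H 1
  set h2 := eMoment H 2
  set h3 := eMoment H 3
  norm_num at m1 m2 m3
  set u := 1 / f with hu
  have hu0 : 0 < u := by positivity
  have hu20 : u ≤ 1 / 20 := one_div_le_one_div_of_le (by norm_num) hf
  have e1 : 1 / f ^ 3 = u ^ 3 := by rw [hu]; field_simp
  have e2 : 1 / (2 * f ^ 2) = u ^ 2 / 2 := by rw [hu]; field_simp
  have e3 : |h1| / f = |h1| * u := by rw [hu]; ring
  have e4 : |h2 - 1| / f ^ 2 = |h2 - 1| * u ^ 2 := by rw [hu]; field_simp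
  rw [e1, e2, e3, e4]
  set Er := u ^ 3 + |h1| * u + |h2 - 1| * u ^ 2 with hEr
  have E3 : u ^ 3 ≤ Er := by
    have : 0 ≤ |h1| * u := by positivity
    have : 0 ≤ |h2 - 1| * u ^ 2 := by positivity
    linarith
  have E1 : |h1| * u ≤ Er := by
    have : 0 ≤ u ^ 3 := by positivity
    have : 0 ≤ |h2 - 1| * u ^ 2 := by positivity
    linarith
  have E2 : |h2 - 1| * u ^ 2 ≤ Er := by
    have : 0 ≤ u ^ 3 := by positivity
    have : 0 ≤ |h1| * u := by positivity
    linarith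
  have E0 : 0 ≤ Er := le_trans (by positivity) E3
  have hw0 : 0 < ‖w‖ := by
    rw [norm_pos_iff]
    rintro rfl
    have := hw.inner_eq
    rw [inner_zero_right] at this
    have : 0 < 1 / f := by positivity
    linarith
  set d := μ - f with hd
  have hμfu : μ⁻¹ ≤ 20 / 17 * u := by
    rw [hu, inv_eq_one_div, mul_one_div, div_le_div_iff₀ hμ0 hf0]; linarith
  have hdu : |d| ≤ 2 * |h1| + 30 * u := by rw [hu]; convert d1 using 2; ring
  have hd3 : |d| ≤ 3 := abs_le.2 ⟨by linarith, by linarith⟩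
  have hu4 : u ^ 4 ≤ Er := by
    refine le_trans ?_ E3
    calc u ^ 4 = u * u ^ 3 := by ring
      _ ≤ 1 * u ^ 3 := by gcongr; linarith
      _ = u ^ 3 := one_mul _
  have hu2h1 : u ^ 2 * |h1| ≤ Er := by
    refine le_trans ?_ E1
    calc u ^ 2 * |h1| = |h1| * u * u := by ring
      _ ≤ |h1| * u * 1 := by gcongr; linarith
      _ = _ := mul_one _
  have hdu2 : |d| * u ^ 2 ≤ 32 * Er := by
    calc |d| * u ^ 2 ≤ (2 * |h1| + 30 * u) * u ^ 2 := by gcongr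
      _ = 2 * (u ^ 2 * |h1|) + 30 * u ^ 3 := by ring
      _ ≤ _ := by linarith
  -- the denominator
  have bX : |μ ^ 2 * ‖w‖ ^ 2 - (1 + 3 * u ^ 2)| ≤ 10 ^ 4 * Er := by
    have s1 : μ ^ 2 * ‖w‖ ^ 2 - (1 + 3 * u ^ 2) =
        (μ ^ 2 * ‖w‖ ^ 2 - (1 + 2 * h1 / μ + 3 * h2 / μ ^ 2)) + 2 * (h1 * μ⁻¹) +
        3 * ((h2 - 1) * μ⁻¹ ^ 2) + 3 * (μ⁻¹ ^ 2 - u ^ 2) := by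
      field_simp; ring
    have s2 : |μ⁻¹ ^ 2 - u ^ 2| ≤ 100 * Er := by
      have : μ⁻¹ ^ 2 - u ^ 2 = -(d * u ^ 2 * (μ⁻¹ + f * μ⁻¹ ^ 2)) := by
        rw [hd, hu]; field_simp; ring
      rw [this, abs_neg, abs_mul, abs_mul, abs_of_pos (pow_pos hu0 2),
        abs_of_pos (by positivity : 0 < μ⁻¹ + f * μ⁻¹ ^ 2)]
      have : μ⁻¹ + f * μ⁻¹ ^ 2 ≤ 3 := by
        calc μ⁻¹ + f * μ⁻¹ ^ 2 ≤ 20 / 17 * u + f * (20 / 17 * u) ^ 2 := by gcongr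
          _ = (20 / 17 + (20 / 17) ^ 2) * u := by rw [hu]; field_simp
          _ ≤ 3 := by nlinarith
      calc |d| * u ^ 2 * (μ⁻¹ + f * μ⁻¹ ^ 2) ≤ 32 * Er * 3 := by gcongr
        _ ≤ _ := by linarith
    have s3 : |μ ^ 2 * ‖w‖ ^ 2 - (1 + 2 * h1 / μ + 3 * h2 / μ ^ 2)| ≤ 1000 * Er := by
      refine hX.trans ?_
      calc 500 / μ ^ 3 = 500 * μ⁻¹ ^ 3 := by field_simp
        _ ≤ 500 * (20 / 17 * u) ^ 3 := by gcongr
        _ = 500 * (20 / 17) ^ 3 * u ^ 3 := by ring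
        _ ≤ 1000 * Er := by gcongr; norm_num
    have s4 : |2 * (h1 * μ⁻¹)| ≤ 3 * Er := by
      rw [abs_mul, abs_mul, abs_of_pos (inv_pos.2 hμ0), abs_of_pos (two_pos : (0:ℝ) < 2)]
      calc 2 * (|h1| * μ⁻¹) ≤ 2 * (|h1| * (20 / 17 * u)) := by gcongr
        _ = 40 / 17 * (|h1| * u) := by ring
        _ ≤ 3 * Er := by gcongr; norm_num
    have s5 : |3 * ((h2 - 1) * μ⁻¹ ^ 2)| ≤ 6 * Er := by
      rw [abs_mul, abs_mul, abs_of_pos (pow_pos (inv_pos.2 hμ0) 2), abs_of_pos (three_pos : (0:ℝ) < 3)]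
      calc 3 * (|h2 - 1| * μ⁻¹ ^ 2) ≤ 3 * (|h2 - 1| * (20 / 17 * u) ^ 2) := by gcongr
        _ = 3 * (20 / 17) ^ 2 * (|h2 - 1| * u ^ 2) := by ring
        _ ≤ 6 * Er := by gcongr; norm_num
    have s6 : |3 * (μ⁻¹ ^ 2 - u ^ 2)| ≤ 300 * Er := by
      rw [abs_mul, abs_of_pos (three_pos : (0:ℝ) < 3)]; linarith
    rw [s1]
    have p1 := abs_add_three (μ ^ 2 * ‖w‖ ^ 2 - (1 + 2 * h1 / μ + 3 * h2 / μ ^ 2))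
      (2 * (h1 * μ⁻¹)) (3 * ((h2 - 1) * μ⁻¹ ^ 2))
    have p2 := abs_add_le ((μ ^ 2 * ‖w‖ ^ 2 - (1 + 2 * h1 / μ + 3 * h2 / μ ^ 2)) +
      2 * (h1 * μ⁻¹) + 3 * ((h2 - 1) * μ⁻¹ ^ 2)) (3 * (μ⁻¹ ^ 2 - u ^ 2))
    linarith
  -- the numerator
  have bY : |(μ * u) ^ 2 - (1 + 2 * u ^ 2)| ≤ 10 ^ 5 * Er := by
    obtain ⟨r, hr⟩ : ∃ r, r = μ - (f + h1 + h2 / f + h3 / f ^ 2) := ⟨_, rfl⟩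
    rw [← hr] at d2
    have hh1 : h1 ^ 2 ≤ 3 * |h1| := by rw [← sq_abs]; nlinarith [abs_nonneg h1]
    have hrb : |r| * u ≤ 40000 * Er := by
      calc |r| * u ≤ 10000 * (1 / f ^ 3 + h1 ^ 2 / f) * u := by gcongr
        _ = 10000 * (u ^ 4 + h1 ^ 2 * u ^ 2) := by rw [hu]; field_simp
        _ ≤ 10000 * (u ^ 4 + 3 * |h1| * u ^ 2) := by gcongr
        _ = 10000 * (u ^ 4 + 3 * (u ^ 2 * |h1|)) := by ring
        _ ≤ _ := by linarith
    have s1 : (μ * u) ^ 2 - (1 + 2 * u ^ 2) = 2 * (h1 * u) + 2 * ((h2 - 1) * u ^ 2) +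
        2 * (h3 * u ^ 3) + 2 * (r * u) + d * (d * u ^ 2) := by
      rw [hr, hd, hu]; field_simp; ring
    have s2 : |2 * (h1 * u)| ≤ 2 * Er := by
      rw [abs_mul, abs_mul, abs_of_pos hu0, abs_of_pos (two_pos : (0:ℝ) < 2)]; linarith
    have s3 : |2 * ((h2 - 1) * u ^ 2)| ≤ 2 * Er := by
      rw [abs_mul, abs_mul, abs_of_pos (pow_pos hu0 2), abs_of_pos (two_pos : (0:ℝ) < 2)]; linarith
    have s4 : |2 * (h3 * u ^ 3)| ≤ 54 * Er := by
      rw [abs_mul, abs_mul, abs_of_pos (pow_pos hu0 3), abs_of_pos (two_pos : (0:ℝ) < 2)]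
      calc 2 * (|h3| * u ^ 3) ≤ 2 * (27 * Er) := by gcongr
        _ = _ := by ring
    have s5 : |2 * (r * u)| ≤ 80000 * Er := by
      rw [abs_mul, abs_mul, abs_of_pos hu0, abs_of_pos (two_pos : (0:ℝ) < 2)]; linarith
    have s6 : |d * (d * u ^ 2)| ≤ 96 * Er := by
      rw [abs_mul, abs_mul, abs_of_pos (pow_pos hu0 2)]
      calc |d| * (|d| * u ^ 2) ≤ 3 * (32 * Er) := by gcongr
        _ = _ := by ring
    rw [s1]
    have p1 := abs_add_three (2 * (h1 * u)) (2 * ((h2 - 1) * u ^ 2)) (2 * (h3 * u ^ 3))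
    have p2 := abs_add_three (2 * (h1 * u) + 2 * ((h2 - 1) * u ^ 2) + 2 * (h3 * u ^ 3))
      (2 * (r * u)) (d * (d * u ^ 2))
    linarith
  -- Cauchy–Schwarz bounds the overlap `1 / (f * ‖w‖)` by `1`, which keeps `‖w‖` away from zero.
  have hX4 : 1 / 4 ≤ μ ^ 2 * ‖w‖ ^ 2 := by
    have := hw.norm_sub_sum_le norm_eVec h (by linarith) 1
    have q1 : 1 / (f * ‖w‖) ≤ 1 := by
      rw [← hsw]
      have := abs_real_inner_le_norm (eVec N) v
      rwa [norm_eVec, hv, one_mul] at this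
    rw [div_le_one (by positivity)] at q1
    have q2 : 17 / 20 * f ≤ μ := by linarith
    have q3 : 17 / 20 ≤ μ * ‖w‖ := by
      calc 17 / 20 ≤ 17 / 20 * (f * ‖w‖) := by linarith
        _ = 17 / 20 * f * ‖w‖ := by ring
        _ ≤ _ := by gcongr
    rw [← mul_pow]
    nlinarith
  have := overlap_scalar hu0 hu20 bX bY hX4 E3 (abs_nonneg (inner ℝ (eVec N) v)) (by
    rw [hsw, hu]; field_simp)
  refine this.trans ?_
  gcongr
  norm_num

theorem exists_sign_overlap [NeZero N] (hH : H.IsHermitian) (h : ‖op H‖ ≤ 3) (hf : 20 ≤ f)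
    {v : Fin N → ℝ} (hv : ∑ i, v i ^ 2 = 1)
    (hv' : (perturbed f H).mulVec v = maxEigenvalue (perturbed f H) • v) :
    ∃ s : ℝ, (s = 1 ∨ s = -1) ∧ |(s • v) ⬝ᵥ unitVec N - (1 - 1 / (2 * f ^ 2))| ≤
      10 ^ 7 * (1 / f ^ 3 + |eMoment H 1| / f + |eMoment H 2 - 1| / f ^ 2) := by
  set w : EuclideanSpace ℝ (Fin N) := WithLp.toLp 2 v with hw
  have h1 : ‖w‖ = 1 := by
    rw [EuclideanSpace.norm_eq]
    simp [hw, hv]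
  have h2 : op H w + (f * inner ℝ (eVec N) w) • eVec N = maxEigenvalue (perturbed f H) • w := by
    rw [← op_perturbed]; ext i; exact congrFun hv' i
  have h3 := strong_overlap hH h hf h1 h2
  have h4 : inner ℝ (eVec N) w = v ⬝ᵥ unitVec N := by
    rw [EuclideanSpace.inner_eq_star_dotProduct]; simp [hw, eVec]
  rw [h4] at h3
  rcases abs_choice (v ⬝ᵥ unitVec N) with h5 | h5
  · exact ⟨1, Or.inl rfl, by rwa [one_smul, ← h5]⟩
  · exact ⟨-1, Or.inr rfl, by rwa [neg_one_smul, neg_dotProduct, ← h5]⟩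

theorem abs_dotProduct_unitVec_le [NeZero N] {v : Fin N → ℝ} (hv : ∑ i, v i ^ 2 = 1) :
    |v ⬝ᵥ unitVec N| ≤ 1 := by
  set w : EuclideanSpace ℝ (Fin N) := WithLp.toLp 2 v with hw
  have h1 : ‖w‖ = 1 := by
    rw [EuclideanSpace.norm_eq]
    simp [hw, hv]
  have h4 : inner ℝ (eVec N) w = v ⬝ᵥ unitVec N := by
    rw [EuclideanSpace.inner_eq_star_dotProduct]; simp [hw, eVec]
  have := abs_real_inner_le_norm (eVec N) w
  rwa [h4, norm_eVec, h1, one_mul] at this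

end


/-! ### Bounded centred ensembles and moments of monomials -/

/-- Independent (up to symmetry), centred entries, bounded by `θ`, with variance at most `1 / N`. -/
structure CenteredEnsemble {Ω : Type*} [MeasurableSpace Ω] (P : Measure Ω) {N : ℕ} (θ : ℝ)
    (H : Ω → Matrix (Fin N) (Fin N) ℝ) : Prop where
  measurable : ∀ i j, Measurable fun ω => H ω i j
  symm : ∀ ω i j, H ω i j = H ω j i
  indep : iIndepFun (fun (s : {s : Fin N × Fin N // s.1 ≤ s.2}) ω => H ω s.1.1 s.1.2) P
  bound : ∀ ω i j, |H ω i j| ≤ θ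
  mean : ∀ i j, ∫ ω, H ω i j ∂P = 0
  second_le : ∀ i j, ∫ ω, (H ω i j) ^ 2 ∂P ≤ 1 / N

/-- The unordered pair `{i, j}` as an index of an independent entry. -/
def edge {N : ℕ} (i j : Fin N) : {s : Fin N × Fin N // s.1 ≤ s.2} :=
  ⟨(min i j, max i j), min_le_max⟩

theorem edge_comm {N : ℕ} (i j : Fin N) : edge i j = edge j i := by
  simp [edge, min_comm, max_comm]

theorem edge_eq_iff {N : ℕ} {i j k l : Fin N} :
    edge i j = edge k l ↔ (i = k ∧ j = l) ∨ (i = l ∧ j = k) := by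
  simp only [edge, Subtype.mk.injEq, Prod.mk.injEq]
  constructor
  · rintro ⟨h1, h2⟩
    rcases le_total i j with h | h <;> rcases le_total k l with h' | h' <;> simp_all
  · rintro (⟨rfl, rfl⟩ | ⟨rfl, rfl⟩)
    · simp
    · simp [min_comm, max_comm]

/-- The monomial `∏ₑ hₑ ^ (m e)` in the independent entries. -/
def monomial {N : ℕ} (H : Matrix (Fin N) (Fin N) ℝ) (m : {s : Fin N × Fin N // s.1 ≤ s.2} → ℕ) : ℝ :=
  ∏ e, H e.1.1 e.1.2 ^ m e

theorem monomial_add {N : ℕ} (H : Matrix (Fin N) (Fin N) ℝ)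
    (m m' : {s : Fin N × Fin N // s.1 ≤ s.2} → ℕ) :
    monomial H (m + m') = monomial H m * monomial H m' := by
  simp [monomial, pow_add, Finset.prod_mul_distrib]

theorem monomial_zero {N : ℕ} (H : Matrix (Fin N) (Fin N) ℝ) : monomial H 0 = 1 := by
  simp [monomial]

theorem monomial_sum {N : ℕ} {ι : Type*} (H : Matrix (Fin N) (Fin N) ℝ) (s : Finset ι)
    (m : ι → {s : Fin N × Fin N // s.1 ≤ s.2} → ℕ) :
    monomial H (∑ i ∈ s, m i) = ∏ i ∈ s, monomial H (m i) := by
  classical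
  induction s using Finset.induction_on with
  | empty => simp [monomial_zero]
  | insert a s ha ih => rw [Finset.sum_insert ha, Finset.prod_insert ha, monomial_add, ih]

theorem monomial_single {N : ℕ} {H : Matrix (Fin N) (Fin N) ℝ} (hs : ∀ i j, H i j = H j i)
    (i j : Fin N) : monomial H (Pi.single (edge i j) 1) = H i j := by
  rw [monomial, Finset.prod_eq_single (edge i j)]
  · simp only [Pi.single_eq_same, pow_one]
    rcases le_total i j with h | h
    · simp [edge, h]
    · simp [edge, h, hs i j]
  · intro e _ he
    simp [Pi.single_eq_of_ne he]
  · simp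

section Moments

variable {Ω : Type*} [MeasurableSpace Ω] {P : Measure Ω} [IsProbabilityMeasure P] {N : ℕ} {θ : ℝ}
  {H : Ω → Matrix (Fin N) (Fin N) ℝ}

theorem CenteredEnsemble.measurable_monomial (h : CenteredEnsemble P θ H)
    (m : {s : Fin N × Fin N // s.1 ≤ s.2} → ℕ) : Measurable fun ω => monomial (H ω) m := by
  unfold monomial
  exact Finset.measurable_prod _ fun e _ => (h.measurable _ _).pow_const _

theorem CenteredEnsemble.integrable_monomial (h : CenteredEnsemble P θ H)
    (m : {s : Fin N × Fin N // s.1 ≤ s.2} → ℕ) : Integrable (fun ω => monomial (H ω) m) P := by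
  refine Integrable.of_bound (h.measurable_monomial m).aestronglyMeasurable
    (∏ e, θ ^ m e) (ae_of_all _ fun ω => ?_)
  rw [monomial, Real.norm_eq_abs, Finset.abs_prod]
  refine Finset.prod_le_prod (fun _ _ => abs_nonneg _) fun e _ => ?_
  rw [abs_pow]
  exact pow_le_pow_left₀ (abs_nonneg _) (h.bound ω _ _) _

theorem CenteredEnsemble.integral_monomial (h : CenteredEnsemble P θ H)
    (m : {s : Fin N × Fin N // s.1 ≤ s.2} → ℕ) :
    ∫ ω, monomial (H ω) m ∂P = ∏ e, ∫ ω, H ω e.1.1 e.1.2 ^ m e ∂P := by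
  unfold monomial
  exact h.indep.integral_fun_prod_comp (f := fun e x => x ^ m e)
    (fun e => (h.measurable _ _).aemeasurable) (fun e => by fun_prop)

theorem CenteredEnsemble.integrable_pow (h : CenteredEnsemble P θ H) (i j : Fin N) (a : ℕ) :
    Integrable (fun ω => H ω i j ^ a) P := by
  refine Integrable.of_bound ((h.measurable i j).pow_const a).aestronglyMeasurable
    (θ ^ a) (ae_of_all _ fun ω => ?_)
  rw [Real.norm_eq_abs, abs_pow]
  exact pow_le_pow_left₀ (abs_nonneg _) (h.bound ω _ _) _

theorem CenteredEnsemble.integrable_abs_pow (h : CenteredEnsemble P θ H) (i j : Fin N) (a : ℕ) :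
    Integrable (fun ω => |H ω i j| ^ a) P := by
  simpa [abs_pow] using (h.integrable_pow i j a).abs

theorem CenteredEnsemble.integral_abs_pow_le (h : CenteredEnsemble P θ H) (i j : Fin N) (a : ℕ) :
    ∫ ω, |H ω i j| ^ (a + 2) ∂P ≤ θ ^ a / N := by
  calc ∫ ω, |H ω i j| ^ (a + 2) ∂P ≤ ∫ ω, θ ^ a * H ω i j ^ 2 ∂P := by
        refine integral_mono (h.integrable_abs_pow i j _) ((h.integrable_pow i j 2).const_mul _)
          fun ω => ?_
        simp only [pow_add, sq_abs]
        gcongr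
        exact h.bound ω i j
    _ = θ ^ a * ∫ ω, H ω i j ^ 2 ∂P := integral_const_mul _ _
    _ ≤ θ ^ a * (1 / N) := by
        have : 0 ≤ θ := by
          have : Nonempty Ω := P.nonempty_of_neZero
          exact (abs_nonneg _).trans (h.bound (Classical.arbitrary Ω) i j)
        gcongr
        exact h.second_le i j
    _ = _ := by ring

theorem CenteredEnsemble.abs_integral_pow_le (h : CenteredEnsemble P θ H) (i j : Fin N) (a : ℕ) :
    |∫ ω, H ω i j ^ (a + 2) ∂P| ≤ θ ^ a / N := by
  refine le_trans ?_ (h.integral_abs_pow_le i j a)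
  refine (abs_integral_le_integral_abs).trans (le_of_eq ?_)
  simp [abs_pow]

theorem CenteredEnsemble.abs_integral_pow_le_one (h : CenteredEnsemble P θ H) (hθ : θ ≤ 1)
    (i j : Fin N) (a : ℕ) : |∫ ω, H ω i j ^ a ∂P| ≤ 1 := by
  refine (abs_integral_le_integral_abs).trans ?_
  calc ∫ ω, |H ω i j ^ a| ∂P ≤ ∫ ω, (1 : ℝ) ∂P := by
        refine integral_mono (h.integrable_pow i j a).abs (integrable_const _) fun ω => ?_
        simp only [abs_pow]
        exact pow_le_one₀ (abs_nonneg _) ((h.bound ω i j).trans hθ)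
    _ = 1 := by simp

/-- An entry that occurs at all costs a factor `1 / N`, whatever its multiplicity. So the weight of
a product of walks can be bounded by the number of distinct edges alone. -/
theorem CenteredEnsemble.abs_integral_pow_le_inv (h : CenteredEnsemble P θ H) (hθ : θ ≤ 1)
    (i j : Fin N) {a : ℕ} (ha : a ≠ 0) : |∫ ω, H ω i j ^ a ∂P| ≤ 1 / N := by
  have : Nonempty Ω := P.nonempty_of_neZero
  have h0 : 0 ≤ θ := (abs_nonneg _).trans (h.bound (Classical.arbitrary Ω) i j)
  match a, ha with
  | 1, _ => simp [h.mean i j]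
  | a + 2, _ =>
    refine (h.abs_integral_pow_le i j a).trans ?_
    gcongr
    exact pow_le_one₀ h0 hθ

end Moments

/-! ### Walk expansion of `⟨e, H ^ k e⟩` -/

/-- The product of the entries of `H` along a walk. -/
def walkProd {N k : ℕ} (H : Matrix (Fin N) (Fin N) ℝ) (w : Fin (k + 1) → Fin N) : ℝ :=
  ∏ s : Fin k, H (w s.castSucc) (w s.succ)

/-- Multiplicities of the edges of a walk. -/
def walkMult {N k : ℕ} (w : Fin (k + 1) → Fin N) : {s : Fin N × Fin N // s.1 ≤ s.2} → ℕ :=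
  ∑ s : Fin k, Pi.single (edge (w s.castSucc) (w s.succ)) 1

theorem walkProd_eq_monomial {N k : ℕ} {H : Matrix (Fin N) (Fin N) ℝ} (hs : ∀ i j, H i j = H j i)
    (w : Fin (k + 1) → Fin N) : walkProd H w = monomial H (walkMult w) := by
  rw [walkMult, monomial_sum, walkProd]
  exact Finset.prod_congr rfl fun s _ => (monomial_single hs _ _).symm

theorem walkMult_ne_zero_iff {N k : ℕ} (w : Fin (k + 1) → Fin N)
    (e : {s : Fin N × Fin N // s.1 ≤ s.2}) :
    walkMult w e ≠ 0 ↔ ∃ s : Fin k, edge (w s.castSucc) (w s.succ) = e := by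
  rw [walkMult, Finset.sum_apply, Ne, Finset.sum_eq_zero_iff]
  push Not
  simp [Pi.single_apply, eq_comm]

theorem pow_mulVec_one {N : ℕ} (H : Matrix (Fin N) (Fin N) ℝ) (k : ℕ) (i : Fin N) :
    ((H ^ k).mulVec fun _ => 1) i =
      ∑ w : Fin k → Fin N, walkProd H (Fin.cons i w : Fin (k + 1) → Fin N) := by
  induction k generalizing i with
  | zero => simp [walkProd]
  | succ k ih =>
    rw [pow_succ', ← Matrix.mulVec_mulVec, Matrix.mulVec, dotProduct]
    rw [← (Fin.consEquiv fun _ : Fin (k + 1) => Fin N).sum_comp, Fintype.sum_prod_type]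
    refine Finset.sum_congr rfl fun j _ => ?_
    rw [ih, Finset.mul_sum]
    refine Finset.sum_congr rfl fun w _ => ?_
    simp [walkProd, Fin.prod_univ_succ, Fin.consEquiv]

theorem op_pow {N : ℕ} (H : Matrix (Fin N) (Fin N) ℝ) (k : ℕ) : op H ^ k = op (H ^ k) :=
  (map_pow _ _ _).symm

theorem eMoment_eq_sum {N : ℕ} (H : Matrix (Fin N) (Fin N) ℝ) (k : ℕ) :
    eMoment H k = 1 / N * ∑ w : Fin (k + 1) → Fin N, walkProd H w := by
  rw [eMoment, op_pow, Matrix.inner_toEuclideanCLM]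
  have h1 : (eVec N).ofLp = (1 / Real.sqrt N) • fun _ => (1 : ℝ) := by
    ext i; simp [eVec, unitVec]
  rw [h1, Matrix.mulVec_smul, smul_dotProduct, dotProduct_smul, smul_smul, smul_eq_mul]
  congr 1
  · rw [div_mul_div_comm, one_mul, Real.mul_self_sqrt (Nat.cast_nonneg N)]
  · rw [← (Fin.consEquiv fun _ : Fin (k + 1) => Fin N).sum_comp, Fintype.sum_prod_type, dotProduct]
    refine Finset.sum_congr rfl fun i _ => ?_
    rw [one_mul, pow_mulVec_one]
    rfl


/-! ### Counting families of walks -/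

/-- A map is determined by a set `J` of indices on which it takes each of its values once, its
restriction to `J`, and, for every other index, some index of `J` with the same value. The power of
two counts the sets `J`. -/
theorem card_functions_with_image {I : Type*} [Fintype I] [DecidableEq I] (N V : ℕ) :
    (Finset.univ.filter fun W : I → Fin N => (Finset.univ.image W).card = V).card ≤
      2 ^ Fintype.card I * (N ^ V * Fintype.card I ^ (Fintype.card I - V)) := by
  have hsub : (Finset.univ.filter fun W : I → Fin N => (Finset.univ.image W).card = V) ⊆
      (Finset.univ.filter fun J : Finset I => J.card = V).biUnion fun J =>
        Finset.univ.filter fun W : I → Fin N => J.image W = Finset.univ.image W := by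
    intro W hW
    have hW' : (Finset.univ.image W).card = V := by simpa using hW
    obtain ⟨J, -, hJ1, hJ2⟩ := Finset.exists_subset_injOn_image_eq_of_surjOn (f := W)
      Set.univ (Finset.univ.image W) (by simp [Set.SurjOn])
    simp only [Finset.mem_biUnion, Finset.mem_filter, Finset.mem_univ, true_and]
    refine ⟨J, ?_, hJ2⟩
    rw [← hW', ← hJ2, Finset.card_image_of_injOn hJ1]
  refine (Finset.card_le_card hsub).trans (Finset.card_biUnion_le.trans ?_)
  have hJ : ∀ J ∈ (Finset.univ.filter fun J : Finset I => J.card = V),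
      (Finset.univ.filter fun W : I → Fin N => J.image W = Finset.univ.image W).card ≤
        N ^ V * Fintype.card I ^ (Fintype.card I - V) := by
    intro J hJ
    have hJ' : J.card = V := by simpa using hJ
    have hex : ∀ W : I → Fin N, J.image W = Finset.univ.image W → ∀ i, ∃ j ∈ J, W j = W i := by
      intro W hW i
      have : W i ∈ J.image W := by rw [hW]; exact Finset.mem_image_of_mem _ (Finset.mem_univ _)
      simpa using this
    let S := {W : I → Fin N // J.image W = Finset.univ.image W}
    let F : S → ((J → Fin N) × ({i // i ∉ J} → I)) := fun W =>
      (fun j => W.1 j, fun i => (hex W.1 W.2 i).choose)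
    have hF : Function.Injective F := by
      rintro ⟨W, hW⟩ ⟨W', hW'⟩ h
      simp only [F, Prod.mk.injEq, funext_iff] at h
      refine Subtype.ext (funext fun i => ?_)
      by_cases hi : i ∈ J
      · exact h.1 ⟨i, hi⟩
      · have h2 := h.2 ⟨i, hi⟩
        have h3 := (hex W hW i).choose_spec
        have h4 := (hex W' hW' i).choose_spec
        calc W i = W (hex W hW i).choose := h3.2.symm
          _ = W' (hex W hW i).choose := h.1 ⟨_, h3.1⟩
          _ = W' (hex W' hW' i).choose := by rw [h2]
          _ = W' i := h4.2
    have := Fintype.card_le_of_injective F hF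
    rw [Fintype.card_prod, Fintype.card_fun, Fintype.card_fun, Fintype.card_fin, Fintype.card_coe,
      hJ', Fintype.card_subtype_compl, Fintype.card_coe, hJ'] at this
    rwa [← Fintype.card_subtype]
  refine (Finset.sum_le_card_nsmul _ _ _ hJ).trans ?_
  rw [smul_eq_mul]
  refine Nat.mul_le_mul_right _ ?_
  calc _ ≤ (Finset.univ : Finset (Finset I)).card := Finset.card_filter_le _ _
    _ = _ := by rw [Finset.card_univ, Fintype.card_finset]

/-! ### Vertices, edges and components of a family of walks. -/

section Family

variable {N n k : ℕ} (W : Fin n → Fin (k + 1) → Fin N)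

/-- The edges used by a family of walks. -/
def familyEdges : Finset {s : Fin N × Fin N // s.1 ≤ s.2} :=
  Finset.univ.filter fun e => ∃ r, walkMult (W r) e ≠ 0

/-- The vertices visited by a family of walks. -/
def familyVertices : Finset (Fin N) :=
  Finset.univ.image fun p : Fin n × Fin (k + 1) => W p.1 p.2

/-- Every walk of the family shares an edge with another one. -/
def IsLinked : Prop := ∀ r, ∃ r' ≠ r, ∃ e, walkMult (W r) e ≠ 0 ∧ walkMult (W r') e ≠ 0

variable {W}

theorem edge_mem_familyEdges (r : Fin n) (s : Fin k) :
    edge (W r s.castSucc) (W r s.succ) ∈ familyEdges W := by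
  simp only [familyEdges, Finset.mem_filter, Finset.mem_univ, true_and]
  exact ⟨r, (walkMult_ne_zero_iff _ _).2 ⟨s, rfl⟩⟩

theorem card_familyVertices_le_two_mul (hk : 1 ≤ k) :
    (familyVertices W).card ≤ 2 * (familyEdges W).card := by
  have h : familyVertices W ⊆ (familyEdges W).biUnion fun e => {e.1.1, e.1.2} := by
    intro v hv
    simp only [familyVertices, Finset.mem_image, Finset.mem_univ, true_and, Prod.exists] at hv
    obtain ⟨r, s, rfl⟩ := hv
    rw [Finset.mem_biUnion]
    have hmem : ∀ i j : Fin N, i ∈ ({(edge i j).1.1, (edge i j).1.2} : Finset (Fin N)) := by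
      intro i j
      rcases le_total i j with h | h <;> simp [edge, h]
    have hmem' : ∀ i j : Fin N, j ∈ ({(edge i j).1.1, (edge i j).1.2} : Finset (Fin N)) := by
      intro i j; rw [edge_comm]; exact hmem j i
    by_cases hs : s = Fin.last k
    · obtain ⟨k', rfl⟩ : ∃ k', k = k' + 1 := ⟨k - 1, by omega⟩
      refine ⟨_, edge_mem_familyEdges r (Fin.last k'), ?_⟩
      rw [hs]
      exact hmem' _ _
    · obtain ⟨t, rfl⟩ := Fin.exists_castSucc_eq.2 hs
      exact ⟨_, edge_mem_familyEdges r t, hmem _ _⟩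
  refine (Finset.card_le_card h).trans (Finset.card_biUnion_le.trans ?_)
  refine (Finset.sum_le_card_nsmul _ _ 2 fun e _ => Finset.card_le_two).trans ?_
  rw [smul_eq_mul, mul_comm]

/-- In a graph the number of vertices is at most the number of edges plus the number of components.
Each component contains a whole walk together with the walks linked to it, hence at least two walks,
so there are at most `n / 2` components. They are counted by linear algebra: the kernel of the
coboundary map `L` consists of the functions constant on components, and the rank of `L` is at most
the number of edges. -/
theorem two_mul_card_familyVertices_le (hW : IsLinked W) :
    2 * (familyVertices W).card ≤ 2 * (familyEdges W).card + n := by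
  classical
  let L : (Fin N → ℚ) →ₗ[ℚ] (familyEdges W → ℚ) :=
    { toFun := fun φ e => φ e.1.1.1 - φ e.1.1.2
      map_add' := fun φ ψ => by ext e; simp; ring
      map_smul' := fun c φ => by ext e; simp; ring }
  have hker : ∀ φ ∈ LinearMap.ker L, ∀ i j, edge i j ∈ familyEdges W → φ i = φ j := by
    intro φ hφ i j hij
    have h1 := congrFun (LinearMap.mem_ker.1 hφ) ⟨edge i j, hij⟩
    simp only [L, LinearMap.coe_mk, AddHom.coe_mk, Pi.zero_apply] at h1
    rcases le_total i j with h | h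
    · simp only [edge, h, min_eq_left, max_eq_right] at h1; linarith
    · simp only [edge, h, min_eq_right, max_eq_left] at h1; linarith
  have hwalk : ∀ φ ∈ LinearMap.ker L, ∀ r (s : Fin (k + 1)), φ (W r s) = φ (W r 0) := by
    intro φ hφ r s
    induction s using Fin.induction with
    | zero => rfl
    | succ s ih => rw [← ih]; exact (hker φ hφ _ _ (edge_mem_familyEdges r s)).symm
  have hend : ∀ φ ∈ LinearMap.ker L, ∀ r e, walkMult (W r) e ≠ 0 → φ e.1.1 = φ (W r 0) := by
    intro φ hφ r e he
    obtain ⟨s, hs⟩ := (walkMult_ne_zero_iff _ _).1 he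
    rcases le_total (W r s.castSucc) (W r s.succ) with h | h
    · rw [← hs]; simp only [edge, h, min_eq_left]; exact hwalk φ hφ r _
    · rw [← hs]; simp only [edge, h, min_eq_right]; exact hwalk φ hφ r _
  -- Walks are identified when no function in the kernel separates them. Linked walks are, since
  -- they share an edge, so every class has at least two elements.
  let S : Setoid (Fin n) :=
    { r := fun r r' => ∀ φ ∈ LinearMap.ker L, φ (W r 0) = φ (W r' 0)
      iseqv := ⟨fun _ _ _ => rfl, fun h φ hφ => (h φ hφ).symm,
        fun h h' φ hφ => (h φ hφ).trans (h' φ hφ)⟩ }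
  have hQ : 2 * Fintype.card (Quotient S) ≤ n := by
    have h1 : (Finset.univ : Finset (Fin n)).card = ∑ q : Quotient S,
        (Finset.univ.filter fun r : Fin n => (Quotient.mk S r) = q).card :=
      Finset.card_eq_sum_card_fiberwise fun _ _ => Finset.mem_univ _
    rw [Finset.card_univ, Fintype.card_fin] at h1
    refine le_of_le_of_eq ?_ h1.symm
    rw [mul_comm, ← smul_eq_mul, ← Finset.card_univ]
    refine Finset.card_nsmul_le_sum _ _ _ fun q _ => ?_
    obtain ⟨r, rfl⟩ := Quotient.exists_rep q
    obtain ⟨r', hr', e, he, he'⟩ := hW r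
    have : Quotient.mk S r' = Quotient.mk S r := by
      refine Quotient.sound fun φ hφ => ?_
      rw [← hend φ hφ r e he, ← hend φ hφ r' e he']
    calc 2 = ({r, r'} : Finset (Fin n)).card := (Finset.card_pair hr'.symm).symm
      _ ≤ _ := Finset.card_le_card fun x hx => by
        rcases Finset.mem_insert.1 hx with rfl | hx
        · simp
        · rw [Finset.mem_singleton.1 hx]; simpa using this
  -- A function in the kernel is determined by one value per class of walks and its values off the
  -- visited vertices; this bounds the dimension of the kernel.
  let M : LinearMap.ker L →ₗ[ℚ] ((Quotient S → ℚ) × ({v // v ∉ familyVertices W} → ℚ)) :=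
    { toFun := fun φ => (fun q => φ.1 (W q.out 0), fun v => φ.1 v)
      map_add' := fun φ ψ => by ext <;> simp
      map_smul' := fun c φ => by ext <;> simp }
  have hM : Function.Injective M := by
    rw [← LinearMap.ker_eq_bot, LinearMap.ker_eq_bot']
    rintro ⟨φ, hφ⟩ h
    simp only [M, LinearMap.coe_mk, AddHom.coe_mk, Prod.mk_eq_zero, funext_iff] at h
    refine Subtype.ext (funext fun v => ?_)
    by_cases hv : v ∈ familyVertices W
    · simp only [familyVertices, Finset.mem_image, Finset.mem_univ, true_and, Prod.exists] at hv
      obtain ⟨r, s, rfl⟩ := hv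
      have h1 : φ (W (Quotient.mk S r).out 0) = φ (W r 0) := Quotient.mk_out (s := S) r φ hφ
      have h2 := h.1 (Quotient.mk S r)
      simp only [Pi.zero_apply] at h2
      simp only [ZeroMemClass.coe_zero, Pi.zero_apply]
      rw [hwalk φ hφ, ← h1, h2]
    · exact h.2 ⟨v, hv⟩
  have h1 := LinearMap.finrank_le_finrank_of_injective hM
  have h2 := L.finrank_range_add_finrank_ker
  have h3 : Module.finrank ℚ (LinearMap.range L) ≤ (familyEdges W).card := by
    refine (Submodule.finrank_le _).trans ?_
    rw [Module.finrank_fintype_fun_eq_card, Fintype.card_coe]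
  rw [Module.finrank_prod, Module.finrank_fintype_fun_eq_card, Module.finrank_fintype_fun_eq_card,
    Fintype.card_subtype_compl, Fintype.card_coe, Fintype.card_fin] at h1
  rw [Module.finrank_fintype_fun_eq_card, Fintype.card_fin] at h2
  have h4 : (familyVertices W).card ≤ N := by
    simpa using Finset.card_le_univ (familyVertices W)
  omega

end Family


/-! ### Central moments of `⟨e, H ^ k e⟩` -/

section CentralMoments

variable {Ω : Type*} [MeasurableSpace Ω] {P : Measure Ω} [IsProbabilityMeasure P] {N : ℕ} {θ : ℝ}
  {H : Ω → Matrix (Fin N) (Fin N) ℝ}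

/-- The set of edges occurring in a multiplicity function. -/
def edgeSupport (m : {s : Fin N × Fin N // s.1 ≤ s.2} → ℕ) :
    Finset {s : Fin N × Fin N // s.1 ≤ s.2} :=
  Finset.univ.filter fun e => m e ≠ 0

theorem mem_edgeSupport {m : {s : Fin N × Fin N // s.1 ≤ s.2} → ℕ}
    {e : {s : Fin N × Fin N // s.1 ≤ s.2}} : e ∈ edgeSupport m ↔ m e ≠ 0 := by
  simp [edgeSupport]

theorem edgeSupport_add (m m' : {s : Fin N × Fin N // s.1 ≤ s.2} → ℕ) :
    edgeSupport (m + m') = edgeSupport m ∪ edgeSupport m' := by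
  ext e; simp [mem_edgeSupport]; omega

theorem CenteredEnsemble.abs_integral_monomial_le (h : CenteredEnsemble P θ H) (hθ : θ ≤ 1)
    (m : {s : Fin N × Fin N // s.1 ≤ s.2} → ℕ) :
    |∫ ω, monomial (H ω) m ∂P| ≤ (1 / N : ℝ) ^ (edgeSupport m).card := by
  rw [h.integral_monomial, Finset.abs_prod, ← Finset.prod_const, edgeSupport, Finset.prod_filter]
  refine Finset.prod_le_prod (fun _ _ => abs_nonneg _) fun e _ => ?_
  split_ifs with he
  · exact h.abs_integral_pow_le_inv hθ _ _ he
  · exact h.abs_integral_pow_le_one hθ _ _ _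

theorem CenteredEnsemble.integral_monomial_add (h : CenteredEnsemble P θ H)
    {m m' : {s : Fin N × Fin N // s.1 ≤ s.2} → ℕ}
    (hd : Disjoint (edgeSupport m) (edgeSupport m')) :
    ∫ ω, monomial (H ω) (m + m') ∂P =
      (∫ ω, monomial (H ω) m ∂P) * ∫ ω, monomial (H ω) m' ∂P := by
  simp only [h.integral_monomial, ← Finset.prod_mul_distrib]
  refine Finset.prod_congr rfl fun e _ => ?_
  by_cases he : m e = 0
  · simp [he]
  · have : m' e = 0 := by
      by_contra he'
      exact Finset.disjoint_left.1 hd (mem_edgeSupport.2 he) (mem_edgeSupport.2 he')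
    simp [this]

variable {ι : Type*} [DecidableEq ι] (m : ι → {s : Fin N × Fin N // s.1 ≤ s.2} → ℕ)

theorem CenteredEnsemble.integrable_prod_centred (h : CenteredEnsemble P θ H) (c : ι → ℝ)
    (S : Finset ι) (m' : {s : Fin N × Fin N // s.1 ≤ s.2} → ℕ) :
    Integrable (fun ω => (∏ r ∈ S, (monomial (H ω) (m r) - c r)) * monomial (H ω) m') P := by
  induction S using Finset.induction_on generalizing m' with
  | empty => simpa using h.integrable_monomial m'
  | insert a S ha ih =>
    have : (fun ω => (∏ r ∈ insert a S, (monomial (H ω) (m r) - c r)) * monomial (H ω) m') =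
        fun ω => (∏ r ∈ S, (monomial (H ω) (m r) - c r)) * monomial (H ω) (m a + m') -
          c a * ((∏ r ∈ S, (monomial (H ω) (m r) - c r)) * monomial (H ω) m') := by
      ext ω; rw [Finset.prod_insert ha, monomial_add]; ring
    rw [this]
    exact (ih _).sub ((ih _).const_mul _)

theorem CenteredEnsemble.integral_prod_centred_insert (h : CenteredEnsemble P θ H) (c : ι → ℝ)
    {S : Finset ι} {a : ι} (ha : a ∉ S) (m' : {s : Fin N × Fin N // s.1 ≤ s.2} → ℕ) :
    ∫ ω, (∏ r ∈ insert a S, (monomial (H ω) (m r) - c r)) * monomial (H ω) m' ∂P =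
      (∫ ω, (∏ r ∈ S, (monomial (H ω) (m r) - c r)) * monomial (H ω) (m a + m') ∂P) -
        c a * ∫ ω, (∏ r ∈ S, (monomial (H ω) (m r) - c r)) * monomial (H ω) m' ∂P := by
  rw [← integral_const_mul, ← integral_sub (h.integrable_prod_centred _ _ _ _)
    ((h.integrable_prod_centred _ _ _ _).const_mul _)]
  congr 1
  ext ω; rw [Finset.prod_insert ha, monomial_add]; ring

/-- Expanding the centred product gives `2 ^ S.card` terms. Splitting off a mean never loses a power
of `1 / N`, because the size of a union of edge sets is at most the sum of the sizes. The monomial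
`m'` collects the factors already expanded and makes the induction run. -/
theorem CenteredEnsemble.abs_integral_prod_centred_le (h : CenteredEnsemble P θ H) (hθ : θ ≤ 1)
    (S : Finset ι) (m' : {s : Fin N × Fin N // s.1 ≤ s.2} → ℕ) :
    |∫ ω, (∏ r ∈ S, (monomial (H ω) (m r) - ∫ ω', monomial (H ω') (m r) ∂P)) *
        monomial (H ω) m' ∂P| ≤
      2 ^ S.card * (1 / N : ℝ) ^ (edgeSupport m' ∪ S.biUnion fun r => edgeSupport (m r)).card := by
  have hN : (0 : ℝ) ≤ 1 / N := by positivity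
  have hN1 : (1 / N : ℝ) ≤ 1 := by
    rcases Nat.eq_zero_or_pos N with rfl | h0
    · simp
    · rw [div_le_one (by positivity)]; exact_mod_cast h0
  induction S using Finset.induction_on generalizing m' with
  | empty => simpa using h.abs_integral_monomial_le hθ m'
  | insert a S ha ih =>
    rw [h.integral_prod_centred_insert m _ ha, Finset.card_insert_of_notMem ha,
      Finset.biUnion_insert]
    refine (abs_sub _ _).trans ?_
    rw [abs_mul, pow_succ, mul_two, add_mul]
    refine add_le_add ((ih _).trans (le_of_eq ?_)) ?_
    · congr 3
      rw [edgeSupport_add]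
      ext e; simp only [Finset.mem_union]; tauto
    · refine (mul_le_mul (h.abs_integral_monomial_le hθ (m a)) (ih m') (abs_nonneg _)
        (by positivity)).trans ?_
      rw [mul_left_comm, ← pow_add]
      refine mul_le_mul_of_nonneg_left (pow_le_pow_of_le_one hN hN1 ?_) (by positivity)
      refine le_trans (Finset.card_le_card ?_) (Finset.card_union_le _ _)
      intro e; simp only [Finset.mem_union]; tauto

/-- A centred factor independent of all the others integrates to zero. The other factors are moved
one by one into `m'`, which stays disjoint from the edges of `a`. -/
theorem CenteredEnsemble.integral_prod_centred_eq_zero (h : CenteredEnsemble P θ H) (c : ι → ℝ)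
    {S : Finset ι} {a : ι} (ha : a ∉ S) (hc : c a = ∫ ω', monomial (H ω') (m a) ∂P)
    (hS : ∀ r ∈ S, Disjoint (edgeSupport (m a)) (edgeSupport (m r)))
    (m' : {s : Fin N × Fin N // s.1 ≤ s.2} → ℕ)
    (hm' : Disjoint (edgeSupport (m a)) (edgeSupport m')) :
    ∫ ω, (∏ r ∈ insert a S, (monomial (H ω) (m r) - c r)) * monomial (H ω) m' ∂P = 0 := by
  induction S using Finset.induction_on generalizing m' with
  | empty =>
    rw [h.integral_prod_centred_insert m c (by simp)]
    simp only [Finset.prod_empty, one_mul]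
    rw [h.integral_monomial_add hm', hc, sub_self]
  | insert b S hb ih =>
    rw [Finset.insert_comm, h.integral_prod_centred_insert m c]
    · rw [ih, ih, mul_zero, sub_zero]
      · exact fun h => ha (Finset.mem_insert_of_mem h)
      · exact fun r hr => hS r (Finset.mem_insert_of_mem hr)
      · exact hm'
      · exact fun h => ha (Finset.mem_insert_of_mem h)
      · exact fun r hr => hS r (Finset.mem_insert_of_mem hr)
      · rw [edgeSupport_add]
        exact Finset.disjoint_union_right.2 ⟨hS b (Finset.mem_insert_self _ _), hm'⟩
    · rw [Finset.mem_insert]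
      rintro (rfl | h')
      · exact ha (Finset.mem_insert_self _ _)
      · exact hb h'

theorem CenteredEnsemble.abs_integral_family_le (h : CenteredEnsemble P θ H) (hθ : θ ≤ 1)
    {n k : ℕ} (W : Fin n → Fin (k + 1) → Fin N) :
    |∫ ω, ∏ r, (walkProd (H ω) (W r) - ∫ ω', walkProd (H ω') (W r) ∂P) ∂P| ≤
      2 ^ n * (1 / N : ℝ) ^ (familyEdges W).card := by
  simp only [walkProd_eq_monomial (h.symm _)]
  have h1 := h.abs_integral_prod_centred_le (fun r => walkMult (W r)) hθ Finset.univ 0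
  simp only [monomial_zero, mul_one, Finset.card_univ, Fintype.card_fin] at h1
  refine h1.trans (le_of_eq ?_)
  congr 3
  ext e
  simp [mem_edgeSupport, familyEdges]

theorem CenteredEnsemble.integral_family_eq_zero (h : CenteredEnsemble P θ H)
    {n k : ℕ} {W : Fin n → Fin (k + 1) → Fin N} (hW : ¬ IsLinked W) :
    ∫ ω, ∏ r, (walkProd (H ω) (W r) - ∫ ω', walkProd (H ω') (W r) ∂P) ∂P = 0 := by
  simp only [walkProd_eq_monomial (h.symm _)]
  simp only [IsLinked] at hW
  push Not at hW
  obtain ⟨r, hr⟩ := hW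
  have h1 := h.integral_prod_centred_eq_zero (fun r => walkMult (W r))
    (fun r => ∫ ω', monomial (H ω') (walkMult (W r)) ∂P) (Finset.notMem_erase r Finset.univ) rfl
    (fun r' hr' => Finset.disjoint_left.2 fun e he he' => mem_edgeSupport.1 he'
      (hr r' (Finset.ne_of_mem_erase hr') e (mem_edgeSupport.1 he))) 0
    (by simp [edgeSupport])
  simpa [monomial_zero, Finset.insert_erase] using h1

/-- With `s = √N` and `M = n (k + 1)`, at most `2 ^ M * s ^ (2 V) * M ^ (M - V)` families visit `V`
vertices, and each weighs at most `s ^ (-max (2 V - n) V)` by the two bounds relating vertices and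
edges. For `V ≥ n` the product is at most `2 ^ M * s ^ n * M ^ (n k)` directly; for `V < n` the
surplus `M ^ (n - V)` is paid by `M ≤ s`. The `M + 1` values of `V` give another factor `2 ^ M`. -/
theorem sum_isLinked_le {n k : ℕ} (hk : 1 ≤ k) {s : ℝ} (hs : 1 ≤ s) (hsN : s ^ 2 = N)
    (hM : (n * (k + 1) : ℕ) ≤ s) (S : Finset (Fin n → Fin (k + 1) → Fin N))
    (hS : ∀ W ∈ S, IsLinked W) :
    ∑ W ∈ S, (1 / N : ℝ) ^ (familyEdges W).card ≤
      s ^ n * (4 ^ (n * (k + 1)) * (n * (k + 1) : ℕ) ^ (n * k)) := by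
  set M := n * (k + 1) with hMdef
  have hs0 : (0 : ℝ) < s := by linarith
  let F : ℕ → ℝ := fun V => (s ^ max (2 * V - n) V)⁻¹
  have h1 : ∀ W ∈ S, (1 / N : ℝ) ^ (familyEdges W).card ≤ F (familyVertices W).card := by
    intro W hW
    rw [← hsN, one_div, inv_pow, ← pow_mul]
    refine inv_anti₀ (by positivity) (pow_le_pow_right₀ hs ?_)
    have := card_familyVertices_le_two_mul (W := W) hk
    have := two_mul_card_familyVertices_le (hS W hW)
    omega
  have hF : ∀ V, 0 ≤ F V := fun V => by positivity
  have hcard : ∀ W : Fin n × Fin (k + 1) → Fin N, (Finset.univ.image W).card ≤ M := by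
    intro W
    refine Finset.card_image_le.trans ?_
    simp [hMdef]
  calc ∑ W ∈ S, (1 / N : ℝ) ^ (familyEdges W).card
      ≤ ∑ W ∈ S, F (familyVertices W).card := Finset.sum_le_sum h1
    _ ≤ ∑ W : Fin n → Fin (k + 1) → Fin N, F (familyVertices W).card :=
        Finset.sum_le_sum_of_subset_of_nonneg (Finset.subset_univ _) fun _ _ _ => hF _
    _ = ∑ W : Fin n × Fin (k + 1) → Fin N, F (Finset.univ.image W).card := by
        rw [← (Equiv.curry (Fin n) (Fin (k + 1)) (Fin N)).sum_comp]
        rfl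
    _ = ∑ V ∈ Finset.range (M + 1), ∑ W : Fin n × Fin (k + 1) → Fin N with
          (Finset.univ.image W).card = V, F (Finset.univ.image W).card :=
        (Finset.sum_fiberwise_of_maps_to (fun W _ => Finset.mem_range_succ_iff.2 (hcard W)) _).symm
    _ ≤ ∑ V ∈ Finset.range (M + 1), 2 ^ M * s ^ n * (M : ℝ) ^ (n * k) := by
        refine Finset.sum_le_sum fun V hV => ?_
        have hVM : V ≤ M := Finset.mem_range_succ_iff.1 hV
        have h2 : ∑ W : Fin n × Fin (k + 1) → Fin N with (Finset.univ.image W).card = V,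
            F (Finset.univ.image W).card = (Finset.univ.filter fun W : Fin n × Fin (k + 1) → Fin N =>
              (Finset.univ.image W).card = V).card * F V := by
          rw [← nsmul_eq_mul, ← Finset.sum_const]
          refine Finset.sum_congr rfl fun W hW => ?_
          rw [(Finset.mem_filter.1 hW).2]
        rw [h2]
        have h3 := card_functions_with_image (I := Fin n × Fin (k + 1)) N V
        rw [Fintype.card_prod, Fintype.card_fin, Fintype.card_fin] at h3
        have h4 : ((Finset.univ.filter fun W : Fin n × Fin (k + 1) → Fin N =>
            (Finset.univ.image W).card = V).card : ℝ) ≤ 2 ^ M * ((s ^ 2) ^ V * (M : ℝ) ^ (M - V)) := by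
          rw [hsN]; exact_mod_cast h3
        refine (mul_le_mul_of_nonneg_right h4 (hF V)).trans ?_
        simp only [F]
        rw [← div_eq_mul_inv, div_le_iff₀ (by positivity), ← pow_mul]
        have key : s ^ (2 * V) * (M : ℝ) ^ (M - V) ≤
            s ^ n * (M : ℝ) ^ (n * k) * s ^ max (2 * V - n) V := by
          have hMn : M - n = n * k := by rw [hMdef, mul_add, mul_one]; omega
          rcases le_or_gt n V with hV' | hV'
          · have : max (2 * V - n) V = 2 * V - n := by omega
            rw [this, mul_right_comm, ← pow_add, show n + (2 * V - n) = 2 * V by omega]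
            refine mul_le_mul_of_nonneg_left ?_ (by positivity)
            rcases Nat.eq_zero_or_pos M with h0 | h0
            · have h5 : n = 0 := by
                rcases Nat.mul_eq_zero.1 (hMdef.symm.trans h0) with h | h
                · exact h
                · omega
              have h6 : M - V = 0 := by omega
              simp [h5, h6]
            · exact pow_le_pow_right₀ (by exact_mod_cast h0) (by omega)
          · have : max (2 * V - n) V = V := by omega
            rw [this, show M - V = (M - n) + (n - V) by
              have : n ≤ M := by rw [hMdef]; exact Nat.le_mul_of_pos_right n (by omega)
              omega, hMn, pow_add]
            calc s ^ (2 * V) * ((M : ℝ) ^ (n * k) * (M : ℝ) ^ (n - V))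
                ≤ s ^ (2 * V) * ((M : ℝ) ^ (n * k) * s ^ (n - V)) := by gcongr
              _ = s ^ n * (M : ℝ) ^ (n * k) * s ^ V := by
                  obtain ⟨d, rfl⟩ := Nat.exists_eq_add_of_lt hV'
                  rw [show V + d + 1 - V = d + 1 by omega]
                  ring
        calc _ = 2 ^ M * (s ^ (2 * V) * (M : ℝ) ^ (M - V)) := rfl
          _ ≤ 2 ^ M * (s ^ n * (M : ℝ) ^ (n * k) * s ^ max (2 * V - n) V) := by gcongr
          _ = _ := by ring
    _ = (M + 1 : ℕ) * (2 ^ M * s ^ n * (M : ℝ) ^ (n * k)) := by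
        rw [Finset.sum_const, Finset.card_range, nsmul_eq_mul]
    _ ≤ 2 ^ M * (2 ^ M * s ^ n * (M : ℝ) ^ (n * k)) := by
        gcongr
        exact_mod_cast Nat.lt_two_pow_self
    _ = s ^ n * (4 ^ M * (M : ℝ) ^ (n * k)) := by
        rw [show (4 : ℝ) = 2 * 2 by norm_num, mul_pow]; ring

theorem CenteredEnsemble.integrable_walkProd (h : CenteredEnsemble P θ H) {k : ℕ}
    (w : Fin (k + 1) → Fin N) : Integrable (fun ω => walkProd (H ω) w) P := by
  simp only [walkProd_eq_monomial (h.symm _)]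
  exact h.integrable_monomial _

theorem CenteredEnsemble.integrable_eMoment (h : CenteredEnsemble P θ H) (k : ℕ) :
    Integrable (fun ω => eMoment (H ω) k) P := by
  simp only [eMoment_eq_sum]
  exact (integrable_finsetSum _ fun w _ => h.integrable_walkProd w).const_mul _

theorem CenteredEnsemble.eMoment_sub_integral (h : CenteredEnsemble P θ H) (k : ℕ) (ω : Ω) :
    eMoment (H ω) k - ∫ ω', eMoment (H ω') k ∂P =
      1 / N * ∑ w : Fin (k + 1) → Fin N,
        (walkProd (H ω) w - ∫ ω', walkProd (H ω') w ∂P) := by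
  simp only [eMoment_eq_sum]
  rw [integral_const_mul, integral_finsetSum _ fun w _ => h.integrable_walkProd w,
    Finset.sum_sub_distrib, mul_sub]

theorem CenteredEnsemble.abs_integral_eMoment_sub_pow_le (h : CenteredEnsemble P θ H)
    (hθ : θ ≤ 1) {n k : ℕ} (hk : 1 ≤ k) (hN : 0 < N) (hM : (n * (k + 1) : ℕ) ≤ Real.sqrt N) :
    Integrable (fun ω => (eMoment (H ω) k - ∫ ω', eMoment (H ω') k ∂P) ^ n) P ∧
    |∫ ω, (eMoment (H ω) k - ∫ ω', eMoment (H ω') k ∂P) ^ n ∂P| ≤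
      2 ^ n * 4 ^ (n * (k + 1)) * (n * (k + 1) : ℕ) ^ (n * k) / Real.sqrt N ^ n := by
  classical
  have hN' : (1 : ℝ) ≤ N := by exact_mod_cast hN
  set s := Real.sqrt N with hsdef
  have hs : 1 ≤ s := Real.one_le_sqrt.2 hN'
  have hs2 : s ^ 2 = N := Real.sq_sqrt (by positivity)
  have hint : ∀ W : Fin n → Fin (k + 1) → Fin N, Integrable (fun ω =>
      ∏ r, (walkProd (H ω) (W r) - ∫ ω', walkProd (H ω') (W r) ∂P)) P := by
    intro W
    simp only [walkProd_eq_monomial (h.symm _)]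
    simpa [monomial_zero] using h.integrable_prod_centred (fun r => walkMult (W r))
      (fun r => ∫ ω', monomial (H ω') (walkMult (W r)) ∂P) Finset.univ 0
  simp only [h.eMoment_sub_integral, mul_pow, Fintype.sum_pow]
  refine ⟨(integrable_finsetSum _ fun W _ => hint W).const_mul _, ?_⟩
  rw [integral_const_mul, integral_finsetSum _ fun W _ => hint W, abs_mul,
    abs_of_nonneg (by positivity : (0 : ℝ) ≤ (1 / N) ^ n)]
  have h1 : |∑ W : Fin n → Fin (k + 1) → Fin N, ∫ ω,
      ∏ r, (walkProd (H ω) (W r) - ∫ ω', walkProd (H ω') (W r) ∂P) ∂P| ≤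
      2 ^ n * (s ^ n * (4 ^ (n * (k + 1)) * (n * (k + 1) : ℕ) ^ (n * k))) := by
    refine (Finset.abs_sum_le_sum_abs _ _).trans ?_
    rw [← Finset.sum_filter_add_sum_filter_not Finset.univ fun W => IsLinked W]
    have h2 : ∑ W : Fin n → Fin (k + 1) → Fin N with ¬ IsLinked W,
        |∫ ω, ∏ r, (walkProd (H ω) (W r) - ∫ ω', walkProd (H ω') (W r) ∂P) ∂P| = 0 :=
      Finset.sum_eq_zero fun W hW => by
        rw [h.integral_family_eq_zero (Finset.mem_filter.1 hW).2, abs_zero]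
    rw [h2, add_zero]
    refine (Finset.sum_le_sum fun W _ => h.abs_integral_family_le hθ W).trans ?_
    rw [← Finset.mul_sum]
    refine mul_le_mul_of_nonneg_left ?_ (by positivity)
    exact sum_isLinked_le hk hs hs2 hM _ fun W hW => (Finset.mem_filter.1 hW).2
  refine (mul_le_mul_of_nonneg_left h1 (by positivity)).trans (le_of_eq ?_)
  rw [← hs2]
  rw [one_div, inv_pow, ← pow_mul, mul_comm 2 n, pow_mul]
  field_simp

end CentralMoments


/-! ### Sums over nonbacktracking walks -/

/-- Multiplicity functions on the edges of the complete graph with loops. -/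
abbrev Mult (N : ℕ) := {s : Fin N × Fin N // s.1 ≤ s.2} → ℕ

/-- The sum of `∏ h · φ (end)` over the walks with `n` steps from `v` that neither use loops nor
backtrack, the first step avoiding `p`. -/
def nbSum {N : ℕ} (H : Matrix (Fin N) (Fin N) ℝ) (φ : Fin N → ℝ) : ℕ → Fin N → Fin N → ℝ
  | 0, _, v => φ v
  | n + 1, p, v => ∑ u, if u = p ∨ u = v then 0 else H v u * nbSum H φ n v u

/-- The corresponding sum of a functional of the multiplicities accumulated along the walk. -/
def nbBound {N : ℕ} (G : Mult N → Fin N → Fin N → ℝ) : ℕ → Mult N → Fin N → Fin N → ℝ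
  | 0, m, p, v => G m p v
  | n + 1, m, p, v => ∑ u, if u = p ∨ u = v then 0 else
      nbBound G n (m + Pi.single (edge v u) 1) v u

/-! ### A potential for partially traced nonbacktracking walks. -/

section Potential

variable {N : ℕ}

/-- The number of edges at `v` used exactly once. -/
def onceDeg (m : Mult N) (v : Fin N) : ℕ := (Finset.univ.filter fun u => m (edge v u) = 1).card

/-- The number of edges at `v`, other than the one to `p`, used exactly once. -/
def onceDegFrom (m : Mult N) (p v : Fin N) : ℕ :=
  (Finset.univ.filter fun u => u ≠ p ∧ m (edge v u) = 1).card

/-- The vertices incident to a used edge. -/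
def touched (m : Mult N) : Finset (Fin N) := Finset.univ.filter fun v => ∃ u, m (edge v u) ≠ 0

/-- The vertex `v` has just been reached for the first time, from `p`. -/
def IsFresh (m : Mult N) (p v : Fin N) : Prop := m (edge v p) = 1 ∧ ∀ u ≠ p, m (edge v u) = 0

/-- The excess of singly used edges. -/
def excess (m : Mult N) (p v : Fin N) : ℕ :=
  (∑ u ∈ Finset.univ.erase v, (onceDeg m u - 2)) + (onceDegFrom m p v - 1)

/-- The weight of an edge used `j` times. -/
noncomputable def edgeWeight (N : ℕ) (θ : ℝ) : ℕ → ℝ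
  | 0 => 1
  | 1 => 1 / N
  | 2 => 1 / N
  | j + 3 => θ * edgeWeight N θ (j + 2)

/-- The weight of a multiplicity function. -/
noncomputable def multWeight (θ : ℝ) (m : Mult N) : ℝ := ∏ e, edgeWeight N θ (m e)

theorem edgeWeight_nonneg {θ : ℝ} (hθ : 0 ≤ θ) : ∀ j, 0 ≤ edgeWeight N θ j
  | 0 => by simp [edgeWeight]
  | 1 => by simp [edgeWeight]
  | 2 => by simp [edgeWeight]
  | j + 3 => by rw [edgeWeight]; exact mul_nonneg hθ (edgeWeight_nonneg hθ _)

theorem edgeWeight_add_two (θ : ℝ) (j : ℕ) : edgeWeight N θ (j + 2) = θ ^ j / N := by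
  induction j with
  | zero => simp [edgeWeight]
  | succ j ih => rw [edgeWeight, ih]; ring

theorem multWeight_nonneg {θ : ℝ} (hθ : 0 ≤ θ) (m : Mult N) : 0 ≤ multWeight θ m :=
  Finset.prod_nonneg fun _ _ => edgeWeight_nonneg hθ _

theorem multWeight_add_single (θ : ℝ) (m : Mult N) (e : {s : Fin N × Fin N // s.1 ≤ s.2}) {c : ℝ}
    (hc : edgeWeight N θ (m e + 1) = c * edgeWeight N θ (m e)) :
    multWeight θ (m + Pi.single e 1) = c * multWeight θ m := by
  classical
  rw [multWeight, multWeight, ← Finset.mul_prod_erase _ _ (Finset.mem_univ e),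
    ← Finset.mul_prod_erase (a := e) Finset.univ (fun e => edgeWeight N θ (m e))
      (Finset.mem_univ e), ← mul_assoc, ← hc]
  congr 1
  · simp
  · refine Finset.prod_congr rfl fun e' he' => ?_
    simp [Pi.single_eq_of_ne (Finset.ne_of_mem_erase he')]

theorem card_touched_le (m : Mult N) : (touched m).card ≤ 2 * ∑ e, m e := by
  have h : touched m ⊆ (edgeSupport m).biUnion fun e => {e.1.1, e.1.2} := by
    intro v hv
    simp only [touched, Finset.mem_filter, Finset.mem_univ, true_and] at hv
    obtain ⟨u, hu⟩ := hv
    refine Finset.mem_biUnion.2 ⟨_, mem_edgeSupport.2 hu, ?_⟩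
    rcases le_total v u with h | h <;> simp [edge, h]
  refine (Finset.card_le_card h).trans (Finset.card_biUnion_le.trans ?_)
  refine (Finset.sum_le_card_nsmul _ _ 2 fun e _ => Finset.card_le_two).trans ?_
  rw [smul_eq_mul, mul_comm]
  refine Nat.mul_le_mul_left _ ?_
  rw [Finset.card_eq_sum_ones]
  refine (Finset.sum_le_sum fun e he => ?_).trans
    (Finset.sum_le_sum_of_subset (Finset.subset_univ (edgeSupport m)))
  exact Nat.one_le_iff_ne_zero.2 (mem_edgeSupport.1 he)

theorem onceDeg_le (m : Mult N) (p v : Fin N) : onceDeg m v ≤ onceDegFrom m p v + 1 := by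
  have h : (Finset.univ.filter fun u => m (edge v u) = 1) ⊆
      insert p (Finset.univ.filter fun u => u ≠ p ∧ m (edge v u) = 1) := by
    intro u; simp only [Finset.mem_filter, Finset.mem_univ, true_and, Finset.mem_insert]; tauto
  exact (Finset.card_le_card h).trans (Finset.card_insert_le _ _)

theorem onceDegFrom_le (m : Mult N) (p v : Fin N) : onceDegFrom m p v ≤ onceDeg m v :=
  Finset.card_le_card fun u => by
    simp only [Finset.mem_filter, Finset.mem_univ, true_and]; tauto

theorem onceDegFrom_le_touched (m : Mult N) (p v : Fin N) :
    onceDegFrom m p v ≤ (touched m).card :=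
  Finset.card_le_card fun u => by
    simp only [Finset.mem_filter, Finset.mem_univ, true_and, touched]
    rintro ⟨-, h⟩
    exact ⟨v, by rw [edge_comm, h]; exact one_ne_zero⟩

/-! ### How one step of the walk changes the potential. -/

section Step

variable {m : Mult N} {p v u : Fin N}

theorem add_single_edge_apply (m : Mult N) (huv : u ≠ v) (x : Fin N) :
    (m + Pi.single (edge v u) 1 : Mult N) (edge v x) = m (edge v x) + if x = u then 1 else 0 := by
  by_cases h : x = u
  · simp [h]
  · rw [Pi.add_apply, Pi.single_eq_of_ne, if_neg h]
    rw [Ne, edge_eq_iff]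
    rintro (⟨-, h'⟩ | ⟨h', -⟩)
    · exact h h'
    · exact huv h'.symm

theorem onceDeg_add_single_of_ne {w : Fin N} (hw : w ≠ u) (hw' : w ≠ v) :
    onceDeg (m + Pi.single (edge v u) 1) w = onceDeg m w := by
  unfold onceDeg
  congr 1
  refine Finset.filter_congr fun x _ => ?_
  rw [Pi.add_apply, Pi.single_eq_of_ne, add_zero]
  rw [Ne, edge_eq_iff]
  rintro (⟨h, -⟩ | ⟨h, -⟩)
  · exact hw' h
  · exact hw h

theorem onceDeg_add_single (huv : u ≠ v) :
    onceDeg (m + Pi.single (edge v u) 1) v =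
      (Finset.univ.filter fun x => x ≠ u ∧ m (edge v x) = 1).card +
        if m (edge v u) = 0 then 1 else 0 := by
  unfold onceDeg
  simp only [add_single_edge_apply m huv]
  split_ifs with h
  · rw [← Finset.card_insert_of_notMem (a := u) (by simp)]
    congr 1
    ext x
    by_cases hx : x = u <;> simp [hx, h]
  · rw [add_zero]
    congr 1
    ext x
    by_cases hx : x = u <;> simp [hx, h]

theorem onceDegFrom_add_single (huv : u ≠ v) :
    onceDegFrom (m + Pi.single (edge v u) 1) v u =
      (Finset.univ.filter fun x => x ≠ v ∧ m (edge u x) = 1).card := by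
  unfold onceDegFrom
  congr 1
  refine Finset.filter_congr fun x _ => ?_
  rw [edge_comm v u, add_single_edge_apply m huv.symm]
  by_cases hx : x = v <;> simp [hx]

theorem excess_add_single (huv : u ≠ v) :
    ∃ R, excess (m + Pi.single (edge v u) 1) v u = R +
        (onceDeg (m + Pi.single (edge v u) 1) v - 2) +
        (onceDegFrom (m + Pi.single (edge v u) 1) v u - 1) ∧
      excess m p v = R + (onceDeg m u - 2) + (onceDegFrom m p v - 1) := by
  classical
  refine ⟨∑ w ∈ (Finset.univ.erase u).erase v, (onceDeg m w - 2), ?_, ?_⟩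
  · rw [excess, ← Finset.sum_erase_add _ _ (Finset.mem_erase.2 ⟨huv.symm, Finset.mem_univ v⟩)]
    congr 2
    refine Finset.sum_congr rfl fun w hw => ?_
    rw [onceDeg_add_single_of_ne (Finset.ne_of_mem_erase (Finset.mem_of_mem_erase hw))
      (Finset.ne_of_mem_erase hw)]
  · rw [excess, ← Finset.sum_erase_add _ _ (Finset.mem_erase.2 ⟨huv, Finset.mem_univ u⟩),
      Finset.erase_right_comm]

/-- A vertex merely passed through carries two singly used edges, the one in and the one out, and at
the current vertex one way on is unambiguous; the truncated subtractions in `excess` make these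
configurations free. Leaving for a new vertex adds one singly used edge at `v`. If `v` was itself
fresh, or had none, it then has at most two, and nothing is charged. -/
theorem excess_fresh_step (huv : u ≠ v) (hu : u ∉ touched m) :
    excess (m + Pi.single (edge v u) 1) v u ≤ excess m p v + 1 ∧
    (IsFresh m p v ∨ onceDeg m v = 0 → excess (m + Pi.single (edge v u) 1) v u ≤ excess m p v) := by
  obtain ⟨R, h1, h2⟩ := excess_add_single (m := m) (p := p) huv
  have hu' : ∀ x, m (edge u x) = 0 := by
    intro x
    by_contra h
    exact hu (by simp only [touched, Finset.mem_filter, Finset.mem_univ, true_and]; exact ⟨x, h⟩)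
  have h3 : onceDegFrom (m + Pi.single (edge v u) 1) v u = 0 := by
    rw [onceDegFrom_add_single huv, Finset.card_eq_zero, Finset.filter_eq_empty_iff]
    intro x _ hx
    rw [hu' x] at hx
    omega
  have h4 : onceDeg (m + Pi.single (edge v u) 1) v ≤ onceDeg m v + 1 := by
    rw [onceDeg_add_single huv]
    refine Nat.add_le_add (Finset.card_le_card fun x => ?_) (by split_ifs <;> simp)
    simp only [Finset.mem_filter, Finset.mem_univ, true_and]; tauto
  have h5 := onceDeg_le m p v
  refine ⟨by omega, fun hF => ?_⟩
  have h6 : onceDeg m v ≤ 1 := by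
    rcases hF with hF | hF
    · have : onceDegFrom m p v = 0 := by
        rw [onceDegFrom, Finset.card_eq_zero, Finset.filter_eq_empty_iff]
        rintro x _ ⟨hx, hx'⟩
        rw [hF.2 x hx] at hx'
        omega
      omega
    · omega
  omega

theorem excess_new_edge_step (huv : u ≠ v) :
    excess (m + Pi.single (edge v u) 1) v u ≤ excess m p v + 2 := by
  obtain ⟨R, h1, h2⟩ := excess_add_single (m := m) (p := p) huv
  have h3 : onceDegFrom (m + Pi.single (edge v u) 1) v u ≤ onceDeg m u := by
    rw [onceDegFrom_add_single huv]
    exact onceDegFrom_le m v u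
  have h4 : onceDeg (m + Pi.single (edge v u) 1) v ≤ onceDeg m v + 1 := by
    rw [onceDeg_add_single huv]
    refine Nat.add_le_add (Finset.card_le_card fun x => ?_) (by split_ifs <;> simp)
    simp only [Finset.mem_filter, Finset.mem_univ, true_and]; tauto
  have h5 := onceDeg_le m p v
  omega

theorem excess_multiple_step (huv : u ≠ v) (h : 2 ≤ m (edge v u)) :
    excess (m + Pi.single (edge v u) 1) v u ≤ excess m p v + 1 := by
  obtain ⟨R, h1, h2⟩ := excess_add_single (m := m) (p := p) huv
  have h3 : onceDegFrom (m + Pi.single (edge v u) 1) v u ≤ onceDeg m u := by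
    rw [onceDegFrom_add_single huv]
    exact onceDegFrom_le m v u
  have h4 : onceDeg (m + Pi.single (edge v u) 1) v ≤ onceDeg m v := by
    rw [onceDeg_add_single huv, if_neg (by omega), add_zero]
    exact onceDegFrom_le m u v
  have h5 := onceDeg_le m p v
  omega

theorem card_ne_add_one {a b : Fin N} (h : m (edge a b) = 1) :
    (Finset.univ.filter fun x => x ≠ b ∧ m (edge a x) = 1).card + 1 = onceDeg m a := by
  rw [onceDeg, ← Finset.card_insert_of_notMem (a := b) (by simp)]
  congr 1
  ext x
  by_cases hx : x = b <;> simp [hx, h]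

/-- Using an edge for the second time removes it from the singly used edges at both ends. If there
were at least two candidates, the excess drops; this drop is what pays for choosing among them. -/
theorem excess_second_step (huv : u ≠ v) (hup : u ≠ p) (h : m (edge v u) = 1) :
    1 ≤ onceDegFrom m p v ∧ excess (m + Pi.single (edge v u) 1) v u ≤ excess m p v ∧
    (2 ≤ onceDegFrom m p v → excess (m + Pi.single (edge v u) 1) v u + 1 ≤ excess m p v) := by
  obtain ⟨R, h1, h2⟩ := excess_add_single (m := m) (p := p) huv
  have h3 : onceDegFrom (m + Pi.single (edge v u) 1) v u + 1 = onceDeg m u := by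
    rw [onceDegFrom_add_single huv]
    exact card_ne_add_one (by rw [edge_comm, h])
  have h4 : onceDeg (m + Pi.single (edge v u) 1) v + 1 = onceDeg m v := by
    rw [onceDeg_add_single huv, if_neg (by omega), add_zero]
    exact card_ne_add_one h
  have h5 := onceDeg_le m p v
  have h6 : 1 ≤ onceDegFrom m p v := by
    rw [onceDegFrom, Nat.one_le_iff_ne_zero, ← Nat.pos_iff_ne_zero, Finset.card_pos]
    exact ⟨u, by simp [hup, h]⟩
  refine ⟨h6, ?_, ?_⟩ <;> omega

theorem isFresh_add_single (huv : u ≠ v) (hu : u ∉ touched m) :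
    IsFresh (m + Pi.single (edge v u) 1) v u := by
  have hu' : ∀ x, m (edge u x) = 0 := by
    intro x
    by_contra h
    exact hu (by simp only [touched, Finset.mem_filter, Finset.mem_univ, true_and]; exact ⟨x, h⟩)
  rw [edge_comm v u]
  refine ⟨?_, fun x hx => ?_⟩
  · rw [add_single_edge_apply m huv.symm]; simp [hu']
  · rw [add_single_edge_apply m huv.symm]; simp [hu', hx]

end Step

theorem sum_add_single (m : Mult N) (e : {s : Fin N × Fin N // s.1 ≤ s.2}) :
    ∑ e', (m + Pi.single e 1 : Mult N) e' = ∑ e', m e' + 1 := by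
  simp [Finset.sum_add_distrib, Finset.sum_pi_single']

-- The next step is of one of four kinds. A new vertex has at most `N` choices of weight `1 / N`,
-- raises the excess by at most one and leads to a fresh state. A new edge to a touched vertex has
-- at most `2 T` choices of weight `1 / N` and raises the excess by at most two. A second use of an
-- edge has weight one; its number of choices is compensated by the drop of the excess, so in total
-- it costs a factor one. A further use has at most `2 T` choices of weight `θ` and raises the
-- excess by at most one. From a fresh state only the first two kinds are possible, as the walk
-- cannot turn back, and then a new vertex does not raise the excess. Summing gives the two
-- recursive inequalities `hΓa` and `hΓb`, with `b` for fresh states and `a` for arbitrary ones.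
set_option maxHeartbeats 1000000 in
theorem nbBound_le {θ κ Γ a b : ℝ} {T : ℕ} (hθ : 0 ≤ θ) (hκ1 : 1 ≤ κ) (hκ : 2 * (T : ℝ) ≤ κ)
    (ha : 0 ≤ a) (hb : 0 ≤ b) (hΓ : 0 ≤ Γ)
    (hΓa : (1 + 2 * T * κ ^ 2 / N + 2 * T * θ * κ) * a + κ * b ≤ Γ * a)
    (hΓb : b + 2 * T * κ ^ 2 / N * a ≤ Γ * b)
    {G : Mult N → Fin N → Fin N → ℝ}
    (hG : ∀ m p v, ∑ e, m e ≤ T → G m p v ≤ multWeight θ m * κ ^ excess m p v * a ∧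
      (IsFresh m p v → G m p v ≤ multWeight θ m * κ ^ excess m p v * b))
    (n : ℕ) : ∀ m p v, ∑ e, m e + n ≤ T →
      nbBound G n m p v ≤ multWeight θ m * κ ^ excess m p v * (Γ ^ n * a) ∧
      (IsFresh m p v → nbBound G n m p v ≤ multWeight θ m * κ ^ excess m p v * (Γ ^ n * b)) := by
  have hκ0 : 0 < κ := by linarith
  induction n with
  | zero => intro m p v hm; simpa [nbBound] using hG m p v (by omega)
  | succ n ih =>
    intro m p v hm
    have ih' : ∀ u, ∑ e, (m + Pi.single (edge v u) 1 : Mult N) e + n ≤ T := by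
      intro u; rw [sum_add_single]; omega
    set A := Γ ^ n * a with hA
    set B := Γ ^ n * b with hB
    have hA0 : 0 ≤ A := by positivity
    have hB0 : 0 ≤ B := by positivity
    set w := multWeight θ m with hw
    have hw0 : 0 ≤ w := multWeight_nonneg hθ m
    set Ψ := excess m p v with hΨ
    have hpow : ∀ {a b : ℕ}, a ≤ b → κ ^ a ≤ κ ^ b := fun h => pow_le_pow_right₀ hκ1 h
    have htouch : ((touched m).card : ℝ) ≤ 2 * T := by
      have := card_touched_le m
      exact_mod_cast this.trans (by omega)
    have hweight : ∀ u, (m (edge v u) = 0 →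
        multWeight θ (m + Pi.single (edge v u) 1) = 1 / N * w) ∧
        (m (edge v u) = 1 → multWeight θ (m + Pi.single (edge v u) 1) = 1 * w) ∧
        (2 ≤ m (edge v u) → multWeight θ (m + Pi.single (edge v u) 1) = θ * w) := by
      intro u
      refine ⟨fun h => ?_, fun h => ?_, fun h => ?_⟩
      · exact multWeight_add_single θ m _ (by rw [h]; simp [edgeWeight])
      · exact multWeight_add_single θ m _ (by rw [h]; simp [edgeWeight])
      · exact multWeight_add_single θ m _ (by
          obtain ⟨j, hj⟩ := Nat.exists_eq_add_of_le h
          rw [hj, show 2 + j + 1 = j + 3 by ring, show 2 + j = j + 2 by ring, edgeWeight])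
    have hfresh : ∀ u, u ≠ v → u ∉ touched m → m (edge v u) = 0 := by
      intro u _ hu
      by_contra h
      refine hu ?_
      simp only [touched, Finset.mem_filter, Finset.mem_univ, true_and]
      exact ⟨v, by rwa [edge_comm]⟩
    have hstep_new : ∀ u, u ≠ v → m (edge v u) = 0 →
        nbBound G n (m + Pi.single (edge v u) 1) v u ≤ w * κ ^ Ψ * (κ ^ 2 / N * A) := by
      intro u huv h0
      refine (ih _ v u (ih' u)).1.trans ?_
      rw [(hweight u).1 h0]
      calc 1 / N * w * κ ^ _ * A ≤ 1 / N * w * κ ^ (Ψ + 2) * A := by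
            gcongr
            exact excess_new_edge_step huv
        _ = _ := by rw [pow_add]; ring
    have hstep_fresh : ∀ u, u ≠ v → u ∉ touched m →
        nbBound G n (m + Pi.single (edge v u) 1) v u ≤ w * κ ^ Ψ * (κ * B / N) ∧
        (IsFresh m p v → nbBound G n (m + Pi.single (edge v u) 1) v u ≤ w * κ ^ Ψ * (B / N)) := by
      intro u huv hu
      have h1 := (ih _ v u (ih' u)).2 (isFresh_add_single huv hu)
      rw [(hweight u).1 (hfresh u huv hu)] at h1
      refine ⟨h1.trans ?_, fun hF => h1.trans ?_⟩
      · calc 1 / N * w * κ ^ _ * B ≤ 1 / N * w * κ ^ (Ψ + 1) * B := by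
              gcongr
              exact (excess_fresh_step huv hu).1
          _ = _ := by rw [pow_add]; ring
      · calc 1 / N * w * κ ^ _ * B ≤ 1 / N * w * κ ^ Ψ * B := by
              gcongr
              exact (excess_fresh_step huv hu).2 (Or.inl hF)
          _ = _ := by ring
    have hN1 : (N : ℝ) * (1 / N) = 1 := by
      have : (N : ℝ) ≠ 0 := by
        have := v.pos
        positivity
      field_simp
    have hcN : ∀ c : ℝ, ∑ u : Fin N, c / N = c := by
      intro c
      rw [Finset.sum_const, Finset.card_univ, Fintype.card_fin, nsmul_eq_mul]
      calc (N : ℝ) * (c / N) = (N * (1 / N)) * c := by ring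
        _ = c := by rw [hN1, one_mul]
    have hct : ∀ c : ℝ, 0 ≤ c → ∑ u : Fin N, (if u ∈ touched m then c else 0) ≤ 2 * T * c := by
      intro c hc
      rw [Finset.sum_ite_mem, Finset.univ_inter, Finset.sum_const, nsmul_eq_mul]
      exact mul_le_mul_of_nonneg_right htouch hc
    rw [nbBound]
    constructor
    · set d := onceDegFrom m p v with hd
      have hdκ : (d : ℝ) ≤ κ := le_trans (by exact_mod_cast onceDegFrom_le_touched m p v)
        (htouch.trans hκ)
      have hterm : ∀ u, (if u = p ∨ u = v then 0 else
          nbBound G n (m + Pi.single (edge v u) 1) v u) ≤ w * κ ^ Ψ * (κ * B / N +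
            (if u ∈ touched m then κ ^ 2 / N * A else 0) +
            (if u ≠ p ∧ m (edge v u) = 1 then A / d else 0) +
            (if u ∈ touched m then θ * κ * A else 0)) := by
        intro u
        have hd0 : (0 : ℝ) ≤ d := Nat.cast_nonneg d
        have n1 : 0 ≤ κ * B / N := by positivity
        have n2 : (0 : ℝ) ≤ if u ∈ touched m then κ ^ 2 / N * A else 0 := by
          split_ifs <;> positivity
        have n3 : (0 : ℝ) ≤ if u ≠ p ∧ m (edge v u) = 1 then A / d else 0 := by
          split_ifs <;> positivity
        have n4 : (0 : ℝ) ≤ if u ∈ touched m then θ * κ * A else 0 := by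
          split_ifs <;> positivity
        have nw : 0 ≤ w * κ ^ Ψ := by positivity
        by_cases hu : u = p ∨ u = v
        · rw [if_pos hu]; exact mul_nonneg nw (by linarith)
        rw [if_neg hu]
        obtain ⟨hup, huv⟩ := not_or.1 hu
        by_cases ht : u ∈ touched m
        · rcases Nat.lt_or_ge (m (edge v u)) 2 with h2 | h2
          · rcases Nat.lt_or_ge (m (edge v u)) 1 with h1 | h1
            · refine (hstep_new u huv (by omega)).trans (mul_le_mul_of_nonneg_left ?_ nw)
              have i2 : (if u ∈ touched m then κ ^ 2 / N * A else 0) = κ ^ 2 / N * A := if_pos ht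
              linarith
            · have h1' : m (edge v u) = 1 := by omega
              obtain ⟨e1, e2, e3⟩ := excess_second_step huv hup h1'
              have : nbBound G n (m + Pi.single (edge v u) 1) v u ≤ w * κ ^ Ψ * (A / d) := by
                refine (ih _ v u (ih' u)).1.trans ?_
                rw [(hweight u).2.1 h1', one_mul]
                have hdpos : (0 : ℝ) < d := by exact_mod_cast e1
                rw [mul_div_assoc', le_div_iff₀ hdpos]
                -- With a single candidate the excess does not grow; with `d ≥ 2` candidates it
                -- drops, gaining `1 / κ ≤ 1 / d`.
                rcases Nat.lt_or_ge d 2 with hd2 | hd2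
                · have : d = 1 := by omega
                  rw [this, Nat.cast_one, mul_one]
                  gcongr
                · calc w * κ ^ _ * A * d ≤ w * κ ^ _ * A * κ := by gcongr
                    _ = w * κ ^ (excess (m + Pi.single (edge v u) 1) v u + 1) * A := by
                      rw [pow_succ]; ring
                    _ ≤ _ := by
                      gcongr
                      exact e3 hd2
              refine this.trans (mul_le_mul_of_nonneg_left ?_ nw)
              have i3 : (if u ≠ p ∧ m (edge v u) = 1 then A / d else 0) = A / d :=
                if_pos (And.intro hup h1')
              linarith
          · have : nbBound G n (m + Pi.single (edge v u) 1) v u ≤ w * κ ^ Ψ * (θ * κ * A) := by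
              refine (ih _ v u (ih' u)).1.trans ?_
              rw [(hweight u).2.2 h2]
              calc θ * w * κ ^ _ * A ≤ θ * w * κ ^ (Ψ + 1) * A := by
                    gcongr
                    exact excess_multiple_step huv h2
                _ = _ := by rw [pow_add]; ring
            refine this.trans (mul_le_mul_of_nonneg_left ?_ nw)
            have i4 : (if u ∈ touched m then θ * κ * A else 0) = θ * κ * A := if_pos ht
            linarith
        · refine (hstep_fresh u huv ht).1.trans (mul_le_mul_of_nonneg_left ?_ nw)
          linarith
      refine (Finset.sum_le_sum fun u _ => hterm u).trans ?_
      rw [← Finset.mul_sum]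
      refine mul_le_mul_of_nonneg_left ?_ (by positivity)
      rw [Finset.sum_add_distrib, Finset.sum_add_distrib, Finset.sum_add_distrib, hcN]
      have hC : ∑ u, (if u ≠ p ∧ m (edge v u) = 1 then A / d else 0) ≤ A := by
        rw [← Finset.sum_filter, Finset.sum_const, nsmul_eq_mul]
        change (d : ℝ) * (A / d) ≤ A
        rcases Nat.eq_zero_or_pos d with h0 | h0
        · simpa [h0] using hA0
        · have : (0 : ℝ) < d := by exact_mod_cast h0
          exact le_of_eq (by field_simp)
      have e1 := hct (κ ^ 2 / N * A) (by positivity)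
      have e2 := hct (θ * κ * A) (by positivity)
      calc _ ≤ κ * B + 2 * T * (κ ^ 2 / N * A) + A + 2 * T * (θ * κ * A) := by linarith
        _ = Γ ^ n * ((1 + 2 * T * κ ^ 2 / N + 2 * T * θ * κ) * a + κ * b) := by
          rw [hA, hB]; ring
        _ ≤ Γ ^ n * (Γ * a) := by gcongr
        _ = _ := by ring
    · intro hF
      have hterm : ∀ u, (if u = p ∨ u = v then 0 else
          nbBound G n (m + Pi.single (edge v u) 1) v u) ≤ w * κ ^ Ψ * (B / N +
            (if u ∈ touched m then κ ^ 2 / N * A else 0)) := by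
        intro u
        have n1 : 0 ≤ B / N := by positivity
        have n2 : (0 : ℝ) ≤ if u ∈ touched m then κ ^ 2 / N * A else 0 := by
          split_ifs <;> positivity
        have nw : 0 ≤ w * κ ^ Ψ := by positivity
        by_cases hu : u = p ∨ u = v
        · rw [if_pos hu]; exact mul_nonneg nw (by linarith)
        rw [if_neg hu]
        obtain ⟨hup, huv⟩ := not_or.1 hu
        by_cases ht : u ∈ touched m
        · refine (hstep_new u huv (hF.2 u hup)).trans (mul_le_mul_of_nonneg_left ?_ nw)
          rw [if_pos ht]
          linarith
        · refine ((hstep_fresh u huv ht).2 hF).trans (mul_le_mul_of_nonneg_left ?_ nw)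
          linarith
      refine (Finset.sum_le_sum fun u _ => hterm u).trans ?_
      rw [← Finset.mul_sum]
      refine mul_le_mul_of_nonneg_left ?_ (by positivity)
      rw [Finset.sum_add_distrib, hcN]
      have e1 := hct (κ ^ 2 / N * A) (by positivity)
      calc _ ≤ B + 2 * T * (κ ^ 2 / N * A) := by linarith
        _ = Γ ^ n * (b + 2 * T * κ ^ 2 / N * a) := by rw [hA, hB]; ring
        _ ≤ Γ ^ n * (Γ * b) := by gcongr
        _ = _ := by ring

end Potential


/-! ### First and second moments of nonbacktracking sums. -/

section NBMoments

variable {Ω : Type*} [MeasurableSpace Ω] {P : Measure Ω} [IsProbabilityMeasure P] {N : ℕ} {θ : ℝ}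
  {H : Ω → Matrix (Fin N) (Fin N) ℝ}

/-- The monomial carries the edges already traversed, and one step of the walk adds its edge to it.
The factor `x` leaves room for a second walk. -/
theorem monomial_mul_nbSum_succ {H : Matrix (Fin N) (Fin N) ℝ} (hs : ∀ i j, H i j = H j i)
    (φ : Fin N → ℝ) (n : ℕ) (p v : Fin N) (m : Mult N) (x : ℝ) :
    monomial H m * (nbSum H φ (n + 1) p v * x) = ∑ u, if u = p ∨ u = v then 0 else
      monomial H (m + Pi.single (edge v u) 1) * (nbSum H φ n v u * x) := by
  rw [nbSum, Finset.sum_mul, Finset.mul_sum]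
  refine Finset.sum_congr rfl fun u _ => ?_
  split_ifs
  · simp
  · rw [monomial_add, monomial_single hs]; ring

theorem CenteredEnsemble.integrable_monomial_mul_nbSum (h : CenteredEnsemble P θ H)
    {g : Ω → ℝ} (hg : ∀ m, Integrable (fun ω => monomial (H ω) m * g ω) P) (φ : Fin N → ℝ) (n : ℕ) :
    ∀ p v m, Integrable (fun ω => monomial (H ω) m * (nbSum (H ω) φ n p v * g ω)) P := by
  induction n with
  | zero =>
    intro p v m
    simp only [nbSum]
    have := (hg m).const_mul (φ v)
    refine this.congr (ae_of_all _ fun ω => ?_)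
    simp only; ring
  | succ n ih =>
    intro p v m
    simp only [monomial_mul_nbSum_succ (h.symm _)]
    refine integrable_finsetSum _ fun u _ => ?_
    split_ifs
    · exact integrable_zero _ _ _
    · exact ih _ _ _

theorem CenteredEnsemble.integrable_nbSum (h : CenteredEnsemble P θ H) (φ : Fin N → ℝ) (n : ℕ)
    (p v : Fin N) : Integrable (fun ω => nbSum (H ω) φ n p v) P := by
  simpa [monomial_zero] using h.integrable_monomial_mul_nbSum (g := fun _ => 1)
    (fun m => by simpa using h.integrable_monomial m) φ n p v 0

theorem CenteredEnsemble.integrable_nbSum_mul (h : CenteredEnsemble P θ H) (φ ψ : Fin N → ℝ)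
    (n n' : ℕ) (p v p' v' : Fin N) :
    Integrable (fun ω => nbSum (H ω) φ n p v * nbSum (H ω) ψ n' p' v') P := by
  have h1 := h.integrable_monomial_mul_nbSum (g := fun ω => nbSum (H ω) ψ n' p' v' * 1)
    (fun m => h.integrable_monomial_mul_nbSum (g := fun _ => 1)
      (fun m => by simpa using h.integrable_monomial m) ψ n' p' v' m) φ n p v 0
  simpa [monomial_zero] using h1

/-- The factor `g` is a spectator while the first walk is traced: it is `1` for a first moment and
another nonbacktracking sum for a second moment, to be traced afterwards on top of the accumulated
multiplicities. -/
theorem CenteredEnsemble.sum_abs_integral_nbSum_le (h : CenteredEnsemble P θ H) {ι : Type*}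
    [Fintype ι] (φ : ι → Fin N → ℝ) {g : ι → Ω → ℝ}
    (hg : ∀ y m, Integrable (fun ω => monomial (H ω) m * g y ω) P)
    {G : Mult N → Fin N → Fin N → ℝ}
    (hG : ∀ m p v, ∑ y, |∫ ω, monomial (H ω) m * (φ y v * g y ω) ∂P| ≤ G m p v) (n : ℕ) :
    ∀ m p v, ∑ y, |∫ ω, monomial (H ω) m * (nbSum (H ω) (φ y) n p v * g y ω) ∂P| ≤
      nbBound G n m p v := by
  induction n with
  | zero => exact hG
  | succ n ih =>
    intro m p v
    simp only [monomial_mul_nbSum_succ (h.symm _), nbBound]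
    have h1 : ∀ y, |∫ ω, ∑ u, (if u = p ∨ u = v then 0 else
        monomial (H ω) (m + Pi.single (edge v u) 1) * (nbSum (H ω) (φ y) n v u * g y ω)) ∂P| ≤
        ∑ u, if u = p ∨ u = v then 0 else |∫ ω, 
          monomial (H ω) (m + Pi.single (edge v u) 1) * (nbSum (H ω) (φ y) n v u * g y ω) ∂P| := by
      intro y
      rw [integral_finsetSum]
      · refine (Finset.abs_sum_le_sum_abs _ _).trans (Finset.sum_le_sum fun u _ => ?_)
        split_ifs <;> simp
      · intro u _
        split_ifs
        · exact integrable_zero _ _ _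
        · exact h.integrable_monomial_mul_nbSum (hg y) _ _ _ _ _
    refine (Finset.sum_le_sum fun y _ => h1 y).trans ?_
    rw [Finset.sum_comm]
    refine Finset.sum_le_sum fun u _ => ?_
    split_ifs
    · simp
    · exact ih _ _ _

theorem CenteredEnsemble.abs_integral_monomial_le_multWeight (h : CenteredEnsemble P θ H)
    (m : Mult N) : |∫ ω, monomial (H ω) m ∂P| ≤ multWeight θ m := by
  rw [h.integral_monomial, Finset.abs_prod, multWeight]
  refine Finset.prod_le_prod (fun _ _ => abs_nonneg _) fun e _ => ?_
  match m e with
  | 0 => simp [edgeWeight]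
  | 1 => simp [edgeWeight, h.mean]
  | j + 2 => rw [edgeWeight_add_two]; exact h.abs_integral_pow_le _ _ _

theorem CenteredEnsemble.integral_monomial_of_isFresh (h : CenteredEnsemble P θ H)
    {m : Mult N} {p v : Fin N} (hF : IsFresh m p v) : ∫ ω, monomial (H ω) m ∂P = 0 := by
  rw [h.integral_monomial]
  refine Finset.prod_eq_zero (Finset.mem_univ (edge v p)) ?_
  rw [hF.1]
  simp [h.mean]

/-- Used when the second walk of a pair starts at `x` with the edges of the first still recorded.
Moving the current position only affects the terms of `v` and `x`, which costs at most one. -/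
theorem excess_restart_le (m : Mult N) (p v x : Fin N) : excess m x x ≤ excess m p v + 1 := by
  classical
  have h1 := onceDegFrom_le m x x
  have h2 := onceDeg_le m p v
  by_cases hx : x = v
  · subst hx
    unfold excess
    omega
  · rw [excess, excess, ← Finset.sum_erase_add _ _ (Finset.mem_erase.2 ⟨Ne.symm hx, Finset.mem_univ v⟩),
      ← Finset.sum_erase_add (Finset.univ.erase v) _ (Finset.mem_erase.2 ⟨hx, Finset.mem_univ x⟩),
      Finset.erase_right_comm]
    omega

theorem excess_zero (p v : Fin N) : excess (0 : Mult N) p v = 0 := by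
  simp [excess, onceDeg, onceDegFrom]

theorem multWeight_zero (θ : ℝ) : multWeight θ (0 : Mult N) = 1 := by
  simp [multWeight, edgeWeight]

/-- The growth rate of the nonbacktracking moments. -/
noncomputable def growth (N : ℕ) (θ : ℝ) (T : ℕ) : ℝ := 1 + 4 * T ^ 2 * θ + 10 * T ^ 2 / Real.sqrt N

theorem one_le_growth {θ : ℝ} (hθ : 0 ≤ θ) (T : ℕ) : 1 ≤ growth N θ T := by
  have : 0 ≤ 4 * (T : ℝ) ^ 2 * θ + 10 * T ^ 2 / Real.sqrt N := by positivity
  rw [growth]; linarith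

/-- The two recursive inequalities of `nbBound_le` for `κ = 2 T` and `b / a = T / √N`; this ratio
balances the term `κ b` in the first against the term with `a / N` in the second. -/
theorem growth_spec {θ : ℝ} (hθ : 0 ≤ θ) {T : ℕ} (hT : 1 ≤ T) (hTN : (T : ℝ) ≤ Real.sqrt N)
    {T' : ℕ} (hT' : T' ≤ T) :
    (1 + 2 * T' * (2 * T : ℝ) ^ 2 / N + 2 * T' * θ * (2 * T)) + (2 * T) * (T / Real.sqrt N) ≤
      growth N θ T ∧
    T / Real.sqrt N + 2 * T' * (2 * T : ℝ) ^ 2 / N ≤ growth N θ T * (T / Real.sqrt N) := by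
  have hT0 : (1 : ℝ) ≤ T := by exact_mod_cast hT
  have hT'0 : (T' : ℝ) ≤ T := by exact_mod_cast hT'
  set s := Real.sqrt N with hs
  have hs0 : 0 < s := by linarith
  have hsN : s ^ 2 = N := Real.sq_sqrt (Nat.cast_nonneg N)
  have h1 : 2 * T' * (2 * T : ℝ) ^ 2 / N ≤ 8 * T ^ 3 / s ^ 2 := by
    rw [hsN]
    refine div_le_div_of_nonneg_right ?_ (Nat.cast_nonneg N)
    calc 2 * (T' : ℝ) * (2 * T) ^ 2 ≤ 2 * T * (2 * T) ^ 2 := by gcongr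
      _ = _ := by ring
  have h2 : 8 * (T : ℝ) ^ 3 / s ^ 2 ≤ 8 * T ^ 2 / s := by
    rw [div_le_div_iff₀ (by positivity) hs0]
    nlinarith [mul_le_mul_of_nonneg_left hTN (by positivity : (0 : ℝ) ≤ T ^ 2 * s)]
  have h3 : 2 * T' * θ * (2 * T) ≤ 4 * T ^ 2 * θ := by
    calc 2 * T' * θ * (2 * T) ≤ 2 * T * θ * (2 * T) := by gcongr
      _ = _ := by ring
  constructor
  · rw [growth]
    have : (2 * T : ℝ) * (T / s) + 8 * T ^ 2 / s = 10 * T ^ 2 / s := by ring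
    linarith
  · have h4 : 8 * (T : ℝ) ^ 3 / s ^ 2 = (8 * T ^ 2 / s) * (T / s) := by field_simp
    have h5 : (0 : ℝ) ≤ T / s := by positivity
    have h6 : 1 + 8 * T ^ 2 / s ≤ growth N θ T := by
      rw [growth]
      have : 8 * (T : ℝ) ^ 2 / s ≤ 10 * T ^ 2 / s := by gcongr; norm_num
      have : 0 ≤ 4 * (T : ℝ) ^ 2 * θ := by positivity
      linarith
    nlinarith [mul_le_mul_of_nonneg_right h6 h5]

theorem CenteredEnsemble.theta_nonneg (h : CenteredEnsemble P θ H) (hN : 0 < N) : 0 ≤ θ := by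
  have : Nonempty Ω := P.nonempty_of_neZero
  exact (abs_nonneg _).trans (h.bound (Classical.arbitrary Ω) ⟨0, hN⟩ ⟨0, hN⟩)

/-- A fresh final state has an edge used once, so its expectation vanishes and every `b ≥ 0` is
admissible at the end of the walk; `a = 1`, `b = T / √N` is the choice matched to `growth_spec`. -/
theorem CenteredEnsemble.nbBound_abs_integral_le (h : CenteredEnsemble P θ H) (hθ : 0 ≤ θ) {T : ℕ}
    (hT : 1 ≤ T) (hTN : (T : ℝ) ≤ Real.sqrt N) {n : ℕ} {m : Mult N} (p v : Fin N)
    (hn : ∑ e, m e + n ≤ T) :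
    nbBound (fun m _ _ => |∫ ω, monomial (H ω) m ∂P|) n m p v ≤
        multWeight θ m * (2 * T : ℝ) ^ excess m p v * growth N θ T ^ n ∧
    (IsFresh m p v → nbBound (fun m _ _ => |∫ ω, monomial (H ω) m ∂P|) n m p v ≤
        multWeight θ m * (2 * T : ℝ) ^ excess m p v * (growth N θ T ^ n * (T / Real.sqrt N))) := by
  have hT0 : (1 : ℝ) ≤ T := by exact_mod_cast hT
  obtain ⟨h1, h2⟩ := growth_spec hθ hT hTN le_rfl
  have := nbBound_le (N := N) (θ := θ) (κ := 2 * T) (Γ := growth N θ T) (a := 1)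
    (b := T / Real.sqrt N) (T := T) hθ (by linarith) le_rfl zero_le_one (by positivity)
    (zero_le_one.trans (one_le_growth hθ T)) (by linarith) (by linarith)
    (G := fun m _ _ => |∫ ω, monomial (H ω) m ∂P|) (fun m p v _ => ⟨?_, fun hF => ?_⟩) n m p v hn
  · simpa using this
  · rw [mul_one]
    refine (h.abs_integral_monomial_le_multWeight m).trans ?_
    exact le_mul_of_one_le_right (multWeight_nonneg hθ m) (one_le_pow₀ (by linarith))
  · rw [h.integral_monomial_of_isFresh hF, abs_zero]
    have := multWeight_nonneg hθ m
    positivity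

/-- The first step always reaches a fresh vertex, so the factor of order `1 / √N` of fresh states is
gained. This is the reason why `⟨e, U_k(H) e⟩` has a small mean for `k ≥ 1`. -/
theorem CenteredEnsemble.abs_integral_nbSum_le (h : CenteredEnsemble P θ H) {k : ℕ}
    (hk : 1 ≤ k) (hkN : (k : ℝ) ≤ Real.sqrt N) {φ : Fin N → ℝ} (hφ : ∀ v, |φ v| ≤ 1) (x : Fin N) :
    |∫ ω, nbSum (H ω) φ k x x ∂P| ≤ growth N θ k ^ k * (k / Real.sqrt N) := by
  have hθ : 0 ≤ θ := h.theta_nonneg x.pos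
  obtain ⟨n, rfl⟩ : ∃ n, k = n + 1 := ⟨k - 1, by omega⟩
  have h1 := h.sum_abs_integral_nbSum_le (ι := Unit) (fun _ => φ) (g := fun _ _ => 1)
    (fun _ m => by simpa using h.integrable_monomial m)
    (G := fun m _ _ => |∫ ω, monomial (H ω) m ∂P|) (fun m p v => by
      simp only [mul_one, Finset.univ_unique, Finset.sum_singleton]
      rw [integral_mul_const, abs_mul]
      exact mul_le_of_le_one_right (abs_nonneg _) (hφ v)) (n + 1) 0 x x
  simp only [Finset.univ_unique, Finset.sum_singleton, monomial_zero, one_mul, mul_one] at h1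
  refine h1.trans ?_
  rw [nbBound]
  have hstep : ∀ u, (if u = x ∨ u = x then 0 else nbBound (fun m _ _ => |∫ ω, monomial (H ω) m ∂P|)
      n ((0 : Mult N) + Pi.single (edge x u) 1) x u) ≤
      1 / N * (growth N θ (n + 1) ^ n * ((n + 1 : ℕ) / Real.sqrt N)) := by
    intro u
    have hg := one_le_growth (N := N) hθ (n + 1)
    split_ifs with hu
    · positivity
    have hux : u ≠ x := fun h => hu (Or.inl h)
    have hnt : u ∉ touched (0 : Mult N) := by simp [touched]
    have h2 := (h.nbBound_abs_integral_le hθ hk hkN (n := n)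
      (m := (0 : Mult N) + Pi.single (edge x u) 1) x u
      (by rw [sum_add_single]; simp; omega)).2 (isFresh_add_single hux hnt)
    have h3 : excess ((0 : Mult N) + Pi.single (edge x u) 1) x u = 0 := by
      have := (excess_fresh_step (p := x) hux hnt).2 (Or.inr (by simp [onceDeg]))
      rw [excess_zero] at this
      omega
    have h4 : multWeight θ ((0 : Mult N) + Pi.single (edge x u) 1) = 1 / N := by
      rw [multWeight_add_single (c := 1 / N), multWeight_zero, mul_one]
      simp [edgeWeight]
    rw [h3, h4, pow_zero, mul_one] at h2
    exact h2
  refine (Finset.sum_le_sum fun u _ => hstep u).trans ?_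
  rw [Finset.sum_const, Finset.card_univ, Fintype.card_fin, nsmul_eq_mul, ← mul_assoc]
  have hN : (N : ℝ) ≠ 0 := by have := x.pos; positivity
  rw [mul_one_div_cancel hN, one_mul]
  have hg := one_le_growth (N := N) hθ (n + 1)
  gcongr
  omega

/-- The square is a pair of walks from `x` with a common end, traced one after the other with total
length `T = 2 l`. The restart at `x` costs a factor `2 T`. As no gain for fresh states is available
at the end of the first walk, `a` is enlarged by `√N / T` to keep the ratio required by
`growth_spec`; this produces the factor `2 √N`. -/
theorem CenteredEnsemble.sum_integral_nbSum_sq_le (h : CenteredEnsemble P θ H) {l : ℕ}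
    (hl : 1 ≤ l) (hlN : (2 * l : ℕ) ≤ Real.sqrt N) (x : Fin N) :
    ∑ y, ∫ ω, nbSum (H ω) (Pi.single y 1) l x x ^ 2 ∂P ≤
      2 * Real.sqrt N * growth N θ (2 * l) ^ (2 * l) := by
  have hθ : 0 ≤ θ := h.theta_nonneg x.pos
  set T := 2 * l with hTl
  have hT : 1 ≤ T := by omega
  have hT0 : (1 : ℝ) ≤ T := by exact_mod_cast hT
  set s := Real.sqrt N with hs
  have hs0 : 0 < s := by linarith
  set Γ := growth N θ T with hΓdef
  have hΓ : 1 ≤ Γ := one_le_growth hθ T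
  have h1 := h.sum_abs_integral_nbSum_le (ι := Fin N) (fun y => Pi.single y 1)
    (g := fun y ω => nbSum (H ω) (Pi.single y 1) l x x)
    (fun y m => by
      simpa using h.integrable_monomial_mul_nbSum (g := fun _ => 1)
        (fun m => by simpa using h.integrable_monomial m) (Pi.single y 1) l x x m)
    (G := fun m _ _ => nbBound (fun m _ _ => |∫ ω, monomial (H ω) m ∂P|) l m x x)
    (fun m p v => by
      -- The first walk ends at `v`, so only the summand `y = v` survives.
      rw [Finset.sum_eq_single v]
      · simp only [Pi.single_eq_same, one_mul]
        have h3 := h.sum_abs_integral_nbSum_le (ι := Unit) (fun _ => Pi.single v 1)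
          (g := fun _ _ => 1)
          (fun _ m => by simpa using h.integrable_monomial m)
          (G := fun m _ _ => |∫ ω, monomial (H ω) m ∂P|) (fun m p v' => by
            simp only [mul_one, Finset.univ_unique, Finset.sum_singleton]
            rw [integral_mul_const, abs_mul]
            refine mul_le_of_le_one_right (abs_nonneg _) ?_
            by_cases hv : v' = v
            · simp [hv]
            · simp [Pi.single_eq_of_ne hv]) l m x x
        simpa using h3
      · intro y _ hy
        simp [Pi.single_eq_of_ne hy.symm]
      · simp) l 0 x x
  simp only [monomial_zero, one_mul, ← pow_two] at h1
  refine (Finset.sum_le_sum fun y _ => le_abs_self _).trans (h1.trans ?_)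
  obtain ⟨h2, h3⟩ := growth_spec hθ hT hlN (show l ≤ T by omega)
  have hb0 : (0 : ℝ) ≤ 2 * T * Γ ^ l := by positivity
  have hsT : 1 ≤ s / T := by rw [le_div_iff₀ (by positivity)]; linarith
  have hsT' : s / T * (T / s) = 1 := by field_simp
  have h4 := nbBound_le (N := N) (θ := θ) (κ := 2 * T) (Γ := Γ) (a := s / T * (2 * T * Γ ^ l))
    (b := 2 * T * Γ ^ l) (T := l) hθ (by linarith)
    (by rw [hTl]; push_cast; linarith [(Nat.cast_nonneg l : (0 : ℝ) ≤ l)])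
    (by positivity) hb0 (by linarith)
    (by
      have : (1 + 2 * l * (2 * T : ℝ) ^ 2 / N + 2 * l * θ * (2 * T)) * (s / T * (2 * T * Γ ^ l)) +
          2 * T * (2 * T * Γ ^ l) = ((1 + 2 * l * (2 * T : ℝ) ^ 2 / N + 2 * l * θ * (2 * T)) +
            (2 * T) * (T / s)) * (s / T * (2 * T * Γ ^ l)) := by
        linear_combination (-(2 * T : ℝ) * (2 * T * Γ ^ l)) * hsT'
      rw [this]
      exact mul_le_mul_of_nonneg_right h2 (by positivity))
    (by
      have : 2 * T * Γ ^ l + 2 * l * (2 * T : ℝ) ^ 2 / N * (s / T * (2 * T * Γ ^ l)) =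
          (T / s + 2 * l * (2 * T : ℝ) ^ 2 / N) * (s / T * (2 * T * Γ ^ l)) := by
        linear_combination (-(2 * T * Γ ^ l : ℝ)) * hsT'
      rw [this]
      refine (mul_le_mul_of_nonneg_right h3 (by positivity)).trans (le_of_eq ?_)
      linear_combination (Γ * (2 * T * Γ ^ l)) * hsT')
    (G := fun m _ _ => nbBound (fun m _ _ => |∫ ω, monomial (H ω) m ∂P|) l m x x)
    (fun m p v hm => by
      have hw := multWeight_nonneg hθ m
      have h5 := (h.nbBound_abs_integral_le hθ hT hlN (n := l) (m := m) x x (by omega)).1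
      have h6 : nbBound (fun m _ _ => |∫ ω, monomial (H ω) m ∂P|) l m x x ≤
          multWeight θ m * (2 * T : ℝ) ^ excess m p v * (2 * T * Γ ^ l) := by
        refine h5.trans ?_
        calc multWeight θ m * (2 * T : ℝ) ^ excess m x x * Γ ^ l
            ≤ multWeight θ m * (2 * T : ℝ) ^ (excess m p v + 1) * Γ ^ l := by
              gcongr
              · linarith
              · exact excess_restart_le m p v x
          _ = _ := by rw [pow_succ]; ring
      refine ⟨h6.trans ?_, fun _ => h6⟩
      refine mul_le_mul_of_nonneg_left ?_ (by positivity)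
      exact le_mul_of_one_le_left hb0 hsT) l 0 x x (by simp)
  refine h4.1.trans (le_of_eq ?_)
  rw [excess_zero, multWeight_zero, hTl, show 2 * l = l + l by ring, pow_add]
  have : ((l + l : ℕ) : ℝ) ≠ 0 := by
    rw [show l + l = T by omega]; positivity
  field_simp

end NBMoments


/-! ### Chebyshev polynomials of the second kind -/

/-- The Chebyshev polynomial of the second kind, normalised so that
`cheb (t + t⁻¹) k = (t ^ (k + 1) - t ^ (-(k + 1))) / (t - t⁻¹)`. -/
def cheb {R : Type*} [Ring R] (x : R) : ℕ → R
  | 0 => 1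
  | 1 => x
  | k + 2 => x * cheb x (k + 1) - cheb x k

theorem cheb_mono {x y : ℝ} (hx : 2 ≤ x) (hxy : x ≤ y) (k : ℕ) :
    0 ≤ cheb x k ∧ cheb x k ≤ cheb y k ∧ 0 ≤ cheb x (k + 1) - cheb x k ∧
      cheb x (k + 1) - cheb x k ≤ cheb y (k + 1) - cheb y k := by
  induction k with
  | zero => simp only [cheb]; refine ⟨?_, ?_, ?_, ?_⟩ <;> linarith
  | succ k ih =>
    obtain ⟨h1, h2, h3, h4⟩ := ih
    have h5 : 0 ≤ cheb x (k + 1) := by linarith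
    have h6 : cheb x (k + 1) ≤ cheb y (k + 1) := by linarith
    have e : ∀ z : ℝ, cheb z (k + 2) - cheb z (k + 1) =
        (z - 2) * cheb z (k + 1) + (cheb z (k + 1) - cheb z k) := by
      intro z; rw [cheb]; ring
    refine ⟨h5, h6, ?_, ?_⟩
    · rw [e]; nlinarith
    · rw [e, e]
      have : (x - 2) * cheb x (k + 1) ≤ (y - 2) * cheb y (k + 1) :=
        mul_le_mul (by linarith) h6 h5 (by linarith)
      linarith

theorem cheb_two (k : ℕ) : cheb (2 : ℝ) k = k + 1 := by
  have : cheb (2 : ℝ) k = k + 1 ∧ cheb (2 : ℝ) (k + 1) = k + 2 := by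
    induction k with
    | zero => simp [cheb]
    | succ k ih =>
      refine ⟨by rw [ih.2]; push_cast; ring, ?_⟩
      rw [cheb, ih.1, ih.2]; push_cast; ring
  exact this.1

/-- The recursion conserves the quadratic form in `hQ`. Completing the square in it gives `|U_(k+1)
- (x / 2) U_k| ≤ 1`, so the absolute value grows by at most one per step. -/
theorem abs_cheb_le_of_abs_le_two {x : ℝ} (hx : |x| ≤ 2) (k : ℕ) : |cheb x k| ≤ k + 1 := by
  have hQ : ∀ k, cheb x (k + 1) ^ 2 - x * cheb x (k + 1) * cheb x k + cheb x k ^ 2 = 1 := by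
    intro k
    induction k with
    | zero => simp [cheb]; ring
    | succ k ih => rw [cheb, ← ih]; ring
  have hx2 : x ^ 2 ≤ 4 := by nlinarith [sq_abs x, abs_nonneg x]
  induction k with
  | zero => simp [cheb]
  | succ k ih =>
    have h1 : (cheb x (k + 1) - x / 2 * cheb x k) ^ 2 ≤ 1 := by
      nlinarith [hQ k, mul_nonneg (by linarith : 0 ≤ 4 - x ^ 2) (sq_nonneg (cheb x k))]
    have h2 : |cheb x (k + 1) - x / 2 * cheb x k| ≤ 1 := by simpa using h1
    have h3 : |x / 2 * cheb x k| ≤ 1 * |cheb x k| := by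
      rw [abs_mul]
      refine mul_le_mul_of_nonneg_right ?_ (abs_nonneg _)
      rw [abs_div, abs_two]; linarith
    have h4 := abs_sub_abs_le_abs_sub (cheb x (k + 1)) (x / 2 * cheb x k)
    push_cast
    linarith

theorem cheb_neg (x : ℝ) (k : ℕ) : cheb (-x) k = (-1) ^ k * cheb x k := by
  have : cheb (-x) k = (-1) ^ k * cheb x k ∧ cheb (-x) (k + 1) = (-1) ^ (k + 1) * cheb x (k + 1) := by
    induction k with
    | zero => simp [cheb]
    | succ k ih =>
      refine ⟨ih.2, ?_⟩
      rw [cheb, ih.1, ih.2, cheb]; ring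
  exact this.1

theorem abs_cheb_abs (x : ℝ) (k : ℕ) : |cheb x k| = |cheb |x| k| := by
  rcases abs_choice x with h | h <;> rw [h]
  rw [cheb_neg, abs_mul]; simp

theorem abs_cheb_le {x y : ℝ} (hy : 2 ≤ y) (hxy : |x| ≤ y) (k : ℕ) : |cheb x k| ≤ cheb y k := by
  rcases le_total |x| 2 with h | h
  · refine (abs_cheb_le_of_abs_le_two h k).trans ?_
    rw [← cheb_two]
    exact (cheb_mono le_rfl hy k).2.1
  · rw [abs_cheb_abs, abs_of_nonneg (cheb_mono h hxy k).1]
    exact (cheb_mono h hxy k).2.1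

theorem sub_inv_mul_cheb {a : ℝ} (ha : a ≠ 0) (k : ℕ) :
    (a - a⁻¹) * cheb (a + a⁻¹) k = a ^ (k + 1) - a⁻¹ ^ (k + 1) := by
  have : (a - a⁻¹) * cheb (a + a⁻¹) k = a ^ (k + 1) - a⁻¹ ^ (k + 1) ∧
      (a - a⁻¹) * cheb (a + a⁻¹) (k + 1) = a ^ (k + 2) - a⁻¹ ^ (k + 2) := by
    induction k with
    | zero => simp [cheb]; ring
    | succ k ih =>
      refine ⟨ih.2, ?_⟩
      have h1 : a * a⁻¹ = 1 := mul_inv_cancel₀ ha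
      rw [cheb]
      have : (a - a⁻¹) * ((a + a⁻¹) * cheb (a + a⁻¹) (k + 1) - cheb (a + a⁻¹) k) =
        (a + a⁻¹) * (a ^ (k + 2) - a⁻¹ ^ (k + 2)) - (a ^ (k + 1) - a⁻¹ ^ (k + 1)) := by
        rw [← ih.1, ← ih.2]; ring
      rw [this]
      linear_combination (a ^ (k + 1) - a⁻¹ ^ (k + 1)) * h1
  exact this.1

theorem pow_le_cheb {a : ℝ} (ha : 1 < a) (k : ℕ) : a ^ k ≤ cheb (a + a⁻¹) k := by
  have h0 : 0 < a := by linarith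
  have hinv : a⁻¹ < 1 := inv_lt_one_of_one_lt₀ ha
  have h1 := sub_inv_mul_cheb h0.ne' k
  have h2 : (a - a⁻¹) * a ^ k ≤ (a - a⁻¹) * cheb (a + a⁻¹) k := by
    rw [h1]
    have h3 : a⁻¹ ^ (k + 1) ≤ a⁻¹ * a ^ k := by
      rw [pow_succ']
      refine mul_le_mul_of_nonneg_left ?_ (by positivity)
      exact (pow_le_one₀ (by positivity) hinv.le).trans (one_le_pow₀ ha.le)
    rw [pow_succ]; linarith
  exact le_of_mul_le_mul_left h2 (by linarith)

theorem cheb_le {a : ℝ} (ha : 1 < a) (k : ℕ) : cheb (a + a⁻¹) k ≤ a ^ k * (1 - (a⁻¹) ^ 2)⁻¹ := by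
  have h0 : 0 < a := by linarith
  have hinv : a⁻¹ < 1 := inv_lt_one_of_one_lt₀ ha
  have hinv0 : 0 < a⁻¹ := by positivity
  have h1 := sub_inv_mul_cheb h0.ne' k
  have h3 : 0 < 1 - (a⁻¹) ^ 2 := by nlinarith
  rw [← div_eq_mul_inv, le_div_iff₀ h3]
  have h2 : a * (cheb (a + a⁻¹) k * (1 - a⁻¹ ^ 2)) ≤ a * a ^ k := by
    have : a * (cheb (a + a⁻¹) k * (1 - a⁻¹ ^ 2)) = (a - a⁻¹) * cheb (a + a⁻¹) k := by
      field_simp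
    rw [this, h1, pow_succ' a k]
    have : 0 ≤ a⁻¹ ^ (k + 1) := by positivity
    linarith
  exact le_of_mul_le_mul_left h2 h0

theorem two_le_add_inv {a : ℝ} (ha : 0 < a) : 2 ≤ a + a⁻¹ := by
  have : a + a⁻¹ - 2 = (a - 1) ^ 2 / a := by field_simp; ring
  have : 0 ≤ (a - 1) ^ 2 / a := by positivity
  linarith

theorem exists_add_inv_eq {y : ℝ} (hy : 2 ≤ y) : ∃ a, 1 ≤ a ∧ a + a⁻¹ = y := by
  have h : 0 ≤ y ^ 2 - 4 := by nlinarith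
  have hs := Real.sq_sqrt h
  have hs0 := Real.sqrt_nonneg (y ^ 2 - 4)
  refine ⟨(y + Real.sqrt (y ^ 2 - 4)) / 2, by linarith, ?_⟩
  have : ((y + Real.sqrt (y ^ 2 - 4)) / 2)⁻¹ = (y - Real.sqrt (y ^ 2 - 4)) / 2 := by
    rw [inv_eq_iff_eq_inv, eq_comm, inv_eq_iff_eq_inv, ← one_div, eq_div_iff]
    · nlinarith
    · linarith
  rw [this]; ring

/-! ### Chebyshev polynomials of a symmetric matrix. -/

section Operator

variable {N : ℕ} {A : Matrix (Fin N) (Fin N) ℝ}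

theorem op_eigenvectorBasis (hA : A.IsHermitian) (i : Fin N) :
    op A (hA.eigenvectorBasis i) = hA.eigenvalues i • hA.eigenvectorBasis i := by
  ext j
  have := congrFun (hA.mulVec_eigenvectorBasis i) j
  simpa using this

theorem cheb_op_eigenvectorBasis (hA : A.IsHermitian) (i : Fin N) (k : ℕ) :
    cheb (op A) k (hA.eigenvectorBasis i) = cheb (hA.eigenvalues i) k • hA.eigenvectorBasis i := by
  have : cheb (op A) k (hA.eigenvectorBasis i) = cheb (hA.eigenvalues i) k • hA.eigenvectorBasis i ∧
      cheb (op A) (k + 1) (hA.eigenvectorBasis i) =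
        cheb (hA.eigenvalues i) (k + 1) • hA.eigenvectorBasis i := by
    induction k with
    | zero => simp [cheb, op_eigenvectorBasis hA]
    | succ k ih =>
      refine ⟨ih.2, ?_⟩
      rw [cheb, _root_.sub_apply, mul_apply_eq_comp, ih.1, ih.2,
        map_smul, op_eigenvectorBasis hA, cheb, smul_smul, ← sub_smul, mul_comm]
  exact this.1

theorem inner_cheb_op (hA : A.IsHermitian) (k : ℕ) (x y : EuclideanSpace ℝ (Fin N)) :
    inner ℝ (cheb (op A) k x) y = inner ℝ x (cheb (op A) k y) := by
  have : (∀ x y, inner ℝ (cheb (op A) k x) y = inner ℝ x (cheb (op A) k y)) ∧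
      ∀ x y, inner ℝ (cheb (op A) (k + 1) x) y = inner ℝ x (cheb (op A) (k + 1) y) := by
    induction k with
    | zero => exact ⟨fun x y => rfl, fun x y => op_symm hA x y⟩
    | succ k ih =>
      refine ⟨ih.2, fun x y => ?_⟩
      have hcomm : op A (cheb (op A) (k + 1) y) = cheb (op A) (k + 1) (op A y) := by
        have : Commute (op A) (cheb (op A) (k + 1)) := by
          have : ∀ k, Commute (op A) (cheb (op A) k) ∧ Commute (op A) (cheb (op A) (k + 1)) := by
            intro k
            induction k with
            | zero => exact ⟨Commute.one_right _, Commute.refl _⟩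
            | succ k ih => exact ⟨ih.2, ((Commute.refl _).mul_right ih.2).sub_right ih.1⟩
          exact (this k).2
        exact congrArg (fun T : EuclideanSpace ℝ (Fin N) →L[ℝ] EuclideanSpace ℝ (Fin N) => T y) this
      rw [cheb, _root_.sub_apply, mul_apply_eq_comp,
        _root_.sub_apply, mul_apply_eq_comp, inner_sub_left,
        inner_sub_right, op_symm hA, ih.1, ih.2, hcomm]
  exact this.1 x y

theorem norm_cheb_op_le (hA : A.IsHermitian) {k : ℕ} {C : ℝ} (hC : 0 ≤ C)
    (h : ∀ i, |cheb (hA.eigenvalues i) k| ≤ C) : ‖cheb (op A) k‖ ≤ C := by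
  refine ContinuousLinearMap.opNorm_le_bound _ hC fun x => ?_
  refine le_of_sq_le_sq ?_ (by positivity)
  rw [mul_pow, ← hA.eigenvectorBasis.sum_sq_norm_inner_right,
    ← hA.eigenvectorBasis.sum_sq_norm_inner_right, Finset.mul_sum]
  refine Finset.sum_le_sum fun i _ => ?_
  rw [← inner_cheb_op hA, cheb_op_eigenvectorBasis, real_inner_smul_left, norm_mul, mul_pow]
  refine mul_le_mul_of_nonneg_right ?_ (sq_nonneg _)
  exact pow_le_pow_left₀ (norm_nonneg _) (h i) 2

theorem abs_eigenvalue_le_norm_op (hA : A.IsHermitian) (i : Fin N) :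
    |hA.eigenvalues i| ≤ ‖op A‖ := by
  have h1 := (op A).le_opNorm (hA.eigenvectorBasis i)
  rw [op_eigenvectorBasis, norm_smul, hA.eigenvectorBasis.norm_eq_one] at h1
  simpa using h1

theorem exists_abs_eigenvalue_eq [NeZero N] (hA : A.IsHermitian) :
    ∃ i, |hA.eigenvalues i| = ‖op A‖ := by
  obtain ⟨i, -, hi⟩ := Finset.exists_max_image Finset.univ (fun i => |hA.eigenvalues i|)
    ⟨(0 : Fin N), Finset.mem_univ _⟩
  refine ⟨i, le_antisymm (abs_eigenvalue_le_norm_op hA i) ?_⟩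
  exact norm_cheb_op_le hA (k := 1) (abs_nonneg _) fun j => hi j (Finset.mem_univ _)

theorem norm_cheb_op_le_cheb (hA : A.IsHermitian) {y : ℝ} (hy : 2 ≤ y) (h : ‖op A‖ ≤ y) (k : ℕ) :
    ‖cheb (op A) k‖ ≤ cheb y k :=
  norm_cheb_op_le hA (cheb_mono hy le_rfl k).1 fun i =>
    abs_cheb_le hy ((abs_eigenvalue_le_norm_op hA i).trans h) k

end Operator

/-- Discrete Duhamel formula: `cheb T` is the fundamental solution of the homogeneous recursion, and
the source `e j`, which enters at index `j + 1`, is propagated over the remaining `k - 1 - j` steps.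
-/
theorem cheb_duhamel {E : Type*} [NormedAddCommGroup E] [NormedSpace ℝ E] (T : E →L[ℝ] E)
    {b e : ℕ → E} (h0 : e 0 = 0) (h1 : b 1 = T (b 0))
    (h : ∀ k, b (k + 2) = T (b (k + 1)) - b k + e (k + 1)) (k : ℕ) :
    b k = cheb T k (b 0) + ∑ j ∈ Finset.range k, cheb T (k - 1 - j) (e j) := by
  have : b k = cheb T k (b 0) + ∑ j ∈ Finset.range k, cheb T (k - 1 - j) (e j) ∧
      b (k + 1) = cheb T (k + 1) (b 0) +
        ∑ j ∈ Finset.range (k + 1), cheb T (k + 1 - 1 - j) (e j) := by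
    induction k with
    | zero => simp [cheb, h0, h1]
    | succ k ih =>
      refine ⟨ih.2, ?_⟩
      rw [h, ih.1, ih.2, map_add, map_sum, Finset.sum_range_succ _ (k + 1),
        Finset.sum_range_succ _ k, Finset.sum_range_succ _ k]
      have hs : ∑ j ∈ Finset.range k, cheb T (k + 1 + 1 - 1 - j) (e j) =
          ∑ j ∈ Finset.range k, T (cheb T (k + 1 - 1 - j) (e j)) -
            ∑ j ∈ Finset.range k, cheb T (k - 1 - j) (e j) := by
        rw [← Finset.sum_sub_distrib]
        refine Finset.sum_congr rfl fun j hj => ?_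
        obtain ⟨d, rfl⟩ := Nat.exists_eq_add_of_lt (Finset.mem_range.1 hj)
        rw [show j + d + 1 + 1 + 1 - 1 - j = d + 2 by omega,
          show j + d + 1 + 1 - 1 - j = d + 1 by omega, show j + d + 1 - 1 - j = d by omega, cheb]
        simp
      rw [hs]
      have e1 : k + 1 - 1 - k = 0 := by omega
      have e2 : k + 1 + 1 - 1 - k = 1 := by omega
      have e3 : k + 1 + 1 - 1 - (k + 1) = 0 := by omega
      rw [e1, e2, e3]
      simp only [cheb, _root_.sub_apply, mul_apply_eq_comp,
        one_apply_eq_self]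
      abel
  exact this.1


/-! ### Nonbacktracking sums as Chebyshev polynomials -/

section NB

variable {N : ℕ} {H : Matrix (Fin N) (Fin N) ℝ} {φ : Fin N → ℝ}

/-- Nonbacktracking sums with unrestricted first step, as a vector. -/
noncomputable def nbVec (H : Matrix (Fin N) (Fin N) ℝ) (φ : Fin N → ℝ) (k : ℕ) :
    EuclideanSpace ℝ (Fin N) := WithLp.toLp 2 fun v => nbSum H φ k v v

/-- Nonbacktracking sums whose first step is along a given directed edge. -/
noncomputable def nbEdge (H : Matrix (Fin N) (Fin N) ℝ) (φ : Fin N → ℝ) (k : ℕ) :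
    EuclideanSpace ℝ (Fin N × Fin N) := WithLp.toLp 2 fun p => H p.1 p.2 * nbSum H φ k p.1 p.2

theorem nbVec_succ_apply (hd : ∀ i, H i i = 0) (k : ℕ) (v : Fin N) :
    nbVec H φ (k + 1) v = ∑ u, nbEdge H φ k (v, u) := by
  simp only [nbVec, nbEdge, nbSum]
  refine Finset.sum_congr rfl fun u _ => ?_
  split_ifs with h
  · have : u = v := by simpa using h
    simp [this, hd]
  · rfl

theorem nbSum_succ_eq (hd : ∀ i, H i i = 0) (k : ℕ) (p v : Fin N) :
    nbSum H φ (k + 1) p v = nbVec H φ (k + 1) v - nbEdge H φ k (v, p) := by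
  rw [nbVec_succ_apply hd, ← Finset.sum_erase_add _ _ (Finset.mem_univ p), add_sub_cancel_right,
    nbSum, ← Finset.sum_erase_add _ _ (Finset.mem_univ p)]
  rw [if_pos (Or.inl rfl), add_zero]
  refine Finset.sum_congr rfl fun u hu => ?_
  have hu' := Finset.ne_of_mem_erase hu
  by_cases h : u = v
  · simp [h, nbEdge, hd]
  · rw [if_neg (by tauto)]; rfl

theorem nbEdge_zero_apply (p : Fin N × Fin N) :
    nbEdge H φ 0 p = H p.1 p.2 * nbVec H φ 0 p.2 := rfl

theorem nbEdge_succ_apply (hd : ∀ i, H i i = 0) (k : ℕ) (p : Fin N × Fin N) :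
    nbEdge H φ (k + 1) p =
      H p.1 p.2 * nbVec H φ (k + 1) p.2 - H p.1 p.2 * nbEdge H φ k (p.2, p.1) := by
  rw [← mul_sub, ← nbSum_succ_eq hd]; rfl

theorem nbVec_one (hd : ∀ i, H i i = 0) : nbVec H φ 1 = op H (nbVec H φ 0) := by
  ext v
  rw [nbVec_succ_apply hd]
  simp only [nbEdge_zero_apply, Matrix.ofLp_toEuclideanCLM, Matrix.mulVec, dotProduct]

/-- The error in the three term recursion. -/
noncomputable def nbError (H : Matrix (Fin N) (Fin N) ℝ) (φ : Fin N → ℝ) :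
    ℕ → EuclideanSpace ℝ (Fin N)
  | 0 => 0
  | k + 1 => nbVec H φ (k + 2) - op H (nbVec H φ (k + 1)) + nbVec H φ k

theorem nbVec_add_two_apply (hd : ∀ i, H i i = 0) (k : ℕ) (v : Fin N) :
    nbVec H φ (k + 2) v = op H (nbVec H φ (k + 1)) v - ∑ u, H v u * nbEdge H φ k (u, v) := by
  rw [nbVec_succ_apply hd]
  simp only [nbEdge_succ_apply hd, Matrix.ofLp_toEuclideanCLM, Matrix.mulVec, dotProduct,
    Finset.sum_sub_distrib]

theorem nbError_one_apply (hs : ∀ i j, H i j = H j i) (hd : ∀ i, H i i = 0) (v : Fin N) :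
    nbError H φ 1 v = (1 - ∑ u, H v u ^ 2) * nbVec H φ 0 v := by
  simp only [nbError, PiLp.add_apply, PiLp.sub_apply]
  rw [nbVec_add_two_apply hd, sub_mul, Finset.sum_mul]
  simp only [nbEdge_zero_apply]
  have : ∀ u, H v u * (H u v * nbVec H φ 0 v) = H v u ^ 2 * nbVec H φ 0 v := by
    intro u; rw [hs u v]; ring
  simp only [this]; ring

/-- Removing immediate returns subtracts `∑ u, H v u ^ 2` times the shorter sum, where the Chebyshev
recursion has the coefficient `1`. The last sum corrects for continuations through `u` that were not
present to be removed. The first error is small because row sums of squares are near `1`, the second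
because the entries are small. -/
theorem nbError_add_two_apply (hs : ∀ i j, H i j = H j i) (hd : ∀ i, H i i = 0) (k : ℕ)
    (v : Fin N) : nbError H φ (k + 2) v =
      (1 - ∑ u, H v u ^ 2) * nbVec H φ (k + 1) v + ∑ u, H v u ^ 2 * nbEdge H φ k (v, u) := by
  simp only [nbError, PiLp.add_apply, PiLp.sub_apply]
  rw [nbVec_add_two_apply hd, sub_mul, Finset.sum_mul]
  simp only [nbEdge_succ_apply hd]
  have : ∀ u, H v u * (H u v * nbVec H φ (k + 1) v - H u v * nbEdge H φ k (v, u)) =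
      H v u ^ 2 * nbVec H φ (k + 1) v - H v u ^ 2 * nbEdge H φ k (v, u) := by
    intro u; rw [hs u v]; ring
  simp only [this, Finset.sum_sub_distrib]; ring

variable {θ ε : ℝ}

theorem norm_diag_le (hε : 0 ≤ ε) (hD : ∀ v, |∑ u, H v u ^ 2 - 1| ≤ ε)
    (x : EuclideanSpace ℝ (Fin N)) :
    ‖(WithLp.toLp 2 fun v => (1 - ∑ u, H v u ^ 2) * x v : EuclideanSpace ℝ (Fin N))‖ ≤
      ε * ‖x‖ := by
  refine le_of_sq_le_sq ?_ (by positivity)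
  rw [mul_pow, EuclideanSpace.norm_sq_eq, EuclideanSpace.norm_sq_eq, Finset.mul_sum]
  refine Finset.sum_le_sum fun v _ => ?_
  simp only [Real.norm_eq_abs, abs_mul, mul_pow]
  refine mul_le_mul_of_nonneg_right (pow_le_pow_left₀ (abs_nonneg _) ?_ 2) (sq_nonneg _)
  rw [abs_sub_comm]; exact hD v

theorem norm_edge_vec_le (hs : ∀ i j, H i j = H j i) (hε : ε ≤ 1)
    (hD : ∀ v, |∑ u, H v u ^ 2 - 1| ≤ ε) (x : EuclideanSpace ℝ (Fin N)) :
    ‖(WithLp.toLp 2 fun p => H p.1 p.2 * x p.2 : EuclideanSpace ℝ (Fin N × Fin N))‖ ≤ 2 * ‖x‖ := by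
  refine le_of_sq_le_sq ?_ (by positivity)
  rw [mul_pow, EuclideanSpace.norm_sq_eq, EuclideanSpace.norm_sq_eq, Finset.mul_sum,
    Fintype.sum_prod_type, Finset.sum_comm]
  refine Finset.sum_le_sum fun v _ => ?_
  simp only [Real.norm_eq_abs, abs_mul, mul_pow, sq_abs, ← Finset.sum_mul]
  refine mul_le_mul_of_nonneg_right ?_ (sq_nonneg _)
  have := (abs_le.1 (hD v)).2
  simp only [fun u => hs u v]
  linarith

theorem norm_edge_swap_le (hθ : 0 ≤ θ) (hb : ∀ i j, |H i j| ≤ θ)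
    (y : EuclideanSpace ℝ (Fin N × Fin N)) :
    ‖(WithLp.toLp 2 fun p => H p.1 p.2 * y (p.2, p.1) : EuclideanSpace ℝ (Fin N × Fin N))‖ ≤
      θ * ‖y‖ := by
  refine le_of_sq_le_sq ?_ (by positivity)
  rw [mul_pow, EuclideanSpace.norm_sq_eq, EuclideanSpace.norm_sq_eq, Finset.mul_sum,
    Fintype.sum_prod_type, Fintype.sum_prod_type, Finset.sum_comm]
  refine Finset.sum_le_sum fun u _ => Finset.sum_le_sum fun v _ => ?_
  simp only [Real.norm_eq_abs, abs_mul, mul_pow]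
  exact mul_le_mul_of_nonneg_right (pow_le_pow_left₀ (abs_nonneg _) (hb _ _) 2) (sq_nonneg _)

theorem norm_sum_sq_edge_le (hθ : 0 ≤ θ) (hb : ∀ i j, |H i j| ≤ θ) (hε : ε ≤ 1)
    (hD : ∀ v, |∑ u, H v u ^ 2 - 1| ≤ ε) (y : EuclideanSpace ℝ (Fin N × Fin N)) :
    ‖(WithLp.toLp 2 fun v => ∑ u, H v u ^ 2 * y (v, u) : EuclideanSpace ℝ (Fin N))‖ ≤
      2 * θ * ‖y‖ := by
  refine le_of_sq_le_sq ?_ (by positivity)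
  rw [mul_pow, EuclideanSpace.norm_sq_eq, EuclideanSpace.norm_sq_eq, Finset.mul_sum,
    Fintype.sum_prod_type]
  refine Finset.sum_le_sum fun v _ => ?_
  simp only [Real.norm_eq_abs, sq_abs, ← Finset.mul_sum]
  refine (Finset.sum_mul_sq_le_sq_mul_sq _ _ _).trans ?_
  refine mul_le_mul_of_nonneg_right ?_ (Finset.sum_nonneg fun _ _ => sq_nonneg _)
  have h1 := (abs_le.1 (hD v)).2
  calc ∑ u, (H v u ^ 2) ^ 2 ≤ ∑ u, θ ^ 2 * H v u ^ 2 := by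
        refine Finset.sum_le_sum fun u _ => ?_
        rw [pow_two (H v u ^ 2)]
        refine mul_le_mul_of_nonneg_right ?_ (sq_nonneg _)
        rw [← sq_abs]
        exact pow_le_pow_left₀ (abs_nonneg _) (hb _ _) 2
    _ = θ ^ 2 * ∑ u, H v u ^ 2 := by rw [Finset.mul_sum]
    _ ≤ θ ^ 2 * 4 := mul_le_mul_of_nonneg_left (by linarith) (sq_nonneg _)
    _ = _ := by ring

theorem norm_nbEdge_zero_le (hs : ∀ i j, H i j = H j i) (hε : ε ≤ 1)
    (hD : ∀ v, |∑ u, H v u ^ 2 - 1| ≤ ε) : ‖nbEdge H φ 0‖ ≤ 2 * ‖nbVec H φ 0‖ :=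
  norm_edge_vec_le hs hε hD (nbVec H φ 0)

theorem norm_nbEdge_succ_le (hs : ∀ i j, H i j = H j i) (hd : ∀ i, H i i = 0) (hθ : 0 ≤ θ)
    (hb : ∀ i j, |H i j| ≤ θ) (hε : ε ≤ 1)
    (hD : ∀ v, |∑ u, H v u ^ 2 - 1| ≤ ε) (k : ℕ) :
    ‖nbEdge H φ (k + 1)‖ ≤ 2 * ‖nbVec H φ (k + 1)‖ + θ * ‖nbEdge H φ k‖ := by
  have : nbEdge H φ (k + 1) =
      (WithLp.toLp 2 fun p => H p.1 p.2 * nbVec H φ (k + 1) p.2) -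
        WithLp.toLp 2 fun p => H p.1 p.2 * nbEdge H φ k (p.2, p.1) := by
    ext p
    rw [nbEdge_succ_apply hd]; rfl
  rw [this]
  exact (norm_sub_le _ _).trans
    (add_le_add (norm_edge_vec_le hs hε hD _) (norm_edge_swap_le hθ hb _))

theorem norm_nbError_one_le (hs : ∀ i j, H i j = H j i) (hd : ∀ i, H i i = 0) (hε0 : 0 ≤ ε)
    (hD : ∀ v, |∑ u, H v u ^ 2 - 1| ≤ ε) : ‖nbError H φ 1‖ ≤ ε * ‖nbVec H φ 0‖ := by
  refine le_trans (le_of_eq ?_) (norm_diag_le hε0 hD _)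
  congr 1
  ext v
  rw [nbError_one_apply hs hd]

theorem norm_nbError_add_two_le (hs : ∀ i j, H i j = H j i) (hd : ∀ i, H i i = 0) (hθ : 0 ≤ θ)
    (hb : ∀ i j, |H i j| ≤ θ) (hε0 : 0 ≤ ε) (hε : ε ≤ 1)
    (hD : ∀ v, |∑ u, H v u ^ 2 - 1| ≤ ε) (k : ℕ) :
    ‖nbError H φ (k + 2)‖ ≤ ε * ‖nbVec H φ (k + 1)‖ + 2 * θ * ‖nbEdge H φ k‖ := by
  have : nbError H φ (k + 2) =
      (WithLp.toLp 2 fun v => (1 - ∑ u, H v u ^ 2) * nbVec H φ (k + 1) v) +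
        WithLp.toLp 2 fun v => ∑ u, H v u ^ 2 * nbEdge H φ k (v, u) := by
    ext v
    rw [nbError_add_two_apply hs hd]; rfl
  rw [this]
  exact (norm_add_le _ _).trans (add_le_add (norm_diag_le hε0 hD _) (norm_sum_sq_edge_le hθ hb hε hD _))

/-- Comparison of nonbacktracking sums with Chebyshev polynomials when the latter grow at most
like `G * a ^ k`. -/
theorem norm_nbVec_sub_cheb_le (hs : ∀ i j, H i j = H j i) (hd : ∀ i, H i i = 0) (hθ : 0 ≤ θ)
    (hθ1 : θ ≤ 1 / 2) (hb : ∀ i j, |H i j| ≤ θ) (hε0 : 0 ≤ ε) (hε : ε ≤ 1)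
    (hD : ∀ v, |∑ u, H v u ^ 2 - 1| ≤ ε) {a G : ℝ} (ha : 1 ≤ a) (hG : 1 ≤ G)
    (hcheb : ∀ k, ‖cheb (op H) k‖ ≤ G * a ^ k) {l : ℕ} (hl : 4 * G ^ 2 * l * (ε + 8 * θ) ≤ 1)
    (hφ : ‖nbVec H φ 0‖ ≤ 1) {k : ℕ} (hk : k ≤ l) :
    ‖nbVec H φ k - cheb (op H) k (nbVec H φ 0)‖ ≤ 2 * G ^ 2 * k * (ε + 8 * θ) * a ^ k := by
  have ha0 : 0 < a := by linarith
  have hduh := cheb_duhamel (op H) (b := nbVec H φ) (e := nbError H φ) rfl (nbVec_one hd)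
    (fun k => by simp only [nbError]; abel)
  set δ := ε + 8 * θ with hδ
  have hδ0 : 0 ≤ δ := by positivity
  -- A bootstrap: the bounds on `nbVec` and `nbEdge` up to `k` control the sources in Duhamel's
  -- formula, and `hl` keeps their accumulated effect below `G * a ^ (k + 1)`, so that the bounds
  -- reproduce themselves.
  have main : ∀ k, k ≤ l → (∀ j, j ≤ k → ‖nbVec H φ j‖ ≤ 2 * G * a ^ j) ∧
      (∀ j, j ≤ k → ‖nbEdge H φ j‖ ≤ 8 * G * a ^ j) ∧
      ‖nbVec H φ k - cheb (op H) k (nbVec H φ 0)‖ ≤ 2 * G ^ 2 * k * δ * a ^ k := by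
    intro k
    induction k with
    | zero =>
      intro _
      have h0 : ‖nbVec H φ 0‖ ≤ 2 * G * a ^ 0 := by rw [pow_zero]; linarith
      refine ⟨fun j hj => ?_, fun j hj => ?_, ?_⟩
      · rw [Nat.le_zero.1 hj]; exact h0
      · rw [Nat.le_zero.1 hj]
        have := norm_nbEdge_zero_le (φ := φ) hs hε hD
        rw [pow_zero] at *; linarith
      · simp [cheb]
    | succ k ih =>
      intro hk
      obtain ⟨h1, h2, -⟩ := ih (by omega)
      have hpa : ∀ j, 0 < a ^ j := fun j => by positivity
      have hmono : ∀ j, a ^ j ≤ a ^ (j + 1) := fun j => pow_le_pow_right₀ ha (by omega)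
      have herr : ∀ j, j ≤ k → ‖nbError H φ j‖ ≤ 2 * G * δ * a ^ j := by
        intro j hj
        match j, hj with
        | 0, _ => simp only [nbError, norm_zero]; positivity
        | 1, hj =>
          refine (norm_nbError_one_le hs hd hε0 hD).trans ?_
          calc ε * ‖nbVec H φ 0‖ ≤ δ * (2 * G * a ^ 0) :=
                mul_le_mul (by linarith) (h1 0 (by omega)) (norm_nonneg _) hδ0
            _ ≤ δ * (2 * G * a ^ 1) := by gcongr; exact Nat.zero_le 1
            _ = _ := by ring
        | j + 2, hj =>
          refine (norm_nbError_add_two_le hs hd hθ hb hε0 hε hD j).trans ?_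
          have e1 := h1 (j + 1) (by omega)
          have e2 := h2 j (by omega)
          calc ε * ‖nbVec H φ (j + 1)‖ + 2 * θ * ‖nbEdge H φ j‖
              ≤ ε * (2 * G * a ^ (j + 2)) + 2 * θ * (8 * G * a ^ (j + 2)) := by
                gcongr
                · exact e1.trans (by gcongr; omega)
                · exact e2.trans (by gcongr; omega)
            _ = 2 * G * δ * a ^ (j + 2) := by rw [hδ]; ring
      have h3 : ‖nbVec H φ (k + 1) - cheb (op H) (k + 1) (nbVec H φ 0)‖ ≤
          2 * G ^ 2 * (k + 1 : ℕ) * δ * a ^ (k + 1) := by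
        rw [hduh (k + 1), add_sub_cancel_left]
        refine (norm_sum_le _ _).trans ?_
        have : ∀ j ∈ Finset.range (k + 1), ‖cheb (op H) (k + 1 - 1 - j) (nbError H φ j)‖ ≤
            2 * G ^ 2 * δ * a ^ (k + 1) := by
          intro j hj
          have hj' : j ≤ k := by have := Finset.mem_range.1 hj; omega
          refine ((cheb (op H) _).le_opNorm _).trans ?_
          calc _ ≤ (G * a ^ (k + 1 - 1 - j)) * (2 * G * δ * a ^ j) :=
                mul_le_mul (hcheb _) (herr j hj') (norm_nonneg _) (by positivity)
            _ = 2 * G ^ 2 * δ * a ^ k := by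
                rw [show k = (k + 1 - 1 - j) + j by omega, pow_add,
                  show k + 1 - 1 - j + j + 1 - 1 - j = k + 1 - 1 - j by omega]; ring
            _ ≤ _ := by gcongr; omega
        refine (Finset.sum_le_card_nsmul _ _ _ this).trans (le_of_eq ?_)
        rw [Finset.card_range, nsmul_eq_mul]; ring
      have h4 : ‖nbVec H φ (k + 1)‖ ≤ 2 * G * a ^ (k + 1) := by
        have h5 : ‖cheb (op H) (k + 1) (nbVec H φ 0)‖ ≤ G * a ^ (k + 1) := by
          refine ((cheb (op H) _).le_opNorm _).trans ?_
          exact (mul_le_mul (hcheb _) hφ (norm_nonneg _) (by positivity)).trans (by rw [mul_one])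
        have h6 := norm_sub_norm_le (nbVec H φ (k + 1)) (cheb (op H) (k + 1) (nbVec H φ 0))
        have h7 : 2 * G ^ 2 * (k + 1 : ℕ) * δ * a ^ (k + 1) ≤ G * a ^ (k + 1) := by
          refine mul_le_mul_of_nonneg_right ?_ (hpa _).le
          have : (((k + 1 : ℕ)) : ℝ) ≤ l := by exact_mod_cast hk
          calc 2 * G ^ 2 * (k + 1 : ℕ) * δ ≤ 2 * G ^ 2 * l * δ := by gcongr
            _ ≤ 1 := by linarith [show 4 * G ^ 2 * l * δ = 2 * (2 * G ^ 2 * l * δ) by ring,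
                show 0 ≤ 2 * G ^ 2 * l * δ by positivity]
            _ ≤ G := hG
        linarith
      refine ⟨fun j hj => ?_, fun j hj => ?_, h3⟩
      · rcases Nat.lt_or_ge j (k + 1) with hj' | hj'
        · exact h1 j (by omega)
        · rw [le_antisymm hj hj']; exact h4
      · rcases Nat.lt_or_ge j (k + 1) with hj' | hj'
        · exact h2 j (by omega)
        · rw [le_antisymm hj hj']
          have e1 := norm_nbEdge_succ_le (φ := φ) hs hd hθ hb hε hD k
          have e2 : θ * ‖nbEdge H φ k‖ ≤ 1 / 2 * (8 * G * a ^ (k + 1)) := by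
            refine mul_le_mul hθ1 ((h2 k le_rfl).trans ?_) (norm_nonneg _) (by norm_num)
            exact mul_le_mul_of_nonneg_left (hmono k) (by positivity)
          linarith
  exact (main k hk).2.2

theorem nbSum_eq_sum_single (k : ℕ) (p v : Fin N) :
    nbSum H φ k p v = ∑ y, φ y * nbSum H (Pi.single y 1) k p v := by
  induction k generalizing p v with
  | zero => simp [nbSum, Pi.single_apply]
  | succ k ih =>
    simp only [nbSum, Finset.mul_sum]
    rw [Finset.sum_comm]
    refine Finset.sum_congr rfl fun u _ => ?_
    split_ifs
    · simp
    · rw [ih, Finset.mul_sum]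
      exact Finset.sum_congr rfl fun y _ => by ring

/-- Cauchy–Schwarz in the terminal weight `φ`, on which the sums depend linearly. The
Hilbert–Schmidt sum on the right does not involve `φ`, so `φ` may be a random eigenvector and
expectations can still be taken afterwards. -/
theorem norm_sq_nbVec_le (k : ℕ) : ‖nbVec H φ k‖ ^ 2 ≤
    (∑ x, ∑ y, nbSum H (Pi.single y 1) k x x ^ 2) * ‖nbVec H φ 0‖ ^ 2 := by
  rw [EuclideanSpace.norm_sq_eq, EuclideanSpace.norm_sq_eq, Finset.sum_mul]
  refine Finset.sum_le_sum fun x _ => ?_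
  simp only [nbVec, Real.norm_eq_abs, sq_abs, nbSum.eq_1]
  rw [nbSum_eq_sum_single, mul_comm]
  exact Finset.sum_mul_sq_le_sq_mul_sq _ _ _

/-- Write `‖H‖ = A + A⁻¹` with `A ≥ a` and take for `φ` an eigenvector whose eigenvalue has modulus
`‖H‖`. There `U_l` has modulus at least `A ^ l`, and `hl` makes the comparison error at most half of
this. -/
theorem pow_le_sum_nbSum_sq [NeZero N] (hs : ∀ i j, H i j = H j i) (hd : ∀ i, H i i = 0)
    (hθ : 0 ≤ θ) (hθ1 : θ ≤ 1 / 2) (hb : ∀ i j, |H i j| ≤ θ) (hε0 : 0 ≤ ε) (hε : ε ≤ 1)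
    (hD : ∀ v, |∑ u, H v u ^ 2 - 1| ≤ ε) {a : ℝ} (ha : 1 < a) {l : ℕ}
    (hl : 4 * ((1 - (a⁻¹) ^ 2)⁻¹) ^ 2 * l * (ε + 8 * θ) ≤ 1) (hH : a + a⁻¹ ≤ ‖op H‖) :
    a ^ (2 * l) / 4 ≤ ∑ x, ∑ y, nbSum H (Pi.single y 1) l x x ^ 2 := by
  have hherm : H.IsHermitian := by ext i j; simp [hs i j]
  obtain ⟨A, hA1, hA⟩ := exists_add_inv_eq ((two_le_add_inv (by linarith : 0 < a)).trans hH)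
  have haA : a ≤ A := by
    by_contra hlt
    push Not at hlt
    have h0 : 0 < A := by linarith
    have : a + a⁻¹ - (A + A⁻¹) = (a - A) * (1 - (a * A)⁻¹) := by
      have : a ≠ 0 := by linarith
      field_simp; ring
    have h2 : (a * A)⁻¹ < 1 := inv_lt_one_of_one_lt₀ (by nlinarith)
    nlinarith [mul_pos (sub_pos.2 hlt) (sub_pos.2 h2)]
  have hA1' : 1 < A := lt_of_lt_of_le ha haA
  set G := (1 - (A⁻¹) ^ 2)⁻¹ with hGdef
  have hainv : a⁻¹ < 1 := inv_lt_one_of_one_lt₀ ha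
  have hAinv : A⁻¹ ≤ a⁻¹ := inv_anti₀ (by linarith) haA
  have hA0 : 0 < A⁻¹ := by positivity
  have hpos : 0 < 1 - (a⁻¹) ^ 2 := by nlinarith
  have hle : 1 - (a⁻¹) ^ 2 ≤ 1 - (A⁻¹) ^ 2 := by nlinarith
  have hG1 : 1 ≤ G := (one_le_inv₀ (by linarith)).2 (by nlinarith)
  have hGle : G ≤ (1 - (a⁻¹) ^ 2)⁻¹ := inv_anti₀ hpos hle
  have hl' : 4 * G ^ 2 * l * (ε + 8 * θ) ≤ 1 := by
    refine le_trans ?_ hl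
    gcongr
  have hcheb : ∀ k, ‖cheb (op H) k‖ ≤ G * A ^ k := by
    intro k
    refine (norm_cheb_op_le_cheb hherm (two_le_add_inv (by linarith)) hA.ge k).trans ?_
    rw [mul_comm]
    exact cheb_le hA1' k
  obtain ⟨i, hi⟩ := exists_abs_eigenvalue_eq hherm
  set φ : Fin N → ℝ := (hherm.eigenvectorBasis i).ofLp with hφ
  have hφ0 : nbVec H φ 0 = hherm.eigenvectorBasis i := by ext v; rfl
  have hn : ‖nbVec H φ 0‖ = 1 := by rw [hφ0, hherm.eigenvectorBasis.norm_eq_one]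
  have h1 := norm_nbVec_sub_cheb_le (φ := φ) hs hd hθ hθ1 hb hε0 hε hD hA1 hG1 hcheb hl' hn.le le_rfl
  have h2 : A ^ l ≤ ‖cheb (op H) l (nbVec H φ 0)‖ := by
    rw [hφ0, cheb_op_eigenvectorBasis, norm_smul, hherm.eigenvectorBasis.norm_eq_one, mul_one,
      Real.norm_eq_abs, abs_cheb_abs, hi, ← hA]
    exact (pow_le_cheb hA1' l).trans (le_abs_self _)
  have h3 : 2 * G ^ 2 * l * (ε + 8 * θ) * A ^ l ≤ A ^ l / 2 := by
    have : 2 * G ^ 2 * l * (ε + 8 * θ) ≤ 1 / 2 := by linarith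
    have hAl : 0 < A ^ l := by positivity
    nlinarith
  have h4 := norm_sub_norm_le (cheb (op H) l (nbVec H φ 0)) (nbVec H φ l)
  rw [norm_sub_rev] at h4
  have h5 : A ^ l / 2 ≤ ‖nbVec H φ l‖ := by linarith
  have h6 := norm_sq_nbVec_le (H := H) (φ := φ) l
  rw [hn, one_pow, mul_one] at h6
  have h7 : (A ^ l / 2) ^ 2 ≤ ‖nbVec H φ l‖ ^ 2 := pow_le_pow_left₀ (by positivity) h5 2
  calc a ^ (2 * l) / 4 = (a ^ l / 2) ^ 2 := by rw [mul_comm 2 l, pow_mul]; ring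
    _ ≤ (A ^ l / 2) ^ 2 := by gcongr
    _ ≤ _ := h7.trans h6

end NB


/-! ### Concentration of row sums and the norm bound -/

section Norm

variable {Ω : Type*} [MeasurableSpace Ω] {P : Measure Ω} [IsProbabilityMeasure P] {N : ℕ} {θ : ℝ}
  {H : Ω → Matrix (Fin N) (Fin N) ℝ}

theorem edge_left_injective (v : Fin N) : Function.Injective (edge v) := by
  intro u u' h
  rcases edge_eq_iff.1 h with ⟨-, h⟩ | ⟨h, h'⟩
  · exact h
  · rw [h', h]

theorem CenteredEnsemble.apply_edge (h : CenteredEnsemble P θ H) (ω : Ω) (v u : Fin N) :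
    H ω (edge v u).1.1 (edge v u).1.2 = H ω v u := by
  rcases le_total v u with hvu | hvu
  · simp [edge, hvu]
  · simp [edge, hvu, h.symm ω v u]

theorem CenteredEnsemble.indep_row (h : CenteredEnsemble P θ H) (v : Fin N) :
    iIndepFun (fun u ω => H ω v u) P := by
  have := h.indep.precomp (edge_left_injective v)
  simpa only [h.apply_edge] using this

/-- At parameter `1 / θ` the exponent `σ h ^ 2 / θ` is at most one in modulus, so `exp y ≤ 1 + y + y
^ 2` applies, and its square is at most `h ^ 2`, which has mean at most `1 / N`. The sign `σ` treats
both tails at once. -/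
theorem CenteredEnsemble.mgf_row_le (h : CenteredEnsemble P θ H) (hθ0 : 0 < θ) (hθ : θ ≤ 1)
    {σ : ℝ} (hσ : |σ| = 1) (v u : Fin N) :
    mgf (fun ω => σ * (H ω v u ^ 2 - ∫ ω', H ω' v u ^ 2 ∂P)) P (1 / θ) ≤ Real.exp (1 / N) := by
  set c := ∫ ω', H ω' v u ^ 2 ∂P with hc
  have hσ2 : σ ^ 2 = 1 := by rw [← sq_abs, hσ, one_pow]
  have hb2 : ∀ ω, H ω v u ^ 2 ≤ θ ^ 2 := fun ω => by
    rw [← sq_abs]; exact pow_le_pow_left₀ (abs_nonneg _) (h.bound ω v u) 2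
  have hpt : ∀ ω, Real.exp (σ / θ * H ω v u ^ 2) ≤
      1 + σ / θ * H ω v u ^ 2 + H ω v u ^ 2 := by
    intro ω
    have h1 : |σ / θ * H ω v u ^ 2| ≤ 1 := by
      rw [abs_mul, abs_div, hσ, abs_of_pos hθ0, abs_of_nonneg (sq_nonneg _), one_div,
        inv_mul_le_iff₀ hθ0]
      nlinarith [hb2 ω]
    have h2 := (abs_le.1 (Real.abs_exp_sub_one_sub_id_le h1)).2
    have h3 : (σ / θ * H ω v u ^ 2) ^ 2 ≤ H ω v u ^ 2 := by
      have : (σ / θ * H ω v u ^ 2) ^ 2 = H ω v u ^ 2 / θ ^ 2 * H ω v u ^ 2 := by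
        rw [mul_pow, div_pow, hσ2]; ring
      rw [this]
      refine mul_le_of_le_one_left (sq_nonneg _) ?_
      rw [div_le_one (by positivity)]
      exact hb2 ω
    linarith
  have hint := h.integrable_pow v u 2
  have hexp : Integrable (fun ω => Real.exp (σ / θ * H ω v u ^ 2)) P := by
    refine Integrable.of_bound (C := 1 + (1 / θ) * θ ^ 2 + θ ^ 2)
      ((((h.measurable v u).pow_const 2).const_mul _).exp).aestronglyMeasurable
      (ae_of_all _ fun ω => ?_)
    rw [Real.norm_eq_abs, abs_of_pos (Real.exp_pos _)]
    refine (hpt ω).trans ?_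
    have h4 : σ / θ * H ω v u ^ 2 ≤ 1 / θ * θ ^ 2 := by
      refine (le_abs_self _).trans ?_
      rw [abs_mul, abs_div, hσ, abs_of_pos hθ0, abs_of_nonneg (sq_nonneg _)]
      exact mul_le_mul_of_nonneg_left (hb2 ω) (by positivity)
    linarith [hb2 ω]
  have h5 : mgf (fun ω => σ * (H ω v u ^ 2 - c)) P (1 / θ) =
      Real.exp (-(σ / θ * c)) * ∫ ω, Real.exp (σ / θ * H ω v u ^ 2) ∂P := by
    rw [mgf, ← integral_const_mul]
    congr 1
    ext ω
    rw [← Real.exp_add]; ring_nf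
  have h6 : ∫ ω, Real.exp (σ / θ * H ω v u ^ 2) ∂P ≤ 1 + σ / θ * c + c := by
    have e0 : ∫ ω, Real.exp (σ / θ * H ω v u ^ 2) ∂P ≤
        ∫ ω, (1 + σ / θ * H ω v u ^ 2 + H ω v u ^ 2) ∂P :=
      integral_mono hexp (((integrable_const _).add (hint.const_mul _)).add hint) hpt
    refine e0.trans (le_of_eq ?_)
    have e1 := integral_add ((integrable_const (1 : ℝ)).add (hint.const_mul (σ / θ))) hint
    have e2 := integral_add (integrable_const (1 : ℝ)) (hint.const_mul (σ / θ)) (μ := P)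
    simp only [Pi.add_apply] at e1
    rw [e1, e2, integral_const_mul]
    simp [hc]
  rw [h5]
  calc Real.exp (-(σ / θ * c)) * ∫ ω, Real.exp (σ / θ * H ω v u ^ 2) ∂P
      ≤ Real.exp (-(σ / θ * c)) * Real.exp (σ / θ * c + 1 / N) := by
        refine mul_le_mul_of_nonneg_left ?_ (Real.exp_pos _).le
        refine h6.trans ?_
        have := Real.add_one_le_exp (σ / θ * c + 1 / N)
        have := h.second_le v u
        linarith
    _ = _ := by rw [← Real.exp_add]; congr 1; ring

theorem CenteredEnsemble.integrable_exp_row (h : CenteredEnsemble P θ H) (σ c t : ℝ) (v : Fin N) :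
    Integrable (fun ω => Real.exp (t * ∑ u, σ * (H ω v u ^ 2 - c))) P := by
  refine Integrable.of_bound (C := Real.exp (|t| * ∑ u : Fin N, |σ| * (θ ^ 2 + |c|))) ?_
    (ae_of_all _ fun ω => ?_)
  · have : Measurable fun ω => ∑ u, σ * (H ω v u ^ 2 - c) :=
      Finset.measurable_sum _ fun u _ => (((h.measurable v u).pow_const 2).sub_const c).const_mul σ
    exact ((this.const_mul t).exp).aestronglyMeasurable
  · rw [Real.norm_eq_abs, abs_of_pos (Real.exp_pos _)]
    refine Real.exp_le_exp.2 ((le_abs_self _).trans ?_)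
    rw [abs_mul]
    refine mul_le_mul_of_nonneg_left ((Finset.abs_sum_le_sum_abs _ _).trans
      (Finset.sum_le_sum fun u _ => ?_)) (abs_nonneg _)
    rw [abs_mul]
    refine mul_le_mul_of_nonneg_left ((abs_sub _ _).trans ?_) (abs_nonneg _)
    rw [abs_of_nonneg (sq_nonneg _)]
    have : H ω v u ^ 2 ≤ θ ^ 2 := by
      rw [← sq_abs]; exact pow_le_pow_left₀ (abs_nonneg _) (h.bound ω v u) 2
    linarith

theorem CenteredEnsemble.row_tail (h : CenteredEnsemble P θ H) (hθ0 : 0 < θ) (hθ : θ ≤ 1)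
    (ε : ℝ) (v : Fin N) :
    P.real {ω | ε ≤ |∑ u, H ω v u ^ 2 - ∑ u, ∫ ω', H ω' v u ^ 2 ∂P|} ≤
      2 * Real.exp (1 - ε / θ) := by
  have key : ∀ σ : ℝ, |σ| = 1 →
      P.real {ω | ε ≤ ∑ u, σ * (H ω v u ^ 2 - ∫ ω', H ω' v u ^ 2 ∂P)} ≤
        Real.exp (1 - ε / θ) := by
    intro σ hσ
    have hmeas : ∀ u, Measurable fun ω => σ * (H ω v u ^ 2 - ∫ ω', H ω' v u ^ 2 ∂P) := fun u =>
      (((h.measurable v u).pow_const 2).sub_const _).const_mul σ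
    have hind : iIndepFun (fun u ω => σ * (H ω v u ^ 2 - ∫ ω', H ω' v u ^ 2 ∂P)) P :=
      (h.indep_row v).comp (fun u x => σ * (x ^ 2 - ∫ ω', H ω' v u ^ 2 ∂P))
        (fun u => by fun_prop)
    have hint : Integrable (fun ω => Real.exp (1 / θ *
        ∑ u, σ * (H ω v u ^ 2 - ∫ ω', H ω' v u ^ 2 ∂P))) P := by
      have h1 := h.integrable_exp_row σ 0 (1 / θ) v
      have h2 := h1.mul_const (Real.exp (1 / θ * ∑ u, σ * (0 - ∫ ω', H ω' v u ^ 2 ∂P)))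
      refine h2.congr (ae_of_all _ fun ω => ?_)
      simp only
      rw [← Real.exp_add, ← mul_add, ← Finset.sum_add_distrib]
      congr 2
      exact Finset.sum_congr rfl fun u _ => by ring
    refine (measure_ge_le_exp_mul_mgf (t := 1 / θ) ε (by positivity) hint).trans ?_
    have h3 : mgf (fun ω => ∑ u, σ * (H ω v u ^ 2 - ∫ ω', H ω' v u ^ 2 ∂P)) P (1 / θ) ≤
        Real.exp 1 := by
      have h4 := hind.mgf_sum (t := 1 / θ) hmeas Finset.univ
      have h5 : (∑ u, fun ω => σ * (H ω v u ^ 2 - ∫ ω', H ω' v u ^ 2 ∂P)) =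
          fun ω => ∑ u, σ * (H ω v u ^ 2 - ∫ ω', H ω' v u ^ 2 ∂P) := by
        ext ω; simp
      rw [h5] at h4
      rw [h4]
      calc _ ≤ ∏ u : Fin N, Real.exp (1 / N) :=
            Finset.prod_le_prod (fun _ _ => mgf_nonneg) fun u _ => h.mgf_row_le hθ0 hθ hσ v u
        _ = Real.exp 1 := by
            rw [Finset.prod_const, Finset.card_univ, Fintype.card_fin, ← Real.exp_nat_mul]
            have : (N : ℝ) ≠ 0 := by have := v.pos; positivity
            congr 1; field_simp
    calc _ ≤ Real.exp (-(1 / θ) * ε) * Real.exp 1 :=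
          mul_le_mul_of_nonneg_left h3 (Real.exp_pos _).le
      _ = _ := by rw [← Real.exp_add]; congr 1; ring
  have hsub : {ω | ε ≤ |∑ u, H ω v u ^ 2 - ∑ u, ∫ ω', H ω' v u ^ 2 ∂P|} ⊆
      {ω | ε ≤ ∑ u, (1 : ℝ) * (H ω v u ^ 2 - ∫ ω', H ω' v u ^ 2 ∂P)} ∪
        {ω | ε ≤ ∑ u, (-1 : ℝ) * (H ω v u ^ 2 - ∫ ω', H ω' v u ^ 2 ∂P)} := by
    intro ω hω
    simp only [Set.mem_ofPred_eq, Set.mem_union, one_mul, neg_mul, Finset.sum_neg_distrib,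
      Finset.sum_sub_distrib] at hω ⊢
    exact le_abs.1 hω
  refine (measureReal_mono hsub (measure_ne_top _ _)).trans ((measureReal_union_le _ _).trans ?_)
  linarith [key 1 (by simp), key (-1) (by simp)]

theorem markov_real {f : Ω → ℝ} (hf : ∀ ω, 0 ≤ f ω) (hint : Integrable f P) {c : ℝ} (hc : 0 < c) :
    P.real {ω | c ≤ f ω} ≤ (∫ ω, f ω ∂P) / c := by
  rw [le_div_iff₀ hc, mul_comm]
  exact mul_meas_ge_le_integral_of_nonneg (ae_of_all _ hf) hint c

/-- The row sums of squares are close to one. -/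
def RowsGood (H : Matrix (Fin N) (Fin N) ℝ) (ε : ℝ) : Prop := ∀ v, |∑ u, H v u ^ 2 - 1| ≤ ε

theorem CenteredEnsemble.rows_tail (h : CenteredEnsemble P θ H) (hθ0 : 0 < θ) (hθ : θ ≤ 1)
    {ε : ℝ} (hvar : ∀ v, |∑ u, ∫ ω, H ω v u ^ 2 ∂P - 1| ≤ ε / 2) :
    P.real {ω | ¬ RowsGood (H ω) ε} ≤ 2 * N * Real.exp (1 - ε / (2 * θ)) := by
  have hsub : {ω | ¬ RowsGood (H ω) ε} ⊆
      ⋃ v ∈ (Finset.univ : Finset (Fin N)),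
        {ω | ε / 2 ≤ |∑ u, H ω v u ^ 2 - ∑ u, ∫ ω', H ω' v u ^ 2 ∂P|} := by
    intro ω hω
    simp only [RowsGood, Set.mem_ofPred_eq, not_forall, not_le] at hω
    obtain ⟨v, hv⟩ := hω
    simp only [Finset.mem_univ, Set.iUnion_true, Set.mem_iUnion, Set.mem_ofPred_eq]
    refine ⟨v, ?_⟩
    have h1 := abs_sub_le (∑ u, H ω v u ^ 2) (∑ u, ∫ ω', H ω' v u ^ 2 ∂P) 1
    linarith [hvar v]
  refine (measureReal_mono hsub (measure_ne_top _ _)).trans ((measureReal_biUnion_finset_le _ _).trans ?_)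
  refine (Finset.sum_le_sum fun v _ => h.row_tail hθ0 hθ (ε / 2) v).trans (le_of_eq ?_)
  rw [Finset.sum_const, Finset.card_univ, Fintype.card_fin, nsmul_eq_mul, div_div]; ring

/-- Markov's inequality for the Hilbert–Schmidt sum that a large norm forces to be large; one factor
`N` counts the starting points. -/
theorem CenteredEnsemble.norm_tail [NeZero N] (h : CenteredEnsemble P θ H)
    (hd : ∀ ω i, H ω i i = 0) (hθ0 : 0 < θ) (hθ : θ ≤ 1 / 2) {ε : ℝ} (hε : ε ≤ 1)
    {a : ℝ} (ha : 1 < a) {l : ℕ} (hl1 : 1 ≤ l) (hlN : (2 * l : ℕ) ≤ Real.sqrt N)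
    (hl : 4 * ((1 - (a⁻¹) ^ 2)⁻¹) ^ 2 * l * (ε + 8 * θ) ≤ 1) :
    P.real {ω | RowsGood (H ω) ε ∧ a + a⁻¹ ≤ ‖op (H ω)‖} ≤
      8 * N * Real.sqrt N * (growth N θ (2 * l) / a) ^ (2 * l) := by
  have ha0 : 0 < a := by linarith
  have hint : ∀ x y, Integrable (fun ω => nbSum (H ω) (Pi.single y 1) l x x ^ 2) P := by
    intro x y
    simp only [pow_two]
    exact h.integrable_nbSum_mul _ _ _ _ _ _ _ _
  have hsub : {ω | RowsGood (H ω) ε ∧ a + a⁻¹ ≤ ‖op (H ω)‖} ⊆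
      {ω | a ^ (2 * l) / 4 ≤ ∑ x, ∑ y, nbSum (H ω) (Pi.single y 1) l x x ^ 2} := by
    rintro ω ⟨h1, h2⟩
    have hε0 : 0 ≤ ε := (abs_nonneg _).trans (h1 ⟨0, NeZero.pos N⟩)
    exact pow_le_sum_nbSum_sq (h.symm ω) (hd ω) hθ0.le hθ (h.bound ω) hε0 hε h1 ha hl h2
  refine (measureReal_mono hsub (measure_ne_top _ _)).trans ?_
  refine (markov_real (fun ω => Finset.sum_nonneg fun x _ => Finset.sum_nonneg fun y _ =>
    sq_nonneg _) (integrable_finsetSum _ fun x _ => integrable_finsetSum _ fun y _ => hint x y)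
    (by positivity)).trans ?_
  have h3 : ∫ ω, ∑ x, ∑ y, nbSum (H ω) (Pi.single y 1) l x x ^ 2 ∂P ≤
      N * (2 * Real.sqrt N * growth N θ (2 * l) ^ (2 * l)) := by
    rw [integral_finsetSum _ fun x _ => integrable_finsetSum _ fun y _ => hint x y]
    have : ∀ x : Fin N, ∫ ω, ∑ y, nbSum (H ω) (Pi.single y 1) l x x ^ 2 ∂P ≤
        2 * Real.sqrt N * growth N θ (2 * l) ^ (2 * l) := by
      intro x
      rw [integral_finsetSum _ fun y _ => hint x y]
      exact h.sum_integral_nbSum_sq_le hl1 hlN x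
    refine (Finset.sum_le_sum fun x _ => this x).trans (le_of_eq ?_)
    rw [Finset.sum_const, Finset.card_univ, Fintype.card_fin, nsmul_eq_mul]
  refine (div_le_div_of_nonneg_right h3 (by positivity)).trans (le_of_eq ?_)
  rw [div_pow]; field_simp; ring

end Norm

/-! ### Expectations of low moments -/

section Expectations

variable {Ω : Type*} [MeasurableSpace Ω] {P : Measure Ω} [IsProbabilityMeasure P] {N : ℕ} {θ : ℝ}
  {H : Ω → Matrix (Fin N) (Fin N) ℝ}

theorem eMoment_one_eq (H : Matrix (Fin N) (Fin N) ℝ) :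
    eMoment H 1 = 1 / N * ∑ i, ∑ j, H i j := by
  rw [eMoment_eq_sum]
  congr 1
  rw [← (finTwoArrowEquiv (Fin N)).symm.sum_comp, Fintype.sum_prod_type]
  simp [walkProd]

theorem CenteredEnsemble.integral_eMoment (h : CenteredEnsemble P θ H) (k : ℕ) :
    ∫ ω, eMoment (H ω) k ∂P = 1 / N * ∑ w : Fin (k + 1) → Fin N, ∫ ω, walkProd (H ω) w ∂P := by
  simp only [eMoment_eq_sum]
  rw [integral_const_mul, integral_finsetSum _ fun w _ => h.integrable_walkProd w]

theorem CenteredEnsemble.integral_eMoment_one (h : CenteredEnsemble P θ H) :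
    ∫ ω, eMoment (H ω) 1 ∂P = 0 := by
  rw [h.integral_eMoment]
  simp [walkProd, h.mean]

theorem CenteredEnsemble.integral_walkProd_eq_zero (h : CenteredEnsemble P θ H) {k : ℕ}
    {w : Fin (k + 1) → Fin N} {s : Fin k}
    (hs : ∀ s' ≠ s, edge (w s'.castSucc) (w s'.succ) ≠ edge (w s.castSucc) (w s.succ)) :
    ∫ ω, walkProd (H ω) w ∂P = 0 := by
  simp only [walkProd_eq_monomial (h.symm _)]
  rw [h.integral_monomial]
  refine Finset.prod_eq_zero (Finset.mem_univ (edge (w s.castSucc) (w s.succ))) ?_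
  have : walkMult w (edge (w s.castSucc) (w s.succ)) = 1 := by
    rw [walkMult, Finset.sum_apply, Finset.sum_eq_single s]
    · simp
    · intro s' _ hs'
      exact Pi.single_eq_of_ne (hs s' hs').symm _
    · simp
  rw [this]
  simp [h.mean]

theorem CenteredEnsemble.integral_eMoment_two (h : CenteredEnsemble P θ H) :
    ∫ ω, eMoment (H ω) 2 ∂P = 1 / N * ∑ i, ∑ j, ∫ ω, H ω i j ^ 2 ∂P := by
  rw [h.integral_eMoment]
  congr 1
  rw [← (Fin.consEquiv fun _ : Fin 3 => Fin N).sum_comp, Fintype.sum_prod_type]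
  refine Finset.sum_congr rfl fun i _ => ?_
  rw [← (finTwoArrowEquiv (Fin N)).symm.sum_comp, Fintype.sum_prod_type]
  refine Finset.sum_congr rfl fun j _ => ?_
  rw [Finset.sum_eq_single i]
  · congr 1
    ext ω
    simp [walkProd, Fin.consEquiv, Fin.prod_univ_two, h.symm ω j i, pow_two]
  · intro k _ hk
    refine h.integral_walkProd_eq_zero (s := 0) fun s' hs' => ?_
    have : s' = 1 := by omega
    subst this
    simp only [Fin.consEquiv, Fin.castSucc_zero, Equiv.coe_fn_mk, Fin.cons_zero]
    intro he
    rcases edge_eq_iff.1 he with ⟨h1, h2⟩ | ⟨h1, h2⟩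
    · simp at h1 h2
      exact hk (h2.trans h1)
    · simp at h1 h2
      exact hk h2
  · simp

/-- Three steps cannot be paired, so a walk contributes only if it uses one edge three times, that
is if it has the form `i, j, i, j`. There are `N ^ 2` such walks, each with mean at most `θ / N`. -/
theorem CenteredEnsemble.abs_integral_eMoment_three_le (h : CenteredEnsemble P θ H) (hN : 0 < N) :
    |∫ ω, eMoment (H ω) 3 ∂P| ≤ θ := by
  have hθ := h.theta_nonneg hN
  rw [h.integral_eMoment, abs_mul, abs_of_nonneg (by positivity : (0 : ℝ) ≤ 1 / N)]
  have hw : ∀ i j k l : Fin N, |∫ ω, walkProd (H ω) (![i, j, k, l] : Fin (3 + 1) → Fin N) ∂P| ≤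
      if k = i ∧ l = j then θ / N else 0 := by
    intro i j k l
    split_ifs with hkl
    · obtain ⟨rfl, rfl⟩ := hkl
      have h1 : ∀ ω, walkProd (H ω) (![k, l, k, l] : Fin (3 + 1) → Fin N) = H ω k l ^ 3 := by
        intro ω
        simp [walkProd, Fin.prod_univ_three, h.symm ω l k]; ring
      simp only [h1]
      simpa using h.abs_integral_pow_le k l 1
    · by_cases h1 : edge i j = edge j k
      · by_cases h2 : edge j k = edge k l
        · exfalso
          rw [edge_eq_iff] at h1 h2
          grind
        · rw [h.integral_walkProd_eq_zero (s := 2), abs_zero]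
          intro s hs
          fin_cases s
          · simpa [h1] using h2
          · simpa using h2
          · simp at hs
      · by_cases h2 : edge j k = edge k l
        · rw [h.integral_walkProd_eq_zero (s := 0), abs_zero]
          intro s hs
          fin_cases s
          · simp at hs
          · simpa using Ne.symm h1
          · simpa [← h2] using Ne.symm h1
        · rw [h.integral_walkProd_eq_zero (s := 1), abs_zero]
          intro s hs
          fin_cases s
          · simpa using h1
          · simp at hs
          · simpa using Ne.symm h2
  have hsum : |∑ w : Fin (3 + 1) → Fin N, ∫ ω, walkProd (H ω) w ∂P| ≤ N * θ := by
    have e : ∑ w : Fin (3 + 1) → Fin N, ∫ ω, walkProd (H ω) w ∂P =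
        ∑ i, ∑ j, ∑ k, ∑ l, ∫ ω, walkProd (H ω) (![i, j, k, l] : Fin (3 + 1) → Fin N) ∂P := by
      rw [← (Fin.consEquiv fun _ : Fin 4 => Fin N).sum_comp, Fintype.sum_prod_type]
      refine Finset.sum_congr rfl fun i _ => ?_
      rw [← (Fin.consEquiv fun _ : Fin 3 => Fin N).sum_comp, Fintype.sum_prod_type]
      refine Finset.sum_congr rfl fun j _ => ?_
      rw [← (finTwoArrowEquiv (Fin N)).symm.sum_comp, Fintype.sum_prod_type]
      rfl
    rw [e]
    have e2 : ∀ i j : Fin N, |∑ k, ∑ l, ∫ ω, walkProd (H ω)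
        (![i, j, k, l] : Fin (3 + 1) → Fin N) ∂P| ≤ θ / N := by
      intro i j
      refine (Finset.abs_sum_le_sum_abs _ _).trans ?_
      refine (Finset.sum_le_sum fun k _ => (Finset.abs_sum_le_sum_abs _ _).trans
        (Finset.sum_le_sum fun l _ => hw i j k l)).trans (le_of_eq ?_)
      rw [Finset.sum_eq_single i]
      · rw [Finset.sum_eq_single j] <;> simp +contextual
      · intro k _ hk; simp [hk]
      · simp
    refine (Finset.abs_sum_le_sum_abs _ _).trans ((Finset.sum_le_sum fun i _ =>
      (Finset.abs_sum_le_sum_abs _ _).trans (Finset.sum_le_sum fun j _ => e2 i j)).trans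
        (le_of_eq ?_))
    have : (N : ℝ) ≠ 0 := by positivity
    simp only [Finset.sum_const, Finset.card_univ, Fintype.card_fin, nsmul_eq_mul]
    field_simp
  calc 1 / (N : ℝ) * |∑ w : Fin (3 + 1) → Fin N, ∫ ω, walkProd (H ω) w ∂P|
      ≤ 1 / N * (N * θ) := mul_le_mul_of_nonneg_left hsum (by positivity)
    _ = θ := by
      have : (N : ℝ) ≠ 0 := by positivity
      field_simp

end Expectations


/-! ### The asymptotic regime -/

/-- Pairs `(N, L)` with `N → ∞`, `L / log N → ∞` and `log N / log L → ∞`. -/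
noncomputable def regime : Filter (ℕ × ℝ) :=
  comap (fun x => (x.1 : ℝ)) atTop ⊓ comap (fun x => x.2 / Real.log x.1) atTop ⊓
    comap (fun x => Real.log x.1 / Real.log x.2) atTop ⊓ comap (fun x => x.2) atTop

theorem tendsto_regime_fst : Tendsto (fun x : ℕ × ℝ => (x.1 : ℝ)) regime atTop :=
  tendsto_comap.mono_left (inf_le_left.trans (inf_le_left.trans inf_le_left))

theorem tendsto_regime_snd : Tendsto (fun x : ℕ × ℝ => x.2) regime atTop :=
  tendsto_comap.mono_left inf_le_right

theorem regime_le (M : ℝ) : ∀ᶠ x in regime, M ≤ x.2 := tendsto_regime_snd.eventually_ge_atTop M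

theorem regime_le_fst (M : ℝ) : ∀ᶠ x in regime, M ≤ (x.1 : ℝ) :=
  tendsto_regime_fst.eventually_ge_atTop M

theorem regime_one_le_log : ∀ᶠ x in regime, 1 ≤ Real.log x.1 :=
  (Real.tendsto_log_atTop.comp tendsto_regime_fst).eventually_ge_atTop 1

theorem regime_log_le (M : ℝ) : ∀ᶠ x in regime, M * Real.log x.1 ≤ x.2 := by
  have h : Tendsto (fun x : ℕ × ℝ => x.2 / Real.log x.1) regime atTop :=
    tendsto_comap.mono_left (inf_le_left.trans (inf_le_left.trans inf_le_right))
  filter_upwards [h.eventually_ge_atTop M, regime_one_le_log] with x h1 h2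
  exact (le_div_iff₀ (by linarith)).1 h1

theorem regime_log_log_le (M : ℝ) : ∀ᶠ x in regime, M * Real.log x.2 ≤ Real.log x.1 := by
  have h : Tendsto (fun x : ℕ × ℝ => Real.log x.1 / Real.log x.2) regime atTop :=
    tendsto_comap.mono_left (inf_le_left.trans inf_le_right)
  filter_upwards [h.eventually_ge_atTop M, regime_le 3] with x h1 h2
  exact (le_div_iff₀ (Real.log_pos (by linarith))).1 h1

theorem regime_pow_le (c : ℕ) : ∀ᶠ x in regime, x.2 ^ c ≤ (x.1 : ℝ) := by
  filter_upwards [regime_log_log_le c, regime_le 1, regime_le_fst 1] with x h1 h2 h3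
  rw [← Real.log_le_log_iff (by positivity) (by linarith), Real.log_pow]
  exact h1

/-- Powers of `N` are negligible against `exp L`. -/
theorem regime_rpow_mul_exp_le (c : ℝ) {a b : ℝ} (hab : a < b) :
    ∀ᶠ x in regime, (x.1 : ℝ) ^ c * Real.exp (-b * x.2) ≤ Real.exp (-a * x.2) := by
  have hba : 0 < b - a := by linarith
  filter_upwards [regime_log_le (c / (b - a)), regime_le_fst 1] with x h1 h2
  rw [Real.rpow_def_of_pos (by linarith), ← Real.exp_add]
  refine Real.exp_le_exp.2 ?_
  rw [div_mul_eq_mul_div, div_le_iff₀ hba] at h1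
  linarith

theorem regime_const_mul_exp_le (C : ℝ) {a b : ℝ} (hab : a < b) :
    ∀ᶠ x in regime, C * Real.exp (-b * x.2) ≤ Real.exp (-a * x.2) := by
  filter_upwards [regime_rpow_mul_exp_le 1 hab, regime_le_fst C] with x h1 h2
  rw [Real.rpow_one] at h1
  exact (mul_le_mul_of_nonneg_right h2 (Real.exp_pos _).le).trans h1

/-- The lower bound on `ξ` gives `L / log N ≥ (log N) ^ a₀`. The upper bound gives `log L = ξ log
log N ≤ A₀ (log log N) ^ 2`, which is negligible against `log N`. -/
theorem tendsto_of_xiBounds {a₀ A₀ : ℝ} (ha₀ : 0 < a₀) (hA₀ : 10 ≤ A₀) :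
    Tendsto (fun x : ℕ × ℝ => (x.1, Real.log x.1 ^ x.2))
      (comap Prod.fst atTop ⊓ 𝓟 {x : ℕ × ℝ | XiBounds a₀ A₀ x.1 x.2}) regime := by
  set F : Filter (ℕ × ℝ) := comap Prod.fst atTop ⊓ 𝓟 {x : ℕ × ℝ | XiBounds a₀ A₀ x.1 x.2} with hF
  have hN : Tendsto (fun x : ℕ × ℝ => (x.1 : ℝ)) F atTop :=
    tendsto_natCast_atTop_atTop.comp (tendsto_comap.mono_left inf_le_left)
  have hl : Tendsto (fun x : ℕ × ℝ => Real.log x.1) F atTop := Real.tendsto_log_atTop.comp hN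
  have hll : Tendsto (fun x : ℕ × ℝ => Real.log (Real.log x.1)) F atTop :=
    Real.tendsto_log_atTop.comp hl
  have hxi : ∀ᶠ x in F, XiBounds a₀ A₀ x.1 x.2 := mem_inf_of_right (mem_principal_self _)
  have h1 : ∀ᶠ x : ℕ × ℝ in F, Real.log x.1 ^ (1 + a₀) ≤ Real.log x.1 ^ x.2 := by
    filter_upwards [hl.eventually_ge_atTop 1, hxi] with x h h'
    exact Real.rpow_le_rpow_of_exponent_le h h'.1
  have h2 : Tendsto (fun x : ℕ × ℝ => Real.log x.1 ^ x.2 / Real.log x.1) F atTop := by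
    refine tendsto_atTop_mono' F ?_ ((tendsto_rpow_atTop ha₀).comp hl)
    filter_upwards [h1, hl.eventually_ge_atTop 1] with x h h'
    rw [le_div_iff₀ (by linarith)]
    refine le_trans (le_of_eq ?_) h
    rw [Real.rpow_add (by linarith), Real.rpow_one, mul_comm]; rfl
  have h3 : Tendsto (fun x : ℕ × ℝ => Real.log x.1 ^ x.2) F atTop := by
    refine tendsto_atTop_mono' F ?_ hl
    filter_upwards [h2.eventually_ge_atTop 1, hl.eventually_ge_atTop 1] with x h h'
    rwa [le_div_iff₀ (by linarith), one_mul] at h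
  have h4 : Tendsto (fun x : ℕ × ℝ => Real.log x.1 / Real.log (Real.log x.1 ^ x.2)) F atTop := by
    have hq : Tendsto (fun y : ℝ => y / Real.log y ^ 2) atTop atTop := by
      have h0 := (Real.isLittleO_pow_log_id_atTop (n := 2)).tendsto_div_nhds_zero
      have h0' : Tendsto (fun y : ℝ => Real.log y ^ 2 / y) atTop (𝓝[>] 0) := by
        rw [tendsto_nhdsWithin_iff]
        refine ⟨h0, ?_⟩
        filter_upwards [eventually_gt_atTop 3] with y hy
        have := Real.log_pos (show 1 < y by linarith)
        have hy0 : 0 < y := by linarith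
        exact Set.mem_Ioi.2 (by positivity)
      refine (tendsto_inv_nhdsGT_zero.comp h0').congr fun y => ?_
      simp
    have h5 : Tendsto (fun x : ℕ × ℝ => Real.log x.1 / Real.log (Real.log x.1) ^ 2 / A₀) F atTop :=
      (hq.comp hl).atTop_div_const (by linarith)
    refine tendsto_atTop_mono' F ?_ h5
    filter_upwards [hl.eventually_ge_atTop 3, hll.eventually_ge_atTop 1, hxi] with x h h' h''
    rw [Real.log_rpow (by linarith), div_div]
    have hx0 : 0 < x.2 := by linarith [h''.1]
    refine div_le_div_of_nonneg_left (by linarith) (by positivity) ?_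
    calc x.2 * Real.log (Real.log x.1) ≤ (A₀ * Real.log (Real.log x.1)) * Real.log (Real.log x.1) :=
          mul_le_mul_of_nonneg_right h''.2 (by linarith)
      _ = _ := by ring
  simp only [regime, tendsto_inf, tendsto_comap_iff]
  exact ⟨⟨⟨hN, h2⟩, h4⟩, h3⟩

/-- Eventual statements in the regime hold for all large `N`, uniformly in the exponent. -/
theorem exists_of_regime {a₀ A₀ : ℝ} (ha₀ : 0 < a₀) (hA₀ : 10 ≤ A₀) {p : ℕ × ℝ → Prop}
    (h : ∀ᶠ x in regime, p x) :
    ∃ N₀ : ℕ, ∀ N ≥ N₀, ∀ ξ, XiBounds a₀ A₀ N ξ → p (N, Real.log N ^ ξ) := by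
  have h1 := (tendsto_of_xiBounds ha₀ hA₀).eventually h
  rw [eventually_inf_principal, eventually_comap] at h1
  obtain ⟨N₀, hN₀⟩ := eventually_atTop.1 h1
  exact ⟨N₀, fun N hN ξ hξ => hN₀ N hN (N, ξ) rfl hξ⟩

/-! ### Tail bounds in the regime -/

universe u

/-- Markov's inequality for the `n`-th power. The threshold is three times the `n`-th root of the
moment bound, and `3 > exp 1`. -/
theorem CenteredEnsemble.eMoment_tail {Ω : Type*} [MeasurableSpace Ω] {P : Measure Ω}
    [IsProbabilityMeasure P] {N : ℕ} {θ : ℝ} {H : Ω → Matrix (Fin N) (Fin N) ℝ}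
    (h : CenteredEnsemble P θ H) (hθ : θ ≤ 1) {n k : ℕ} (hn : Even n) (hn0 : n ≠ 0) (hk : 1 ≤ k)
    (hN : 0 < N) (hM : (n * (k + 1) : ℕ) ≤ Real.sqrt N) :
    P.real {ω | 6 * 4 ^ (k + 1) * ((n * (k + 1) : ℕ) : ℝ) ^ k / Real.sqrt N ≤
      |eMoment (H ω) k - ∫ ω', eMoment (H ω') k ∂P|} ≤ Real.exp (-n) := by
  obtain ⟨hint, hle⟩ := h.abs_integral_eMoment_sub_pow_le hθ (n := n) hk hN hM
  set Y : Ω → ℝ := fun ω => eMoment (H ω) k - ∫ ω', eMoment (H ω') k ∂P with hY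
  have hs : 0 < Real.sqrt N := Real.sqrt_pos.2 (by exact_mod_cast hN)
  have hM0 : (0 : ℝ) < (n * (k + 1) : ℕ) := by
    have : 0 < n * (k + 1) := Nat.mul_pos (Nat.pos_of_ne_zero hn0) (by omega)
    exact_mod_cast this
  set R : ℝ := 2 * 4 ^ (k + 1) * ((n * (k + 1) : ℕ) : ℝ) ^ k / Real.sqrt N with hR
  have hR0 : 0 < R := by positivity
  have hbound : ∫ ω, Y ω ^ n ∂P ≤ R ^ n := by
    refine (le_abs_self _).trans (hle.trans (le_of_eq ?_))
    rw [hR, div_pow, mul_pow, mul_pow, ← pow_mul, ← pow_mul, mul_comm (k + 1) n, mul_comm k n]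
  have hsub : {ω | 6 * 4 ^ (k + 1) * ((n * (k + 1) : ℕ) : ℝ) ^ k / Real.sqrt N ≤ |Y ω|} ⊆
      {ω | (3 * R) ^ n ≤ Y ω ^ n} := by
    intro ω hω
    simp only [Set.mem_ofPred_eq] at hω ⊢
    rw [← hn.pow_abs (Y ω)]
    refine pow_le_pow_left₀ (by positivity) (le_trans (le_of_eq ?_) hω) n
    rw [hR]; ring
  refine (measureReal_mono hsub (measure_ne_top _ _)).trans ?_
  refine (markov_real (fun ω => hn.pow_nonneg _) hint (by positivity)).trans ?_
  rw [div_le_iff₀ (by positivity), mul_pow]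
  refine hbound.trans ?_
  have h3 : Real.exp (-n) * 3 ^ n ≥ 1 := by
    have : Real.exp (-n) = (Real.exp 1)⁻¹ ^ n := by
      rw [← Real.exp_neg, ← Real.exp_nat_mul]; simp
    rw [this, ← mul_pow]
    refine one_le_pow₀ ?_
    rw [inv_mul_eq_div, le_div_iff₀ (Real.exp_pos 1), one_mul]
    linarith [Real.exp_one_lt_d9]
  have hRn : 0 < R ^ n := by positivity
  nlinarith

-- The number `a = 1 + min η 1` satisfies `a + a⁻¹ ≤ 2 + η`. For walks of length `l` of order `L`,
-- both `l ^ 2 θ` and `l ^ 2 / √N` are `O(1 / L)`, so the growth rate falls below `√a` and the bound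
-- of `CenteredEnsemble.norm_tail` is at most `8 N ^ (3 / 2) a ^ (-l)`. The constant `κ` is chosen
-- so that `a ^ (-l) ≤ exp (-3 L)`, which beats the power of `N`.
set_option maxHeartbeats 1000000 in
theorem eventually_norm_tail {C η : ℝ} (hC : 0 < C) (hη : 0 < η) :
    ∀ᶠ x in regime, ∀ (Ω : Type u) [MeasurableSpace Ω] (P : Measure Ω) [IsProbabilityMeasure P]
      (θ : ℝ) (H : Ω → Matrix (Fin x.1) (Fin x.1) ℝ), CenteredEnsemble P θ H →
      (∀ ω i, H ω i i = 0) → 0 < θ → θ * x.2 ^ 3 ≤ C → x.2 ^ 3 ≤ C * Real.sqrt x.1 →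
      (∀ v, |∑ u, ∫ ω, H ω v u ^ 2 ∂P - 1| ≤ 2 / x.1) →
      P.real {ω | 2 + η ≤ ‖op (H ω)‖} ≤ Real.exp (-x.2) ∧
      P.real {ω | ¬ RowsGood (H ω) (1 / (x.2 * Real.sqrt x.2))} ≤ Real.exp (-x.2) := by
  set a : ℝ := 1 + min η 1 with ha
  have hm0 : 0 < min η 1 := lt_min hη one_pos
  have hm1 : min η 1 ≤ 1 := min_le_right _ _
  have ha1 : 1 < a := by linarith
  have haη : a + a⁻¹ ≤ 2 + η := by
    have : a + a⁻¹ - 2 = (min η 1) ^ 2 / a := by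
      rw [ha]; field_simp; ring
    have h2 : (min η 1) ^ 2 / a ≤ (min η 1) ^ 2 := div_le_self (sq_nonneg _) ha1.le
    have h3 : (min η 1) ^ 2 ≤ min η 1 := by nlinarith
    linarith [min_le_left η 1]
  set G : ℝ := (1 - (a⁻¹) ^ 2)⁻¹ with hG
  have hla : 0 < Real.log a := Real.log_pos ha1
  set κ : ℝ := 3 / Real.log a + 1 with hκ
  have hκ1 : 1 ≤ κ := by have : 0 < 3 / Real.log a := by positivity
                         linarith
  have hb : 0 < Real.sqrt a - 1 := by
    have : 1 < Real.sqrt a := by rw [Real.lt_sqrt (by norm_num)]; simpa using ha1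
    linarith
  filter_upwards [regime_le 4, regime_le (64 * κ * (1 + G) ^ 4 * (1 + 8 * C) ^ 2 * κ + 1), regime_le (16 * κ * C),
    regime_le ((64 * κ ^ 2 * C + 160 * κ ^ 2 * C) / (Real.sqrt a - 1)), regime_le (2 * C),
    regime_le (256 * C ^ 2), regime_pow_le 4,
    regime_rpow_mul_exp_le 2 (show (2 : ℝ) < 3 by norm_num), regime_le_fst 64,
    regime_const_mul_exp_le (2 * Real.exp 1) (show (1 : ℝ) < 2 by norm_num),
    regime_rpow_mul_exp_le 1 (show (3 : ℝ) < 4 by norm_num),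
    regime_const_mul_exp_le (2 * Real.exp 1) (show (2 : ℝ) < 3 by norm_num),
    regime_const_mul_exp_le 2 (show (1 : ℝ) < 2 by norm_num)]
    with x hL4 hL1 hL2 hL3 hL5 hL6 hLN hexp hN64 hexp2 hexp3 hexp4 hexp5
  intro Ω _ P _ θ H h hd hθ0 hθC hLC hvar
  obtain ⟨N, L⟩ := x
  simp only at *
  have hL0 : 0 < L := by linarith
  have hN0 : (0 : ℝ) < N := by linarith
  have : NeZero N := ⟨by rintro rfl; simp at hN0⟩
  set s := Real.sqrt L with hs
  have hs2 : s ^ 2 = L := Real.sq_sqrt hL0.le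
  have hs0 : 0 < s := Real.sqrt_pos.2 hL0
  have hs1 : 2 ≤ s := Real.le_sqrt_of_sq_le (by linarith only [hL4])
  set r := Real.sqrt N with hr
  have hr0 : 0 < r := Real.sqrt_pos.2 hN0
  have hr2 : r ^ 2 = N := Real.sq_sqrt hN0.le
  have hθL : θ ≤ C / L ^ 3 := by rwa [le_div_iff₀ (by positivity)]
  have hrL : L ^ 3 / C ≤ r := by rw [div_le_iff₀ hC]; linarith
  -- The precision `L ^ (-3 / 2)` lies between two requirements: the comparison with Chebyshev
  -- polynomials over `l` steps needs `L * ε` small, and the concentration of the rows needs `ε / θ`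
  -- much larger than `L`, where `θ = O(L ^ (-3))`.
  set ε := 1 / (L * s) with hε
  have hε1 : ε ≤ 1 := by rw [hε, div_le_one (by positivity)]; nlinarith only [hs1, hL4]
  set l := ⌈κ * L⌉₊ with hl
  have hlow : κ * L ≤ l := Nat.le_ceil _
  have hup : (l : ℝ) ≤ 2 * κ * L := by
    have := (Nat.ceil_lt_add_one (by positivity : 0 ≤ κ * L)).le
    nlinarith only [this, hκ1, hL4]
  have hl1 : 1 ≤ l := by
    have : (1 : ℝ) ≤ l := by nlinarith only [hlow, hκ1, hL4]
    exact_mod_cast this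
  have hL2' : θ * L ≤ C / L ^ 2 := by
    calc θ * L ≤ C / L ^ 3 * L := by gcongr
      _ = _ := by field_simp
  -- the length of the walks
  have c1 : ((2 * l : ℕ) : ℝ) ≤ r := by
    push_cast
    refine le_trans ?_ hrL
    rw [le_div_iff₀ hC]
    have : L * L ≤ L ^ 3 := by
      rw [← pow_two]; exact pow_le_pow_right₀ (by linarith only [hL4]) (by norm_num)
    calc 2 * (l : ℝ) * C ≤ 2 * (2 * κ * L) * C := by gcongr
      _ = (4 * κ * C) * L := by ring
      _ ≤ L * L := by
        refine mul_le_mul_of_nonneg_right ?_ hL0.le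
        have := mul_pos (lt_of_lt_of_le one_pos hκ1) hC
        linarith only [this, hL2]
      _ ≤ _ := this
  have c2 : 4 * G ^ 2 * l * (ε + 8 * θ) ≤ 1 := by
    have hG0 : 0 ≤ G ^ 2 := sq_nonneg G
    have e1 : L * (ε + 8 * θ) ≤ (1 + 8 * C) / s := by
      have : L * ε = 1 / s := by rw [hε]; field_simp
      have h2 : C / L ^ 2 ≤ C / s := by
        refine div_le_div_of_nonneg_left hC.le hs0 ?_
        nlinarith only [hs1, hs2, hL4]
      rw [mul_add, this, add_div]
      have : 8 * C / s = 8 * (C / s) := by ring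
      linarith
    have e2 : 8 * G ^ 2 * κ * (1 + 8 * C) ≤ s := by
      refine le_of_sq_le_sq ?_ hs0.le
      rw [hs2]
      have hG0' : 0 ≤ G := by
        rw [hG]
        have : a⁻¹ < 1 := inv_lt_one_of_one_lt₀ ha1
        have : 0 < a⁻¹ := by positivity
        exact inv_nonneg.2 (by nlinarith only [this, ‹a⁻¹ < 1›])
      have : G ^ 4 ≤ (1 + G) ^ 4 := pow_le_pow_left₀ hG0' (by linarith) 4
      calc (8 * G ^ 2 * κ * (1 + 8 * C)) ^ 2 = 64 * κ * G ^ 4 * (1 + 8 * C) ^ 2 * κ := by ring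
        _ ≤ 64 * κ * (1 + G) ^ 4 * (1 + 8 * C) ^ 2 * κ := by gcongr
        _ ≤ L := by linarith only [hL1]
    have hεθ : 0 ≤ ε + 8 * θ := by positivity
    calc 4 * G ^ 2 * l * (ε + 8 * θ) ≤ 4 * G ^ 2 * (2 * κ * L) * (ε + 8 * θ) := by gcongr
      _ = 8 * G ^ 2 * κ * (L * (ε + 8 * θ)) := by ring
      _ ≤ 8 * G ^ 2 * κ * ((1 + 8 * C) / s) := by gcongr
      _ = 8 * G ^ 2 * κ * (1 + 8 * C) / s := by ring
      _ ≤ 1 := (div_le_one hs0).2 e2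
  have hθ12 : θ ≤ 1 / 2 := by
    refine hθL.trans ?_
    rw [div_le_iff₀ (by positivity)]
    have : L ≤ L ^ 3 := le_self_pow₀ (by linarith only [hL4]) (by norm_num)
    linarith only [this, hL5]
  -- growth rate
  have c3 : growth N θ (2 * l) ≤ Real.sqrt a := by
    rw [growth, ← hr]
    push_cast
    have e1 : 4 * (2 * (l : ℝ)) ^ 2 * θ ≤ 64 * κ ^ 2 * C / L := by
      calc 4 * (2 * (l : ℝ)) ^ 2 * θ ≤ 4 * (2 * (2 * κ * L)) ^ 2 * (C / L ^ 3) := by gcongr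
        _ = _ := by field_simp; ring
    have e2 : 10 * (2 * (l : ℝ)) ^ 2 / r ≤ 160 * κ ^ 2 * C / L := by
      calc 10 * (2 * (l : ℝ)) ^ 2 / r ≤ 10 * (2 * (2 * κ * L)) ^ 2 / (L ^ 3 / C) := by gcongr
        _ = _ := by field_simp; ring
    have e3 : (64 * κ ^ 2 * C + 160 * κ ^ 2 * C) / L ≤ Real.sqrt a - 1 := by
      rw [div_le_iff₀ hL0]; rw [div_le_iff₀ hb] at hL3; linarith only [hL3]
    rw [add_div] at e3
    linarith only [e1, e2, e3]
  have c4 : 8 * N * r * (growth N θ (2 * l) / a) ^ (2 * l) ≤ Real.exp (-2 * L) := by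
    have ha0 : 0 < a := by linarith
    have hg := one_le_growth (N := N) hθ0.le (2 * l)
    have e1 : (growth N θ (2 * l) / a) ^ (2 * l) ≤ Real.exp (-3 * L) := by
      have e2 : growth N θ (2 * l) / a ≤ (Real.sqrt a)⁻¹ := by
        rw [div_le_iff₀ ha0, inv_mul_eq_div, Real.div_sqrt]
        exact c3
      calc (growth N θ (2 * l) / a) ^ (2 * l) ≤ ((Real.sqrt a)⁻¹) ^ (2 * l) := by
            gcongr
        _ = Real.exp (-(Real.log a * l)) := by
            rw [pow_mul, inv_pow, Real.sq_sqrt ha0.le, inv_pow, Real.exp_neg, mul_comm,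
              Real.exp_nat_mul, Real.exp_log ha0]
        _ ≤ Real.exp (-3 * L) := by
            refine Real.exp_le_exp.2 ?_
            have : 3 * L ≤ Real.log a * l := by
              calc 3 * L = Real.log a * (3 / Real.log a * L) := by field_simp
                _ ≤ Real.log a * (κ * L) := by
                  gcongr; linarith only [hκ]
                _ ≤ _ := by gcongr
            linarith only [this]
    have e3 : 8 * (N : ℝ) * r ≤ (N : ℝ) ^ (2 : ℝ) := by
      rw [Real.rpow_two, pow_two]
      have : 8 * r ≤ N := by
        have h8 : 8 ≤ r := Real.le_sqrt_of_sq_le (by linarith only [hN64])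
        rw [← hr2]; nlinarith only [h8, hr0]
      nlinarith only [this, hN0]
    calc _ ≤ (N : ℝ) ^ (2 : ℝ) * Real.exp (-3 * L) := by gcongr
      _ ≤ _ := hexp
  have hNε : 2 / (N : ℝ) ≤ ε / 2 := by
    rw [hε, div_div, div_le_div_iff₀ hN0 (by positivity)]
    have h1 : s ≤ L := by nlinarith only [hs1, hs2]
    have h2 : L * s ≤ L * L := mul_le_mul_of_nonneg_left h1 hL0.le
    have h16 : 16 * (L * L) ≤ L ^ 4 := by
      have : 16 ≤ L * L := by nlinarith only [hL4]
      nlinarith only [this]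
    nlinarith only [h2, h16, hLN]
  have c5 := h.rows_tail hθ0 (by linarith) (ε := ε) fun v => (hvar v).trans hNε
  have c6 : 2 * N * Real.exp (1 - ε / (2 * θ)) ≤ Real.exp (-2 * L) := by
    have e1 : 4 * L ≤ ε / (2 * θ) := by
      rw [le_div_iff₀ (by positivity), hε, le_div_iff₀ (by positivity)]
      have : θ * L * L * s ≤ 1 / 8 := by
        have e2 : θ * L * L * s ≤ C / s := by
          calc θ * L * L * s = (θ * L ^ 3) * s / L := by field_simp
            _ ≤ C * s / L := by gcongr
            _ = C / s := by rw [← hs2]; field_simp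
        have e3 : 8 * C ≤ s := by
          refine le_of_sq_le_sq ?_ hs0.le
          rw [hs2]
          nlinarith only [hL6, hC]
        refine e2.trans ?_
        rw [div_le_iff₀ hs0]; linarith only [e3]
      linarith only [this]
    calc 2 * N * Real.exp (1 - ε / (2 * θ)) ≤ 2 * N * Real.exp (1 + -4 * L) := by
          gcongr; linarith
      _ = 2 * Real.exp 1 * ((N : ℝ) ^ (1 : ℝ) * Real.exp (-4 * L)) := by
          rw [Real.exp_add, Real.rpow_one]; ring
      _ ≤ 2 * Real.exp 1 * Real.exp (-3 * L) := by gcongr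
      _ ≤ _ := hexp4
  have c7 : Real.exp (-2 * L) ≤ Real.exp (-L) := Real.exp_le_exp.2 (by linarith)
  refine ⟨?_, c5.trans (c6.trans c7)⟩
  have c8 := h.norm_tail hd hθ0 hθ12 hε1 ha1 hl1 c1 c2
  have hsub : {ω | 2 + η ≤ ‖op (H ω)‖} ⊆ {ω | RowsGood (H ω) ε ∧ a + a⁻¹ ≤ ‖op (H ω)‖} ∪
      {ω | ¬ RowsGood (H ω) ε} := by
    intro ω hω
    simp only [Set.mem_ofPred_eq, Set.mem_union] at hω ⊢
    by_cases hg : RowsGood (H ω) ε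
    · exact Or.inl ⟨hg, haη.trans hω⟩
    · exact Or.inr hg
  refine (measureReal_mono hsub (measure_ne_top _ _)).trans ((measureReal_union_le _ _).trans ?_)
  rw [neg_one_mul] at hexp5
  linarith


/-! ### Truncation -/

/-- The value `x` if `|x| ≤ θ`, and `0` otherwise. -/
noncomputable def truncate (θ x : ℝ) : ℝ := if |x| ≤ θ then x else 0

theorem measurable_truncate (θ : ℝ) : Measurable (truncate θ) :=
  Measurable.ite (measurableSet_le (by fun_prop) measurable_const) measurable_id measurable_const

theorem abs_truncate_le {θ : ℝ} (hθ : 0 ≤ θ) (x : ℝ) : |truncate θ x| ≤ θ := by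
  unfold truncate; split_ifs with h
  · exact h
  · simpa using hθ

theorem sq_eq_truncate (θ x : ℝ) : x ^ 2 = truncate θ x ^ 2 + (x - truncate θ x) ^ 2 := by
  unfold truncate; split_ifs <;> ring

theorem abs_sub_truncate_pow_le {θ : ℝ} (hθ : 0 < θ) {p j : ℕ} (hj : 1 ≤ j) (hjp : j ≤ p) (x : ℝ) :
    |x - truncate θ x| ^ j ≤ |x| ^ p / θ ^ (p - j) := by
  unfold truncate; split_ifs with h
  · rw [sub_self, abs_zero, zero_pow (by omega)]; positivity
  · rw [sub_zero, le_div_iff₀ (by positivity)]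
    calc |x| ^ j * θ ^ (p - j) ≤ |x| ^ j * |x| ^ (p - j) := by gcongr; exact (not_le.1 h).le
      _ = |x| ^ p := by rw [← pow_add]; congr 1; omega

/-! ### Truncation of a single random variable. -/

section Entry

variable {Ω : Type*} [MeasurableSpace Ω] {P : Measure Ω} [IsProbabilityMeasure P] {X : Ω → ℝ}
  {θ B : ℝ}

theorem integral_sub_truncate_pow_le (hX : Measurable X) (hθ : 0 < θ) {p j : ℕ}
    (hj : 1 ≤ j) (hjp : j ≤ p) (hint : Integrable (fun ω => |X ω| ^ p) P)
    (hB : ∫ ω, |X ω| ^ p ∂P ≤ B) :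
    Integrable (fun ω => |X ω - truncate θ (X ω)| ^ j) P ∧
      ∫ ω, |X ω - truncate θ (X ω)| ^ j ∂P ≤ B / θ ^ (p - j) := by
  have hm : Measurable fun ω => |X ω - truncate θ (X ω)| ^ j := by
    have := (measurable_truncate θ).comp hX
    exact ((hX.sub this).abs).pow_const j
  have h1 : Integrable (fun ω => |X ω - truncate θ (X ω)| ^ j) P := by
    refine (hint.div_const (θ ^ (p - j))).mono' hm.aestronglyMeasurable (ae_of_all _ fun ω => ?_)
    rw [Real.norm_eq_abs, abs_of_nonneg (by positivity)]
    exact abs_sub_truncate_pow_le hθ hj hjp _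
  refine ⟨h1, ?_⟩
  calc ∫ ω, |X ω - truncate θ (X ω)| ^ j ∂P ≤ ∫ ω, |X ω| ^ p / θ ^ (p - j) ∂P :=
        integral_mono h1 (hint.div_const _) fun ω => abs_sub_truncate_pow_le hθ hj hjp _
    _ = (∫ ω, |X ω| ^ p ∂P) / θ ^ (p - j) := integral_div _ _
    _ ≤ _ := by gcongr

theorem measure_lt_abs_le (hθ : 0 < θ) {p : ℕ} (hint : Integrable (fun ω => |X ω| ^ p) P)
    (hB : ∫ ω, |X ω| ^ p ∂P ≤ B) : P.real {ω | θ < |X ω|} ≤ B / θ ^ p := by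
  have hsub : {ω | θ < |X ω|} ⊆ {ω | θ ^ p ≤ |X ω| ^ p} := fun ω hω =>
    pow_le_pow_left₀ hθ.le (le_of_lt hω) p
  refine (measureReal_mono hsub (measure_ne_top _ _)).trans ?_
  refine (markov_real (fun ω => by positivity) hint (by positivity)).trans ?_
  gcongr

/-- The centred truncation of a random variable. -/
noncomputable def centredTruncation (P : Measure Ω) (θ : ℝ) (X : Ω → ℝ) (ω : Ω) : ℝ :=
  truncate θ (X ω) - ∫ ω', truncate θ (X ω') ∂P

theorem integrable_truncate (hX : Measurable X) (hθ : 0 ≤ θ) :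
    Integrable (fun ω => truncate θ (X ω)) P :=
  Integrable.of_bound ((measurable_truncate θ).comp hX).aestronglyMeasurable θ
    (ae_of_all _ fun ω => abs_truncate_le hθ _)

theorem abs_centredTruncation_le (hθ : 0 ≤ θ) (ω : Ω) :
    |centredTruncation P θ X ω| ≤ 2 * θ := by
  have h1 : |∫ ω', truncate θ (X ω') ∂P| ≤ θ := by
    have := norm_integral_le_of_norm_le_const (μ := P) (f := fun ω' => truncate θ (X ω')) (C := θ)
      (ae_of_all _ fun ω => abs_truncate_le hθ _)
    simpa using this
  unfold centredTruncation
  have h2 := abs_truncate_le hθ (X ω)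
  exact (abs_sub _ _).trans (by linarith)

theorem integral_centredTruncation (hX : Measurable X) (hθ : 0 ≤ θ) :
    ∫ ω, centredTruncation P θ X ω ∂P = 0 := by
  unfold centredTruncation
  rw [integral_sub (integrable_truncate hX hθ) (integrable_const _)]
  simp

theorem integral_centredTruncation_sq (hX : Measurable X) (hθ : 0 ≤ θ) :
    ∫ ω, centredTruncation P θ X ω ^ 2 ∂P =
      ∫ ω, truncate θ (X ω) ^ 2 ∂P - (∫ ω, truncate θ (X ω) ∂P) ^ 2 := by
  set c := ∫ ω, truncate θ (X ω) ∂P with hc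
  have h1 := integrable_truncate (P := P) hX hθ
  have h2 : Integrable (fun ω => truncate θ (X ω) ^ 2) P :=
    Integrable.of_bound (((measurable_truncate θ).comp hX).pow_const 2).aestronglyMeasurable (θ ^ 2)
      (ae_of_all _ fun ω => by
        rw [norm_pow]; exact pow_le_pow_left₀ (norm_nonneg _) (abs_truncate_le hθ _) 2)
  have e : ∀ ω, centredTruncation P θ X ω ^ 2 =
      truncate θ (X ω) ^ 2 - (2 * c * truncate θ (X ω) - c ^ 2) := fun ω => by
    unfold centredTruncation; rw [← hc]; ring
  simp only [e]
  have hI : Integrable (fun ω => 2 * c * truncate θ (X ω) - c ^ 2) P :=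
    (h1.const_mul _).sub (integrable_const _)
  rw [integral_sub h2 hI, integral_sub (h1.const_mul _) (integrable_const _), integral_const_mul, ← hc]
  simp; ring

/-- The truncated and the discarded part have disjoint supports, so their squares add up, and since
`X` is centred their means are opposite. Truncation and recentring therefore lower the second moment
by at most `t + t ^ 2`. -/
theorem centredTruncation_variance (hX : Measurable X) (hθ : 0 ≤ θ) (hX2 : MemLp X 2 P)
    (hmean : ∫ ω, X ω ∂P = 0) {t : ℝ}
    (hi2 : Integrable (fun ω => |X ω - truncate θ (X ω)| ^ 2) P)
    (h1 : ∫ ω, |X ω - truncate θ (X ω)| ^ 1 ∂P ≤ t)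
    (h2 : ∫ ω, |X ω - truncate θ (X ω)| ^ 2 ∂P ≤ t) (ht1 : t ≤ 1) :
    |∫ ω, truncate θ (X ω) ∂P| ≤ t ∧
    ∫ ω, centredTruncation P θ X ω ^ 2 ∂P ≤ ∫ ω, X ω ^ 2 ∂P ∧
    ∫ ω, X ω ^ 2 ∂P ≤ ∫ ω, centredTruncation P θ X ω ^ 2 ∂P + 2 * t := by
  simp only [pow_one, sq_abs] at *
  have hX1 : Integrable X P := hX2.integrable (by norm_num)
  have hint := integrable_truncate (P := P) hX hθ
  have hsub : ∫ ω, truncate θ (X ω) ∂P = -∫ ω, (X ω - truncate θ (X ω)) ∂P := by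
    rw [integral_sub hX1 hint, hmean]; ring
  have h3 : |∫ ω, truncate θ (X ω) ∂P| ≤ t := by
    rw [hsub, abs_neg]
    exact abs_integral_le_integral_abs.trans h1
  have h4 : Integrable (fun ω => truncate θ (X ω) ^ 2) P :=
    Integrable.of_bound (((measurable_truncate θ).comp hX).pow_const 2).aestronglyMeasurable (θ ^ 2)
      (ae_of_all _ fun ω => by
        rw [norm_pow]; exact pow_le_pow_left₀ (norm_nonneg _) (abs_truncate_le hθ _) 2)
  have h5 : ∫ ω, X ω ^ 2 ∂P = ∫ ω, truncate θ (X ω) ^ 2 ∂P +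
      ∫ ω, (X ω - truncate θ (X ω)) ^ 2 ∂P := by
    rw [← integral_add h4 hi2]
    exact integral_congr_ae (ae_of_all _ fun ω => sq_eq_truncate θ (X ω))
  have h6 : 0 ≤ ∫ ω, (X ω - truncate θ (X ω)) ^ 2 ∂P := integral_nonneg fun _ => sq_nonneg _
  have h7 := integral_centredTruncation_sq (P := P) hX hθ
  have h8 : (∫ ω, truncate θ (X ω) ∂P) ^ 2 ≤ t := by
    rw [← sq_abs]; nlinarith [abs_nonneg (∫ ω, truncate θ (X ω) ∂P)]
  refine ⟨h3, ?_, ?_⟩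
  · rw [h7, h5]; nlinarith [sq_nonneg (∫ ω, truncate θ (X ω) ∂P)]
  · rw [h7, h5]; linarith

end Entry

/-- The matrix `H` is approximated by the bounded ensemble `F` and by the bounded ensemble `G` with
zero diagonal. -/
structure IsApproximation {Ω : Type*} [MeasurableSpace Ω] (P : Measure Ω) {N : ℕ} (θ τ : ℝ)
    (H F G : Ω → Matrix (Fin N) (Fin N) ℝ) : Prop where
  full : CenteredEnsemble P θ F
  hollow : CenteredEnsemble P θ G
  diag : ∀ ω i, G ω i i = 0
  hollow_row : ∀ v, |∑ u, ∫ ω, G ω v u ^ 2 ∂P - 1| ≤ 2 / N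
  full_var : ∀ i j, 1 / (N : ℝ) - 1 / N ^ 2 ≤ ∫ ω, F ω i j ^ 2 ∂P
  near_hollow : ∀ ω, ‖op (F ω - G ω)‖ ≤ θ
  tail : P.real {ω | τ < ∑ i, ∑ j, |H ω i j - F ω i j|} ≤ τ
  integrable : Integrable (fun ω => ∑ i, ∑ j, |H ω i j - F ω i j|) P
  integral_le : ∫ ω, ∑ i, ∑ j, |H ω i j - F ω i j| ∂P ≤ τ

theorem norm_op_diagonal_le {N : ℕ} {D : Matrix (Fin N) (Fin N) ℝ} {c : ℝ} (hc : 0 ≤ c)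
    (hoff : ∀ i j, i ≠ j → D i j = 0) (hD : ∀ i, |D i i| ≤ c) : ‖op D‖ ≤ c := by
  refine ContinuousLinearMap.opNorm_le_bound _ hc fun x => ?_
  refine le_of_sq_le_sq ?_ (by positivity)
  rw [mul_pow, EuclideanSpace.norm_sq_eq, EuclideanSpace.norm_sq_eq, Finset.mul_sum]
  refine Finset.sum_le_sum fun i _ => ?_
  have : (op D x) i = D i i * x i := by
    simp only [Matrix.ofLp_toEuclideanCLM, Matrix.mulVec, dotProduct]
    rw [Finset.sum_eq_single i]
    · intro j _ hj; rw [hoff i j hj.symm, zero_mul]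
    · simp
  rw [this, norm_mul, mul_pow]
  exact mul_le_mul_of_nonneg_right (pow_le_pow_left₀ (norm_nonneg _) (hD i) 2) (sq_nonneg _)

/-- Unless some entry exceeds `θ`, truncation changes nothing, and only the recentring by at most
`t` per entry remains. The exceptional event is thus a union of `N ^ 2` events of probability at
most `t`. -/
theorem isApproximation_of_tails {Ω : Type*} [MeasurableSpace Ω] {P : Measure Ω}
    [IsProbabilityMeasure P] {A₀ Cm Cq : ℝ} {N : ℕ} {ξ q : ℝ}
    {H : Ω → Matrix (Fin N) (Fin N) ℝ} (hH : IsSparseMatrix P A₀ Cm Cq N ξ q H) (hN : 0 < N)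
    {θ t τ : ℝ} (hθ : 0 < θ) (ht0 : 0 ≤ t) (ht1 : t ≤ 1)
    (hi1 : ∀ i j, Integrable (fun ω => |H ω i j - truncate θ (H ω i j)| ^ 1) P)
    (hi2 : ∀ i j, Integrable (fun ω => |H ω i j - truncate θ (H ω i j)| ^ 2) P)
    (h0 : ∀ i j, P.real {ω | θ < |H ω i j|} ≤ t)
    (h1 : ∀ i j, ∫ ω, |H ω i j - truncate θ (H ω i j)| ^ 1 ∂P ≤ t)
    (h2 : ∀ i j, ∫ ω, |H ω i j - truncate θ (H ω i j)| ^ 2 ∂P ≤ t)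
    (htN : 2 * t ≤ 1 / N ^ 2) (htτ : 2 * N ^ 2 * t ≤ τ) :
    IsApproximation P (2 * θ) τ H (fun ω i j => centredTruncation P θ (fun ω => H ω i j) ω)
      (fun ω i j => if i = j then 0 else centredTruncation P θ (fun ω => H ω i j) ω) := by
  have hN' : (1 : ℝ) ≤ N := by exact_mod_cast hN
  have hθ0 := hθ.le
  have hmeas : ∀ i j, Measurable fun ω => centredTruncation P θ (fun ω => H ω i j) ω := fun i j =>
    ((measurable_truncate θ).comp (hH.measurable i j)).sub_const _
  have hsymm : ∀ i j, (fun ω => H ω i j) = fun ω => H ω j i := fun i j =>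
    funext fun ω => hH.symm ω i j
  have hvar : ∀ i j, |∫ ω, truncate θ (H ω i j) ∂P| ≤ t ∧
      ∫ ω, centredTruncation P θ (fun ω => H ω i j) ω ^ 2 ∂P ≤ ∫ ω, H ω i j ^ 2 ∂P ∧
      ∫ ω, H ω i j ^ 2 ∂P ≤ ∫ ω, centredTruncation P θ (fun ω => H ω i j) ω ^ 2 ∂P + 2 * t :=
    fun i j => centredTruncation_variance (hH.measurable i j) hθ0 (hH.memLp_two i j) (hH.mean i j)
      (hi2 i j) (h1 i j) (h2 i j) ht1
  have hv : ∀ i j, ∫ ω, H ω i j ^ 2 ∂P = 1 / N := by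
    intro i j; rw [← hH.variance i j]; simp only [sq_abs]
  have hfull : CenteredEnsemble P (2 * θ)
      (fun ω i j => centredTruncation P θ (fun ω => H ω i j) ω) := by
    refine ⟨hmeas, fun ω i j => by rw [hsymm i j], ?_, fun ω i j => abs_centredTruncation_le hθ0 ω,
      fun i j => integral_centredTruncation (hH.measurable i j) hθ0, fun i j => ?_⟩
    · exact hH.indep.comp (fun s x => truncate θ x - ∫ ω, truncate θ (H ω s.1.1 s.1.2) ∂P)
        (fun s => (measurable_truncate θ).sub_const _)
    · rw [← hv i j]; exact (hvar i j).2.1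
  have hlow : ∀ i j, 1 / (N : ℝ) - 1 / N ^ 2 ≤
      ∫ ω, centredTruncation P θ (fun ω => H ω i j) ω ^ 2 ∂P := by
    intro i j
    have := (hvar i j).2.2
    rw [hv i j] at this
    linarith
  have hdiff : ∀ i j ω, |H ω i j - centredTruncation P θ (fun ω => H ω i j) ω| ≤
      |H ω i j - truncate θ (H ω i j)| + t := by
    intro i j ω
    have e : H ω i j - centredTruncation P θ (fun ω => H ω i j) ω =
        (H ω i j - truncate θ (H ω i j)) + ∫ ω, truncate θ (H ω i j) ∂P := by
      unfold centredTruncation; ring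
    rw [e]
    exact (abs_add_le _ _).trans (add_le_add le_rfl (hvar i j).1)
  have hintd : ∀ i j, Integrable
      (fun ω => |H ω i j - centredTruncation P θ (fun ω => H ω i j) ω|) P := by
    intro i j
    refine ((hi1 i j).add (integrable_const t)).mono'
      ((hH.measurable i j).sub (hmeas i j)).abs.aestronglyMeasurable (ae_of_all _ fun ω => ?_)
    rw [Real.norm_eq_abs, abs_abs]
    simpa using hdiff i j ω
  refine ⟨hfull, ?_, fun ω i => by simp, fun v => ?_, hlow, fun ω => ?_, ?_, ?_, ?_⟩
  · refine ⟨fun i j => ?_, fun ω i j => ?_, ?_, fun ω i j => ?_, fun i j => ?_, fun i j => ?_⟩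
    · by_cases hij : i = j
      · simp [hij]
      · simpa [hij] using hmeas i j
    · by_cases hij : i = j
      · simp [hij]
      · simp only [hij, Ne.symm hij, if_false]; rw [hsymm i j]
    · exact hH.indep.comp (fun s x => if s.1.1 = s.1.2 then 0 else
        truncate θ x - ∫ ω, truncate θ (H ω s.1.1 s.1.2) ∂P)
        (fun s => by
          split_ifs
          · exact measurable_const
          · exact (measurable_truncate θ).sub_const _)
    · split_ifs
      · rw [abs_zero]; positivity
      · exact abs_centredTruncation_le hθ0 ω
    · by_cases hij : i = j
      · simp [hij]
      · simpa [hij] using hfull.mean i j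
    · by_cases hij : i = j
      · simp [hij]
      · simpa [hij] using hfull.second_le i j
  · have e : ∀ u, ∫ ω, (if v = u then (0 : ℝ) else
        centredTruncation P θ (fun ω => H ω v u) ω) ^ 2 ∂P =
        if v = u then 0 else ∫ ω, centredTruncation P θ (fun ω => H ω v u) ω ^ 2 ∂P := by
      intro u; split_ifs <;> simp
    simp only [e]
    rw [← Finset.sum_erase_add _ _ (Finset.mem_univ v), if_pos rfl, add_zero]
    have hcard : ((Finset.univ.erase v).card : ℝ) = N - 1 := by
      rw [Finset.card_erase_of_mem (Finset.mem_univ v), Finset.card_univ, Fintype.card_fin,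
        Nat.cast_sub hN, Nat.cast_one]
    have hu : ∑ u ∈ Finset.univ.erase v, (if v = u then 0 else
        ∫ ω, centredTruncation P θ (fun ω => H ω v u) ω ^ 2 ∂P) ≤ (N - 1) * (1 / N) := by
      rw [← hcard, ← nsmul_eq_mul]
      refine Finset.sum_le_card_nsmul _ _ _ fun u hu => ?_
      rw [if_neg (Finset.ne_of_mem_erase hu).symm]
      exact hfull.second_le v u
    have hl : (N - 1) * (1 / N - 1 / N ^ 2) ≤ ∑ u ∈ Finset.univ.erase v, (if v = u then 0 else
        ∫ ω, centredTruncation P θ (fun ω => H ω v u) ω ^ 2 ∂P) := by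
      rw [← hcard, ← nsmul_eq_mul]
      refine Finset.card_nsmul_le_sum _ _ _ fun u hu => ?_
      rw [if_neg (Finset.ne_of_mem_erase hu).symm]
      exact hlow v u
    have hN0 : (0 : ℝ) < N := by linarith
    have e1 : ((N : ℝ) - 1) * (1 / N) = 1 - 1 / N := by field_simp
    have e2 : ((N : ℝ) - 1) * (1 / N - 1 / N ^ 2) = 1 - 2 / N + 1 / N ^ 2 := by field_simp; ring
    have e3 : (0 : ℝ) ≤ 1 / N ^ 2 := by positivity
    have e4 : (0 : ℝ) ≤ 1 / N := by positivity
    have e5 : (2 : ℝ) / N = 2 * (1 / N) := by ring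
    rw [abs_le]; constructor <;> linarith
  · refine norm_op_diagonal_le (by positivity) (fun i j hij => ?_) fun i => ?_
    · change centredTruncation P θ (fun ω => H ω i j) ω - (if i = j then 0 else
        centredTruncation P θ (fun ω => H ω i j) ω) = 0
      rw [if_neg hij, sub_self]
    · change |centredTruncation P θ (fun ω => H ω i i) ω - (if i = i then 0 else
        centredTruncation P θ (fun ω => H ω i i) ω)| ≤ 2 * θ
      rw [if_pos rfl, sub_zero]
      exact abs_centredTruncation_le hθ0 ω
  · have hsub : {ω | τ < ∑ i, ∑ j, |H ω i j - centredTruncation P θ (fun ω => H ω i j) ω|} ⊆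
        ⋃ p ∈ (Finset.univ : Finset (Fin N × Fin N)), {ω | θ < |H ω p.1 p.2|} := by
      intro ω hω
      by_contra hc
      simp only [Finset.mem_univ, Set.iUnion_true, Set.mem_iUnion, Set.mem_ofPred_eq, not_exists,
        not_lt, Prod.forall] at hc
      have : ∑ i, ∑ j, |H ω i j - centredTruncation P θ (fun ω => H ω i j) ω| ≤
          ∑ i : Fin N, ∑ j : Fin N, t := by
        refine Finset.sum_le_sum fun i _ => Finset.sum_le_sum fun j _ => (hdiff i j ω).trans ?_
        simp [truncate, hc i j]
      have h3 : ∑ i : Fin N, ∑ j : Fin N, t = N ^ 2 * t := by simp; ring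
      have h4 : (N : ℝ) ^ 2 * t ≤ 2 * N ^ 2 * t := by
        have : 0 ≤ (N : ℝ) ^ 2 * t := by positivity
        linarith
      have hω' : τ < ∑ i, ∑ j, |H ω i j - centredTruncation P θ (fun ω => H ω i j) ω| := hω
      linarith
    refine (measureReal_mono hsub (measure_ne_top _ _)).trans
      ((measureReal_biUnion_finset_le _ _).trans ?_)
    refine (Finset.sum_le_sum fun p _ => h0 p.1 p.2).trans ?_
    rw [Finset.sum_const, Finset.card_univ, Fintype.card_prod, Fintype.card_fin, nsmul_eq_mul]
    push_cast
    have : 0 ≤ (N : ℝ) ^ 2 * t := by positivity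
    nlinarith
  · exact integrable_finsetSum _ fun i _ => integrable_finsetSum _ fun j _ => hintd i j
  · rw [integral_finsetSum _ fun i _ => integrable_finsetSum _ fun j _ => hintd i j]
    have : ∀ i, ∫ ω, ∑ j, |H ω i j - centredTruncation P θ (fun ω => H ω i j) ω| ∂P ≤
        ∑ j : Fin N, 2 * t := by
      intro i
      rw [integral_finsetSum _ fun j _ => hintd i j]
      refine Finset.sum_le_sum fun j _ => ?_
      have h3 := integral_mono (hintd i j) ((hi1 i j).add (integrable_const t)) (fun ω => by
        simpa using hdiff i j ω)
      refine h3.trans ?_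
      have h4 := integral_add (hi1 i j) (integrable_const t)
      simp only [Pi.add_apply]
      rw [h4]
      have := h1 i j
      simp only [integral_const, probReal_univ, one_smul]
      linarith
    refine (Finset.sum_le_sum fun i _ => this i).trans (le_trans (le_of_eq ?_) htτ)
    simp; ring

/-- Sparse matrices can be truncated at a level of order `1 / q`. -/
theorem eventually_isApproximation {A₀ Cm Cq : ℝ} (hCm : 0 < Cm) (hCq : 0 < Cq) :
    ∀ᶠ x in regime, ∀ (Ω : Type u) [MeasurableSpace Ω] (P : Measure Ω) [IsProbabilityMeasure P]
      (ξ q : ℝ) (H : Ω → Matrix (Fin x.1) (Fin x.1) ℝ), IsSparseMatrix P A₀ Cm Cq x.1 ξ q H →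
      x.2 ≤ Real.log x.1 ^ (A₀ * Real.log (Real.log x.1)) → x.2 ^ 3 ≤ q →
      ∃ F G, IsApproximation P (2 * Real.exp 2 * Cm / q) (Real.exp (-x.2)) H F G := by
  filter_upwards [regime_le 4, regime_le_fst 1,
    regime_const_mul_exp_le ((1 + Cm) ^ 2 * Cq ^ 2 * Real.exp 6) (show (3 / 2 : ℝ) < 2 by norm_num),
    regime_rpow_mul_exp_le 3 (show (1 : ℝ) < 3 / 2 by norm_num),
    regime_rpow_mul_exp_le 3 (show (0 : ℝ) < 3 / 2 by norm_num), regime_le_fst 2]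
    with x hL4 hN1 hexp1 hexp2 hexp3 hN2
  intro Ω _ P _ ξ q H hH hLp hLq
  obtain ⟨N, L⟩ := x
  simp only at *
  have hL0 : 0 < L := by linarith
  have hN0 : (0 : ℝ) < N := by linarith
  have hq1 : 1 ≤ q := (one_le_pow₀ (by linarith)).trans hLq
  have hq0 : 0 < q := by linarith
  -- The hypothesis on `L` makes moments of this order available; Markov's inequality with them is
  -- exponentially strong in `L`.
  set p := ⌊L⌋₊ with hp
  have hpL : (p : ℝ) ≤ L := Nat.floor_le hL0.le
  have hLp1 : L < p + 1 := Nat.lt_floor_add_one L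
  have hp3 : 3 ≤ p := Nat.le_floor (by push_cast; linarith)
  -- The factor `exp 2` over the moment scale `Cm / q` turns the `p`-th moment into `exp (-2 p)`, up
  -- to a prefactor that stays bounded because `q ^ 2 / N ≤ Cq ^ 2`. The loss from `exp (-2 L)` to
  -- `t` absorbs the constants.
  set θ := Real.exp 2 * Cm / q with hθdef
  have hθ : 0 < θ := by positivity
  have hint : ∀ i j, Integrable (fun ω => |H ω i j| ^ p) P :=
    hH.integrable_pow p hp3 (hpL.trans hLp)
  have hB := hH.moment p hp3 (hpL.trans hLp)
  set t := Real.exp (-(3 / 2) * L) with ht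
  have hq2 : q ^ 2 ≤ Cq ^ 2 * N := by
    calc q ^ 2 ≤ (Cq * Real.sqrt N) ^ 2 := pow_le_pow_left₀ hq0.le hH.q_upper 2
      _ = _ := by rw [mul_pow, Real.sq_sqrt hN0.le]
  have key : ∀ j ≤ 2, Cm ^ p / (N * q ^ (p - 2)) / θ ^ (p - j) ≤ t := by
    intro j hj
    have e1 : Cm ^ p / (N * q ^ (p - 2)) / θ ^ (p - j) =
        Cm ^ j * q ^ (2 - j) / N * Real.exp (-2) ^ (p - j) := by
      rw [hθdef, div_pow, mul_pow, Real.exp_neg, inv_pow, show Cm ^ p = Cm ^ (p - j) * Cm ^ j by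
        rw [← pow_add]; congr 1; omega]
      have : q ^ (p - j) = q ^ (p - 2) * q ^ (2 - j) := by rw [← pow_add]; congr 1; omega
      rw [this]
      field_simp
    have e2 : Cm ^ j ≤ (1 + Cm) ^ 2 :=
      (pow_le_pow_left₀ hCm.le (by linarith) j).trans (pow_le_pow_right₀ (by linarith) hj)
    have e3 : q ^ (2 - j) ≤ q ^ 2 := pow_le_pow_right₀ hq1 (by omega)
    have e4 : Real.exp (-2) ^ (p - j) ≤ Real.exp 6 * Real.exp (-2 * L) := by
      rw [← Real.exp_nat_mul, ← Real.exp_add]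
      refine Real.exp_le_exp.2 ?_
      rw [Nat.cast_sub (by omega)]
      have : (j : ℝ) ≤ 2 := by exact_mod_cast hj
      linarith
    rw [e1]
    calc Cm ^ j * q ^ (2 - j) / N * Real.exp (-2) ^ (p - j)
        ≤ (1 + Cm) ^ 2 * q ^ 2 / N * (Real.exp 6 * Real.exp (-2 * L)) := by gcongr
      _ ≤ (1 + Cm) ^ 2 * (Cq ^ 2 * N) / N * (Real.exp 6 * Real.exp (-2 * L)) := by gcongr
      _ = (1 + Cm) ^ 2 * Cq ^ 2 * Real.exp 6 * Real.exp (-2 * L) := by field_simp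
      _ ≤ t := hexp1
  have k1 := fun i j => integral_sub_truncate_pow_le (hH.measurable i j) hθ le_rfl
    (show 1 ≤ p by omega) (hint i j) (hB i j)
  have k2 := fun i j => integral_sub_truncate_pow_le (hH.measurable i j) hθ (show 1 ≤ 2 by norm_num)
    (show 2 ≤ p by omega) (hint i j) (hB i j)
  have hcube : (N : ℝ) ^ (3 : ℝ) = N ^ 2 * N := by
    rw [show (3 : ℝ) = (3 : ℕ) by norm_num, Real.rpow_natCast]; ring
  rw [hcube] at hexp2 hexp3
  have ht0 : 0 < t := Real.exp_pos _
  have hN2t : 0 < (N : ℝ) ^ 2 * t := by positivity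
  have := isApproximation_of_tails hH (by exact_mod_cast hN0) hθ ht0.le
    (Real.exp_le_one_iff.2 (by linarith)) (fun i j => (k1 i j).1) (fun i j => (k2 i j).1)
    (fun i j => (measure_lt_abs_le hθ (hint i j) (hB i j)).trans (key 0 (by norm_num)))
    (fun i j => (k1 i j).2.trans (key 1 (by norm_num)))
    (fun i j => (k2 i j).2.trans (key 2 le_rfl)) (τ := Real.exp (-L))
    (by
      rw [le_div_iff₀ (by positivity)]
      have : Real.exp (-0 * L) = 1 := by simp
      rw [this] at hexp3
      nlinarith)
    (by
      rw [neg_one_mul] at hexp2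
      nlinarith)
  rw [show 2 * Real.exp 2 * Cm / q = 2 * θ by rw [hθdef]; ring]
  exact ⟨_, _, this⟩


/-! ### The top eigenvalue when Chebyshev forms are small -/

section Weak

variable {N : ℕ} {H : Matrix (Fin N) (Fin N) ℝ}

/-- A truncated Chebyshev expansion of the resolvent at `s + s⁻¹`, applied to `e`. -/
noncomputable def chebResolvent (H : Matrix (Fin N) (Fin N) ℝ) (s : ℝ) (K : ℕ) :
    EuclideanSpace ℝ (Fin N) :=
  ∑ k ∈ Finset.range K, (s⁻¹ ^ (k + 1)) • cheb (op H) k (eVec N)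

/-- The error of `chebResolvent` as an approximate resolvent. -/
noncomputable def chebRemainder (H : Matrix (Fin N) (Fin N) ℝ) (s : ℝ) (K : ℕ) :
    EuclideanSpace ℝ (Fin N) :=
  (s⁻¹ ^ (K + 2)) • cheb (op H) K (eVec N) - (s⁻¹ ^ (K + 1)) • cheb (op H) (K + 1) (eVec N)

/-- The generating function of the Chebyshev polynomials is `∑ s ^ (-k-1) U_k(x) = 1 / (s + s⁻¹ -
x)`. For the truncated sum the recursion telescopes and leaves two boundary terms. -/
theorem smul_chebResolvent {s : ℝ} (hs : s ≠ 0) (K : ℕ) :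
    (s + s⁻¹) • chebResolvent H s (K + 1) =
      op H (chebResolvent H s (K + 1)) + eVec N + chebRemainder H s K := by
  have hss : s * s⁻¹ = 1 := mul_inv_cancel₀ hs
  have hU : ∀ k, op H (cheb (op H) (k + 1) (eVec N)) =
      cheb (op H) (k + 2) (eVec N) + cheb (op H) k (eVec N) := by
    intro k; rw [cheb, _root_.sub_apply, mul_apply_eq_comp]; abel
  induction K with
  | zero =>
    simp only [chebResolvent, chebRemainder, Finset.sum_range_one, zero_add, pow_one, cheb,
      one_apply_eq_self, map_smul]
    match_scalars
    · linear_combination hss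
    · ring
  | succ K ih =>
    have e : chebResolvent H s (K + 1 + 1) =
        chebResolvent H s (K + 1) + (s⁻¹ ^ (K + 2)) • cheb (op H) (K + 1) (eVec N) := by
      rw [chebResolvent, Finset.sum_range_succ]; rfl
    rw [e, smul_add, ih, map_add, map_smul, hU, chebRemainder, chebRemainder]
    match_scalars <;> first | ring1 | linear_combination (s⁻¹ ^ (K + 1)) * hss

variable {a G s : ℝ}

theorem norm_chebRemainder_le [NeZero N] (ha : 1 ≤ a) (hG : 0 ≤ G)
    (hcheb : ∀ k, ‖cheb (op H) k‖ ≤ G * a ^ k) (hs : 1 ≤ s) (K : ℕ) :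
    ‖chebRemainder H s K‖ ≤ 2 * G * (a / s) ^ (K + 1) := by
  have hs0 : 0 < s := by linarith
  have hv : ∀ k, ‖cheb (op H) k (eVec N)‖ ≤ G * a ^ k := fun k => by
    have := (cheb (op H) k).le_opNorm (eVec N)
    rw [norm_eVec, mul_one] at this
    exact this.trans (hcheb k)
  have hsi : s⁻¹ ≤ 1 := inv_le_one_of_one_le₀ hs
  have hsi0 : 0 < s⁻¹ := by positivity
  rw [chebRemainder]
  refine (norm_sub_le _ _).trans ?_
  rw [norm_smul, norm_smul, norm_pow, norm_pow, Real.norm_eq_abs, abs_of_pos hsi0]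
  have h1 : s⁻¹ ^ (K + 2) * ‖cheb (op H) K (eVec N)‖ ≤ s⁻¹ ^ (K + 1) * (G * a ^ (K + 1)) := by
    refine mul_le_mul (pow_le_pow_of_le_one hsi0.le hsi (by omega)) ((hv K).trans ?_)
      (norm_nonneg _) (by positivity)
    exact mul_le_mul_of_nonneg_left (pow_le_pow_right₀ ha (by omega)) hG
  have h2 : s⁻¹ ^ (K + 1) * ‖cheb (op H) (K + 1) (eVec N)‖ ≤ s⁻¹ ^ (K + 1) * (G * a ^ (K + 1)) :=
    mul_le_mul_of_nonneg_left (hv _) (by positivity)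
  rw [div_eq_mul_inv, mul_pow]
  linarith

/-- Only the term `k = 0` survives. The limit `s⁻¹` is the value at `s + s⁻¹` of the resolvent
transform of the semicircle law. -/
theorem abs_inner_chebResolvent_sub_le [NeZero N] {η : ℝ} (hη : 0 ≤ η) (hs : 1 < s) {K : ℕ}
    (h : ∀ k, 1 ≤ k → k ≤ K → |inner ℝ (eVec N) (cheb (op H) k (eVec N))| ≤ η) :
    |inner ℝ (eVec N) (chebResolvent H s (K + 1)) - s⁻¹| ≤ η / (s * (s - 1)) := by
  have hs0 : 0 < s := by linarith
  have hsi : s⁻¹ < 1 := inv_lt_one_of_one_lt₀ hs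
  have hsi0 : 0 < s⁻¹ := by positivity
  rw [chebResolvent, inner_sum, Finset.sum_range_succ']
  have e0 : inner ℝ (eVec N) (s⁻¹ ^ (0 + 1) • cheb (op H) 0 (eVec N)) = s⁻¹ := by
    simp [cheb, real_inner_smul_right, norm_eVec]
  rw [e0, add_sub_cancel_right]
  refine (Finset.abs_sum_le_sum_abs _ _).trans ?_
  have h1 : ∀ k ∈ Finset.range K, |inner ℝ (eVec N)
      (s⁻¹ ^ (k + 1 + 1) • cheb (op H) (k + 1) (eVec N))| ≤ η * s⁻¹ ^ 2 * s⁻¹ ^ k := by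
    intro k hk
    rw [real_inner_smul_right, abs_mul, abs_of_pos (by positivity)]
    have := h (k + 1) (by omega) (by have := Finset.mem_range.1 hk; omega)
    calc _ ≤ s⁻¹ ^ (k + 1 + 1) * η := by gcongr
      _ = _ := by ring
  refine (Finset.sum_le_sum h1).trans ?_
  rw [← Finset.mul_sum]
  have h2 : ∑ k ∈ Finset.range K, s⁻¹ ^ k ≤ (1 - s⁻¹)⁻¹ := by
    rw [← tsum_geometric_of_lt_one hsi0.le hsi]
    exact (summable_geometric_of_lt_one hsi0.le hsi).sum_le_tsum _ fun _ _ => by positivity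
  calc η * s⁻¹ ^ 2 * ∑ k ∈ Finset.range K, s⁻¹ ^ k ≤ η * s⁻¹ ^ 2 * (1 - s⁻¹)⁻¹ := by gcongr
    _ = η / (s * (s - 1)) := by
      have : s - 1 ≠ 0 := by linarith
      have e : 1 - s⁻¹ = (s - 1) / s := by field_simp
      rw [e]
      field_simp

-- At `z = f + f⁻¹` the secular equation holds approximately. The lower bound is a Rayleigh quotient
-- at the approximate resolvent vector and needs no prior information on `μ`. For the upper bound
-- suppose `μ > z`: then `μ` lies above `ρ + γ`, the exact secular equation is available, and
-- writing `μ = s + s⁻¹` with `s > f` it gives `f⁻¹ ≈ s⁻¹`. The series decays at the rate `a / (1 +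
-- ε₀)`.
set_option maxHeartbeats 2000000 in
theorem weak_expansion [NeZero N] (hH : H.IsHermitian) {ε₀ f γ ρ η : ℝ} (hε₀ : 0 < ε₀)
    (hf : 1 + ε₀ ≤ f) (ha : 1 ≤ a) (haε : a ≤ 1 + ε₀) (hG : 0 ≤ G)
    (hcheb : ∀ k, ‖cheb (op H) k‖ ≤ G * a ^ k) (hρ : ‖op H‖ ≤ ρ) (hγ : 0 < γ)
    (hgap : ρ + γ ≤ f + f⁻¹) (hη : 0 ≤ η) (hη1 : 2 * η ≤ ε₀) {m : ℕ}
    (h : ∀ k, 1 ≤ k → k ≤ m + 1 → |inner ℝ (eVec N) (cheb (op H) k (eVec N))| ≤ η) :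
    |maxEigenvalue (perturbed f H) - (f + f⁻¹)| ≤
      2 * η * (1 + ε₀) / ε₀ + (4 * G * a + 2 * G * a ^ 2 / γ) * (a / (1 + ε₀)) ^ m := by
  set μ := maxEigenvalue (perturbed f H) with hμ
  set z := f + f⁻¹ with hz
  have hf1 : 1 < f := by linarith
  have hf0 : 0 < f := by linarith
  set r := a / (1 + ε₀) with hr
  have hr0 : 0 ≤ r := by positivity
  have hr1 : r ≤ 1 := (div_le_one (by linarith)).2 haε
  have hdec : ∀ s, f ≤ s → a / s ≤ r := fun s hs =>
    div_le_div_of_nonneg_left (by linarith) (by linarith) (by linarith)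
  have hff : ∀ s, f ≤ s → f / (s - 1) ≤ (1 + ε₀) / ε₀ := by
    intro s hs
    rw [div_le_div_iff₀ (by linarith) hε₀]
    nlinarith
  have hrm : 0 ≤ r ^ m := by positivity
  have nn1 : 0 ≤ 2 * G * a ^ 2 / γ * r ^ m := by positivity
  have nn2 : 0 ≤ 4 * G * a * r ^ m := by positivity
  have nn3 : 0 ≤ η * ((1 + ε₀) / ε₀) := by positivity
  have goal_eq : 2 * η * (1 + ε₀) / ε₀ + (4 * G * a + 2 * G * a ^ 2 / γ) * r ^ m =
      2 * (η * ((1 + ε₀) / ε₀)) + 4 * G * a * r ^ m + 2 * G * a ^ 2 / γ * r ^ m := by ring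
  rw [goal_eq, abs_le]
  constructor
  · -- Rayleigh quotient of the approximate resolvent
    set p := chebResolvent H f (m + 2) with hp
    set c := inner ℝ (eVec N) p with hc
    have h1 := smul_chebResolvent (H := H) hf0.ne' (m + 1)
    have h2 := norm_chebRemainder_le ha hG hcheb hf1.le (m + 1)
    have h3 := abs_inner_chebResolvent_sub_le hη hf1 h
    have h4 := top_rayleigh hH f p
    set R := chebRemainder H f (m + 1) with hR
    change |c - f⁻¹| ≤ _ at h3
    have h5 : op H p = z • p - eVec N - R := by
      rw [hz, hp, h1]; abel
    rw [h5, inner_sub_right, inner_sub_right, real_inner_smul_right, real_inner_self_eq_norm_sq,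
      real_inner_comm] at h4
    change z * ‖p‖ ^ 2 - c - inner ℝ p R + f * c ^ 2 ≤ μ * ‖p‖ ^ 2 at h4
    have h6 : |inner ℝ p R| ≤ ‖p‖ * ‖R‖ := abs_real_inner_le_norm p R
    have h7 : |c| ≤ ‖p‖ := by
      have := abs_real_inner_le_norm (eVec N) p
      rwa [norm_eVec, one_mul] at this
    set δ := f * |c - f⁻¹| with hδ
    have hδη : δ ≤ η / (f - 1) := by
      calc δ ≤ f * (η / (f * (f - 1))) := mul_le_mul_of_nonneg_left h3 hf0.le
        _ = _ := by
          have : f - 1 ≠ 0 := by linarith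
          field_simp
    have hδ2 : δ ≤ 1 / 2 := by
      refine hδη.trans ?_
      rw [div_le_iff₀ (by linarith)]; linarith
    have h8 : f⁻¹ / 2 ≤ ‖p‖ := by
      have : |c - f⁻¹| ≤ f⁻¹ / 2 := by
        rw [hδ] at hδ2
        calc |c - f⁻¹| = f * |c - f⁻¹| * f⁻¹ := by field_simp
          _ ≤ 1 / 2 * f⁻¹ := by gcongr
          _ = _ := by ring
      have := (abs_le.1 this).1
      linarith [le_abs_self c]
    have hp0 : 0 < ‖p‖ := lt_of_lt_of_le (by positivity) h8
    -- As `H p = z p - e - R`, the Rayleigh quotient differs from `z` by `f c ^ 2 - c` and an `R`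
    -- term, and `f c ^ 2 - c = c * (f * (c - f⁻¹))` is small.
    have h9 : -(δ + ‖R‖) ≤ (μ - z) * ‖p‖ := by
      have e1 : f * c ^ 2 - c = c * (f * (c - f⁻¹)) := by field_simp
      have e2 : |c * (f * (c - f⁻¹))| ≤ ‖p‖ * δ := by
        rw [abs_mul, abs_mul, abs_of_pos hf0]
        exact mul_le_mul_of_nonneg_right h7 (by positivity)
      have e3 := (abs_le.1 e2).1
      have e4 := (abs_le.1 h6).2
      have e5 : -(δ + ‖R‖) * ‖p‖ ≤ (μ - z) * ‖p‖ * ‖p‖ := by nlinarith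
      exact le_of_mul_le_mul_right e5 hp0
    have h10 : -(2 * f * (δ + ‖R‖)) ≤ μ - z := by
      by_contra hlt
      push Not at hlt
      have e1 : 0 ≤ δ + ‖R‖ := by positivity
      have e2 : (μ - z) * ‖p‖ < -(2 * f * (δ + ‖R‖)) * ‖p‖ := mul_lt_mul_of_pos_right hlt hp0
      have e3 : 2 * f * (δ + ‖R‖) * (f⁻¹ / 2) ≤ 2 * f * (δ + ‖R‖) * ‖p‖ := by gcongr
      have e4 : 2 * f * (δ + ‖R‖) * (f⁻¹ / 2) = δ + ‖R‖ := by field_simp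
      linarith
    have h11 : 2 * f * δ ≤ 2 * (η * ((1 + ε₀) / ε₀)) := by
      have := hff f le_rfl
      calc 2 * f * δ ≤ 2 * f * (η / (f - 1)) := by gcongr
        _ = 2 * (η * (f / (f - 1))) := by ring
        _ ≤ _ := by gcongr
    have h12 : 2 * f * ‖R‖ ≤ 4 * G * a * r ^ m := by
      have hd := hdec f le_rfl
      calc 2 * f * ‖R‖ ≤ 2 * f * (2 * G * (a / f) ^ (m + 1 + 1)) := by gcongr
        _ = 4 * G * a * (a / f) ^ (m + 1) := by rw [pow_succ]; field_simp; ring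
        _ ≤ 4 * G * a * r ^ (m + 1) := by gcongr
        _ ≤ 4 * G * a * r ^ m := by
          refine mul_le_mul_of_nonneg_left (pow_le_pow_of_le_one hr0 hr1 (by omega)) (by positivity)
    linarith
  · by_cases hle : μ ≤ z
    · linarith
    push Not at hle
    have hz2 : 2 ≤ z := two_le_add_inv hf0
    obtain ⟨s, hs1, hs⟩ := exists_add_inv_eq (hz2.trans hle.le)
    have hs0 : 0 < s := by linarith
    have hfs : f < s := by
      by_contra hlt
      push Not at hlt
      have e : z - μ = (f - s) * (1 - (f * s)⁻¹) := by
        rw [hz, ← hs]; field_simp; ring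
      have e2 : (f * s)⁻¹ ≤ 1 := inv_le_one_of_one_le₀ (by nlinarith)
      nlinarith [mul_nonneg (sub_nonneg.2 hlt) (sub_nonneg.2 e2)]
    obtain ⟨w, hw⟩ := exists_isSecular hH hρ hf0 (show ρ < μ by linarith)
    set p := chebResolvent H s (m + 2) with hp
    have h1 := smul_chebResolvent (H := H) hs0.ne' (m + 1)
    have h2 := norm_chebRemainder_le ha hG hcheb hs1 (m + 1)
    have h3 := abs_inner_chebResolvent_sub_le hη (by linarith : 1 < s) h
    set R := chebRemainder H s (m + 1) with hR
    rw [hs] at h1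
    change μ • p = op H p + eVec N + R at h1
    have h4 : μ • (p - w) = op H (p - w) + R := by
      rw [smul_sub, h1, hw.eq, map_sub]; abel
    have h5 : γ * ‖p - w‖ ≤ ‖R‖ := by
      have e1 : μ * ‖p - w‖ ≤ ρ * ‖p - w‖ + ‖R‖ := by
        calc μ * ‖p - w‖ = ‖μ • (p - w)‖ := by
              rw [norm_smul, Real.norm_eq_abs, abs_of_pos (by linarith)]
          _ ≤ ‖op H (p - w)‖ + ‖R‖ := by rw [h4]; exact norm_add_le _ _
          _ ≤ _ := by
            gcongr
            exact ((op H).le_opNorm _).trans (by gcongr)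
      have e2 : (ρ + γ) * ‖p - w‖ ≤ μ * ‖p - w‖ := by
        refine mul_le_mul_of_nonneg_right ?_ (norm_nonneg _); linarith
      linarith
    have h6 : |inner ℝ (eVec N) (p - w)| ≤ ‖R‖ / γ := by
      have := abs_real_inner_le_norm (eVec N) (p - w)
      rw [norm_eVec, one_mul] at this
      exact this.trans ((le_div_iff₀ hγ).2 (by linarith))
    rw [inner_sub_right, hw.inner_eq] at h6
    change |inner ℝ (eVec N) p - s⁻¹| ≤ _ at h3
    have h7 : f⁻¹ - s⁻¹ ≤ η / (s * (s - 1)) + 2 * G * (a / s) ^ (m + 2) / γ := by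
      have e1 := (abs_le.1 h6).1
      have e2 := (abs_le.1 h3).2
      have e3 : ‖R‖ / γ ≤ 2 * G * (a / s) ^ (m + 2) / γ := by gcongr
      rw [one_div] at e1
      linarith
    have h8 : s - f ≤ η * (f / (s - 1)) + 2 * G * a * (a / s) ^ (m + 1) * f / γ := by
      have e1 : s - f = s * f * (f⁻¹ - s⁻¹) := by field_simp
      have hs1' : s - 1 ≠ 0 := by linarith
      calc s - f ≤ s * f * (η / (s * (s - 1)) + 2 * G * (a / s) ^ (m + 2) / γ) := by
            rw [e1]; gcongr
        _ = _ := by rw [pow_succ _ (m + 1)]; field_simp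
    have h9 : 2 * G * a * (a / s) ^ (m + 1) * f / γ ≤ 2 * G * a ^ 2 / γ * r ^ m := by
      have hd := hdec s hfs.le
      have e2 : (a / s) ^ (m + 1) * f ≤ r ^ m * a := by
        calc (a / s) ^ (m + 1) * f ≤ (a / s) ^ (m + 1) * s := by gcongr
          _ = (a / s) ^ m * a := by rw [pow_succ]; field_simp
          _ ≤ _ := by gcongr
      calc 2 * G * a * (a / s) ^ (m + 1) * f / γ = 2 * G * a / γ * ((a / s) ^ (m + 1) * f) := by ring
        _ ≤ 2 * G * a / γ * (r ^ m * a) := by gcongr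
        _ = _ := by ring
    have h10 : μ - z ≤ s - f := by
      have : s⁻¹ ≤ f⁻¹ := inv_anti₀ hf0 hfs.le
      rw [← hs, hz]; linarith
    have h11 : η * (f / (s - 1)) ≤ η * ((1 + ε₀) / ε₀) := by
      have := hff s hfs.le
      gcongr
    linarith

end Weak


/-! ### Quadratic forms of Chebyshev polynomials -/

/-- The fluctuation scale of `eMoment H k` at probability `exp (-2 L)`. -/
noncomputable def momentScale (N : ℕ) (L : ℝ) (k : ℕ) : ℝ :=
  6 * 4 ^ (k + 1) * (4 * L * (k + 1)) ^ k / Real.sqrt N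

/-- The bound is uniform for all `k < L`, since the fluctuation estimate needs moments up to order
about `log N`. -/
theorem eventually_eMoment_tail :
    ∀ᶠ x in regime, ∀ (Ω : Type u) [MeasurableSpace Ω] (P : Measure Ω) [IsProbabilityMeasure P]
      (θ : ℝ) (H : Ω → Matrix (Fin x.1) (Fin x.1) ℝ), CenteredEnsemble P θ H → θ ≤ 1 →
      ∀ k : ℕ, 1 ≤ k → (k + 1 : ℝ) ≤ x.2 →
      P.real {ω | momentScale x.1 x.2 k ≤ |eMoment (H ω) k - ∫ ω', eMoment (H ω') k ∂P|} ≤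
        Real.exp (-2 * x.2) := by
  filter_upwards [regime_le 4, regime_pow_le 6, regime_le_fst 1] with x hL hLN hN1
  intro Ω _ P _ θ H h hθ k hk hkL
  obtain ⟨N, L⟩ := x
  simp only at *
  have hL0 : 0 < L := by linarith
  have hN0 : 0 < N := by
    have : (0 : ℝ) < N := by linarith
    exact_mod_cast this
  -- An even order between `2 L` and `4 L`: the lower bound gives the probability, the upper bound
  -- the factor `4 L` in `momentScale`.
  set n := 2 * ⌈L⌉₊ with hn
  have hlow : 2 * L ≤ n := by
    rw [hn]; push_cast; linarith [Nat.le_ceil L]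
  have hup : (n : ℝ) ≤ 4 * L := by
    rw [hn]; push_cast; linarith [Nat.ceil_lt_add_one hL0.le]
  have hM : ((n * (k + 1) : ℕ) : ℝ) ≤ 4 * L * (k + 1) := by
    push_cast; gcongr
  have hMN : ((n * (k + 1) : ℕ) : ℝ) ≤ Real.sqrt N := by
    refine hM.trans (Real.le_sqrt_of_sq_le ?_)
    calc (4 * L * (k + 1)) ^ 2 ≤ (4 * L * L) ^ 2 := by gcongr
      _ = 4 * 4 * L ^ 4 := by ring
      _ ≤ L * L * L ^ 4 := by gcongr
      _ = L ^ 6 := by ring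
      _ ≤ N := hLN
  have hn0 : n ≠ 0 := by
    have : (0 : ℝ) < n := by linarith
    exact_mod_cast this.ne'
  have h1 := h.eMoment_tail hθ (even_two_mul _) hn0 hk hN0 hMN
  refine (measureReal_mono ?_ (measure_ne_top _ _)).trans
    (h1.trans (Real.exp_le_exp.2 (by linarith)))
  intro ω hω
  simp only [Set.mem_ofPred_eq] at hω ⊢
  refine le_trans ?_ hω
  rw [momentScale]
  gcongr

theorem eventually_momentScale_le (k : ℕ) {η : ℝ} (hη : 0 < η) :
    ∀ᶠ x in regime, momentScale x.1 x.2 k ≤ η := by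
  filter_upwards [regime_pow_le (2 * (k + 1)), regime_le (6 * 4 ^ (k + 1) * (4 * (k + 1)) ^ k / η),
    regime_le 1] with x h1 h2 h3
  have hs : x.2 ^ (k + 1) ≤ Real.sqrt x.1 := Real.le_sqrt_of_sq_le (by rw [← pow_mul, mul_comm]; exact h1)
  rw [div_le_iff₀ hη] at h2
  have hx : 0 < x.2 := by linarith
  rw [momentScale, div_le_iff₀ (lt_of_lt_of_le (by positivity) hs)]
  calc 6 * 4 ^ (k + 1) * (4 * x.2 * (k + 1)) ^ k
      = (6 * 4 ^ (k + 1) * (4 * (k + 1)) ^ k) * x.2 ^ k := by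
        rw [show 4 * x.2 * (k + 1) = (4 * (k + 1)) * x.2 by ring, mul_pow]; ring
    _ ≤ (x.2 * η) * x.2 ^ k := by gcongr
    _ = η * x.2 ^ (k + 1) := by ring
    _ ≤ _ := by gcongr

theorem aeval_cheb {R : Type*} [Ring R] [Algebra ℝ R] (T : R) (k : ℕ) :
    Polynomial.aeval T (cheb (Polynomial.X : Polynomial ℝ) k) = cheb T k := by
  have : Polynomial.aeval T (cheb (Polynomial.X : Polynomial ℝ) k) = cheb T k ∧
      Polynomial.aeval T (cheb (Polynomial.X : Polynomial ℝ) (k + 1)) = cheb T (k + 1) := by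
    induction k with
    | zero => simp [cheb]
    | succ k ih =>
      refine ⟨ih.2, ?_⟩
      rw [cheb, cheb, map_sub, map_mul, ih.1, ih.2, Polynomial.aeval_X]
  exact this.1

/-- Chebyshev forms are fixed linear combinations of moments. -/
theorem inner_cheb_eq_sum {N : ℕ} (H : Matrix (Fin N) (Fin N) ℝ) (k : ℕ) :
    inner ℝ (eVec N) (cheb (op H) k (eVec N)) =
      ∑ j ∈ Finset.range ((cheb (Polynomial.X : Polynomial ℝ) k).natDegree + 1),
        (cheb (Polynomial.X : Polynomial ℝ) k).coeff j * eMoment H j := by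
  rw [← aeval_cheb, Polynomial.aeval_eq_sum_range, _root_.sum_apply, inner_sum]
  refine Finset.sum_congr rfl fun j _ => ?_
  rw [_root_.smul_apply, real_inner_smul_right]
  rfl

/-- A hollow ensemble satisfying the quantitative assumptions of the regime. -/
structure IsHollowEnsemble {Ω : Type*} [MeasurableSpace Ω] (P : Measure Ω) (C : ℝ) {N : ℕ}
    (L θ : ℝ) (H : Ω → Matrix (Fin N) (Fin N) ℝ) : Prop where
  ensemble : CenteredEnsemble P θ H
  diag : ∀ ω i, H ω i i = 0
  pos : 0 < θ
  theta_le : θ * L ^ 3 ≤ C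
  pow_le : L ^ 3 ≤ C * Real.sqrt N
  row : ∀ v, |∑ u, ∫ ω, H ω v u ^ 2 ∂P - 1| ≤ 2 / N

theorem abs_nbSum_le {N : ℕ} {H : Matrix (Fin N) (Fin N) ℝ} {φ : Fin N → ℝ}
    (hH : ∀ i j, |H i j| ≤ 1) (hφ : ∀ i, |φ i| ≤ 1) (k : ℕ) (p v : Fin N) :
    |nbSum H φ k p v| ≤ (N : ℝ) ^ k := by
  induction k generalizing p v with
  | zero => simpa [nbSum] using hφ v
  | succ k ih =>
    rw [nbSum]
    refine (Finset.abs_sum_le_sum_abs _ _).trans ?_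
    have : ∀ u ∈ (Finset.univ : Finset (Fin N)),
        |if u = p ∨ u = v then 0 else H v u * nbSum H φ k v u| ≤ (N : ℝ) ^ k := by
      intro u _
      split_ifs
      · simp
      · rw [abs_mul]
        calc _ ≤ 1 * (N : ℝ) ^ k := mul_le_mul (hH _ _) (ih _ _) (abs_nonneg _) zero_le_one
          _ = _ := one_mul _
    refine (Finset.sum_le_sum this).trans (le_of_eq ?_)
    rw [Finset.sum_const, Finset.card_univ, Fintype.card_fin, nsmul_eq_mul, pow_succ']

theorem inner_nbVec_unitVec {N : ℕ} (H : Matrix (Fin N) (Fin N) ℝ) (k : ℕ) :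
    inner ℝ (eVec N) (nbVec H (unitVec N) k) = 1 / N * ∑ x, nbSum H (fun _ => 1) k x x := by
  have h : ∀ x, nbSum H (unitVec N) k x x = 1 / Real.sqrt N * nbSum H (fun _ => 1) k x x := by
    intro x
    rw [nbSum_eq_sum_single, nbSum_eq_sum_single (φ := fun _ => 1), Finset.mul_sum]
    simp [unitVec]
  rw [PiLp.inner_apply, Finset.mul_sum]
  refine Finset.sum_congr rfl fun x _ => ?_
  simp only [nbVec, eVec, h, unitVec, RCLike.inner_apply, conj_trivial]
  have : (1 : ℝ) / N = 1 / Real.sqrt N * (1 / Real.sqrt N) := by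
    rw [div_mul_div_comm, one_mul, Real.mul_self_sqrt (Nat.cast_nonneg N)]
  rw [this]; ring

theorem cheb_le_pow {y : ℝ} (hy : 2 ≤ y) (k : ℕ) : cheb y k ≤ y ^ k := by
  induction k using Nat.twoStepInduction with
  | zero => simp [cheb]
  | one => simp [cheb]
  | more k _ ih =>
    rw [cheb, pow_succ']
    have h1 := (cheb_mono hy le_rfl k).1
    have h2 : y * cheb y (k + 1) ≤ y * y ^ (k + 1) := mul_le_mul_of_nonneg_left ih (by linarith)
    linarith

/-- Passes from typical events to expectations. In its uses `D` is a crude power of `N` and `p` is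
exponentially small in `L`, so the bad event does not matter. -/
theorem integral_abs_le_of_tail {Ω : Type*} [MeasurableSpace Ω] {P : Measure Ω}
    [IsProbabilityMeasure P] {Z g : Ω → ℝ} (hZ : Integrable Z P) (hg : Integrable g P)
    (hg0 : ∀ ω, 0 ≤ g ω) {D p : ℝ} (hD : ∀ ω, |Z ω| ≤ D) (hD0 : 0 ≤ D)
    (hp : P.real {ω | g ω < |Z ω|} ≤ p) : ∫ ω, |Z ω| ∂P ≤ ∫ ω, g ω ∂P + D * p := by
  set S := {ω | g ω < |Z ω|} with hS
  have hSm : NullMeasurableSet S P := nullMeasurableSet_lt hg.aemeasurable hZ.abs.aemeasurable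
  have hind : Integrable (S.indicator fun _ => D) P :=
    (integrable_const D).indicator₀ hSm
  have h1 : ∀ ω, |Z ω| ≤ g ω + S.indicator (fun _ => D) ω := by
    intro ω
    by_cases h : ω ∈ S
    · rw [Set.indicator_of_mem h]; linarith [hD ω, hg0 ω]
    · rw [Set.indicator_of_notMem h, add_zero]
      exact not_lt.1 h
  calc ∫ ω, |Z ω| ∂P ≤ ∫ ω, (g ω + S.indicator (fun _ => D) ω) ∂P :=
        integral_mono hZ.abs (hg.add hind) h1
    _ = ∫ ω, g ω ∂P + D * P.real S := by
        rw [integral_add hg hind, integral_indicator₀ hSm]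
        simp [mul_comm]
    _ ≤ _ := by gcongr

theorem CenteredEnsemble.integrable_inner_cheb {Ω : Type*} [MeasurableSpace Ω] {P : Measure Ω}
    [IsProbabilityMeasure P] {N : ℕ} {θ : ℝ} {H : Ω → Matrix (Fin N) (Fin N) ℝ}
    (h : CenteredEnsemble P θ H) (k : ℕ) :
    Integrable (fun ω => inner ℝ (eVec N) (cheb (op (H ω)) k (eVec N))) P := by
  simp only [inner_cheb_eq_sum]
  exact integrable_finsetSum _ fun j _ => (h.integrable_eMoment j).const_mul _

-- On the event of bounded norm and good rows, the Chebyshev form is close to the nonbacktracking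
-- form, whose mean is `O(1 / √N)` for fixed `k`. Off this event both are at most a power of `N`.
set_option maxHeartbeats 1000000 in
theorem eventually_abs_integral_cheb_le {C η : ℝ} (hC : 0 < C) (hη : 0 < η) {k : ℕ} (hk : 1 ≤ k) :
    ∀ᶠ x in regime, ∀ (Ω : Type u) [MeasurableSpace Ω] (P : Measure Ω) [IsProbabilityMeasure P]
      (θ : ℝ) (H : Ω → Matrix (Fin x.1) (Fin x.1) ℝ), IsHollowEnsemble P C x.2 θ H →
      |∫ ω, inner ℝ (eVec x.1) (cheb (op (H ω)) k (eVec x.1)) ∂P| ≤ η := by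
  -- Chosen so that the norm bound `3` of the typical event is `a + a⁻¹`.
  obtain ⟨a, ha0, haeq⟩ := exists_add_inv_eq (show (2 : ℝ) ≤ 3 by norm_num)
  have ha1 : 1 < a := by
    rcases ha0.lt_or_eq with h | h
    · exact h
    · subst h; norm_num at haeq
  set G : ℝ := (1 - (a⁻¹) ^ 2)⁻¹ with hG
  have hG1 : 1 ≤ G := by
    have h1 : a⁻¹ < 1 := inv_lt_one_of_one_lt₀ ha1
    have h2 : 0 < a⁻¹ := by positivity
    rw [hG, one_le_inv₀ (by nlinarith)]
    nlinarith
  have hk0 : (0 : ℝ) < k := by exact_mod_cast hk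
  have hk1 : (1 : ℝ) ≤ k := by exact_mod_cast hk
  set M : ℝ := 4 * G ^ 2 * k * (1 + 8 * C) * (a ^ k + 1) with hM
  have hM0 : 0 < M := by positivity
  filter_upwards [regime_le 4, regime_le_fst 4, eventually_norm_tail.{u} hC one_pos,
    regime_pow_le 6, regime_le M, regime_le (M / (η / 2)), regime_le (16 * k ^ 2 * C),
    regime_le (20 * k ^ 2 * C), regime_le (2 * C), regime_le (2 ^ k * k * C / (η / 4)),
    regime_rpow_mul_exp_le (2 * k : ℕ) (show (1 / 2 : ℝ) < 1 by norm_num),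
    regime_const_mul_exp_le (4 / (η / 4)) (show (0 : ℝ) < 1 / 2 by norm_num)]
    with x hL4 hN4 htail hLN hLM hLMη hLg1 hLg2 hLC hLη hexp1 hexp2
  intro Ω _ P _ θ H h
  obtain ⟨ht1, ht2⟩ := htail Ω P θ H h.ensemble h.diag h.pos h.theta_le h.pow_le h.row
  obtain ⟨h, hd, hθ0, hθC, hLC', hrow⟩ := h
  obtain ⟨N, L⟩ := x
  simp only at *
  have hL0 : 0 < L := by linarith
  have hN0 : (0 : ℝ) < N := by linarith
  have : NeZero N := ⟨by rintro rfl; simp at hN0⟩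
  set r := Real.sqrt N with hr
  have hr0 : 0 < r := Real.sqrt_pos.2 hN0
  have hLL3 : L ≤ L ^ 3 := le_self_pow₀ (by linarith only [hL4]) (by norm_num)
  have hθL : θ ≤ C / L := by
    rw [le_div_iff₀ hL0]
    exact (mul_le_mul_of_nonneg_left hLL3 hθ0.le).trans hθC
  have hrL : L ^ 3 / C ≤ r := by rw [div_le_iff₀ hC]; linarith only [hLC']
  have hrL' : 1 / r ≤ C / L := by
    rw [div_le_div_iff₀ hr0 hL0]; linarith only [hLC', hLL3]
  have hθ12 : θ ≤ 1 / 2 := by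
    refine hθL.trans ?_
    rw [div_le_iff₀ hL0]; linarith only [hLC]
  set ε := 1 / (L * Real.sqrt L) with hε
  have hε0 : 0 ≤ ε := by positivity
  have hεL : ε ≤ 1 / L := by
    rw [hε]
    refine div_le_div_of_nonneg_left zero_le_one hL0 ?_
    have : 1 ≤ Real.sqrt L := Real.le_sqrt_of_sq_le (by linarith only [hL4])
    nlinarith only [this, hL0]
  have hε1 : ε ≤ 1 := hεL.trans (by rw [div_le_one hL0]; linarith only [hL4])
  have hsum : ε + 8 * θ ≤ (1 + 8 * C) / L := by
    rw [add_div, mul_div_assoc]; linarith only [hεL, hθL]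
  have hl : 4 * G ^ 2 * k * (ε + 8 * θ) ≤ 1 := by
    calc 4 * G ^ 2 * k * (ε + 8 * θ) ≤ 4 * G ^ 2 * k * ((1 + 8 * C) / L) := by gcongr
      _ = 4 * G ^ 2 * k * (1 + 8 * C) * 1 / L := by ring
      _ ≤ 4 * G ^ 2 * k * (1 + 8 * C) * (a ^ k + 1) / L := by
        gcongr; linarith [pow_pos (by linarith : 0 < a) k]
      _ ≤ 1 := (div_le_one hL0).2 hLM
  have hNk : ((k : ℕ) : ℝ) ≤ r := by
    have : 1 / L ≤ 1 := by rw [div_le_one hL0]; linarith only [hL4]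
    refine le_trans ?_ hrL
    rw [le_div_iff₀ hC]
    have e1 : (k : ℝ) * C ≤ 16 * k ^ 2 * C := by
      have : (k : ℝ) ≤ 16 * k ^ 2 := by nlinarith only [hk1]
      exact mul_le_mul_of_nonneg_right this hC.le
    linarith only [e1, hLg1, hLL3]
  -- the nonbacktracking form
  set A : Ω → ℝ := fun ω => inner ℝ (eVec N) (cheb (op (H ω)) k (eVec N)) with hA
  set B : Ω → ℝ := fun ω => inner ℝ (eVec N) (nbVec (H ω) (unitVec N) k) with hB
  have hBint : Integrable B P := by
    simp only [hB, inner_nbVec_unitVec]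
    exact (integrable_finsetSum _ fun v _ => h.integrable_nbSum _ k v v).const_mul _
  have hAint : Integrable A P := h.integrable_inner_cheb k
  have hBmean : |∫ ω, B ω ∂P| ≤ η / 4 := by
    have e1 : ∀ v, |∫ ω, nbSum (H ω) (fun _ => 1) k v v ∂P| ≤ 2 ^ k * (k / r) := by
      intro v
      refine (h.abs_integral_nbSum_le hk hNk (φ := fun _ => 1) (by simp) v).trans ?_
      have hg0 := one_le_growth (N := N) hθ0.le k
      have : growth N θ k ≤ 2 := by
        have e1 : 4 * (k : ℝ) ^ 2 * θ ≤ 4 * (k : ℝ) ^ 2 * (C / L) := by gcongr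
        have e2 : 4 * (k : ℝ) ^ 2 * (C / L) ≤ 1 / 4 := by
          rw [← mul_div_assoc, div_le_iff₀ hL0]; linarith only [hLg1]
        have e3 : 10 * (k : ℝ) ^ 2 / r ≤ 10 * k ^ 2 * (C / L) := by
          rw [div_eq_mul_one_div]; gcongr
        have e4 : 10 * (k : ℝ) ^ 2 * (C / L) ≤ 1 / 2 := by
          rw [← mul_div_assoc, div_le_iff₀ hL0]; linarith only [hLg2]
        rw [growth]; linarith only [e1, e2, e3, e4]
      gcongr
    have e2 : ∫ ω, B ω ∂P = 1 / N * ∑ v, ∫ ω, nbSum (H ω) (fun _ => 1) k v v ∂P := by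
      simp only [hB, inner_nbVec_unitVec]
      rw [integral_const_mul, integral_finsetSum _ fun v _ => h.integrable_nbSum _ k v v]
    rw [e2, abs_mul, abs_of_pos (by positivity)]
    calc 1 / (N : ℝ) * |∑ v, ∫ ω, nbSum (H ω) (fun _ => 1) k v v ∂P|
        ≤ 1 / (N : ℝ) * ∑ v : Fin N, 2 ^ k * (k / r) := by
          gcongr
          exact (Finset.abs_sum_le_sum_abs _ _).trans (Finset.sum_le_sum fun v _ => e1 v)
      _ = 2 ^ k * k * (1 / r) := by
          rw [Finset.sum_const, Finset.card_univ, Fintype.card_fin, nsmul_eq_mul]; field_simp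
      _ ≤ 2 ^ k * k * (C / L) := by gcongr
      _ ≤ η / 4 := by
          rw [div_le_iff₀ (by positivity)] at hLη
          rw [← mul_div_assoc, div_le_iff₀ hL0]; linarith only [hLη]
  -- comparison
  have hnb0 : ∀ ω, nbVec (H ω) (unitVec N) 0 = eVec N := fun ω => rfl
  have hgood : ∀ ω, ‖op (H ω)‖ ≤ 3 → RowsGood (H ω) ε → |A ω - B ω| ≤ η / 4 := by
    intro ω h1 h2
    have hH : (H ω).IsHermitian := Matrix.IsHermitian.ext fun i j => h.symm ω j i
    have h3 := norm_nbVec_sub_cheb_le (φ := unitVec N) (h.symm ω) (hd ω) hθ0.le hθ12 (h.bound ω)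
      hε0 hε1 h2 ha0 hG1 (fun j => (norm_cheb_op_le_cheb hH (by norm_num) h1 j).trans
        (by rw [← haeq]; exact (cheb_le ha1 j).trans_eq (mul_comm _ _)))
      hl (by rw [hnb0, norm_eVec]) le_rfl
    have h4 : |A ω - B ω| ≤ ‖nbVec (H ω) (unitVec N) k - cheb (op (H ω)) k (eVec N)‖ := by
      have := abs_real_inner_le_norm (eVec N)
        (nbVec (H ω) (unitVec N) k - cheb (op (H ω)) k (eVec N))
      rw [norm_eVec, one_mul, inner_sub_right] at this
      rw [abs_sub_comm]; exact this
    rw [hnb0] at h3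
    refine h4.trans (h3.trans ?_)
    calc 2 * G ^ 2 * k * (ε + 8 * θ) * a ^ k ≤ 2 * G ^ 2 * k * ((1 + 8 * C) / L) * (a ^ k + 1) := by
          gcongr; linarith
      _ = M / 2 / L := by rw [hM]; ring
      _ ≤ η / 4 := by
        rw [div_le_iff₀ (by positivity)] at hLMη
        rw [div_le_iff₀ hL0]; linarith only [hLMη]
  have hcrude : ∀ ω, |A ω - B ω| ≤ 2 * (N : ℝ) ^ (2 * k) := by
    intro ω
    have hH : (H ω).IsHermitian := Matrix.IsHermitian.ext fun i j => h.symm ω j i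
    have hb1 : ∀ i j, |H ω i j| ≤ 1 := fun i j => (h.bound ω i j).trans (by linarith)
    have h1 : ‖op (H ω)‖ ≤ (N : ℝ) ^ 2 := by simpa using norm_op_le_of_abs_le hb1
    have h2 : |A ω| ≤ (N : ℝ) ^ (2 * k) := by
      have e1 := abs_real_inner_le_norm (eVec N) (cheb (op (H ω)) k (eVec N))
      have e2 := (cheb (op (H ω)) k).le_opNorm (eVec N)
      have hN2 : (2 : ℝ) ≤ (N : ℝ) ^ 2 := by nlinarith only [hN4]
      have e3 := (norm_cheb_op_le_cheb hH hN2 h1 k).trans (cheb_le_pow hN2 k)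
      rw [norm_eVec, one_mul] at e1
      rw [norm_eVec, mul_one] at e2
      rw [← pow_mul] at e3
      exact e1.trans (e2.trans e3)
    have h3 : |B ω| ≤ (N : ℝ) ^ (2 * k) := by
      simp only [hB, inner_nbVec_unitVec]
      rw [abs_mul, abs_of_pos (by positivity)]
      calc 1 / (N : ℝ) * |∑ v, nbSum (H ω) (fun _ => 1) k v v|
          ≤ 1 / (N : ℝ) * ∑ v : Fin N, (N : ℝ) ^ k := by
            gcongr
            exact (Finset.abs_sum_le_sum_abs _ _).trans
              (Finset.sum_le_sum fun v _ => abs_nbSum_le hb1 (by simp) k v v)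
        _ = (N : ℝ) ^ k := by
            rw [Finset.sum_const, Finset.card_univ, Fintype.card_fin, nsmul_eq_mul]; field_simp
        _ ≤ _ := pow_le_pow_right₀ (by linarith only [hN4]) (by omega)
    linarith only [abs_sub (A ω) (B ω), h2, h3]
  have hbad : P.real {ω | η / 4 < |A ω - B ω|} ≤ 2 * Real.exp (-L) := by
    have hsub : {ω | η / 4 < |A ω - B ω|} ⊆
        {ω | 2 + 1 ≤ ‖op (H ω)‖} ∪ {ω | ¬ RowsGood (H ω) ε} := by
      intro ω hω
      simp only [Set.mem_ofPred_eq, Set.mem_union] at hω ⊢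
      by_contra! hcon
      exact absurd (hgood ω (by linarith [hcon.1]) hcon.2) (not_le.2 hω)
    refine (measureReal_mono hsub (measure_ne_top _ _)).trans ((measureReal_union_le _ _).trans ?_)
    linarith
  have hAB := integral_abs_le_of_tail (hAint.sub hBint) (integrable_const (η / 4))
    (fun _ => by positivity) hcrude (by positivity) hbad
  have hfin : 2 * (N : ℝ) ^ (2 * k) * (2 * Real.exp (-L)) ≤ η / 4 := by
    rw [Real.rpow_natCast] at hexp1
    simp only [neg_mul, one_mul, zero_mul, neg_zero, Real.exp_zero] at hexp1 hexp2
    rw [div_mul_eq_mul_div, div_le_iff₀ (by positivity)] at hexp2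
    linarith only [hexp1, hexp2]
  have e1 : |∫ ω, (A ω - B ω) ∂P| ≤ ∫ ω, |A ω - B ω| ∂P := abs_integral_le_integral_abs
  rw [integral_sub hAint hBint] at e1
  have e2 := abs_sub_abs_le_abs_sub (∫ ω, A ω ∂P) (∫ ω, B ω ∂P)
  have e3 : ∫ ω, |A ω - B ω| ∂P ≤ η / 4 + 2 * (N : ℝ) ^ (2 * k) * (2 * Real.exp (-L)) := by
    simpa using hAB
  linarith only [e1, e2, e3, hfin, hBmean, hη]

/-- The mean is already small, and the centred form is a combination of finitely many centred
moments with coefficients independent of `N`, each of which concentrates. -/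
theorem eventually_cheb_tail {C η : ℝ} (hC : 0 < C) (hη : 0 < η) {k : ℕ} (hk : 1 ≤ k) :
    ∀ᶠ x in regime, ∀ (Ω : Type u) [MeasurableSpace Ω] (P : Measure Ω) [IsProbabilityMeasure P]
      (θ : ℝ) (H : Ω → Matrix (Fin x.1) (Fin x.1) ℝ), IsHollowEnsemble P C x.2 θ H →
      P.real {ω | η ≤ |inner ℝ (eVec x.1) (cheb (op (H ω)) k (eVec x.1))|} ≤ Real.exp (-x.2) := by
  set p := cheb (Polynomial.X : Polynomial ℝ) k with hp
  set d := p.natDegree with hd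
  set S : ℝ := ∑ j ∈ Finset.range (d + 1), |p.coeff j| with hS
  have hS0 : 0 ≤ S := Finset.sum_nonneg fun _ _ => abs_nonneg _
  have hη' : 0 < η / (4 * (S + 1)) := by positivity
  have hsc : ∀ᶠ x in regime, ∀ j ∈ Finset.range (d + 1), momentScale x.1 x.2 j ≤ η / (4 * (S + 1)) :=
    (Filter.eventually_all_finset _).2 fun j _ => eventually_momentScale_le j hη'
  filter_upwards [eventually_abs_integral_cheb_le.{u} hC (half_pos hη) hk, hsc,
    eventually_eMoment_tail.{u}, regime_le (d + 1), regime_le_fst 1, regime_le 4, regime_le C,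
    regime_const_mul_exp_le (d + 1) (show (1 : ℝ) < 2 by norm_num)]
    with x hmean hsc htail hdL hN1 hL4 hLC hexp
  intro Ω _ P _ θ H h
  have hm := hmean Ω P θ H h
  obtain ⟨N, L⟩ := x
  simp only at *
  have hL0 : 0 < L := by linarith
  have hN0 : (0 : ℝ) < N := by linarith
  have : NeZero N := ⟨by rintro rfl; simp at hN0⟩
  have hθ1 : θ ≤ 1 := by
    have h1 : θ * L ≤ θ * L ^ 3 :=
      mul_le_mul_of_nonneg_left (le_self_pow₀ (by linarith) (by norm_num)) h.pos.le
    by_contra! hcon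
    nlinarith [h.theta_le]
  set Y : ℕ → Ω → ℝ := fun j ω => eMoment (H ω) j - ∫ ω', eMoment (H ω') j ∂P with hY
  have hsub : {ω | η ≤ |inner ℝ (eVec N) (cheb (op (H ω)) k (eVec N))|} ⊆
      ⋃ j ∈ Finset.Icc 1 d, {ω | momentScale N L j ≤ |Y j ω|} := by
    intro ω hω
    by_contra hcon
    simp only [Set.mem_iUnion, Set.mem_ofPred_eq, not_exists, not_le, Finset.mem_Icc] at hcon hω
    have e1 : inner ℝ (eVec N) (cheb (op (H ω)) k (eVec N)) -
        ∫ ω', inner ℝ (eVec N) (cheb (op (H ω')) k (eVec N)) ∂P =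
          ∑ j ∈ Finset.range (d + 1), p.coeff j * Y j ω := by
      simp only [inner_cheb_eq_sum]
      rw [integral_finsetSum _ fun j _ => (h.ensemble.integrable_eMoment j).const_mul _,
        ← Finset.sum_sub_distrib]
      refine Finset.sum_congr rfl fun j _ => ?_
      rw [integral_const_mul, hY, mul_sub]
    have e2 : |∑ j ∈ Finset.range (d + 1), p.coeff j * Y j ω| ≤ η / 4 := by
      refine (Finset.abs_sum_le_sum_abs _ _).trans ?_
      have : ∀ j ∈ Finset.range (d + 1), |p.coeff j * Y j ω| ≤ |p.coeff j| * (η / (4 * (S + 1))) := by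
        intro j hj
        rw [abs_mul]
        refine mul_le_mul_of_nonneg_left ?_ (abs_nonneg _)
        rcases Nat.eq_zero_or_pos j with rfl | hj0
        · simp only [hY, eMoment_zero]; simpa using hη'.le
        · exact (hcon j ⟨hj0, by have := Finset.mem_range.1 hj; omega⟩).le.trans (hsc j hj)
      refine (Finset.sum_le_sum this).trans ?_
      rw [← Finset.sum_mul, ← hS, mul_div_assoc', div_le_div_iff₀ (by positivity) (by norm_num)]
      nlinarith
    rw [← e1] at e2
    have e3 := abs_sub_abs_le_abs_sub (inner ℝ (eVec N) (cheb (op (H ω)) k (eVec N)))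
      (∫ ω', inner ℝ (eVec N) (cheb (op (H ω')) k (eVec N)) ∂P)
    linarith
  refine (measureReal_mono hsub (measure_ne_top _ _)).trans
    ((measureReal_biUnion_finset_le _ _).trans ?_)
  refine (Finset.sum_le_sum (g := fun _ => Real.exp (-2 * L)) fun j hj => ?_).trans ?_
  · rw [Finset.mem_Icc] at hj
    refine htail Ω P θ H h.ensemble hθ1 j hj.1 ?_
    have : (j : ℝ) ≤ d := by exact_mod_cast hj.2
    linarith
  · rw [Finset.sum_const, Nat.card_Icc, nsmul_eq_mul]
    rw [neg_one_mul] at hexp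
    refine le_trans ?_ hexp
    gcongr
    simp


/-! ### Typical events and the position of the top eigenvalue -/

/-- A symmetric random matrix `H` with bounded approximations `F` and `G`, at the scales of the
regime. -/
structure IsRegular {Ω : Type*} [MeasurableSpace Ω] (P : Measure Ω) (C : ℝ) {N : ℕ}
    (L q θ : ℝ) (H F G : Ω → Matrix (Fin N) (Fin N) ℝ) : Prop where
  measurable : ∀ i j, Measurable fun ω => H ω i j
  symm : ∀ ω i j, H ω i j = H ω j i
  q_lower : L ^ 3 ≤ q
  q_upper : q ≤ C * Real.sqrt N
  theta_pos : 0 < θ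
  theta_le : θ * q ≤ C
  approx : IsApproximation P θ (Real.exp (-L)) H F G

theorem norm_op_sub_le_sum {N : ℕ} (A B : Matrix (Fin N) (Fin N) ℝ) :
    ‖op (A - B)‖ ≤ ∑ i, ∑ j, |A i j - B i j| := norm_op_le_sum _

variable {Ω : Type*} [MeasurableSpace Ω] {P : Measure Ω} {N : ℕ} {C L q θ : ℝ}
  {H F G : Ω → Matrix (Fin N) (Fin N) ℝ}

theorem IsRegular.isHollowEnsemble (h : IsRegular P C L q θ H F G) : IsHollowEnsemble P C L θ G where
  ensemble := h.approx.hollow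
  diag := h.approx.diag
  pos := h.theta_pos
  theta_le := (mul_le_mul_of_nonneg_left h.q_lower h.theta_pos.le).trans h.theta_le
  pow_le := h.q_lower.trans h.q_upper
  row := h.approx.hollow_row

theorem IsRegular.isHermitian (h : IsRegular P C L q θ H F G) (ω : Ω) : (H ω).IsHermitian :=
  Matrix.IsHermitian.ext fun i j => h.symm ω j i

theorem IsRegular.isHermitian_full (h : IsRegular P C L q θ H F G) (ω : Ω) : (F ω).IsHermitian :=
  Matrix.IsHermitian.ext fun i j => h.approx.full.symm ω j i

theorem IsRegular.isHermitian_hollow (h : IsRegular P C L q θ H F G) (ω : Ω) :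
    (G ω).IsHermitian :=
  Matrix.IsHermitian.ext fun i j => h.approx.hollow.symm ω j i

theorem IsRegular.theta_mul_le (h : IsRegular P C L q θ H F G) (hL : 1 ≤ L) : θ * L ≤ C :=
  (mul_le_mul_of_nonneg_left ((le_self_pow₀ hL (by norm_num)).trans h.q_lower)
    h.theta_pos.le).trans h.theta_le

/-- With `a = 1 + ε₀ / 2` the norm is typically below `a + a⁻¹`, which leaves a fixed gap `γ` to `f
+ f⁻¹` and a convergent Chebyshev series. Its length `m` depends only on `η` and `ε₀`, so finitely
many forms have to be controlled. The passage from `G` to `F` to `H` costs `θ` and `exp (-L)`. -/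
theorem eventually_weak_position {C ε₀ η : ℝ} (hC : 0 < C) (hε₀ : 0 < ε₀) (hη : 0 < η) :
    ∀ᶠ x in regime, ∀ (Ω : Type u) [MeasurableSpace Ω] (P : Measure Ω) [IsProbabilityMeasure P]
      (q θ f : ℝ) (H F G : Ω → Matrix (Fin x.1) (Fin x.1) ℝ),
      IsRegular P C x.2 q θ H F G → 1 + ε₀ ≤ f →
      P.real {ω | η < |maxEigenvalue (perturbed f (H ω)) - (f + 1 / f)|} ≤
        Real.exp (-(1 / 2) * x.2) := by
  set a : ℝ := 1 + ε₀ / 2 with ha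
  set b : ℝ := 1 + ε₀ with hb
  have ha1 : 1 < a := by rw [ha]; linarith
  have hab : a < b := by rw [ha, hb]; linarith
  have ha0 : 0 < a := by linarith
  have hb0 : 0 < b := by linarith
  have hmono : ∀ s t : ℝ, 1 ≤ s → s ≤ t → s + s⁻¹ ≤ t + t⁻¹ := by
    intro s t hs hst
    have hs0 : 0 < s := by linarith
    have ht0 : 0 < t := by linarith
    have e : t + t⁻¹ - (s + s⁻¹) = (t - s) * (1 - (s * t)⁻¹) := by field_simp; ring
    have e2 : (s * t)⁻¹ ≤ 1 := inv_le_one_of_one_le₀ (by nlinarith)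
    nlinarith [mul_nonneg (sub_nonneg.2 hst) (sub_nonneg.2 e2)]
  set γ : ℝ := b + b⁻¹ - (a + a⁻¹) with hγ
  have hγ0 : 0 < γ := by
    have e : b + b⁻¹ - (a + a⁻¹) = (b - a) * (1 - (a * b)⁻¹) := by field_simp; ring
    have e2 : (a * b)⁻¹ < 1 := inv_lt_one_of_one_lt₀ (by nlinarith)
    rw [hγ, e]
    exact mul_pos (by linarith) (by linarith)
  have hρ2 : 0 < a + a⁻¹ - 2 := by
    have : a + a⁻¹ - 2 = (a - 1) ^ 2 / a := by field_simp; ring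
    rw [this]
    have : 0 < a - 1 := by linarith
    positivity
  set G₀ : ℝ := (1 - (a⁻¹) ^ 2)⁻¹ with hG
  have hG0 : 0 ≤ G₀ := by
    have h1 : a⁻¹ < 1 := inv_lt_one_of_one_lt₀ ha1
    have h2 : 0 < a⁻¹ := by positivity
    exact inv_nonneg.2 (by nlinarith)
  set M : ℝ := 4 * G₀ * a + 2 * G₀ * a ^ 2 / γ with hM
  have hM0 : 0 ≤ M := by positivity
  have hr : Tendsto (fun m : ℕ => M * (a / b) ^ m) atTop (𝓝 (M * 0)) :=
    (tendsto_pow_atTop_nhds_zero_of_lt_one (by positivity)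
      ((div_lt_one hb0).2 hab)).const_mul M
  rw [mul_zero] at hr
  obtain ⟨m, hm⟩ := (hr.eventually_lt_const (show (0 : ℝ) < η / 4 by positivity)).exists
  set η₁ : ℝ := min (ε₀ / 2) (η * ε₀ / (8 * b)) with hη₁
  have hη₁0 : 0 < η₁ := lt_min (by positivity) (by positivity)
  have hη₁a : 2 * η₁ ≤ ε₀ := by linarith [min_le_left (ε₀ / 2) (η * ε₀ / (8 * b))]
  have hη₁b : 2 * η₁ * b / ε₀ ≤ η / 4 := by
    have := min_le_right (ε₀ / 2) (η * ε₀ / (8 * b))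
    rw [← hη₁, le_div_iff₀ (by positivity)] at this
    rw [div_le_iff₀ hε₀]; linarith
  have hcheb : ∀ᶠ x in regime, ∀ k ∈ Finset.Icc 1 (m + 1), ∀ (Ω : Type u) [MeasurableSpace Ω]
      (P : Measure Ω) [IsProbabilityMeasure P]
      (θ : ℝ) (H : Ω → Matrix (Fin x.1) (Fin x.1) ℝ), IsHollowEnsemble P C x.2 θ H →
      P.real {ω | η₁ ≤ |inner ℝ (eVec x.1) (cheb (op (H ω)) k (eVec x.1))|} ≤ Real.exp (-x.2) :=
    (Filter.eventually_all_finset _).2 fun k hk =>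
      eventually_cheb_tail hC hη₁0 (Finset.mem_Icc.1 hk).1
  filter_upwards [hcheb, eventually_norm_tail.{u} hC hρ2, regime_le 1, regime_le_fst 1,
    regime_le (C / (η / 4)), regime_const_mul_exp_le (m + 3) (show (1 / 2 : ℝ) < 1 by norm_num),
    regime_const_mul_exp_le (4 / η) (show (0 : ℝ) < 1 by norm_num)]
    with x hcheb hnorm hL1 hN1 hLC hexp hexpη
  intro Ω _ P _ q θ f H F G h hf
  obtain ⟨N, L⟩ := x
  simp only [neg_mul, one_mul, zero_mul, neg_zero, Real.exp_zero] at *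
  have hN0 : (0 : ℝ) < N := by linarith
  have : NeZero N := ⟨by rintro rfl; simp at hN0⟩
  have hE := h.isHollowEnsemble
  obtain ⟨hn, -⟩ := hnorm Ω P θ G hE.ensemble hE.diag hE.pos hE.theta_le hE.pow_le hE.row
  have hθη : θ ≤ η / 4 := by
    have h1 := h.theta_mul_le hL1
    rw [div_le_iff₀ (by positivity)] at hLC
    by_contra! hcon
    nlinarith
  have hτη : Real.exp (-L) ≤ η / 4 := by
    rw [div_mul_eq_mul_div, div_le_one hη] at hexpη
    linarith
  have hsub : {ω | η < |maxEigenvalue (perturbed f (H ω)) - (f + 1 / f)|} ⊆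
      ({ω | Real.exp (-L) < ∑ i, ∑ j, |H ω i j - F ω i j|} ∪
        {ω | 2 + (a + a⁻¹ - 2) ≤ ‖op (G ω)‖}) ∪
      ⋃ k ∈ Finset.Icc 1 (m + 1),
        {ω | η₁ ≤ |inner ℝ (eVec N) (cheb (op (G ω)) k (eVec N))|} := by
    intro ω hω
    by_contra hcon
    simp only [Set.mem_union, Set.mem_iUnion, Set.mem_ofPred_eq, not_or, not_exists, not_le,
      not_lt, Finset.mem_Icc] at hcon hω
    obtain ⟨⟨h1, h2⟩, h3⟩ := hcon
    have h2' : ‖op (G ω)‖ ≤ a + a⁻¹ := by linarith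
    have w1 := weak_expansion (h.isHermitian_hollow ω) hε₀ hf ha1.le hab.le hG0
      (fun k => (norm_cheb_op_le_cheb (h.isHermitian_hollow ω) (two_le_add_inv ha0) h2' k).trans
        ((cheb_le ha1 k).trans_eq (mul_comm _ _))) h2' hγ0
      (by have := hmono b f (by linarith) hf; rw [hγ]; linarith) hη₁0.le hη₁a
      (m := m) fun k hk1 hk2 => (h3 k ⟨hk1, hk2⟩).le
    have w2 := abs_maxEigenvalue_perturbed_sub_le (h.isHermitian_full ω) (h.isHermitian_hollow ω) f
    have w3 := abs_maxEigenvalue_perturbed_sub_le (h.isHermitian ω) (h.isHermitian_full ω) f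
    have w4 := h.approx.near_hollow ω
    have w5 := norm_op_sub_le_sum (H ω) (F ω)
    rw [← hb, ← hM] at w1
    rw [one_div] at hω
    rw [lt_abs] at hω
    rw [abs_le] at w1 w2 w3
    rcases hω with hω | hω
    · linarith [w1.2, w2.2, w3.2]
    · linarith [w1.1, w2.1, w3.1]
  refine (measureReal_mono hsub (measure_ne_top _ _)).trans ((measureReal_union_le _ _).trans ?_)
  have e1 := measureReal_union_le (μ := P) {ω | Real.exp (-L) < ∑ i, ∑ j, |H ω i j - F ω i j|}
    {ω | 2 + (a + a⁻¹ - 2) ≤ ‖op (G ω)‖}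
  have e2 : P.real (⋃ k ∈ Finset.Icc 1 (m + 1),
      {ω | η₁ ≤ |inner ℝ (eVec N) (cheb (op (G ω)) k (eVec N))|}) ≤ (m + 1) * Real.exp (-L) := by
    refine (measureReal_biUnion_finset_le _ _).trans ?_
    refine (Finset.sum_le_sum (g := fun _ => Real.exp (-L)) fun k hk => hcheb k hk Ω P θ G hE).trans ?_
    simp
  have e3 := h.approx.tail
  linarith

/-- The deterministic information available on a typical event. -/
structure IsTypical {N : ℕ} (L θ : ℝ) (H F : Matrix (Fin N) (Fin N) ℝ) : Prop where
  norm_le : ‖op H‖ ≤ 3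
  norm_full_le : ‖op F‖ ≤ 3
  near : ‖op (H - F)‖ ≤ Real.exp (-L)
  one : |eMoment F 1| ≤ momentScale N L 1
  two : |eMoment F 2 - 1| ≤ 1 / N + momentScale N L 2
  three : |eMoment F 3| ≤ θ + momentScale N L 3

theorem IsApproximation.abs_integral_eMoment_two_sub_one_le [IsProbabilityMeasure P] [NeZero N]
    {τ : ℝ} (h : IsApproximation P θ τ H F G) : |∫ ω, eMoment (F ω) 2 ∂P - 1| ≤ 1 / N := by
  have hN : (N : ℝ) ≠ 0 := Nat.cast_ne_zero.2 (NeZero.ne N)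
  have hN0 : (0 : ℝ) < N := by positivity
  rw [h.full.integral_eMoment_two]
  have h1 : ∑ i, ∑ j, ∫ ω, F ω i j ^ 2 ∂P ≤ ∑ i : Fin N, ∑ j : Fin N, 1 / (N : ℝ) :=
    Finset.sum_le_sum fun i _ => Finset.sum_le_sum fun j _ => h.full.second_le i j
  have h2 : ∑ i : Fin N, ∑ j : Fin N, (1 / (N : ℝ) - 1 / N ^ 2) ≤ ∑ i, ∑ j, ∫ ω, F ω i j ^ 2 ∂P :=
    Finset.sum_le_sum fun i _ => Finset.sum_le_sum fun j _ => h.full_var i j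
  simp only [Finset.sum_const, Finset.card_univ, Fintype.card_fin, nsmul_eq_mul] at h1 h2
  have e1 : (N : ℝ) * (N * (1 / N)) = N := by field_simp
  have e2 : (N : ℝ) * (N * (1 / N - 1 / N ^ 2)) = N - 1 := by field_simp
  rw [e1] at h1
  rw [e2] at h2
  rw [abs_le]
  constructor
  · calc -(1 / (N : ℝ)) = 1 / N * (N - 1) - 1 := by field_simp; ring
      _ ≤ _ := by gcongr
  · calc _ ≤ 1 / (N : ℝ) * N - 1 := by gcongr
      _ = 0 := by field_simp; ring
      _ ≤ _ := by positivity

/-- The hollow part has norm at most `5 / 2` and the diagonal at most `1 / 4`; the last `1 / 4`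
below `3` is reserved for the truncation error. -/
theorem eventually_norm_full {C : ℝ} (hC : 0 < C) :
    ∀ᶠ x in regime, ∀ (Ω : Type u) [MeasurableSpace Ω] (P : Measure Ω) [IsProbabilityMeasure P]
      (q θ : ℝ) (H F G : Ω → Matrix (Fin x.1) (Fin x.1) ℝ), IsRegular P C x.2 q θ H F G →
      θ ≤ 1 / 4 ∧ P.real {ω | 11 / 4 < ‖op (F ω)‖} ≤ Real.exp (-x.2) := by
  filter_upwards [eventually_norm_tail.{u} hC (show (0 : ℝ) < 1 / 2 by norm_num), regime_le 1,
    regime_le (4 * C)] with x hnorm hL1 hLC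
  intro Ω _ P _ q θ H F G h
  have hE := h.isHollowEnsemble
  obtain ⟨hn, -⟩ := hnorm Ω P θ G hE.ensemble hE.diag hE.pos hE.theta_le hE.pow_le hE.row
  have hθ : θ ≤ 1 / 4 := by
    have h1 := h.theta_mul_le hL1
    by_contra! hcon
    nlinarith
  refine ⟨hθ, (measureReal_mono ?_ (measure_ne_top _ _)).trans hn⟩
  intro ω hω
  simp only [Set.mem_ofPred_eq] at hω ⊢
  have h1 := h.approx.near_hollow ω
  have h2 : ‖op (F ω)‖ ≤ ‖op (G ω)‖ + ‖op (F ω - G ω)‖ := by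
    have := norm_add_le (op (G ω)) (op (F ω - G ω))
    rwa [← map_add, add_sub_cancel] at this
  linarith

theorem eventually_isTypical {C : ℝ} (hC : 0 < C) :
    ∀ᶠ x in regime, ∀ (Ω : Type u) [MeasurableSpace Ω] (P : Measure Ω) [IsProbabilityMeasure P]
      (q θ : ℝ) (H F G : Ω → Matrix (Fin x.1) (Fin x.1) ℝ), IsRegular P C x.2 q θ H F G →
      P.real {ω | ¬ IsTypical x.2 θ (H ω) (F ω)} ≤ Real.exp (-(1 / 2) * x.2) := by
  filter_upwards [eventually_norm_full.{u} hC, eventually_eMoment_tail.{u}, regime_le 4,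
    regime_le_fst 1, regime_const_mul_exp_le 4 (show (0 : ℝ) < 1 by norm_num),
    regime_const_mul_exp_le 5 (show (1 / 2 : ℝ) < 1 by norm_num)]
    with x hnorm htail hL4 hN1 hexp4 hexp
  intro Ω _ P _ q θ H F G h
  obtain ⟨hθ, hn⟩ := hnorm Ω P q θ H F G h
  obtain ⟨N, L⟩ := x
  simp only at *
  simp only [neg_mul, one_mul, zero_mul, neg_zero, Real.exp_zero] at *
  have hN0 : (0 : ℝ) < N := by linarith
  have : NeZero N := ⟨by rintro rfl; simp at hN0⟩
  have hN : 0 < N := by exact_mod_cast hN0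
  have hθ1 : θ ≤ 1 := by linarith
  have t1 := htail Ω P θ F h.approx.full hθ1 1 le_rfl (by norm_num; linarith)
  have t2 := htail Ω P θ F h.approx.full hθ1 2 (by norm_num) (by norm_num; linarith)
  have t3 := htail Ω P θ F h.approx.full hθ1 3 (by norm_num) (by norm_num; linarith)
  set A : ℕ → Set Ω := fun k =>
    {ω | momentScale N L k ≤ |eMoment (F ω) k - ∫ ω', eMoment (F ω') k ∂P|} with hA
  have hsub : {ω | ¬ IsTypical L θ (H ω) (F ω)} ⊆
      ({ω | Real.exp (-L) < ∑ i, ∑ j, |H ω i j - F ω i j|} ∪ {ω | 11 / 4 < ‖op (F ω)‖}) ∪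
        (A 1 ∪ (A 2 ∪ A 3)) := by
    intro ω hω
    by_contra hcon
    simp only [hA, Set.mem_union, Set.mem_ofPred_eq, not_or, not_le, not_lt] at hcon hω
    obtain ⟨⟨h1, h2⟩, h3, h4, h5⟩ := hcon
    have h6 := (norm_op_sub_le_sum (H ω) (F ω)).trans h1
    have m1 := h.approx.full.integral_eMoment_one
    have m2 := h.approx.abs_integral_eMoment_two_sub_one_le
    have m3 := h.approx.full.abs_integral_eMoment_three_le hN
    refine hω ⟨?_, by linarith, h6, ?_, ?_, ?_⟩
    · have := norm_add_le (op (F ω)) (op (H ω - F ω))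
      rw [← map_add, add_sub_cancel] at this
      linarith
    · rw [m1, sub_zero] at h3; exact h3.le
    · rw [abs_lt] at h4; rw [abs_le] at m2 ⊢
      constructor <;> linarith [m2.1, m2.2, h4.1, h4.2]
    · rw [abs_lt] at h5; rw [abs_le] at m3 ⊢
      constructor <;> linarith [m3.1, m3.2, h5.1, h5.2]
  refine (measureReal_mono hsub (measure_ne_top _ _)).trans ((measureReal_union_le _ _).trans ?_)
  have e1 := measureReal_union_le (μ := P)
    {ω | Real.exp (-L) < ∑ i, ∑ j, |H ω i j - F ω i j|} {ω | 11 / 4 < ‖op (F ω)‖}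
  have e2 := measureReal_union_le (μ := P) (A 1) (A 2 ∪ A 3)
  have e3 := measureReal_union_le (μ := P) (A 2) (A 3)
  have e4 : Real.exp (-(2 * L)) ≤ Real.exp (-L) := Real.exp_le_exp.2 (by linarith)
  have e5 := h.approx.tail
  linarith


/-! ### Precise location of the top eigenvalue and of its eigenvector -/

theorem regime_momentScale_le :
    ∀ᶠ x in regime, momentScale x.1 x.2 1 = 768 * (x.2 / Real.sqrt x.1) ∧
      768 * (x.2 / Real.sqrt x.1) ≤ 1 ∧
      momentScale x.1 x.2 2 = 55296 * (x.2 ^ 2 / Real.sqrt x.1) ∧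
      momentScale x.1 x.2 3 = 6291456 * (x.2 ^ 3 / Real.sqrt x.1) ∧
      1 / (x.1 : ℝ) ≤ x.2 / Real.sqrt x.1 ∧ Real.exp (-x.2) ≤ x.2 / Real.sqrt x.1 ∧
      x.2 ^ 4 ≤ Real.sqrt x.1 := by
  filter_upwards [regime_le 768, regime_pow_le 8, regime_le_fst 1,
    regime_rpow_mul_exp_le 1 (show (0 : ℝ) < 1 by norm_num)] with x hL hN8 hN1 hexp
  obtain ⟨N, L⟩ := x
  simp only [neg_mul, one_mul, zero_mul, neg_zero, Real.exp_zero, Real.rpow_one] at *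
  have hL0 : 0 < L := by linarith
  have hN0 : (0 : ℝ) < N := by linarith
  set r := Real.sqrt N with hr
  have hr2 : r ^ 2 = N := Real.sq_sqrt hN0.le
  have hr0 : 0 < r := Real.sqrt_pos.2 hN0
  have h4 : L ^ 4 ≤ r := Real.le_sqrt_of_sq_le (by rw [← pow_mul]; exact hN8)
  have hr1 : 1 ≤ r := (one_le_pow₀ (by linarith)).trans h4
  have h1N : 1 / (N : ℝ) ≤ L / r := by
    rw [div_le_div_iff₀ hN0 hr0, ← hr2]
    nlinarith only [mul_nonneg (sub_nonneg.2 hr1) hr0.le, mul_nonneg (sq_nonneg r) (sub_nonneg.2 hL)]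
  refine ⟨?_, ?_, ?_, ?_, h1N, ?_, h4⟩
  · simp only [momentScale, ← hr]; push_cast; ring
  · rw [← mul_div_assoc, div_le_one hr0]
    have : L * L ≤ L ^ 4 := by
      rw [← pow_two]; exact pow_le_pow_right₀ (by linarith) (by norm_num)
    nlinarith
  · simp only [momentScale, ← hr]; push_cast; ring
  · simp only [momentScale, ← hr]; push_cast; ring
  · refine le_trans ?_ h1N
    rw [le_div_iff₀ hN0]; linarith

/-- For `f ≥ L` the surplus powers of `L` are absorbed by `f`; for `f ≤ L` the left sides are below
`1 / f ^ 3` because `L ^ 4 ≤ r`. This is why the fluctuations of the second and third moments leave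
only one power of `L` in the error. -/
theorem mul_pow_div_le {L f r : ℝ} (hL : 1 ≤ L) (hf : 1 ≤ f) (hr : L ^ 4 ≤ r) :
    L ^ 2 / r / f ≤ 1 / f ^ 3 + L / r ∧ L ^ 3 / r / f ^ 2 ≤ 1 / f ^ 3 + L / r := by
  have hL0 : 0 < L := by linarith
  have hf0 : 0 < f := by linarith
  have hr0 : 0 < r := lt_of_lt_of_le (by positivity) hr
  have n1 : 0 ≤ 1 / f ^ 3 := by positivity
  have n2 : 0 ≤ L / r := by positivity
  rcases le_total L f with h | h
  · have h1 : L ^ 2 / r / f ≤ L / r := by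
      rw [div_div, div_le_div_iff₀ (by positivity) hr0]
      calc L ^ 2 * r = L * (r * L) := by ring
        _ ≤ L * (r * f) := by gcongr
    have h2 : L ^ 3 / r / f ^ 2 ≤ L / r := by
      rw [div_div, div_le_div_iff₀ (by positivity) hr0]
      calc L ^ 3 * r = L * (r * L ^ 2) := by ring
        _ ≤ L * (r * f ^ 2) := by gcongr
    constructor <;> linarith
  · have h1 : L ^ 2 / r / f ≤ 1 / f ^ 3 := by
      rw [div_div, div_le_div_iff₀ (by positivity) (by positivity), one_mul]
      calc L ^ 2 * f ^ 3 = L ^ 2 * f ^ 2 * f := by ring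
        _ ≤ L ^ 2 * L ^ 2 * f := by gcongr
        _ = L ^ 4 * f := by ring
        _ ≤ r * f := by gcongr
    have h2 : L ^ 3 / r / f ^ 2 ≤ 1 / f ^ 3 := by
      rw [div_div, div_le_div_iff₀ (by positivity) (by positivity), one_mul]
      calc L ^ 3 * f ^ 3 = L ^ 3 * f * f ^ 2 := by ring
        _ ≤ L ^ 3 * L * f ^ 2 := by gcongr
        _ = L ^ 4 * f ^ 2 := by ring
        _ ≤ r * f ^ 2 := by gcongr
    constructor <;> linarith

/-- The trivial bound for bounded `f`. -/
theorem abs_maxEigenvalue_sub_le_of_lt {N : ℕ} [NeZero N] {H : Matrix (Fin N) (Fin N) ℝ} {f : ℝ}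
    (hH : H.IsHermitian) (h : ‖op H‖ ≤ 3) (hf1 : 1 ≤ f) (hf : f < 20) :
    |maxEigenvalue (perturbed f H) - (f + 1 / f)| ≤ 32000 * (1 / f ^ 3) := by
  have hf0 : 0 < f := by linarith
  have h1 := le_maxEigenvalue_perturbed (f := f) hH h
  have h2 := maxEigenvalue_perturbed_le hH h hf0.le
  have h3 : 1 / f ≤ 1 := by rw [div_le_one hf0]; exact hf1
  have h4 : 0 < 1 / f := by positivity
  have h5 : 4 ≤ 32000 * (1 / f ^ 3) := by
    rw [mul_one_div, le_div_iff₀ (by positivity)]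
    have : f ^ 3 ≤ 20 ^ 3 := pow_le_pow_left₀ hf0.le hf.le 3
    linarith
  rw [abs_le]; constructor <;> linarith

theorem IsTypical.abs_maxEigenvalue_sub_le {N : ℕ} [NeZero N] {L θ C q f : ℝ}
    {H F : Matrix (Fin N) (Fin N) ℝ} (h : IsTypical L θ H F) (hH : H.IsHermitian)
    (hF : F.IsHermitian) (hL : 1 ≤ L) (hC : 0 < C) (hq : 0 < q) (hθ : θ * q ≤ C) (hf1 : 1 ≤ f)
    (h1 : momentScale N L 1 = 768 * (L / Real.sqrt N)) (h1' : 768 * (L / Real.sqrt N) ≤ 1)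
    (h2 : momentScale N L 2 = 55296 * (L ^ 2 / Real.sqrt N))
    (h3 : momentScale N L 3 = 6291456 * (L ^ 3 / Real.sqrt N))
    (hNL : 1 / (N : ℝ) ≤ L / Real.sqrt N) (hexp : Real.exp (-L) ≤ L / Real.sqrt N)
    (h4 : L ^ 4 ≤ Real.sqrt N) :
    |maxEigenvalue (perturbed f H) - (f + 1 / f)| ≤
      (10 ^ 8 + C) * (1 / f ^ 3 + 1 / (f ^ 2 * q) + L / Real.sqrt N) := by
  have hf0 : 0 < f := by linarith
  set r := Real.sqrt N with hr
  have hr0 : 0 < r := lt_of_lt_of_le (by positivity) h4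
  have n1 : 0 < 1 / f ^ 3 := by positivity
  have n2 : 0 < 1 / (f ^ 2 * q) := by positivity
  have n3 : 0 < L / r := by positivity
  by_cases hf : f < 20
  · refine (abs_maxEigenvalue_sub_le_of_lt hH h.norm_le hf1 hf).trans ?_
    nlinarith only [mul_pos hC n1, mul_pos hC n2, mul_pos hC n3, n1, n2, n3]
  push Not at hf
  have w1 := abs_maxEigenvalue_perturbed_sub_le hH hF f
  have w2 := (strong_expansion hF h.norm_full_le hf).2
  have w3 := h.one
  have w4 := h.two
  have w5 := h.three
  have hnear := h.near
  rw [h1] at w3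
  rw [h2] at w4
  rw [h3] at w5
  obtain ⟨b2, b3⟩ := mul_pow_div_le hL hf1 h4
  have hinv : 1 / f ≤ 1 := by rw [div_le_one hf0]; exact hf1
  have c1 : eMoment F 1 ^ 2 / f ≤ 768 * (L / r) := by
    calc eMoment F 1 ^ 2 / f = |eMoment F 1| * |eMoment F 1| * (1 / f) := by
          rw [← pow_two, sq_abs, div_eq_mul_one_div]
      _ ≤ (768 * (L / r)) * 1 * 1 := by
          have := w3.trans h1'
          gcongr
      _ = _ := by ring
  have c2 : |eMoment F 2 / f - 1 / f| ≤ L / r + 55296 * (1 / f ^ 3 + L / r) := by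
    rw [← sub_div, abs_div, abs_of_pos hf0]
    calc |eMoment F 2 - 1| / f ≤ (L / r + 55296 * (L ^ 2 / r)) / f := by
          gcongr; linarith
      _ = L / r * (1 / f) + 55296 * (L ^ 2 / r / f) := by ring
      _ ≤ L / r * 1 + 55296 * (1 / f ^ 3 + L / r) := by gcongr
      _ = _ := by ring
  have c3 : |eMoment F 3 / f ^ 2| ≤ C * (1 / (f ^ 2 * q)) + 6291456 * (1 / f ^ 3 + L / r) := by
    rw [abs_div, abs_of_pos (by positivity : 0 < f ^ 2)]
    have hθ' : θ ≤ C / q := by rwa [le_div_iff₀ hq]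
    calc |eMoment F 3| / f ^ 2 ≤ (C / q + 6291456 * (L ^ 3 / r)) / f ^ 2 := by
          gcongr; linarith
      _ = C * (1 / (f ^ 2 * q)) + 6291456 * (L ^ 3 / r / f ^ 2) := by field_simp
      _ ≤ _ := by gcongr
  set m := maxEigenvalue (perturbed f H)
  set mF := maxEigenvalue (perturbed f F)
  have key : |m - (f + 1 / f)| ≤ |m - mF| +
      |mF - (f + eMoment F 1 + eMoment F 2 / f + eMoment F 3 / f ^ 2)| + |eMoment F 1| +
      |eMoment F 2 / f - 1 / f| + |eMoment F 3 / f ^ 2| := by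
    have e : m - (f + 1 / f) = (m - mF) +
      (mF - (f + eMoment F 1 + eMoment F 2 / f + eMoment F 3 / f ^ 2)) + eMoment F 1 +
      (eMoment F 2 / f - 1 / f) + eMoment F 3 / f ^ 2 := by ring
    rw [e]
    refine (abs_add_le _ _).trans (add_le_add_left ?_ _)
    refine (abs_add_le _ _).trans (add_le_add_left ?_ _)
    refine (abs_add_le _ _).trans (add_le_add_left ?_ _)
    exact abs_add_le _ _
  nlinarith only [key, w1, w2, w3, c1, c2, c3, hnear, hexp, n1, n2, n3, mul_pos hC n1,
    mul_pos hC n2, mul_pos hC n3]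

theorem abs_eMoment_two_sub_le {N : ℕ} [NeZero N] {H F : Matrix (Fin N) (Fin N) ℝ}
    (hH : ‖op H‖ ≤ 3) (hF : ‖op F‖ ≤ 3) : |eMoment H 2 - eMoment F 2| ≤ 6 * ‖op (H - F)‖ := by
  have e : op H ^ 2 - op F ^ 2 = op H * op (H - F) + op (H - F) * op F := by
    have : op (H - F) = op H - op F := map_sub _ _ _
    rw [this, mul_sub, sub_mul, pow_two, pow_two]; abel
  have e1 : eMoment H 2 - eMoment F 2 = inner ℝ (eVec N) ((op H ^ 2 - op F ^ 2) (eVec N)) := by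
    rw [eMoment, eMoment, ← inner_sub_right]; rfl
  have e2 : ‖op H ^ 2 - op F ^ 2‖ ≤ 6 * ‖op (H - F)‖ := by
    rw [e]
    refine (norm_add_le _ _).trans ?_
    have h1 := norm_mul_le (op H) (op (H - F))
    have h2 := norm_mul_le (op (H - F)) (op F)
    nlinarith only [h1, h2, mul_le_mul_of_nonneg_right hH (norm_nonneg (op (H - F))),
      mul_le_mul_of_nonneg_right hF (norm_nonneg (op (H - F)))]
  rw [e1]
  have e3 := abs_real_inner_le_norm (eVec N) ((op H ^ 2 - op F ^ 2) (eVec N))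
  have e4 := (op H ^ 2 - op F ^ 2).le_opNorm (eVec N)
  rw [norm_eVec, one_mul] at e3
  rw [norm_eVec, mul_one] at e4
  exact e3.trans (e4.trans e2)

theorem abs_eMoment_one_sub_le {N : ℕ} [NeZero N] (H F : Matrix (Fin N) (Fin N) ℝ) :
    |eMoment H 1 - eMoment F 1| ≤ ‖op (H - F)‖ := by
  have e1 : eMoment H 1 - eMoment F 1 = inner ℝ (eVec N) (op (H - F) (eVec N)) := by
    have : op (H - F) = op H - op F := map_sub _ _ _
    rw [eMoment, eMoment, ← inner_sub_right, this, pow_one, pow_one, _root_.sub_apply]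
  rw [e1]
  have e3 := abs_real_inner_le_norm (eVec N) (op (H - F) (eVec N))
  have e4 := (op (H - F)).le_opNorm (eVec N)
  rw [norm_eVec, one_mul] at e3
  rw [norm_eVec, mul_one] at e4
  exact e3.trans e4

theorem IsTypical.exists_sign {N : ℕ} [NeZero N] {L θ f : ℝ}
    {H F : Matrix (Fin N) (Fin N) ℝ} (h : IsTypical L θ H F) (hH : H.IsHermitian)
    (hL : 1 ≤ L) (hf1 : 1 ≤ f)
    (h1 : momentScale N L 1 = 768 * (L / Real.sqrt N))
    (h2 : momentScale N L 2 = 55296 * (L ^ 2 / Real.sqrt N))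
    (hNL : 1 / (N : ℝ) ≤ L / Real.sqrt N) (hexp : Real.exp (-L) ≤ L / Real.sqrt N)
    {v : Fin N → ℝ} (hv : ∑ i, v i ^ 2 = 1)
    (hv' : (perturbed f H).mulVec v = maxEigenvalue (perturbed f H) • v) :
    ∃ s : ℝ, (s = 1 ∨ s = -1) ∧ |(s • v) ⬝ᵥ unitVec N - (1 - 1 / (2 * f ^ 2))| ≤
      10 ^ 12 * (1 / f ^ 3 + L ^ 2 / (f * Real.sqrt N)) := by
  have hf0 : 0 < f := by linarith
  have hN0 : (0 : ℝ) < N := Nat.cast_pos.2 (NeZero.pos N)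
  set r := Real.sqrt N with hr
  have hr0 : 0 < r := Real.sqrt_pos.2 hN0
  have n1 : 0 < 1 / f ^ 3 := by positivity
  have n3 : 0 < L ^ 2 / (f * r) := by positivity
  -- For bounded `f` the error `1 / f ^ 3` is bounded below, so the trivial bound on the overlap
  -- suffices with either sign.
  by_cases hf : f < 20
  · refine ⟨1, Or.inl rfl, ?_⟩
    have e1 := abs_le.1 (abs_dotProduct_unitVec_le hv)
    have e2 : 1 / (2 * f ^ 2) ≤ 1 := by
      rw [div_le_one (by positivity)]; nlinarith only [hf1]
    have e3 : 0 < 1 / (2 * f ^ 2) := by positivity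
    have h5 : 4 ≤ 32000 * (1 / f ^ 3) := by
      rw [mul_one_div, le_div_iff₀ (by positivity)]
      have : f ^ 3 ≤ 20 ^ 3 := pow_le_pow_left₀ hf0.le hf.le 3
      linarith
    rw [one_smul, abs_le]
    constructor <;> nlinarith only [e1.1, e1.2, e2, e3, h5, n1, n3]
  push Not at hf
  obtain ⟨s, hs, hle⟩ := exists_sign_overlap hH h.norm_le hf hv hv'
  refine ⟨s, hs, hle.trans ?_⟩
  have w1 := abs_eMoment_one_sub_le H F
  have w2 := abs_eMoment_two_sub_le h.norm_le h.norm_full_le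
  have w3 := h.one
  have w4 := h.two
  have hnear := h.near
  rw [h1] at w3
  rw [h2] at w4
  have hLr : L / r ≤ L ^ 2 / r := by gcongr; nlinarith only [hL]
  have c1 : |eMoment H 1| ≤ 769 * (L ^ 2 / r) := by
    have := abs_sub_abs_le_abs_sub (eMoment H 1) (eMoment F 1)
    linarith
  have c2 : |eMoment H 2 - 1| ≤ 55303 * (L ^ 2 / r) := by
    have := abs_sub_abs_le_abs_sub (eMoment H 2 - 1) (eMoment F 2 - 1)
    rw [sub_sub_sub_cancel_right] at this
    linarith
  have d1 : |eMoment H 1| / f ≤ 769 * (L ^ 2 / (f * r)) := by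
    calc _ ≤ 769 * (L ^ 2 / r) / f := by gcongr
      _ = _ := by field_simp
  have d2 : |eMoment H 2 - 1| / f ^ 2 ≤ 55303 * (L ^ 2 / (f * r)) := by
    calc _ ≤ 55303 * (L ^ 2 / r) / f ^ 2 := by gcongr
      _ ≤ 55303 * (L ^ 2 / r) / f := by
        gcongr; nlinarith only [hf1]
      _ = _ := by field_simp
  nlinarith only [d1, d2, n1, n3]

theorem eventually_strong_position {C : ℝ} (hC : 0 < C) :
    ∀ᶠ x in regime, ∀ (Ω : Type u) [MeasurableSpace Ω] (P : Measure Ω) [IsProbabilityMeasure P]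
      (q θ f : ℝ) (H F G : Ω → Matrix (Fin x.1) (Fin x.1) ℝ),
      IsRegular P C x.2 q θ H F G → 1 ≤ f →
      P.real {ω | |maxEigenvalue (perturbed f (H ω)) - (f + 1 / f)| ≤
        (10 ^ 8 + C) * (1 / f ^ 3 + 1 / (f ^ 2 * q) + x.2 / Real.sqrt x.1)}ᶜ ≤
          Real.exp (-(1 / 2) * x.2) ∧
      P.real {ω | ∀ v : Fin x.1 → ℝ, ∑ i, v i ^ 2 = 1 →
        (perturbed f (H ω)).mulVec v = maxEigenvalue (perturbed f (H ω)) • v →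
        ∃ s : ℝ, (s = 1 ∨ s = -1) ∧ |(s • v) ⬝ᵥ unitVec x.1 - (1 - 1 / (2 * f ^ 2))| ≤
          10 ^ 12 * (1 / f ^ 3 + x.2 ^ 2 / (f * Real.sqrt x.1))}ᶜ ≤
            Real.exp (-(1 / 2) * x.2) := by
  filter_upwards [eventually_isTypical.{u} hC, regime_momentScale_le, regime_le 1, regime_le_fst 1]
    with x htyp hx hL1 hN1
  intro Ω _ P _ q θ f H F G h hf
  obtain ⟨h1, h1', h2, h3, hNL, hexp, h4⟩ := hx
  have ht := htyp Ω P q θ H F G h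
  have hN0 : (0 : ℝ) < x.1 := by linarith
  have : NeZero x.1 := ⟨by intro h0; simp [h0] at hN0⟩
  have hq : 0 < q := lt_of_lt_of_le (by positivity) h.q_lower
  constructor
  · refine (measureReal_mono (fun ω hω => ?_) (measure_ne_top _ _)).trans ht
    simp only [Set.mem_ofPred_eq]
    refine fun hT => hω ?_
    simp only [Set.mem_ofPred_eq]
    exact hT.abs_maxEigenvalue_sub_le (h.isHermitian ω) (h.isHermitian_full ω) hL1 hC hq h.theta_le
      hf h1 h1' h2 h3 hNL hexp h4
  · refine (measureReal_mono (fun ω hω => ?_) (measure_ne_top _ _)).trans ht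
    simp only [Set.mem_ofPred_eq]
    refine fun hT => hω ?_
    simp only [Set.mem_ofPred_eq]
    intro v hv hv'
    exact hT.exists_sign (h.isHermitian ω) hL1 hf h1 h2 hNL hexp hv hv'


/-! ### Measurability and the expectation of the top eigenvalue -/

/-- The perturbation inequality needs symmetric matrices. Symmetrising extends the top eigenvalue to
a continuous function on all matrices that is unchanged on symmetric ones; measurability in `ω`
follows. -/
theorem continuous_maxEigenvalue_symmetrized {N : ℕ} [NeZero N] (f : ℝ) :
    Continuous fun M : Fin N → Fin N → ℝ =>
      maxEigenvalue (perturbed f (Matrix.of fun i j => (M i j + M j i) / 2)) := by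
  have hs : ∀ M : Fin N → Fin N → ℝ,
      (Matrix.of fun i j => (M i j + M j i) / 2).IsHermitian := fun M =>
    Matrix.IsHermitian.ext fun i j => by simp [add_comm]
  rw [continuous_iff_continuousAt]
  intro B
  refine tendsto_iff_norm_sub_tendsto_zero.2 ?_
  have hlim : Tendsto (fun M : Fin N → Fin N → ℝ =>
      ∑ i, ∑ j, |(M i j + M j i) / 2 - (B i j + B j i) / 2|) (𝓝 B) (𝓝 0) := by
    have : Continuous fun M : Fin N → Fin N → ℝ =>
        ∑ i, ∑ j, |(M i j + M j i) / 2 - (B i j + B j i) / 2| := by fun_prop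
    have h0 := this.tendsto B
    simpa using h0
  refine squeeze_zero (fun _ => norm_nonneg _) (fun M => ?_) hlim
  exact (abs_maxEigenvalue_perturbed_sub_le (hs M) (hs B) f).trans (norm_op_sub_le_sum _ _)

theorem measurable_maxEigenvalue {Ω : Type*} [MeasurableSpace Ω] {N : ℕ} (f : ℝ)
    {H : Ω → Matrix (Fin N) (Fin N) ℝ} (hm : ∀ i j, Measurable fun ω => H ω i j)
    (hs : ∀ ω i j, H ω i j = H ω j i) :
    Measurable fun ω => maxEigenvalue (perturbed f (H ω)) := by
  rcases Nat.eq_zero_or_pos N with rfl | hN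
  · have : (fun ω => maxEigenvalue (perturbed f (H ω))) = fun _ => maxEigenvalue (perturbed f (0 : Matrix (Fin 0) (Fin 0) ℝ)) := by
      funext ω
      rw [Subsingleton.elim (H ω) 0]
    rw [this]
    exact measurable_const
  · have : NeZero N := ⟨hN.ne'⟩
    have h1 : Measurable fun ω => fun i j => H ω i j :=
      measurable_pi_lambda _ fun i => measurable_pi_lambda _ fun j => hm i j
    have h2 := (continuous_maxEigenvalue_symmetrized (N := N) f).measurable.comp h1
    convert h2 using 1
    funext ω
    simp only [Function.comp]
    congr 2
    ext i j
    simp [hs ω j i]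

section

variable {Ω : Type*} [MeasurableSpace Ω] {P : Measure Ω} [IsProbabilityMeasure P] {N : ℕ}
  {C L q θ f : ℝ} {H F G : Ω → Matrix (Fin N) (Fin N) ℝ}

theorem CenteredEnsemble.norm_op_le (h : CenteredEnsemble P θ F) (hθ : θ ≤ 1) (ω : Ω) :
    ‖op (F ω)‖ ≤ (N : ℝ) ^ 2 := by
  simpa using norm_op_le_of_abs_le fun i j => (h.bound ω i j).trans hθ

theorem CenteredEnsemble.isHermitian (h : CenteredEnsemble P θ F) (ω : Ω) :
    (F ω).IsHermitian := Matrix.IsHermitian.ext fun i j => h.symm ω j i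

theorem abs_maxEigenvalue_sub_le_norm [NeZero N] {A : Matrix (Fin N) (Fin N) ℝ}
    (hA : A.IsHermitian) (hf : 0 ≤ f) : |maxEigenvalue (perturbed f A) - f| ≤ ‖op A‖ := by
  have h1 := le_maxEigenvalue_perturbed (f := f) hA le_rfl
  have h2 := maxEigenvalue_perturbed_le hA le_rfl hf
  rw [abs_le]; constructor <;> linarith

theorem CenteredEnsemble.integrable_maxEigenvalue [NeZero N] (h : CenteredEnsemble P θ F)
    (hθ : θ ≤ 1) (hf : 0 ≤ f) : Integrable (fun ω => maxEigenvalue (perturbed f (F ω))) P := by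
  refine Integrable.of_bound (C := f + N ^ 2)
    (measurable_maxEigenvalue f h.measurable h.symm).aestronglyMeasurable
    (ae_of_all _ fun ω => ?_)
  have h1 := abs_le.1 (abs_maxEigenvalue_sub_le_norm (h.isHermitian ω) hf)
  have h2 := h.norm_op_le hθ ω
  rw [Real.norm_eq_abs, abs_le]
  constructor <;> linarith

theorem IsRegular.integrable_maxEigenvalue_sub [NeZero N] (h : IsRegular P C L q θ H F G)
    (f : ℝ) : Integrable (fun ω => maxEigenvalue (perturbed f (H ω)) -
      maxEigenvalue (perturbed f (F ω))) P := by
  refine Integrable.mono' h.approx.integrable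
    ((measurable_maxEigenvalue f h.measurable h.symm).sub
      (measurable_maxEigenvalue f h.approx.full.measurable h.approx.full.symm)).aestronglyMeasurable
    (ae_of_all _ fun ω => ?_)
  exact (abs_maxEigenvalue_perturbed_sub_le (h.isHermitian ω) (h.isHermitian_full ω) f).trans
    (norm_op_sub_le_sum _ _)

theorem IsRegular.integral_abs_maxEigenvalue_sub_le [NeZero N] (h : IsRegular P C L q θ H F G)
    (f : ℝ) : ∫ ω, |maxEigenvalue (perturbed f (H ω)) - maxEigenvalue (perturbed f (F ω))| ∂P ≤
      Real.exp (-L) := by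
  refine (integral_mono (h.integrable_maxEigenvalue_sub f).abs h.approx.integrable
    fun ω => ?_).trans h.approx.integral_le
  exact (abs_maxEigenvalue_perturbed_sub_le (h.isHermitian ω) (h.isHermitian_full ω) f).trans
    (norm_op_sub_le_sum _ _)

theorem IsRegular.integrable_maxEigenvalue [NeZero N] (h : IsRegular P C L q θ H F G)
    (hθ : θ ≤ 1) (hf : 0 ≤ f) : Integrable (fun ω => maxEigenvalue (perturbed f (H ω))) P := by
  refine ((h.integrable_maxEigenvalue_sub f).add
    (h.approx.full.integrable_maxEigenvalue hθ hf)).congr (ae_of_all _ fun ω => ?_)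
  simp

theorem IsRegular.abs_integral_maxEigenvalue_sub_le [NeZero N] (h : IsRegular P C L q θ H F G)
    (hθ : θ ≤ 1) (hf : 0 ≤ f) : |∫ ω, maxEigenvalue (perturbed f (H ω)) ∂P -
      ∫ ω, maxEigenvalue (perturbed f (F ω)) ∂P| ≤ Real.exp (-L) := by
  rw [← integral_sub (h.integrable_maxEigenvalue hθ hf)
    (h.approx.full.integrable_maxEigenvalue hθ hf)]
  exact abs_integral_le_integral_abs.trans (h.integral_abs_maxEigenvalue_sub_le f)

theorem CenteredEnsemble.integral_eMoment_one_sq_le (h : CenteredEnsemble P θ F) (hθ : θ ≤ 1)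
    (hN : 16 ≤ (N : ℝ)) : Integrable (fun ω => eMoment (F ω) 1 ^ 2) P ∧
      ∫ ω, eMoment (F ω) 1 ^ 2 ∂P ≤ 16384 / N := by
  have hN0 : (0 : ℝ) < N := by linarith
  have h4 : (4 : ℝ) ≤ Real.sqrt N := Real.le_sqrt_of_sq_le (by norm_num; exact_mod_cast hN)
  have := h.abs_integral_eMoment_sub_pow_le hθ (n := 2) (k := 1) le_rfl
    (by exact_mod_cast hN0) (by push_cast; linarith)
  simp only [h.integral_eMoment_one, sub_zero] at this
  refine ⟨this.1, (le_abs_self _).trans (this.2.trans (le_of_eq ?_))⟩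
  rw [Real.sq_sqrt hN0.le]; norm_num

end

/-- Taking expectations removes the linear term, which dominates the pathwise error. What remains of
it is the mean of `eMoment 1 ^ 2 / f`, of order `1 / (f N)`. The bad event is negligible because `f`
is at most a power of `N`. -/
theorem eventually_abs_integral_maxEigenvalue_sub_le {C Cf : ℝ} (hC : 0 < C) :
    ∀ᶠ x in regime, ∀ (Ω : Type u) [MeasurableSpace Ω] (P : Measure Ω) [IsProbabilityMeasure P]
      (q θ f : ℝ) (H F G : Ω → Matrix (Fin x.1) (Fin x.1) ℝ),
      IsRegular P C x.2 q θ H F G → 1 ≤ f → f ≤ (x.1 : ℝ) ^ Cf →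
      Integrable (fun ω => maxEigenvalue (perturbed f (H ω))) P ∧
      |(∫ ω, maxEigenvalue (perturbed f (H ω)) ∂P) - (f + 1 / f)| ≤
        (10 ^ 9 + C) * (1 / f ^ 3 + 1 / (f ^ 2 * q) + 1 / (f * x.1)) := by
  filter_upwards [eventually_norm_full.{u} hC, regime_le 1, regime_le_fst 16,
    regime_rpow_mul_exp_le (8 + Cf) (show (0 : ℝ) < 1 by norm_num)] with x hnorm hL1 hN16 hexp
  intro Ω _ P _ q θ f H F G h hf hfC
  obtain ⟨hθ4, hn⟩ := hnorm Ω P q θ H F G h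
  obtain ⟨N, L⟩ := x
  simp only [neg_mul, one_mul, zero_mul, neg_zero, Real.exp_zero] at *
  have hθ : θ ≤ 1 := by linarith
  have hf0 : 0 < f := by linarith
  have hN0 : (0 : ℝ) < N := by linarith
  have : NeZero N := ⟨by rintro rfl; simp at hN0⟩
  have hq : 0 < q := lt_of_lt_of_le (by positivity) h.q_lower
  have hF := h.approx.full
  refine ⟨h.integrable_maxEigenvalue hθ hf0.le, ?_⟩
  have n1 : 0 < 1 / f ^ 3 := by positivity
  have n2 : 0 < 1 / (f ^ 2 * q) := by positivity
  have n3 : 0 < 1 / (f * N) := by positivity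
  -- exponentially small terms
  have hsmall : (N : ℝ) ^ 7 * Real.exp (-L) ≤ 1 / (f * N) := by
    rw [le_div_iff₀ (by positivity)]
    refine le_trans ?_ hexp
    rw [Real.rpow_add hN0]
    have : (N : ℝ) ^ (8 : ℝ) = (N : ℝ) ^ 8 := by exact_mod_cast Real.rpow_natCast (N : ℝ) 8
    rw [this]
    calc (N : ℝ) ^ 7 * Real.exp (-L) * (f * N) = (N : ℝ) ^ 8 * f * Real.exp (-L) := by ring
      _ ≤ _ := by gcongr
  have hN7 : 16 ≤ (N : ℝ) ^ 7 := hN16.trans (le_self_pow₀ (by linarith) (by norm_num))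
  have hN67 : 16 * (N : ℝ) ^ 6 ≤ (N : ℝ) ^ 7 := by
    rw [pow_succ (N : ℝ) 6, mul_comm]; gcongr
  have hep := Real.exp_pos (-L)
  have w1 := h.abs_integral_maxEigenvalue_sub_le hθ hf0.le
  have hτ : Real.exp (-L) ≤ 1 / (f * N) := by nlinarith only [hsmall, hN7, hep]
  have hmu := hF.integrable_maxEigenvalue hθ hf0.le
  set m := ∫ ω, maxEigenvalue (perturbed f (H ω)) ∂P
  set mF := ∫ ω, maxEigenvalue (perturbed f (F ω)) ∂P with hmF
  have hbad : P.real {ω | 3 < ‖op (F ω)‖} ≤ Real.exp (-L) := by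
    refine (measureReal_mono (fun ω hω => ?_) (measure_ne_top _ _)).trans hn
    simp only [Set.mem_ofPred_eq] at hω ⊢
    linarith
  by_cases hf20 : f < 20
  · have e1 := integral_abs_le_of_tail (hmu.sub (integrable_const f)) (integrable_const 3)
      (fun _ => by norm_num) (D := N ^ 2) (p := Real.exp (-L))
      (fun ω => (abs_maxEigenvalue_sub_le_norm (hF.isHermitian ω) hf0.le).trans
        (hF.norm_op_le hθ ω)) (by positivity)
      ((measureReal_mono (fun ω hω => by
        simp only [Set.mem_ofPred_eq] at hω ⊢
        exact lt_of_lt_of_le hω (abs_maxEigenvalue_sub_le_norm (hF.isHermitian ω) hf0.le))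
        (measure_ne_top _ _)).trans hbad)
    have e2 : |mF - f| ≤ ∫ ω, |maxEigenvalue (perturbed f (F ω)) - f| ∂P := by
      have := abs_integral_le_integral_abs (μ := P)
        (f := fun ω => maxEigenvalue (perturbed f (F ω)) - f)
      rw [integral_sub hmu (integrable_const f)] at this
      simpa using this
    have e3 : ∫ ω, |maxEigenvalue (perturbed f (F ω)) - f| ∂P ≤ 3 + N ^ 2 * Real.exp (-L) := by
      simpa using e1
    have e4 : (N : ℝ) ^ 2 * Real.exp (-L) ≤ 1 / (f * N) :=
      le_trans (by gcongr <;> linarith) hsmall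
    have e5 : 4 ≤ 32000 * (1 / f ^ 3) := by
      rw [mul_one_div, le_div_iff₀ (by positivity)]
      have : f ^ 3 ≤ 20 ^ 3 := pow_le_pow_left₀ hf0.le hf20.le 3
      linarith
    have e6 : 1 / f ≤ 1 := by rw [div_le_one hf0]; exact hf
    have e7 : 0 < 1 / f := by positivity
    have e8 : |m - (f + 1 / f)| ≤ 4 + 2 * (1 / (f * N)) := by
      rw [abs_le] at *
      constructor <;> linarith [w1.1, w1.2, e2.1, e2.2]
    nlinarith only [e8, e5, n1, n2, n3, mul_pos hC n1, mul_pos hC n2, mul_pos hC n3]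
  push Not at hf20
  obtain ⟨hi1, hi2⟩ := hF.integral_eMoment_one_sq_le hθ hN16
  have hik := fun k => hF.integrable_eMoment k
  set Z : Ω → ℝ := fun ω => maxEigenvalue (perturbed f (F ω)) -
    (f + eMoment (F ω) 1 + eMoment (F ω) 2 / f + eMoment (F ω) 3 / f ^ 2) with hZ
  have i1 : Integrable (fun ω => f + eMoment (F ω) 1) P := (integrable_const f).add (hik 1)
  have i2 : Integrable (fun ω => f + eMoment (F ω) 1 + eMoment (F ω) 2 / f) P :=
    i1.add ((hik 2).div_const _)
  have hint : Integrable (fun ω => f + eMoment (F ω) 1 + eMoment (F ω) 2 / f +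
      eMoment (F ω) 3 / f ^ 2) P := i2.add ((hik 3).div_const _)
  have hZi : Integrable Z P := hmu.sub hint
  set g : Ω → ℝ := fun ω => 10000 * (1 / f ^ 3 + eMoment (F ω) 1 ^ 2 / f) with hg
  have hgi : Integrable g P := ((integrable_const _).add (hi1.div_const _)).const_mul _
  have hcr : ∀ ω, |Z ω| ≤ 4 * (N : ℝ) ^ 6 := by
    intro ω
    have hle := hF.norm_op_le hθ ω
    have k1 := abs_maxEigenvalue_sub_le_norm (hF.isHermitian ω) hf0.le
    have k2 := abs_eMoment_le hle 1
    have k3 := abs_eMoment_le hle 2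
    have k4 := abs_eMoment_le hle 3
    have p1 : (N : ℝ) ^ 2 ≤ N ^ 6 := pow_le_pow_right₀ (by linarith) (by norm_num)
    have p2 : (N : ℝ) ^ 4 ≤ N ^ 6 := pow_le_pow_right₀ (by linarith) (by norm_num)
    rw [← pow_mul] at k2 k3 k4
    norm_num at k2 k3 k4
    have k3' : |eMoment (F ω) 2 / f| ≤ N ^ 4 := by
      rw [abs_div, abs_of_pos hf0]
      exact (div_le_self (abs_nonneg _) hf).trans k3
    have k4' : |eMoment (F ω) 3 / f ^ 2| ≤ N ^ 6 := by
      rw [abs_div, abs_of_pos (by positivity : 0 < f ^ 2)]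
      exact (div_le_self (abs_nonneg _) (one_le_pow₀ hf)).trans k4
    simp only [hZ]
    rw [abs_le] at *
    constructor <;> linarith [k1.1, k1.2, k2.1, k2.2, k3'.1, k3'.2, k4'.1, k4'.2]
  have hZt : P.real {ω | g ω < |Z ω|} ≤ Real.exp (-L) := by
    refine (measureReal_mono (fun ω hω => ?_) (measure_ne_top _ _)).trans hbad
    simp only [Set.mem_ofPred_eq] at hω ⊢
    by_contra! hcon
    exact absurd (strong_expansion (hF.isHermitian ω) hcon hf20).2 (not_le.2 hω)
  have e1 := integral_abs_le_of_tail hZi hgi (fun ω => by positivity) hcr (by positivity) hZt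
  have e2 : ∫ ω, g ω ∂P ≤ 10000 * (1 / f ^ 3) + 163840000 * (1 / (f * N)) := by
    simp only [hg]
    rw [integral_const_mul, integral_add (integrable_const _) (hi1.div_const _), integral_const,
      probReal_univ, one_smul, integral_div]
    have : (∫ ω, eMoment (F ω) 1 ^ 2 ∂P) / f ≤ 16384 * (1 / (f * N)) := by
      calc _ ≤ 16384 / N / f := by gcongr
        _ = _ := by field_simp
    linarith
  have e3 : ∫ ω, Z ω ∂P = mF - (f + (∫ ω, eMoment (F ω) 2 ∂P) / f +
      (∫ ω, eMoment (F ω) 3 ∂P) / f ^ 2) := by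
    simp only [hZ]
    rw [integral_sub hmu hint,
      integral_add i2 ((hik 3).div_const _), integral_add i1 ((hik 2).div_const _),
      integral_add (integrable_const f) (hik 1), hF.integral_eMoment_one, integral_div,
      integral_div]
    simp [hmF]
  have e4 : |∫ ω, Z ω ∂P| ≤ ∫ ω, |Z ω| ∂P := abs_integral_le_integral_abs
  rw [e3] at e4
  have e5 : |(∫ ω, eMoment (F ω) 2 ∂P) / f - 1 / f| ≤ 1 / (f * N) := by
    rw [← sub_div, abs_div, abs_of_pos hf0]
    calc _ ≤ 1 / (N : ℝ) / f := by
          gcongr; exact h.approx.abs_integral_eMoment_two_sub_one_le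
      _ = _ := by field_simp
  have e6 : |(∫ ω, eMoment (F ω) 3 ∂P) / f ^ 2| ≤ C * (1 / (f ^ 2 * q)) := by
    rw [abs_div, abs_of_pos (by positivity : 0 < f ^ 2)]
    have h1 := hF.abs_integral_eMoment_three_le (NeZero.pos N)
    have h2 : θ ≤ C / q := by rw [le_div_iff₀ hq]; exact h.theta_le
    calc _ ≤ C / q / f ^ 2 := by gcongr; exact h1.trans h2
      _ = _ := by field_simp
  have e7 : 4 * (N : ℝ) ^ 6 * Real.exp (-L) ≤ 1 / (f * N) := by
    refine le_trans ?_ hsmall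
    gcongr
    linarith [pow_pos hN0 6]
  have e8 : |m - (f + 1 / f)| ≤ 10000 * (1 / f ^ 3) + 163840003 * (1 / (f * N)) +
      C * (1 / (f ^ 2 * q)) := by
    rw [abs_le] at w1 e5 e6 e4 ⊢
    constructor <;> linarith [w1.1, w1.2, e5.1, e5.2, e6.1, e6.2, e4.1, e4.2]
  nlinarith only [e8, n1, n2, n3, mul_pos hC n1, mul_pos hC n2, mul_pos hC n3]


/-! ### Fluctuations of the top eigenvalue -/

/-- The weighted sum of moment fluctuations controlling the top eigenvalue. -/
noncomputable def fluctuationSum (f : ℝ) (K : ℕ) (y : ℕ → ℝ) : ℝ :=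
  y 1 / f + ∑ k ∈ Finset.Icc 2 K, (2 / f) ^ (k - 1) * y k

theorem fluctuationSum_mono {f : ℝ} (hf : 0 ≤ f) {K : ℕ} (hK : 1 ≤ K) {y z : ℕ → ℝ}
    (h : ∀ k, 1 ≤ k → k ≤ K → y k ≤ z k) : fluctuationSum f K y ≤ fluctuationSum f K z := by
  unfold fluctuationSum
  refine add_le_add (div_le_div_of_nonneg_right (h 1 le_rfl hK) hf)
    (Finset.sum_le_sum fun k hk => ?_)
  rw [Finset.mem_Icc] at hk
  exact mul_le_mul_of_nonneg_left (h k (by omega) hk.2) (by positivity)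

theorem fluctuationSum_nonneg {f : ℝ} (hf : 0 ≤ f) {K : ℕ} {y : ℕ → ℝ} (h : ∀ k, 0 ≤ y k) :
    0 ≤ fluctuationSum f K y := by
  unfold fluctuationSum
  exact add_nonneg (div_nonneg (h 1) hf) (Finset.sum_nonneg fun k _ => mul_nonneg (by positivity) (h k))

theorem fluctuationSum_add (f : ℝ) (K : ℕ) (y z : ℕ → ℝ) :
    fluctuationSum f K (fun k => y k + z k) = fluctuationSum f K y + fluctuationSum f K z := by
  simp only [fluctuationSum, mul_add, Finset.sum_add_distrib, add_div]
  ring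

theorem add_three_sq_le (j : ℕ) : ((j : ℝ) + 3) ^ 2 ≤ 9 * 2 ^ j := by
  induction j with
  | zero => norm_num
  | succ j ih =>
    rw [pow_succ (2 : ℝ)]; push_cast
    nlinarith [(Nat.cast_nonneg j : (0 : ℝ) ≤ j)]

/-- The factor `k ^ k` in `momentScale` does not spoil convergence, because the sum stops at `K`: by
`hf` the ratio `32 l (k + 1) / f` stays below `4 / 25`, and the sum is comparable to its first
terms. -/
theorem fluctuationSum_momentScale_le {N : ℕ} {l f : ℝ} {K : ℕ} (hl : 1 / 2 ≤ l) (hf0 : 0 < f)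
    (hf : 200 * (l * (K + 1)) ≤ f) :
    fluctuationSum f K (momentScale N l) ≤ 250000 * (l ^ 2 / (f * Real.sqrt N)) := by
  set r := Real.sqrt N with hr
  have hr0 : 0 ≤ r := Real.sqrt_nonneg _
  have hl0 : 0 < l := by linarith
  have n1 : 0 ≤ l ^ 2 / (f * r) := by positivity
  have h1 : momentScale N l 1 / f ≤ 1536 * (l ^ 2 / (f * r)) := by
    rw [momentScale, ← hr]
    calc _ = (768 * l) / (f * r) := by push_cast; rw [div_div, mul_comm r f]; ring
      _ ≤ (1536 * l ^ 2) / (f * r) :=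
          div_le_div_of_nonneg_right (by nlinarith) (by positivity)
      _ = _ := by ring
  have h2 : ∀ j ∈ Finset.range (K - 1), (2 / f) ^ (2 + j - 1) * momentScale N l (2 + j) ≤
      110592 * (l ^ 2 / (f * r)) * (8 / 25) ^ j := by
    intro j hj
    have hjK : (j : ℝ) + 3 ≤ K + 1 := by
      have : j + 3 ≤ K + 1 := by have := Finset.mem_range.1 hj; omega
      exact_mod_cast this
    have hratio : 32 * (l * (j + 3)) / f ≤ 4 / 25 := by
      rw [div_le_iff₀ hf0]
      have : l * (j + 3) ≤ l * (K + 1) := by gcongr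
      linarith
    have e1 : (2 / f) ^ (2 + j - 1) * momentScale N l (2 + j) =
        12288 * (l ^ 2 / (f * r)) * ((j + 3) ^ 2 * (32 * (l * (j + 3)) / f) ^ j) := by
      have e0 : 2 + j - 1 = j + 1 := by omega
      rw [e0, momentScale, ← hr]
      push_cast
      have e2 : (2 : ℝ) + j + 1 = j + 3 := by ring
      have e3 : (32 * (l * ((j : ℝ) + 3)) / f) = (2 / f) * 4 * (4 * l * (j + 3)) := by ring
      rw [e2, e3, mul_pow _ (4 * l * ((j : ℝ) + 3)), mul_pow (2 / f),
        show 2 + j + 1 = j + 3 by ring, show 2 + j = j + 2 by ring]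
      simp only [pow_add]
      ring
    rw [e1]
    calc 12288 * (l ^ 2 / (f * r)) * ((j + 3) ^ 2 * (32 * (l * (j + 3)) / f) ^ j)
        ≤ 12288 * (l ^ 2 / (f * r)) * ((9 * 2 ^ j) * (4 / 25) ^ j) := by
          gcongr
          exact add_three_sq_le j
      _ = 110592 * (l ^ 2 / (f * r)) * (2 * (4 / 25)) ^ j := by rw [mul_pow]; ring
      _ = _ := by norm_num
  have h3 : ∑ k ∈ Finset.Icc 2 K, (2 / f) ^ (k - 1) * momentScale N l k ≤
      110592 * (l ^ 2 / (f * r)) * 2 := by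
    have e : Finset.Icc 2 K = Finset.Ico 2 (K + 1) := by ext; simp
    rw [e, Finset.sum_Ico_eq_sum_range, show K + 1 - 2 = K - 1 by omega]
    refine (Finset.sum_le_sum h2).trans ?_
    rw [← Finset.mul_sum]
    refine mul_le_mul_of_nonneg_left ?_ (by positivity)
    have hs := summable_geometric_of_lt_one (show (0 : ℝ) ≤ 8 / 25 by norm_num) (by norm_num)
    refine (hs.sum_le_tsum _ fun _ _ => by positivity).trans ?_
    rw [tsum_geometric_of_lt_one (by norm_num) (by norm_num)]
    norm_num
  rw [fluctuationSum]
  linarith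

section

variable {Ω : Type*} [MeasurableSpace Ω] {P : Measure Ω} [IsProbabilityMeasure P] {N : ℕ}
  {θ : ℝ} {F : Ω → Matrix (Fin N) (Fin N) ℝ}

/-- The fluctuation of a moment. -/
noncomputable def momentFluctuation (P : Measure Ω) (F : Ω → Matrix (Fin N) (Fin N) ℝ) (k : ℕ)
    (ω : Ω) : ℝ := |eMoment (F ω) k - ∫ ω', eMoment (F ω') k ∂P|

theorem CenteredEnsemble.integrable_momentFluctuation (h : CenteredEnsemble P θ F) (k : ℕ) :
    Integrable (momentFluctuation P F k) P :=
  ((h.integrable_eMoment k).sub (integrable_const _)).abs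

/-- Only the variance is used, via `2 y ≤ y ^ 2 / s + s`. The scale `l = 1 / 2` in place of `L` is
essential for the central limit theorem: for `f` of order `L ^ 2`, the pointwise error `L ^ 2 / (f
√N)` times `√N` would not tend to zero. -/
theorem CenteredEnsemble.integral_momentFluctuation_le (h : CenteredEnsemble P θ F) (hθ : θ ≤ 1)
    {k : ℕ} (hk : 1 ≤ k) (hN : 0 < N) (hkN : 2 * (k + 1 : ℝ) ≤ Real.sqrt N) :
    ∫ ω, momentFluctuation P F k ω ∂P ≤ momentScale N (1 / 2) k := by
  have hN0 : (0 : ℝ) < N := by exact_mod_cast hN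
  have hr0 : 0 < Real.sqrt N := Real.sqrt_pos.2 hN0
  obtain ⟨h1, h2⟩ := h.abs_integral_eMoment_sub_pow_le hθ (n := 2) hk hN (by push_cast; exact hkN)
  set s : ℝ := 2 * 4 ^ (k + 1) * (2 * (k + 1)) ^ k / Real.sqrt N with hs
  have hs0 : 0 < s := by positivity
  have e1 : (2 : ℝ) ^ 2 * 4 ^ (2 * (k + 1)) * ((2 * (k + 1) : ℕ) : ℝ) ^ (2 * k) /
      Real.sqrt N ^ 2 = s ^ 2 := by
    rw [hs, div_pow, mul_pow, mul_pow, ← pow_mul, ← pow_mul, mul_comm (k + 1) 2, mul_comm k 2]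
    push_cast; ring
  rw [e1] at h2
  have h3 : ∀ ω, momentFluctuation P F k ω ≤
      (2 * s)⁻¹ * (eMoment (F ω) k - ∫ ω', eMoment (F ω') k ∂P) ^ 2 + s / 2 := by
    intro ω
    rw [momentFluctuation, ← sq_abs]
    set y := |eMoment (F ω) k - ∫ ω', eMoment (F ω') k ∂P|
    have : (2 * s)⁻¹ * y ^ 2 + s / 2 - y = (2 * s)⁻¹ * (y - s) ^ 2 := by field_simp; ring
    have : 0 ≤ (2 * s)⁻¹ * (y - s) ^ 2 := by positivity
    linarith
  have hle : ∫ ω, momentFluctuation P F k ω ∂P ≤ s := by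
    have h4 : Integrable (fun ω => (2 * s)⁻¹ *
        (eMoment (F ω) k - ∫ ω', eMoment (F ω') k ∂P) ^ 2 + s / 2) P :=
      (h1.const_mul _).add (integrable_const _)
    refine (integral_mono (h.integrable_momentFluctuation k) h4 h3).trans ?_
    rw [integral_add (h1.const_mul _) (integrable_const _), integral_const_mul, integral_const,
      probReal_univ, one_smul]
    calc _ ≤ (2 * s)⁻¹ * s ^ 2 + s / 2 := by gcongr; exact (le_abs_self _).trans h2
      _ = s := by field_simp; norm_num
  refine hle.trans ?_
  rw [hs, momentScale]
  gcongr
  · norm_num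
  · linarith

theorem CenteredEnsemble.integrable_fluctuationSum (h : CenteredEnsemble P θ F) (f : ℝ) (K : ℕ) :
    Integrable (fun ω => fluctuationSum f K fun k => momentFluctuation P F k ω) P :=
  ((h.integrable_momentFluctuation 1).div_const _).add
    (integrable_finsetSum _ fun k _ => (h.integrable_momentFluctuation k).const_mul _)

theorem CenteredEnsemble.integral_fluctuationSum (h : CenteredEnsemble P θ F) (f : ℝ) (K : ℕ) :
    ∫ ω, fluctuationSum f K (fun k => momentFluctuation P F k ω) ∂P =
      fluctuationSum f K fun k => ∫ ω, momentFluctuation P F k ω ∂P := by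
  unfold fluctuationSum
  rw [integral_add ((h.integrable_momentFluctuation 1).div_const _)
    (integrable_finsetSum _ fun k _ => (h.integrable_momentFluctuation k).const_mul _),
    integral_div, integral_finsetSum _ fun k _ => (h.integrable_momentFluctuation k).const_mul _]
  simp only [integral_const_mul]

/-- The part of the top eigenvalue that is not explained by the linear statistic. -/
noncomputable def nonlinearPart (P : Measure Ω) (f : ℝ) (F : Ω → Matrix (Fin N) (Fin N) ℝ)
    (ω : Ω) : ℝ :=
  maxEigenvalue (perturbed f (F ω)) - ∫ ω', maxEigenvalue (perturbed f (F ω')) ∂P -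
    eMoment (F ω) 1

variable [NeZero N] {f p : ℝ} {K : ℕ}

/-- The top eigenvalue at `ω` is compared with that at every other sample point `ω'` by
`strong_difference`, and the result is integrated over `ω'`. As the linear statistic has mean zero,
this integral is the nonlinear part, and the mean of the top eigenvalue never has to be expanded. -/
theorem CenteredEnsemble.abs_nonlinearPart_le (h : CenteredEnsemble P θ F) (hθ : θ ≤ 1)
    (hf : 200 ≤ f) (hK : 2 ≤ K) (hp : P.real {ω | 3 < ‖op (F ω)‖} ≤ p) {ω : Ω}
    (hω : ‖op (F ω)‖ ≤ 3) :
    |nonlinearPart P f F ω| ≤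
      100 * (fluctuationSum f K (fun k => momentFluctuation P F k ω) +
        (∫ ω', fluctuationSum f K (fun k => momentFluctuation P F k ω') ∂P) +
        f * (6 / f) ^ (K + 1)) + 4 * N ^ 2 * p := by
  have hf0 : 0 < f := by linarith
  have hmu := h.integrable_maxEigenvalue hθ hf0.le
  set Φ : Ω → ℝ := fun ω => fluctuationSum f K (fun k => momentFluctuation P F k ω) with hΦ
  have hΦi : Integrable Φ P := h.integrable_fluctuationSum f K
  have hΦ0 : ∀ ω, 0 ≤ Φ ω := fun ω => fluctuationSum_nonneg hf0.le fun k => abs_nonneg _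
  set D : Ω → ℝ := fun ω' => (maxEigenvalue (perturbed f (F ω)) - maxEigenvalue (perturbed f (F ω'))) -
    (eMoment (F ω) 1 - eMoment (F ω') 1) with hD
  have i1 : Integrable (fun ω' => maxEigenvalue (perturbed f (F ω)) -
      maxEigenvalue (perturbed f (F ω'))) P := (integrable_const _).sub hmu
  have i2 : Integrable (fun ω' => eMoment (F ω) 1 - eMoment (F ω') 1) P :=
    (integrable_const _).sub (h.integrable_eMoment 1)
  have hDi : Integrable D P := i1.sub i2
  have hDint : ∫ ω', D ω' ∂P = nonlinearPart P f F ω := by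
    simp only [hD]
    rw [integral_sub i1 i2, integral_sub (integrable_const _) hmu,
      integral_sub (integrable_const _) (h.integrable_eMoment 1), h.integral_eMoment_one,
      nonlinearPart]
    simp
  set g : Ω → ℝ := fun ω' => 100 * (Φ ω + Φ ω' + f * (6 / f) ^ (K + 1)) with hg
  have j1 : Integrable (fun ω' => Φ ω + Φ ω') P := (integrable_const _).add hΦi
  have hgi : Integrable g P := (j1.add (integrable_const _)).const_mul _
  have hcr : ∀ ω', |D ω'| ≤ 4 * (N : ℝ) ^ 2 := by
    intro ω'
    have a1 := abs_le.1 (abs_maxEigenvalue_sub_le_norm (h.isHermitian ω) hf0.le)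
    have a2 := abs_le.1 (abs_maxEigenvalue_sub_le_norm (h.isHermitian ω') hf0.le)
    have a3 := abs_le.1 (abs_eMoment_le (h.norm_op_le hθ ω) 1)
    have a4 := abs_le.1 (abs_eMoment_le (h.norm_op_le hθ ω') 1)
    have a5 := h.norm_op_le hθ ω
    have a6 := h.norm_op_le hθ ω'
    rw [pow_one] at a3 a4
    simp only [hD]
    rw [abs_le]
    constructor <;> linarith [a1.1, a1.2, a2.1, a2.2, a3.1, a3.2, a4.1, a4.2]
  have hDt : P.real {ω' | g ω' < |D ω'|} ≤ p := by
    refine (measureReal_mono (fun ω' hω' => ?_) (measure_ne_top _ _)).trans hp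
    simp only [Set.mem_ofPred_eq] at hω' ⊢
    by_contra! hcon
    refine absurd (strong_difference (h.isHermitian ω) (h.isHermitian ω') hω hcon hf hK)
      (not_le.2 (lt_of_le_of_lt ?_ hω'))
    simp only [hg]
    refine mul_le_mul_of_nonneg_left (add_le_add_left ?_ _) (by norm_num)
    have e : Φ ω + Φ ω' = fluctuationSum f K fun k =>
      momentFluctuation P F k ω + momentFluctuation P F k ω' := by
        rw [fluctuationSum_add]
    rw [e]
    refine fluctuationSum_mono (y := fun k => |eMoment (F ω) k - eMoment (F ω') k|) hf0.le (by omega)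
      fun k _ _ => ?_
    simp only [momentFluctuation]
    rw [abs_sub_comm (eMoment (F ω') k)]
    exact abs_sub_le _ _ _
  have e1 := integral_abs_le_of_tail hDi hgi (fun ω' => by have := hΦ0 ω; have := hΦ0 ω'; positivity)
    hcr (by positivity) hDt
  have e2 : ∫ ω', g ω' ∂P = 100 * (Φ ω + (∫ ω', Φ ω' ∂P) + f * (6 / f) ^ (K + 1)) := by
    simp only [hg]
    rw [integral_const_mul, integral_add j1 (integrable_const _),
      integral_add (integrable_const _) hΦi]
    simp
  rw [← hDint]
  refine abs_integral_le_integral_abs.trans (e1.trans (le_of_eq ?_))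
  rw [e2]

theorem CenteredEnsemble.integral_abs_nonlinearPart_le (h : CenteredEnsemble P θ F) (hθ : θ ≤ 1)
    (hf : 200 ≤ f) (hK : 2 ≤ K) (hp : P.real {ω | 3 < ‖op (F ω)‖} ≤ p) :
    Integrable (nonlinearPart P f F) P ∧ ∫ ω, |nonlinearPart P f F ω| ∂P ≤
      200 * (∫ ω', fluctuationSum f K (fun k => momentFluctuation P F k ω') ∂P) +
        100 * (f * (6 / f) ^ (K + 1)) + 8 * N ^ 2 * p := by
  have hf0 : 0 < f := by linarith
  have hp0 : 0 ≤ p := measureReal_nonneg.trans hp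
  have hmu := h.integrable_maxEigenvalue hθ hf0.le
  set Φ : Ω → ℝ := fun ω => fluctuationSum f K (fun k => momentFluctuation P F k ω) with hΦ
  have hΦi : Integrable Φ P := h.integrable_fluctuationSum f K
  have hΦ0 : ∀ ω, 0 ≤ Φ ω := fun ω => fluctuationSum_nonneg hf0.le fun k => abs_nonneg _
  have hΦI : 0 ≤ ∫ ω, Φ ω ∂P := integral_nonneg hΦ0
  have i1 : Integrable (fun ω => maxEigenvalue (perturbed f (F ω)) -
      ∫ ω', maxEigenvalue (perturbed f (F ω')) ∂P) P := hmu.sub (integrable_const _)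
  have hZ : Integrable (nonlinearPart P f F) P := i1.sub (h.integrable_eMoment 1)
  refine ⟨hZ, ?_⟩
  obtain ⟨c, hc⟩ : ∃ c : ℝ, c = (∫ ω, Φ ω ∂P) + f * (6 / f) ^ (K + 1) := ⟨_, rfl⟩
  have hc0 : 0 ≤ c := by rw [hc]; positivity
  set g : Ω → ℝ := fun ω => 100 * Φ ω + (100 * c + 4 * N ^ 2 * p) with hg
  have hgi : Integrable g P := (hΦi.const_mul _).add (integrable_const _)
  have hcr : ∀ ω, |nonlinearPart P f F ω| ≤ 4 * (N : ℝ) ^ 2 := by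
    intro ω
    have a1 := abs_le.1 (abs_maxEigenvalue_sub_le_norm (h.isHermitian ω) hf0.le)
    have a3 := abs_le.1 (abs_eMoment_le (h.norm_op_le hθ ω) 1)
    have a5 := h.norm_op_le hθ ω
    have a2 : |∫ ω', (maxEigenvalue (perturbed f (F ω')) - f) ∂P| ≤ (N : ℝ) ^ 2 := by
      have := norm_integral_le_of_norm_le_const (μ := P) (C := (N : ℝ) ^ 2)
        (f := fun ω' => maxEigenvalue (perturbed f (F ω')) - f) (ae_of_all _ fun ω' =>
          (abs_maxEigenvalue_sub_le_norm (h.isHermitian ω') hf0.le).trans (h.norm_op_le hθ ω'))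
      simpa using this
    rw [integral_sub hmu (integrable_const _), integral_const, probReal_univ, one_smul] at a2
    rw [pow_one] at a3
    have hNN : 0 ≤ (N : ℝ) ^ 2 := by positivity
    rw [nonlinearPart]
    rw [abs_le] at a2 ⊢
    constructor <;> linarith [a1.1, a1.2, a2.1, a2.2, a3.1, a3.2]
  have hZt : P.real {ω | g ω < |nonlinearPart P f F ω|} ≤ p := by
    refine (measureReal_mono (fun ω hω => ?_) (measure_ne_top _ _)).trans hp
    simp only [Set.mem_ofPred_eq] at hω ⊢
    by_contra! hcon
    refine absurd (h.abs_nonlinearPart_le hθ hf hK hp hcon) (not_le.2 (lt_of_le_of_lt ?_ hω))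
    simp only [hg, hc]
    linarith
  have hg0 : ∀ ω, 0 ≤ g ω := fun ω => by have := hΦ0 ω; positivity
  have e1 := integral_abs_le_of_tail hZ hgi hg0 hcr (by positivity) hZt
  have e2 : ∫ ω, g ω ∂P = 100 * ∫ ω, Φ ω ∂P + (100 * c + 4 * N ^ 2 * p) := by
    simp only [hg]
    rw [integral_add (hΦi.const_mul _) (integrable_const _), integral_const_mul, integral_const,
      probReal_univ, one_smul]
  rw [e2, hc] at e1
  linarith only [e1]

end


/-- Since `6 / f ≤ exp (-1)`, the first `⌈log N⌉` factors give `1 / N`; the remaining two give `36 /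
f ^ 2`. -/
theorem mul_six_div_pow_le {f N : ℝ} (hf : 200 ≤ f) (hN : 1 ≤ N) :
    f * (6 / f) ^ (⌈Real.log N⌉₊ + 2) ≤ 36 * (1 / (f * N)) := by
  have hf0 : 0 < f := by linarith
  have hN0 : 0 < N := by linarith
  have h1 : (6 / f) ^ ⌈Real.log N⌉₊ ≤ 1 / N := by
    have e1 : 6 / f ≤ Real.exp (-1) := by
      rw [div_le_iff₀ hf0, Real.exp_neg, inv_mul_eq_div, le_div_iff₀ (Real.exp_pos 1)]
      linarith [Real.exp_one_lt_d9]
    calc (6 / f) ^ ⌈Real.log N⌉₊ ≤ Real.exp (-1) ^ ⌈Real.log N⌉₊ := by gcongr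
      _ = Real.exp (-⌈Real.log N⌉₊) := by rw [← Real.exp_nat_mul]; simp
      _ ≤ Real.exp (-Real.log N) := Real.exp_le_exp.2 (neg_le_neg (Nat.le_ceil _))
      _ = 1 / N := by rw [Real.exp_neg, Real.exp_log hN0, one_div]
  calc f * (6 / f) ^ (⌈Real.log N⌉₊ + 2) = 36 / f * (6 / f) ^ ⌈Real.log N⌉₊ := by
        rw [pow_add]; field_simp; norm_num
    _ ≤ 36 / f * (1 / N) := by gcongr
    _ = _ := by field_simp

section

variable {Ω : Type*} [MeasurableSpace Ω] {P : Measure Ω} [IsProbabilityMeasure P] {N : ℕ}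
  [NeZero N] {C L q θ f : ℝ} {H F G : Ω → Matrix (Fin N) (Fin N) ℝ}

theorem IsRegular.abs_nonlinearPart_sub_le (h : IsRegular P C L q θ H F G) (hθ : θ ≤ 1)
    (hf : 0 ≤ f) (ω : Ω) : |nonlinearPart P f H ω - nonlinearPart P f F ω| ≤
      2 * (∑ i, ∑ j, |H ω i j - F ω i j|) + Real.exp (-L) := by
  have h1 := abs_maxEigenvalue_perturbed_sub_le (h.isHermitian ω) (h.isHermitian_full ω) f
  have h2 := abs_eMoment_one_sub_le (H ω) (F ω)
  have h3 := h.abs_integral_maxEigenvalue_sub_le hθ hf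
  have h4 := norm_op_sub_le_sum (H ω) (F ω)
  rw [nonlinearPart, nonlinearPart]
  rw [abs_le] at *
  constructor <;> linarith [h1.1, h1.2, h2.1, h2.2, h3.1, h3.2]

theorem IsRegular.integral_abs_nonlinearPart_le (h : IsRegular P C L q θ H F G) (hθ : θ ≤ 1)
    (hf : 0 ≤ f) (hF : Integrable (nonlinearPart P f F) P) :
    Integrable (nonlinearPart P f H) P ∧
      ∫ ω, |nonlinearPart P f H ω| ∂P ≤
        ∫ ω, |nonlinearPart P f F ω| ∂P + 3 * Real.exp (-L) := by
  have hm : Measurable (nonlinearPart P f H) := by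
    refine ((measurable_maxEigenvalue f h.measurable h.symm).sub_const _).sub ?_
    simp only [eMoment_one_eq]
    exact (Finset.measurable_sum _ fun i _ => Finset.measurable_sum _ fun j _ =>
      h.measurable i j).const_mul _
  have hb : ∀ ω, |nonlinearPart P f H ω| ≤ |nonlinearPart P f F ω| +
      (2 * (∑ i, ∑ j, |H ω i j - F ω i j|) + Real.exp (-L)) := fun ω => by
    have := abs_sub_abs_le_abs_sub (nonlinearPart P f H ω) (nonlinearPart P f F ω)
    linarith [h.abs_nonlinearPart_sub_le hθ hf ω]
  have i1 : Integrable (fun ω => 2 * (∑ i, ∑ j, |H ω i j - F ω i j|) + Real.exp (-L)) P :=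
    (h.approx.integrable.const_mul 2).add (integrable_const _)
  have i2 : Integrable (fun ω => |nonlinearPart P f F ω| +
      (2 * (∑ i, ∑ j, |H ω i j - F ω i j|) + Real.exp (-L))) P := hF.abs.add i1
  have hH : Integrable (nonlinearPart P f H) P :=
    i2.mono' hm.aestronglyMeasurable (ae_of_all _ hb)
  refine ⟨hH, (integral_mono hH.abs i2 hb).trans ?_⟩
  rw [integral_add hF.abs i1, integral_add (h.approx.integrable.const_mul 2) (integrable_const _),
    integral_const_mul, integral_const, probReal_univ, one_smul]
  linarith [h.approx.integral_le]

end

set_option maxHeartbeats 1000000 in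
theorem eventually_nonlinearPart_le {C Cf : ℝ} (hC : 0 < C) :
    ∀ᶠ x in regime, ∀ (Ω : Type u) [MeasurableSpace Ω] (P : Measure Ω) [IsProbabilityMeasure P]
      (q θ f : ℝ) (H F G : Ω → Matrix (Fin x.1) (Fin x.1) ℝ),
      IsRegular P C x.2 q θ H F G → 200 * x.2 ^ 2 ≤ f → f ≤ (x.1 : ℝ) ^ Cf →
      P.real {ω | |nonlinearPart P f H ω| ≤ 10 ^ 8 * (x.2 ^ 2 / (f * Real.sqrt x.1))}ᶜ ≤
        Real.exp (-(1 / 2) * x.2) ∧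
      Integrable (nonlinearPart P f H) P ∧
      ∫ ω, |nonlinearPart P f H ω| ∂P ≤ 10 ^ 8 * (1 / (f * Real.sqrt x.1)) := by
  filter_upwards [eventually_norm_full.{u} hC, eventually_eMoment_tail.{u}, regime_le 6,
    regime_le_fst 16, regime_log_le 2, regime_one_le_log, regime_pow_le 4,
    regime_rpow_mul_exp_le (8 + Cf) (show (0 : ℝ) < 1 by norm_num),
    regime_rpow_mul_exp_le 1 (show (1 : ℝ) < 2 by norm_num),
    regime_const_mul_exp_le 3 (show (1 / 2 : ℝ) < 1 by norm_num)]
    with x hnorm htail hL6 hN16 hlogL hlog1 hL4 hexp hexp2 hexp3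
  intro Ω _ P _ q θ f H F G h hfL hfC
  obtain ⟨hθ4, hn⟩ := hnorm Ω P q θ H F G h
  obtain ⟨N, L⟩ := x
  simp only [neg_mul, one_mul, zero_mul, neg_zero, Real.exp_zero, Real.rpow_one] at *
  have hθ : θ ≤ 1 := by linarith
  have hL0 : 0 < L := by linarith
  have hf200 : 200 ≤ f := by nlinarith
  have hf0 : 0 < f := by linarith
  have hN0 : (0 : ℝ) < N := by linarith
  have : NeZero N := ⟨by rintro rfl; simp at hN0⟩
  have hF := h.approx.full
  set r := Real.sqrt N with hr
  have hr2 : r ^ 2 = N := Real.sq_sqrt hN0.le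
  have hr4 : 4 ≤ r := Real.le_sqrt_of_sq_le (by linarith)
  have hLr : L ^ 2 ≤ r := Real.le_sqrt_of_sq_le (by rw [← pow_mul]; exact hL4)
  obtain ⟨n, hnn⟩ : ∃ n, n = ⌈Real.log N⌉₊ := ⟨_, rfl⟩
  have hn_up : (n : ℝ) ≤ Real.log N + 1 := hnn ▸ (Nat.ceil_lt_add_one (by linarith)).le
  have hn1 : 1 ≤ n := by
    have : (1 : ℝ) ≤ n := hnn ▸ hlog1.trans (Nat.le_ceil _)
    exact_mod_cast this
  -- About `log N` terms make the tail of the series `O(1 / (f N))`. As `log N` is negligible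
  -- against `L`, the moment bounds hold up to this order, and `f ≥ 200 L ^ 2` keeps the series
  -- geometric.
  obtain ⟨K, hK⟩ : ∃ K, K = n + 1 := ⟨_, rfl⟩
  have hKL : (K : ℝ) + 1 ≤ L := by rw [hK]; push_cast; linarith
  have hK2 : 2 ≤ K := by omega
  -- error terms
  have hrN : 1 / (f * N) ≤ 1 / (f * r) := by
    rw [← hr2]; gcongr; nlinarith
  have n3 : 0 < 1 / (f * r) := by positivity
  have hsmall : (N : ℝ) ^ 7 * Real.exp (-L) ≤ 1 / (f * r) := by
    refine le_trans ?_ hrN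
    rw [le_div_iff₀ (by positivity)]
    refine le_trans ?_ hexp
    rw [Real.rpow_add hN0]
    have : (N : ℝ) ^ (8 : ℝ) = (N : ℝ) ^ 8 := by exact_mod_cast Real.rpow_natCast (N : ℝ) 8
    rw [this]
    calc (N : ℝ) ^ 7 * Real.exp (-L) * (f * N) = (N : ℝ) ^ 8 * f * Real.exp (-L) := by ring
      _ ≤ _ := by gcongr
  have hep := Real.exp_pos (-L)
  have hN7 : 16 * (N : ℝ) ^ 2 ≤ (N : ℝ) ^ 7 := by
    have : 16 ≤ (N : ℝ) ^ 5 := hN16.trans (le_self_pow₀ (by linarith) (by norm_num))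
    calc 16 * (N : ℝ) ^ 2 ≤ (N : ℝ) ^ 5 * N ^ 2 := by gcongr
      _ = _ := by ring
  have hs1 : 16 * (N : ℝ) ^ 2 * Real.exp (-L) ≤ 1 / (f * r) :=
    (mul_le_mul_of_nonneg_right hN7 hep.le).trans hsmall
  have hs2 : Real.exp (-L) ≤ 1 / (f * r) := by
    refine le_trans ?_ hs1
    have : 1 ≤ 16 * (N : ℝ) ^ 2 := by nlinarith
    nlinarith
  have hrest : f * (6 / f) ^ (K + 1) ≤ 36 * (1 / (f * r)) := by
    rw [hK, hnn]
    exact (mul_six_div_pow_le hf200 (by linarith)).trans (by linarith)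
  have hbad : P.real {ω | 3 < ‖op (F ω)‖} ≤ Real.exp (-L) := by
    refine (measureReal_mono (fun ω hω => ?_) (measure_ne_top _ _)).trans hn
    simp only [Set.mem_ofPred_eq] at hω ⊢
    linarith
  have hmean : ∫ ω, fluctuationSum f K (fun k => momentFluctuation P F k ω) ∂P ≤
      62500 * (1 / (f * r)) := by
    rw [hF.integral_fluctuationSum]
    have hk : ∀ k, 1 ≤ k → k ≤ K →
        ∫ ω, momentFluctuation P F k ω ∂P ≤ momentScale N (1 / 2) k := by
      intro k hk1 hk2
      refine hF.integral_momentFluctuation_le hθ hk1 (NeZero.pos N) ?_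
      have : (k : ℝ) ≤ K := by exact_mod_cast hk2
      nlinarith
    refine (fluctuationSum_mono hf0.le (by omega) hk).trans ?_
    have := fluctuationSum_momentScale_le (N := N) (l := 1 / 2) (K := K) le_rfl hf0
      (by nlinarith)
    refine this.trans (le_of_eq ?_)
    rw [← hr]; ring
  have hflu : fluctuationSum f K (momentScale N L) ≤ 250000 * (L ^ 2 / (f * r)) :=
    fluctuationSum_momentScale_le (by linarith) hf0 (by nlinarith)
  have hL2 : 1 / (f * r) ≤ L ^ 2 / (f * r) := by gcongr; nlinarith
  obtain ⟨hFi, hFI⟩ := hF.integral_abs_nonlinearPart_le hθ hf200 hK2 hbad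
  obtain ⟨hHi, hHI⟩ := h.integral_abs_nonlinearPart_le hθ hf0.le hFi
  refine ⟨?_, hHi, hHI.trans ?_⟩
  · have hsub : {ω | |nonlinearPart P f H ω| ≤ 10 ^ 8 * (L ^ 2 / (f * r))}ᶜ ⊆
        ({ω | Real.exp (-L) < ∑ i, ∑ j, |H ω i j - F ω i j|} ∪ {ω | 3 < ‖op (F ω)‖}) ∪
          ⋃ k ∈ Finset.Icc 1 K, {ω | momentScale N L k ≤ momentFluctuation P F k ω} := by
      intro ω hω
      by_contra hcon
      refine hω ?_
      simp only [Set.mem_union, Set.mem_iUnion, Set.mem_ofPred_eq, not_or, not_exists, not_le,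
        not_lt, Finset.mem_Icc] at hcon ⊢
      obtain ⟨⟨h1, h2⟩, h3⟩ := hcon
      have w1 := h.abs_nonlinearPart_sub_le hθ hf0.le ω
      have w2 := hF.abs_nonlinearPart_le hθ hf200 hK2 hbad h2
      have w3 := fluctuationSum_mono (f := f) (K := K) hf0.le (by omega)
        fun k hk1 hk2 => (h3 k ⟨hk1, hk2⟩).le
      have w4 := abs_sub_abs_le_abs_sub (nonlinearPart P f H ω) (nonlinearPart P f F ω)
      change |nonlinearPart P f H ω| ≤ _
      linarith only [w1, w2, w3, w4, h1, hmean, hflu, hrest, hs1, hs2, hL2, n3]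
    refine (measureReal_mono hsub (measure_ne_top _ _)).trans ((measureReal_union_le _ _).trans ?_)
    have e1 := measureReal_union_le (μ := P) {ω | Real.exp (-L) < ∑ i, ∑ j, |H ω i j - F ω i j|}
      {ω | 3 < ‖op (F ω)‖}
    have e2 : P.real (⋃ k ∈ Finset.Icc 1 K,
        {ω | momentScale N L k ≤ momentFluctuation P F k ω}) ≤ Real.exp (-L) := by
      refine (measureReal_biUnion_finset_le _ _).trans ?_
      refine (Finset.sum_le_sum (g := fun _ => Real.exp (-(2 * L))) fun k hk => ?_).trans ?_
      · rw [Finset.mem_Icc] at hk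
        have : (k : ℝ) ≤ K := by exact_mod_cast hk.2
        exact htail Ω P θ F hF hθ k hk.1 (by linarith)
      · rw [Finset.sum_const, Nat.card_Icc, nsmul_eq_mul, add_tsub_cancel_right]
        refine le_trans ?_ hexp2
        have h4 : L ≤ L ^ 4 := le_self_pow₀ (by linarith only [hL6]) (by norm_num)
        have hKN : (K : ℝ) ≤ N := by linarith only [h4, hL4, hKL]
        exact mul_le_mul_of_nonneg_right hKN (Real.exp_pos _).le
    have e3 := h.approx.tail
    linarith
  · linarith


/-! ### A quantitative central limit theorem for the linear statistic -/

theorem norm_exp_mul_I_sub_le (x : ℝ) :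
    ‖Complex.exp (x * Complex.I) - (1 + x * Complex.I - x ^ 2 / 2)‖ ≤ 4 * |x| ^ 3 := by
  have hn : ‖(x : ℂ) * Complex.I‖ = |x| := by simp
  by_cases hx : |x| ≤ 1
  · have h := Complex.exp_bound (x := x * Complex.I) (by rw [hn]; exact hx) (n := 3) (by norm_num)
    have e : ∑ m ∈ Finset.range 3, ((x : ℂ) * Complex.I) ^ m / (m.factorial : ℂ) =
        1 + x * Complex.I - x ^ 2 / 2 := by
      simp [Finset.sum_range_succ, Nat.factorial, mul_pow]
      ring
    rw [e, hn] at h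
    refine h.trans ?_
    norm_num [Nat.factorial]
    nlinarith [pow_nonneg (abs_nonneg x) 3]
  · push Not at hx
    have h1 : ‖Complex.exp (x * Complex.I)‖ = 1 := Complex.norm_exp_ofReal_mul_I x
    have h2 : ‖(1 + x * Complex.I - x ^ 2 / 2 : ℂ)‖ ≤ 1 + |x| + |x| ^ 2 / 2 := by
      refine (norm_sub_le _ _).trans (add_le_add ((norm_add_le _ _).trans ?_) ?_)
      · rw [hn]; simp
      · simp
    refine (norm_sub_le _ _).trans ?_
    rw [h1]
    have h3 : |x| ≤ |x| ^ 3 := le_self_pow₀ hx.le (by norm_num)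
    have h4 : |x| ^ 2 ≤ |x| ^ 3 := pow_le_pow_right₀ hx.le (by norm_num)
    linarith

theorem abs_exp_neg_sub_le {y : ℝ} (hy : 0 ≤ y) : |Real.exp (-y) - (1 - y)| ≤ y ^ 2 := by
  by_cases h : y ≤ 1
  · have := Real.abs_exp_sub_one_sub_id_le (x := -y) (by rw [abs_neg, abs_of_nonneg hy]; exact h)
    rw [neg_sq] at this
    convert this using 2
    ring
  · push Not at h
    have h1 : Real.exp (-y) ≤ 1 := Real.exp_le_one_iff.2 (by linarith)
    have h2 := Real.add_one_le_exp (-y)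
    rw [abs_of_nonneg (by linarith)]
    nlinarith

theorem norm_prod_sub_prod_le_sum {ι : Type*} (s : Finset ι) {a b : ι → ℂ} (ha : ∀ i, ‖a i‖ ≤ 1)
    (hb : ∀ i, ‖b i‖ ≤ 1) : ‖∏ i ∈ s, a i - ∏ i ∈ s, b i‖ ≤ ∑ i ∈ s, ‖a i - b i‖ := by
  classical
  induction s using Finset.induction_on with
  | empty => simp
  | insert i s hi ih =>
    rw [Finset.prod_insert hi, Finset.prod_insert hi, Finset.sum_insert hi]
    have e : a i * ∏ j ∈ s, a j - b i * ∏ j ∈ s, b j =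
        (a i - b i) * ∏ j ∈ s, a j + b i * (∏ j ∈ s, a j - ∏ j ∈ s, b j) := by ring
    rw [e]
    refine (norm_add_le _ _).trans (add_le_add ?_ ?_)
    · rw [norm_mul]
      have : ‖∏ j ∈ s, a j‖ ≤ 1 := by
        rw [norm_prod]; exact Finset.prod_le_one (fun _ _ => norm_nonneg _) fun _ _ => ha _
      exact mul_le_of_le_one_right (norm_nonneg _) this
    · rw [norm_mul]
      exact (mul_le_of_le_one_left (norm_nonneg _) (hb i)).trans ih

/-! ### Characteristic functions and the linear statistic. -/

section

variable {Ω : Type*} [MeasurableSpace Ω] {P : Measure Ω} [IsProbabilityMeasure P]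

theorem charFun_map_eq_integral {X : Ω → ℝ} (hX : AEMeasurable X P) (t : ℝ) :
    charFun (P.map X) t = ∫ ω, Complex.exp ((t * X ω : ℝ) * Complex.I) ∂P := by
  rw [charFun_apply_real, integral_map hX (by fun_prop)]
  simp

theorem integrable_exp_mul_I {X : Ω → ℝ} (hX : AEMeasurable X P) :
    Integrable (fun ω => Complex.exp (X ω * Complex.I)) P := by
  refine Integrable.of_bound (C := 1) ?_ (ae_of_all _ fun ω => (Complex.norm_exp_ofReal_mul_I _).le)
  have : AEMeasurable (fun ω => Complex.exp (X ω * Complex.I)) P := by fun_prop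
  exact this.aestronglyMeasurable

theorem norm_charFun_sub_le {X Y : Ω → ℝ} (hX : AEMeasurable X P) (hY : AEMeasurable Y P)
    (h : Integrable (fun ω => X ω - Y ω) P) (t : ℝ) :
    ‖charFun (P.map X) t - charFun (P.map Y) t‖ ≤ |t| * ∫ ω, |X ω - Y ω| ∂P := by
  rw [charFun_map_eq_integral hX, charFun_map_eq_integral hY,
    ← integral_sub (integrable_exp_mul_I (hX.const_mul t)) (integrable_exp_mul_I (hY.const_mul t)),
    ← integral_const_mul]
  refine norm_integral_le_of_norm_le (h.abs.const_mul _) (ae_of_all _ fun ω => ?_)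
  have e : Complex.exp ((t * X ω : ℝ) * Complex.I) - Complex.exp ((t * Y ω : ℝ) * Complex.I) =
      Complex.exp ((t * Y ω : ℝ) * Complex.I) *
        (Complex.exp (Complex.I * (t * X ω - t * Y ω : ℝ)) - 1) := by
    rw [mul_sub, ← Complex.exp_add, mul_one]
    congr 2
    push_cast; ring
  rw [e, norm_mul, Complex.norm_exp_ofReal_mul_I, one_mul]
  refine Real.norm_exp_I_mul_ofReal_sub_one_le.trans (le_of_eq ?_)
  rw [← mul_sub, Real.norm_eq_abs, abs_mul]

theorem norm_charFun_sub_exp_le {X : Ω → ℝ} (hX : Measurable X) {v b : ℝ}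
    (h2 : Integrable (fun ω => X ω ^ 2) P) (h3 : Integrable (fun ω => |X ω| ^ 3) P)
    (h0 : ∫ ω, X ω ∂P = 0) (hv : ∫ ω, X ω ^ 2 ∂P = v) (hb : ∫ ω, |X ω| ^ 3 ∂P ≤ b) (t : ℝ) :
    ‖charFun (P.map X) t - (Real.exp (-(t ^ 2 * v / 2)) : ℝ)‖ ≤ 4 * (|t| ^ 3 * b) + t ^ 4 * v ^ 2 := by
  have h1 : Integrable X P :=
    ((memLp_two_iff_integrable_sq hX.aestronglyMeasurable).2 h2).integrable (by norm_num)
  have hv0 : 0 ≤ v := hv ▸ integral_nonneg fun ω => sq_nonneg _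
  have i1 : Integrable (fun ω => ((t * X ω : ℝ) : ℂ) * Complex.I) P :=
    ((h1.const_mul t).ofReal (𝕜 := ℂ)).mul_const _
  have i2 : Integrable (fun ω => (((t * X ω : ℝ) : ℂ)) ^ 2 / 2) P := by
    have e : (fun ω => (((t * X ω : ℝ) : ℂ)) ^ 2 / 2) = fun ω => ((t ^ 2 * X ω ^ 2 / 2 : ℝ) : ℂ) := by
      funext ω; push_cast; ring
    rw [e]
    exact ((h2.const_mul (t ^ 2)).div_const 2).ofReal
  have i3 : Integrable (fun ω => 1 + ((t * X ω : ℝ) : ℂ) * Complex.I) P :=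
    (integrable_const _).add i1
  have i4 : Integrable (fun ω => 1 + ((t * X ω : ℝ) : ℂ) * Complex.I -
    (((t * X ω : ℝ) : ℂ)) ^ 2 / 2) P := i3.sub i2
  have e1 : ∫ ω, (1 + ((t * X ω : ℝ) : ℂ) * Complex.I - (((t * X ω : ℝ) : ℂ)) ^ 2 / 2) ∂P =
      ((1 - t ^ 2 * v / 2 : ℝ) : ℂ) := by
    rw [integral_sub i3 i2, integral_add (integrable_const _) i1, integral_mul_const,
      integral_complex_ofReal, integral_const_mul, h0, integral_const, probReal_univ, one_smul]
    have : ∫ ω, (((t * X ω : ℝ) : ℂ)) ^ 2 / 2 ∂P = ((t ^ 2 * v / 2 : ℝ) : ℂ) := by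
      rw [← hv, ← integral_const_mul, ← integral_div, ← integral_complex_ofReal]
      congr 1
      funext ω
      push_cast; ring
    rw [this]; push_cast; ring
  have e2 : ‖charFun (P.map X) t - ((1 - t ^ 2 * v / 2 : ℝ) : ℂ)‖ ≤ 4 * (|t| ^ 3 * b) := by
    rw [charFun_map_eq_integral hX.aemeasurable, ← e1,
      ← integral_sub (integrable_exp_mul_I (hX.aemeasurable.const_mul t)) i4]
    have : ∫ ω, 4 * (|t| ^ 3 * |X ω| ^ 3) ∂P ≤ 4 * (|t| ^ 3 * b) := by
      rw [integral_const_mul, integral_const_mul]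
      gcongr
    refine (norm_integral_le_of_norm_le ((h3.const_mul _).const_mul _) (ae_of_all _ fun ω => ?_)).trans
      this
    refine (norm_exp_mul_I_sub_le _).trans (le_of_eq ?_)
    rw [abs_mul, mul_pow]
  have e3 : ‖((1 - t ^ 2 * v / 2 : ℝ) : ℂ) - (Real.exp (-(t ^ 2 * v / 2)) : ℝ)‖ ≤ t ^ 4 * v ^ 2 := by
    rw [← Complex.ofReal_sub, Complex.norm_real, Real.norm_eq_abs, abs_sub_comm]
    refine (abs_exp_neg_sub_le (by positivity)).trans ?_
    have : 0 ≤ t ^ 4 * v ^ 2 := by positivity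
    nlinarith
  calc _ ≤ ‖charFun (P.map X) t - ((1 - t ^ 2 * v / 2 : ℝ) : ℂ)‖ +
        ‖((1 - t ^ 2 * v / 2 : ℝ) : ℂ) - (Real.exp (-(t ^ 2 * v / 2)) : ℝ)‖ :=
      norm_sub_le_norm_sub_add_norm_sub _ _ _
    _ ≤ _ := add_le_add e2 e3

/-- The number of matrix positions carrying the entry `s`. -/
noncomputable def entryCount {N : ℕ} (s : {s : Fin N × Fin N // s.1 ≤ s.2}) : ℕ :=
  (Finset.univ.filter fun p : Fin N × Fin N => edge p.1 p.2 = s).card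

theorem entryCount_edge {N : ℕ} (i j : Fin N) :
    entryCount (edge i j) = if i = j then 1 else 2 := by
  have : (Finset.univ.filter fun p : Fin N × Fin N => edge p.1 p.2 = edge i j) =
      {(i, j), (j, i)} := by
    ext ⟨a, b⟩
    simp [edge_eq_iff]
  rw [entryCount, this]
  split_ifs with h
  · simp [h]
  · rw [Finset.card_pair]
    simp [Prod.ext_iff, h]

theorem edge_self_eq {N : ℕ} (s : {s : Fin N × Fin N // s.1 ≤ s.2}) : edge s.1.1 s.1.2 = s := by
  obtain ⟨⟨a, b⟩, h⟩ := s
  have h' : a ≤ b := h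
  simp [edge, h']

theorem entryCount_le {N : ℕ} (s : {s : Fin N × Fin N // s.1 ≤ s.2}) : entryCount s ≤ 2 := by
  rw [← edge_self_eq s, entryCount_edge]
  split_ifs <;> norm_num

theorem sum_edge_eq {N : ℕ} (g : {s : Fin N × Fin N // s.1 ≤ s.2} → ℝ) :
    ∑ i, ∑ j, g (edge i j) = ∑ s, entryCount s * g s := by
  rw [← Fintype.sum_prod_type' (f := fun i j => g (edge i j)),
    ← Finset.sum_fiberwise (s := Finset.univ) (g := fun p : Fin N × Fin N => edge p.1 p.2)]
  refine Finset.sum_congr rfl fun s _ => ?_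
  rw [Finset.sum_congr rfl fun p hp => by rw [(Finset.mem_filter.1 hp).2], Finset.sum_const,
    nsmul_eq_mul, entryCount]

/-- Off-diagonal entries occupy two positions and diagonal ones a single position. This value makes
the variance of the linear statistic, normalised by `√(N / 2)`, equal to `1 - 1 / (2 N)`. -/
theorem sum_entryCount_sq {N : ℕ} :
    ∑ s : {s : Fin N × Fin N // s.1 ≤ s.2}, (entryCount s : ℝ) ^ 2 = 2 * N ^ 2 - N := by
  simp only [pow_two]
  rw [← sum_edge_eq fun s => (entryCount s : ℝ)]
  have : ∀ i j : Fin N, (entryCount (edge i j) : ℝ) = 2 - if i = j then 1 else 0 := by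
    intro i j
    rw [entryCount_edge]; split_ifs <;> norm_num
  simp only [this, Finset.sum_sub_distrib]
  simp
  ring

theorem IsSparseMatrix.eMoment_one_eq_sum {A₀ Cm Cq ξ q : ℝ} {N : ℕ}
    {H : Ω → Matrix (Fin N) (Fin N) ℝ} (h : IsSparseMatrix P A₀ Cm Cq N ξ q H) (ω : Ω) (a : ℝ) :
    a * eMoment (H ω) 1 = ∑ s : {s : Fin N × Fin N // s.1 ≤ s.2},
      (a * (1 / N) * entryCount s) * H ω s.1.1 s.1.2 := by
  have e : ∀ i j, H ω i j = H ω (edge i j).1.1 (edge i j).1.2 := by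
    intro i j
    rcases le_total i j with hij | hij
    · simp [edge, hij]
    · simp [edge, hij, h.symm ω i j]
  have : ∑ i, ∑ j, H ω i j = ∑ s : {s : Fin N × Fin N // s.1 ≤ s.2},
      entryCount s * H ω s.1.1 s.1.2 := by
    rw [← sum_edge_eq fun s => H ω s.1.1 s.1.2]
    exact Finset.sum_congr rfl fun i _ => Finset.sum_congr rfl fun j _ => e i j
  rw [eMoment_one_eq, this, Finset.mul_sum, Finset.mul_sum]
  refine Finset.sum_congr rfl fun s _ => ?_
  ring

/-- A Lyapunov argument: the characteristic function factorises, each factor differs from the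
Gaussian one by its third absolute moment, of order `N ^ (-5 / 2)`, and by the square of its
variance, and there are at most `N ^ 2` factors. Of `q` only `q ≥ 1` matters. -/
theorem IsSparseMatrix.norm_charFun_linear_sub_le {A₀ Cm Cq ξ q : ℝ} {N : ℕ}
    {H : Ω → Matrix (Fin N) (Fin N) ℝ} (h : IsSparseMatrix P A₀ Cm Cq N ξ q H) (hN : 0 < N)
    (h3 : (3 : ℝ) ≤ Real.log N ^ (A₀ * Real.log (Real.log N))) (hCm : 0 < Cm) (hq : 1 ≤ q) (t : ℝ) :
    ‖charFun (P.map fun ω => Real.sqrt (N / 2) * eMoment (H ω) 1) t -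
      (Real.exp (-(t ^ 2 * (1 - 1 / (2 * N)) / 2)) : ℝ)‖ ≤
        16 * |t| ^ 3 * Cm ^ 3 / Real.sqrt N + 4 * t ^ 4 / N ^ 2 := by
  have hN0 : (0 : ℝ) < N := by exact_mod_cast hN
  have hN1 : (1 : ℝ) ≤ N := by exact_mod_cast hN
  set r := Real.sqrt N with hr
  have hr0 : 0 < r := Real.sqrt_pos.2 hN0
  have hr2 : r ^ 2 = N := Real.sq_sqrt hN0.le
  set a := Real.sqrt (N / 2) with ha
  have ha0 : 0 ≤ a := Real.sqrt_nonneg _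
  have ha2 : a ^ 2 = N / 2 := Real.sq_sqrt (by positivity)
  have har : a ≤ r := Real.sqrt_le_sqrt (by linarith)
  set c : {s : Fin N × Fin N // s.1 ≤ s.2} → ℝ := fun s => a * (1 / N) * entryCount s with hc
  set X : {s : Fin N × Fin N // s.1 ≤ s.2} → Ω → ℝ := fun s ω => c s * H ω s.1.1 s.1.2 with hX
  have hm : ∀ s, Measurable (X s) := fun s => (h.measurable _ _).const_mul _
  have hind : iIndepFun X P :=
    h.indep.comp (fun s x => c s * x) fun s => measurable_const_mul _
  have hsum : (fun ω => a * eMoment (H ω) 1) = fun ω => ∑ s, X s ω := by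
    funext ω; exact h.eMoment_one_eq_sum ω a
  have hc2 : ∀ s, c s ^ 2 = 1 / (2 * N) * (entryCount s : ℝ) ^ 2 := by
    intro s
    simp only [hc]
    rw [mul_pow, mul_pow, ha2]; field_simp
  have hcount : ∀ s : {s : Fin N × Fin N // s.1 ≤ s.2}, (entryCount s : ℝ) ≤ 2 := fun s => by
    exact_mod_cast entryCount_le s
  have hc2' : ∀ s, c s ^ 2 ≤ 2 / N := by
    intro s
    have h1 : (entryCount s : ℝ) ^ 2 ≤ 2 ^ 2 := pow_le_pow_left₀ (by positivity) (hcount s) 2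
    rw [hc2]
    calc _ ≤ 1 / (2 * (N : ℝ)) * 2 ^ 2 := by gcongr
      _ = _ := by field_simp
  have hc1 : ∀ s, |c s| ≤ 2 / r := by
    intro s
    simp only [hc]
    rw [abs_of_nonneg (by positivity)]
    calc a * (1 / N) * entryCount s ≤ r * (1 / N) * 2 := by gcongr; exact hcount s
      _ = _ := by rw [← hr2]; field_simp
  have hc3 : ∀ s, |c s| ^ 3 ≤ 4 / (r * N) := by
    intro s
    calc |c s| ^ 3 = |c s| * c s ^ 2 := by rw [pow_succ' , sq_abs]
      _ ≤ 2 / r * (2 / N) := by gcongr; exacts [hc1 s, hc2' s]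
      _ = _ := by field_simp; norm_num
  set v : {s : Fin N × Fin N // s.1 ≤ s.2} → ℝ := fun s => c s ^ 2 * (1 / N) with hv
  have hvar : ∀ s, ∫ ω, X s ω ^ 2 ∂P = v s := by
    intro s
    have := h.variance s.1.1 s.1.2
    simp only [sq_abs] at this
    simp only [hX, mul_pow]
    rw [integral_const_mul, this]
  have hV : ∑ s, v s = 1 - 1 / (2 * N) := by
    simp only [hv, hc2]
    rw [← Finset.sum_mul, ← Finset.mul_sum, sum_entryCount_sq]
    field_simp
  have hthird : ∀ s, Integrable (fun ω => |X s ω| ^ 3) P ∧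
      ∫ ω, |X s ω| ^ 3 ∂P ≤ 4 / (r * N) * (Cm ^ 3 / N) := by
    intro s
    have i := h.integrable_pow 3 le_rfl (by exact_mod_cast h3) s.1.1 s.1.2
    have m := h.moment 3 le_rfl (by exact_mod_cast h3) s.1.1 s.1.2
    simp only [hX, abs_mul, mul_pow]
    refine ⟨i.const_mul _, ?_⟩
    rw [integral_const_mul]
    refine mul_le_mul (hc3 s) (m.trans ?_) (integral_nonneg fun ω => by positivity) (by positivity)
    refine div_le_div_of_nonneg_left (by positivity) hN0 ?_
    exact le_mul_of_one_le_right hN0.le (one_le_pow₀ hq)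
  have hone : ∀ s, ‖charFun (P.map (X s)) t - (Real.exp (-(t ^ 2 * v s / 2)) : ℝ)‖ ≤
      4 * (|t| ^ 3 * (4 / (r * N) * (Cm ^ 3 / N))) + t ^ 4 * (2 / N * (1 / N)) ^ 2 := by
    intro s
    have i2 : Integrable (fun ω => X s ω ^ 2) P := by
      simp only [hX, mul_pow]
      exact ((h.memLp_two s.1.1 s.1.2).integrable_sq).const_mul _
    have h0 : ∫ ω, X s ω ∂P = 0 := by
      simp only [hX]
      rw [integral_const_mul, h.mean, mul_zero]
    refine (norm_charFun_sub_exp_le (hm s) i2 (hthird s).1 h0 (hvar s) (hthird s).2 t).trans ?_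
    have hvs : v s ≤ 2 / N * (1 / N) := by
      simp only [hv]
      exact mul_le_mul_of_nonneg_right (hc2' s) (by positivity)
    have hv0 : 0 ≤ v s := by simp only [hv]; positivity
    gcongr
  have hprod : ((Real.exp (-(t ^ 2 * (1 - 1 / (2 * N)) / 2)) : ℝ) : ℂ) =
      ∏ s, ((Real.exp (-(t ^ 2 * v s / 2)) : ℝ) : ℂ) := by
    rw [← Complex.ofReal_prod, ← Real.exp_sum, ← hV, Finset.mul_sum, Finset.sum_div,
      Finset.sum_neg_distrib]
  rw [hsum, hind.charFun_map_fun_sum_eq_prod (fun s => (hm s).aemeasurable), Finset.prod_apply,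
    hprod]
  have hP : ∀ s, IsProbabilityMeasure (P.map (X s)) := fun s =>
    Measure.isProbabilityMeasure_map (hm s).aemeasurable
  refine (norm_prod_sub_prod_le_sum _ (fun s => norm_charFun_le_one t) fun s => ?_).trans ?_
  · rw [Complex.norm_real, Real.norm_eq_abs, abs_of_pos (Real.exp_pos _)]
    refine Real.exp_le_one_iff.2 ?_
    have hv0 : 0 ≤ v s := by simp only [hv]; positivity
    have : 0 ≤ t ^ 2 * v s / 2 := by positivity
    linarith
  · refine (Finset.sum_le_sum fun s _ => hone s).trans ?_
    rw [Finset.sum_const, nsmul_eq_mul]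
    have hcard : ((Finset.univ : Finset {s : Fin N × Fin N // s.1 ≤ s.2}).card : ℝ) ≤ N ^ 2 := by
      have h1 := Fintype.card_subtype_le fun s : Fin N × Fin N => s.1 ≤ s.2
      rw [Fintype.card_prod, Fintype.card_fin] at h1
      rw [Finset.card_univ, pow_two]
      exact_mod_cast h1
    calc _ ≤ (N : ℝ) ^ 2 * (4 * (|t| ^ 3 * (4 / (r * N) * (Cm ^ 3 / N))) +
          t ^ 4 * (2 / N * (1 / N)) ^ 2) := by gcongr
      _ = _ := by field_simp; ring

end


theorem abs_exp_neg_sub_exp_neg_le {a b : ℝ} (ha : 0 ≤ a) (hab : a ≤ b) :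
    |Real.exp (-a) - Real.exp (-b)| ≤ b - a := by
  have h1 : Real.exp (-b) ≤ Real.exp (-a) := Real.exp_le_exp.2 (by linarith)
  have h2 : Real.exp (-a) ≤ 1 := Real.exp_le_one_iff.2 (by linarith)
  have h3 : Real.exp (-b) = Real.exp (-a) * Real.exp (-(b - a)) := by
    rw [← Real.exp_add]; congr 1; ring
  have h4 := Real.add_one_le_exp (-(b - a))
  have h5 := Real.exp_pos (-a)
  rw [abs_of_nonneg (by linarith), h3]
  nlinarith

/-- After scaling by `√(N / 2)` the nonlinear part is `O(1 / f)` in `L¹`, which vanishes in the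
limit because `f ≥ 200 L ^ 2`. The linear part has variance `1 - 1 / (2 N)`, which is then replaced
by `1`. -/
theorem eventually_norm_charFun_sub_le {C Cf A₀ Cm Cq : ℝ} (hC : 0 < C) (hCm : 0 < Cm) (t : ℝ)
    {η : ℝ} (hη : 0 < η) :
    ∀ᶠ x in regime, ∀ (Ω : Type u) [MeasurableSpace Ω] (P : Measure Ω) [IsProbabilityMeasure P]
      (ξ q θ f : ℝ) (H F G : Ω → Matrix (Fin x.1) (Fin x.1) ℝ),
      IsSparseMatrix P A₀ Cm Cq x.1 ξ q H →
      x.2 ≤ Real.log x.1 ^ (A₀ * Real.log (Real.log x.1)) →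
      IsRegular P C x.2 q θ H F G → 200 * x.2 ^ 2 ≤ f → f ≤ (x.1 : ℝ) ^ Cf →
      ‖charFun (P.map fun ω => Real.sqrt (x.1 / 2) * (maxEigenvalue (perturbed f (H ω)) -
        ∫ ω', maxEigenvalue (perturbed f (H ω')) ∂P)) t - (Real.exp (-(t ^ 2 / 2)) : ℝ)‖ ≤ η := by
  filter_upwards [eventually_nonlinearPart_le.{u} (Cf := Cf) hC, regime_le 3, regime_pow_le 2,
    regime_le (|t| * 10 ^ 8 / (η / 4)), regime_le (16 * |t| ^ 3 * Cm ^ 3 / (η / 4)),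
    regime_le (4 * t ^ 4 / (η / 4)), regime_le (t ^ 2 / (η / 4))]
    with x hx hL3 hLN ht1 ht2 ht3 ht4
  intro Ω _ P _ ξ q θ f H F G hS hLA h hfL hfC
  obtain ⟨-, hi, hI⟩ := hx Ω P q θ f H F G h hfL hfC
  obtain ⟨N, L⟩ := x
  simp only at *
  have hL0 : 0 < L := by linarith
  have hN0 : (0 : ℝ) < N := lt_of_lt_of_le (by positivity) hLN
  have hN : 0 < N := by exact_mod_cast hN0
  have hη4 : 0 < η / 4 := by positivity
  rw [div_le_iff₀ hη4] at ht1 ht2 ht3 ht4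
  set r := Real.sqrt N with hr
  have hLr : L ≤ r := Real.le_sqrt_of_sq_le hLN
  have hr0 : 0 < r := by linarith
  have hLN1 : L ≤ N := by nlinarith
  have hf0 : 0 < f := by nlinarith
  have hq : 1 ≤ q := (one_le_pow₀ (by linarith)).trans h.q_lower
  set a := Real.sqrt (N / 2) with ha
  have ha0 : 0 ≤ a := Real.sqrt_nonneg _
  have har : a ≤ r := Real.sqrt_le_sqrt (by linarith)
  set X : Ω → ℝ := fun ω => a * (maxEigenvalue (perturbed f (H ω)) -
    ∫ ω', maxEigenvalue (perturbed f (H ω')) ∂P) with hX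
  set Y : Ω → ℝ := fun ω => a * eMoment (H ω) 1 with hY
  have hXm : Measurable X :=
    ((measurable_maxEigenvalue f h.measurable h.symm).sub_const _).const_mul _
  have hYm : Measurable Y := by
    simp only [hY, eMoment_one_eq]
    exact ((Finset.measurable_sum _ fun i _ => Finset.measurable_sum _ fun j _ =>
      h.measurable i j).const_mul _).const_mul _
  have hXY : ∀ ω, X ω - Y ω = a * nonlinearPart P f H ω := fun ω => by
    simp only [hX, hY, nonlinearPart]; ring
  have e1 : ‖charFun (P.map X) t - charFun (P.map Y) t‖ ≤ η / 4 := by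
    refine (norm_charFun_sub_le hXm.aemeasurable hYm.aemeasurable ?_ t).trans ?_
    · simp only [hXY]; exact hi.const_mul _
    · simp only [hXY, abs_mul, abs_of_nonneg ha0]
      rw [integral_const_mul]
      have hI0 : 0 ≤ ∫ ω, |nonlinearPart P f H ω| ∂P := integral_nonneg fun _ => abs_nonneg _
      calc |t| * (a * ∫ ω, |nonlinearPart P f H ω| ∂P)
          ≤ |t| * (r * (10 ^ 8 * (1 / (f * r)))) := by gcongr
        _ = |t| * 10 ^ 8 / f := by field_simp
        _ ≤ |t| * 10 ^ 8 / L := by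
          gcongr
          nlinarith
        _ ≤ η / 4 := by rw [div_le_iff₀ hL0]; linarith
  have e2 := hS.norm_charFun_linear_sub_le hN (hL3.trans hLA) hCm hq t
  have e3 : 16 * |t| ^ 3 * Cm ^ 3 / r ≤ η / 4 := by
    rw [div_le_iff₀ hr0]; nlinarith
  have e4 : 4 * t ^ 4 / (N : ℝ) ^ 2 ≤ η / 4 := by
    rw [div_le_iff₀ (by positivity)]
    have : L ≤ (N : ℝ) ^ 2 := by nlinarith
    nlinarith
  have e5 : ‖((Real.exp (-(t ^ 2 * (1 - 1 / (2 * N)) / 2)) : ℝ) : ℂ) -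
      (Real.exp (-(t ^ 2 / 2)) : ℝ)‖ ≤ η / 4 := by
    rw [← Complex.ofReal_sub, Complex.norm_real, Real.norm_eq_abs]
    have h1 : 1 / (2 * (N : ℝ)) ≤ 1 := by
      rw [div_le_one (by positivity)]; linarith
    have h2 : 0 < 1 / (2 * (N : ℝ)) := by positivity
    have ht0 := sq_nonneg t
    refine (abs_exp_neg_sub_exp_neg_le (by nlinarith) (by nlinarith)).trans ?_
    have : t ^ 2 / 2 - t ^ 2 * (1 - 1 / (2 * (N : ℝ))) / 2 = t ^ 2 / N / 4 := by
      field_simp; ring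
    rw [this]
    have h3 : t ^ 2 / N ≤ η / 4 := by rw [div_le_iff₀ hN0]; nlinarith
    have h4 : 0 ≤ t ^ 2 / N := by positivity
    linarith
  calc _ ≤ ‖charFun (P.map X) t - charFun (P.map Y) t‖ +
        ‖charFun (P.map Y) t - (Real.exp (-(t ^ 2 * (1 - 1 / (2 * N)) / 2)) : ℝ)‖ +
        ‖((Real.exp (-(t ^ 2 * (1 - 1 / (2 * N)) / 2)) : ℝ) : ℂ) -
          (Real.exp (-(t ^ 2 / 2)) : ℝ)‖ :=
        (norm_sub_le_norm_sub_add_norm_sub _ _ _).trans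
          (add_le_add_left (norm_sub_le_norm_sub_add_norm_sub _ _ _) _)
    _ ≤ η := by linarith

/-! ### Passing to uniform statements in the size -/

/-- A diagonal argument: at size `N` the precision is `1 / (m + 1)` for the largest `m ≤ N` whose
threshold `N₁ m` has been passed. -/
theorem exists_tendsto_zero_of_forall {Q : ℕ → ℝ → Prop}
    (h : ∀ η : ℝ, 0 < η → ∃ N₁ : ℕ, ∀ N ≥ N₁, Q N η) :
    ∃ (δ : ℕ → ℝ) (N₀ : ℕ), Tendsto δ atTop (𝓝 0) ∧ ∀ N ≥ N₀, Q N (δ N) := by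
  classical
  choose N₁ hN₁ using fun m : ℕ => h (1 / ((m : ℝ) + 1)) (by positivity)
  set g : ℕ → ℕ := fun N => Nat.findGreatest (fun m => N₁ m ≤ N) N with hg
  refine ⟨fun N => 1 / ((g N : ℝ) + 1), N₁ 0, ?_, fun N hN => ?_⟩
  · have hgt : Tendsto g atTop atTop := by
      refine tendsto_atTop.2 fun M => ?_
      filter_upwards [eventually_ge_atTop (max M (N₁ M))] with N hN
      exact Nat.le_findGreatest ((le_max_left _ _).trans hN) ((le_max_right _ _).trans hN)
    exact tendsto_one_div_add_atTop_nhds_zero_nat.comp hgt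
  · exact hN₁ (g N) N (Nat.findGreatest_spec (P := fun m => N₁ m ≤ N) (Nat.zero_le N) hN)

/-- A single constant dominates both `θ * q = 2 * exp 2 * Cm` and `q / √N ≤ Cq`. -/
theorem exists_isRegular {a₀ A₀ Cm Cq Cf ε₀ : ℝ} (ha₀ : 0 < a₀) (hA₀ : 10 ≤ A₀) (hCm : 0 < Cm)
    (hCq : 0 < Cq) : ∃ N₀ : ℕ, ∀ N ≥ N₀, ∀ (Ω : Type u) [MeasurableSpace Ω] (P : Measure Ω)
      [IsProbabilityMeasure P] (ξ q f : ℝ) (H : Ω → Matrix (Fin N) (Fin N) ℝ),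
      Admissible P a₀ A₀ Cm Cq Cf ε₀ N ξ q f H →
      Real.log N ^ ξ ≤ Real.log N ^ (A₀ * Real.log (Real.log N)) ∧
      Real.log N ^ (2 * ξ) = (Real.log N ^ ξ) ^ 2 ∧
      ∃ θ F G, IsRegular P (2 * Real.exp 2 * Cm + Cq) (Real.log N ^ ξ) q θ H F G := by
  obtain ⟨N₀, hN₀⟩ := exists_of_regime ha₀ hA₀
    ((eventually_isApproximation.{u} (A₀ := A₀) hCm hCq).and
      ((regime_le 1).and regime_one_le_log))
  refine ⟨N₀, fun N hN Ω _ P _ ξ q f H h => ?_⟩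
  obtain ⟨h1, h2, h3⟩ := hN₀ N hN ξ h.xi
  simp only at h1 h2 h3
  have hlog0 : 0 ≤ Real.log N := by linarith
  have hLA : Real.log N ^ ξ ≤ Real.log N ^ (A₀ * Real.log (Real.log N)) :=
    Real.rpow_le_rpow_of_exponent_le h3 h.xi.2
  have hpow : ∀ n : ℕ, Real.log N ^ (n * ξ) = (Real.log N ^ ξ) ^ n := fun n => by
    rw [mul_comm, Real.rpow_mul hlog0, Real.rpow_natCast]
  have hp2 := hpow 2
  have hp3 := hpow 3
  norm_num at hp2 hp3
  have hq3 : (Real.log N ^ ξ) ^ 3 ≤ q := hp3 ▸ h.sparse.q_lower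
  have hq : 0 < q := lt_of_lt_of_le (by positivity) hq3
  refine ⟨hLA, hp2, ?_⟩
  obtain ⟨F, G, hFG⟩ := h1 Ω P ξ q H h.sparse hLA hq3
  have hE : 0 < 2 * Real.exp 2 * Cm := by positivity
  refine ⟨_, F, G, h.sparse.measurable, h.sparse.symm, hq3, h.sparse.q_upper.trans ?_, ?_, ?_, hFG⟩
  · exact mul_le_mul_of_nonneg_right (by linarith) (Real.sqrt_nonneg _)
  · positivity
  · rw [div_mul_cancel₀ _ hq.ne']; linarith


/-- By monotonicity of `t + 1 / t` the gap above `2` is smallest at `f = 1 + ε`. Half of it is the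
constant of the theorem, and the other half is the tolerance granted to the position of the
eigenvalue. -/
theorem two_add_gap_le {ε f : ℝ} (hε : 0 < ε) (hf : 1 + ε ≤ f) :
    2 + 2 * (ε ^ 2 / (2 * (1 + ε))) ≤ f + 1 / f := by
  have hf0 : 0 < f := by linarith
  have h1 : 2 + 2 * (ε ^ 2 / (2 * (1 + ε))) = (1 + ε) + 1 / (1 + ε) := by field_simp; ring
  have h2 : f + 1 / f - ((1 + ε) + 1 / (1 + ε)) =
      (f - (1 + ε)) * (f * (1 + ε) - 1) / (f * (1 + ε)) := by field_simp; ring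
  have h3 : 0 ≤ (f - (1 + ε)) * (f * (1 + ε) - 1) / (f * (1 + ε)) := by
    refine div_nonneg (mul_nonneg (by linarith) ?_) (by positivity)
    nlinarith
  linarith

theorem HighProb.of_real_le {Ω : Type*} [MeasurableSpace Ω] {P : Measure Ω} [IsProbabilityMeasure P]
    {N : ℕ} {ξ ν : ℝ} {E S : Set Ω} (h : P.real S ≤ Real.exp (-ν * Real.log N ^ ξ))
    (hES : Eᶜ ⊆ S) : HighProb P N ξ ν E :=
  (measureReal_mono hES).trans h

theorem exists_maxEigenvalue_estimates {a₀ A₀ Cm Cq Cf ε₀ : ℝ} (ha₀ : 0 < a₀) (hA₀ : 10 ≤ A₀)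
    (hCm : 0 < Cm) (hCq : 0 < Cq) (hε₀ : 0 < ε₀) {K : ℝ}
    (hK : K = 10 ^ 12 + (2 * Real.exp 2 * Cm + Cq)) :
    ∃ (N₀ : ℕ) (δ : ℕ → ℝ), Tendsto δ atTop (𝓝 0) ∧ ∀ N : ℕ, N₀ ≤ N →
      ∀ (Ω : Type u) [MeasurableSpace Ω] (P : Measure Ω) [IsProbabilityMeasure P] (ξ q f : ℝ)
        (H : Ω → Matrix (Fin N) (Fin N) ℝ),
      Admissible P a₀ A₀ Cm Cq Cf ε₀ N ξ q f H →
      HighProb P N ξ (1 / 2)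
        {ω | |maxEigenvalue (perturbed f (H ω)) - (f + 1 / f)| ≤ δ N} ∧
      HighProb P N ξ (1 / 2)
        {ω | 2 + ε₀ ^ 2 / (2 * (1 + ε₀)) ≤ maxEigenvalue (perturbed f (H ω))} ∧
      Integrable (fun ω => maxEigenvalue (perturbed f (H ω))) P ∧
      |(∫ ω, maxEigenvalue (perturbed f (H ω)) ∂P) - (f + 1 / f)| ≤
        K * (1 / f ^ 3 + 1 / (f ^ 2 * q) + 1 / (f * N)) ∧
      HighProb P N ξ (1 / 2)
        {ω | |maxEigenvalue (perturbed f (H ω)) - (f + 1 / f)| ≤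
          K * (1 / f ^ 3 + 1 / (f ^ 2 * q) + (Real.log N) ^ ξ / Real.sqrt N)} ∧
      HighProb P N ξ (1 / 2)
        {ω | ∀ v : Fin N → ℝ, ∑ i, v i ^ 2 = 1 →
          (perturbed f (H ω)).mulVec v =
            maxEigenvalue (perturbed f (H ω)) • v →
          ∃ s : ℝ, (s = 1 ∨ s = -1) ∧
            |(s • v) ⬝ᵥ unitVec N - (1 - 1 / (2 * f ^ 2))| ≤
              K * (1 / f ^ 3 + (Real.log N) ^ (2 * ξ) / (f * Real.sqrt N))} ∧
      (200 * (Real.log N) ^ (2 * ξ) ≤ f → 2 ≤ ξ →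
        HighProb P N ξ (1 / 2)
          {ω | |maxEigenvalue (perturbed f (H ω)) -
              ((∫ ω', maxEigenvalue (perturbed f (H ω')) ∂P) +
                1 / (N : ℝ) * ∑ i, ∑ j, H ω i j)| ≤
            K * ((Real.log N) ^ (2 * ξ) / (f * Real.sqrt N))}) := by
  obtain ⟨C, hC_def⟩ : ∃ C : ℝ, C = 2 * Real.exp 2 * Cm + Cq := ⟨_, rfl⟩
  have hC : 0 < C := by rw [hC_def]; positivity
  rw [← hC_def] at hK
  have hc0 : 0 < ε₀ ^ 2 / (2 * (1 + ε₀)) := by positivity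
  obtain ⟨N₁, hreg⟩ := exists_isRegular.{u} (Cf := Cf) (ε₀ := ε₀) ha₀ hA₀ hCm hCq
  obtain ⟨N₂, hev⟩ := exists_of_regime ha₀ hA₀
    ((eventually_weak_position.{u} hC hε₀ hc0).and ((eventually_strong_position.{u} hC).and
      ((eventually_abs_integral_maxEigenvalue_sub_le.{u} (Cf := Cf) hC).and
        ((eventually_nonlinearPart_le.{u} (Cf := Cf) hC).and ((regime_le 1).and
          (regime_le_fst 1))))))
  obtain ⟨δ, N₃, hδ, hpos⟩ := exists_tendsto_zero_of_forall fun η hη =>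
    exists_of_regime ha₀ hA₀ (eventually_weak_position.{u} hC hε₀ hη)
  refine ⟨N₁ + N₂ + N₃, δ, hδ, fun N hN Ω _ P _ ξ q f H hA => ?_⟩
  obtain ⟨-, hp2, θ, F, G, hR⟩ := hreg N (by omega) Ω P ξ q f H hA
  rw [← hC_def] at hR
  obtain ⟨hweak, hstrong, hmean, hfluct, hL1, hN1⟩ := hev N (by omega) ξ hA.xi
  have hpos := hpos N (by omega) ξ hA.xi Ω P q θ f H F G hR hA.f_lower
  have hweak := hweak Ω P q θ f H F G hR hA.f_lower
  have hf1 : 1 ≤ f := by linarith [hA.f_lower]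
  have hf0 : 0 < f := by linarith
  obtain ⟨hs1, hs2⟩ := hstrong Ω P q θ f H F G hR hf1
  obtain ⟨hi, hm⟩ := hmean Ω P q θ f H F G hR hf1 hA.f_upper
  rw [hp2]
  simp only at hL1 hN1 hs1 hs2 hm hweak hpos
  have hq : 0 < q := (pow_pos (by linarith) 3).trans_le hR.q_lower
  have hN0 : (0 : ℝ) < N := by linarith
  have hs0 : 0 < Real.sqrt N := Real.sqrt_pos.2 hN0
  have hL0 : 0 < Real.log N ^ ξ := by linarith
  have hpL : 0 ≤ (Real.log N ^ ξ) ^ 2 := sq_nonneg _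
  refine ⟨.of_real_le hpos fun ω hω => ?_, .of_real_le hweak fun ω hω => ?_, hi,
    hm.trans ?_, .of_real_le hs1 ?_, .of_real_le hs2 ?_, fun hf _ => ?_⟩
  · simp only [Set.mem_compl_iff, Set.mem_ofPred_eq, not_le] at hω
    exact hω
  · have h1 := two_add_gap_le hε₀ hA.f_lower
    simp only [Set.mem_compl_iff, Set.mem_ofPred_eq, not_le] at hω
    rw [Set.mem_ofPred_eq]
    refine lt_of_lt_of_le ?_ (neg_le_abs _)
    linarith only [h1, hω]
  · gcongr
    rw [hK]; norm_num
  · refine Set.compl_subset_compl.2 fun ω hω => ?_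
    rw [Set.mem_ofPred_eq] at hω ⊢
    refine hω.trans ?_
    gcongr
    rw [hK]; norm_num
  · refine Set.compl_subset_compl.2 fun ω hω v hv hv' => ?_
    obtain ⟨s, hs, hsv⟩ := hω v hv hv'
    refine ⟨s, hs, hsv.trans ?_⟩
    gcongr
    rw [hK]; linarith
  · refine .of_real_le (hfluct Ω P q θ f H F G hR hf hA.f_upper).1
      (Set.compl_subset_compl.2 fun ω hω => ?_)
    have h1 : |nonlinearPart P f H ω| ≤ 10 ^ 8 * ((Real.log N ^ ξ) ^ 2 / (f * Real.sqrt N)) := hω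
    rw [nonlinearPart, eMoment_one_eq, sub_sub] at h1
    refine h1.trans ?_
    gcongr
    rw [hK]; linarith

theorem tendstoInDistribution_maxEigenvalue {a₀ A₀ Cm Cq Cf ε₀ : ℝ} (ha₀ : 0 < a₀)
    (hA₀ : 10 ≤ A₀) (hCm : 0 < Cm) (hCq : 0 < Cq) {N : ℕ → ℕ} (hN : Tendsto N atTop atTop)
    (Ω : ℕ → Type u) [∀ k, MeasurableSpace (Ω k)] (P : ∀ k, Measure (Ω k))
    [∀ k, IsProbabilityMeasure (P k)] (ξ q f : ℕ → ℝ)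
    (H : ∀ k, Ω k → Matrix (Fin (N k)) (Fin (N k)) ℝ)
    (hA : ∀ k, Admissible (P k) a₀ A₀ Cm Cq Cf ε₀ (N k) (ξ k) (q k) (f k) (H k))
    (hf : ∀ k, 200 * (Real.log (N k)) ^ (2 * ξ k) ≤ f k) :
    TendstoInDistribution
      (fun k ω => Real.sqrt (N k / 2) * (maxEigenvalue (perturbed (f k) (H k ω)) -
        ∫ ω', maxEigenvalue (perturbed (f k) (H k ω')) ∂(P k)))
      atTop (fun x : ℝ => x) P (gaussianReal 0 1) where
  forall_aemeasurable k := (((measurable_maxEigenvalue (f k) (hA k).sparse.measurable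
    (hA k).sparse.symm).sub_const _).const_mul _).aemeasurable
  aemeasurable_limit := aemeasurable_id
  tendsto := by
    refine ProbabilityMeasure.tendsto_iff_tendsto_charFun.2 fun t => ?_
    simp only [ProbabilityMeasure.coe_mk, Measure.map_id']
    have hC : 0 < 2 * Real.exp 2 * Cm + Cq := by positivity
    obtain ⟨N₁, hreg⟩ := exists_isRegular.{u} (Cf := Cf) (ε₀ := ε₀) ha₀ hA₀ hCm hCq
    have hg : charFun (gaussianReal 0 1) t = (Real.exp (-(t ^ 2 / 2)) : ℝ) := by
      rw [charFun_gaussianReal]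
      push_cast
      congr 1
      simp
    rw [hg, Metric.tendsto_atTop']
    intro η hη
    obtain ⟨N₂, hev⟩ := exists_of_regime ha₀ hA₀
      (eventually_norm_charFun_sub_le.{u} (Cf := Cf) (A₀ := A₀) (Cq := Cq) hC hCm t (half_pos hη))
    obtain ⟨k₀, hk₀⟩ := eventually_atTop.1 (hN.eventually_ge_atTop (N₁ + N₂))
    refine ⟨k₀, fun k hk => ?_⟩
    have hk := hk₀ k hk.le
    obtain ⟨hp1, hp2, θ, F, G, hR⟩ := hreg (N k) (by omega) _ _ _ _ _ _ (hA k)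
    rw [dist_eq_norm]
    have hfk := hf k
    rw [hp2] at hfk
    exact (hev (N k) (by omega) (ξ k) (hA k).xi (Ω k) (P k) (ξ k) (q k) θ (f k) (H k) F G
      (hA k).sparse hp1 hR hfk (hA k).f_upper).trans_lt (half_lt_self hη)

end SparseRM

theorem theorem5p2 :
    -- `c ε₀` is the gap constant; it depends on `ε₀` only
    ∃ c : ℝ → ℝ, (∀ ε₀ : ℝ, 0 < ε₀ → 0 < c ε₀) ∧
    ∀ Cm Cq : ℝ, 0 < Cm → 0 < Cq →
    ∃ ν : ℝ, 0 < ν ∧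
    ∀ a₀ A₀ Cf ε₀ : ℝ, 0 < a₀ → 10 ≤ A₀ → 0 < Cf → 0 < ε₀ →
    ∃ (K C₀ : ℝ) (N₀ : ℕ) (δ : ℕ → ℝ), 0 < K ∧ 0 < C₀ ∧ Tendsto δ atTop (𝓝 0) ∧
    (∀ (N : ℕ), N₀ ≤ N →
      ∀ (Ω : Type*) [MeasurableSpace Ω] (P : Measure Ω) [IsProbabilityMeasure P] (ξ q f : ℝ)
        (H : Ω → Matrix (Fin N) (Fin N) ℝ),
      SparseRM.Admissible P a₀ A₀ Cm Cq Cf ε₀ N ξ q f H →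
      -- position of the largest eigenvalue
      SparseRM.HighProb P N ξ ν
        {ω | |SparseRM.maxEigenvalue (SparseRM.perturbed f (H ω)) - (f + 1 / f)| ≤ δ N} ∧
      -- gap
      SparseRM.HighProb P N ξ ν
        {ω | 2 + c ε₀ ≤ SparseRM.maxEigenvalue (SparseRM.perturbed f (H ω))} ∧
      -- expectation
      Integrable (fun ω => SparseRM.maxEigenvalue (SparseRM.perturbed f (H ω))) P ∧
      |(∫ ω, SparseRM.maxEigenvalue (SparseRM.perturbed f (H ω)) ∂P) - (f + 1 / f)| ≤
        K * (1 / f ^ 3 + 1 / (f ^ 2 * q) + 1 / (f * N)) ∧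
      -- precise position for large `f`
      SparseRM.HighProb P N ξ ν
        {ω | |SparseRM.maxEigenvalue (SparseRM.perturbed f (H ω)) - (f + 1 / f)| ≤
          K * (1 / f ^ 3 + 1 / (f ^ 2 * q) + (Real.log N) ^ ξ / Real.sqrt N)} ∧
      -- every normalized top eigenvector, with its sign suitably chosen
      SparseRM.HighProb P N ξ ν
        {ω | ∀ v : Fin N → ℝ, ∑ i, v i ^ 2 = 1 →
          (SparseRM.perturbed f (H ω)).mulVec v =
            SparseRM.maxEigenvalue (SparseRM.perturbed f (H ω)) • v →
          ∃ s : ℝ, (s = 1 ∨ s = -1) ∧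
            |(s • v) ⬝ᵥ SparseRM.unitVec N - (1 - 1 / (2 * f ^ 2))| ≤
              K * (1 / f ^ 3 + (Real.log N) ^ (2 * ξ) / (f * Real.sqrt N))} ∧
      -- fluctuations for large `f`
      (C₀ * (Real.log N) ^ (2 * ξ) ≤ f → 2 ≤ ξ →
        SparseRM.HighProb P N ξ ν
          {ω | |SparseRM.maxEigenvalue (SparseRM.perturbed f (H ω)) -
              ((∫ ω', SparseRM.maxEigenvalue (SparseRM.perturbed f (H ω')) ∂P) +
                1 / (N : ℝ) * ∑ i, ∑ j, H ω i j)| ≤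
            K * ((Real.log N) ^ (2 * ξ) / (f * Real.sqrt N))})) ∧
    -- central limit theorem, along any sequence of sizes tending to infinity
    (∀ (N : ℕ → ℕ), Tendsto N atTop atTop →
      ∀ (Ω : ℕ → Type*) [∀ k, MeasurableSpace (Ω k)] (P : ∀ k, Measure (Ω k))
        [∀ k, IsProbabilityMeasure (P k)] (ξ q f : ℕ → ℝ)
        (H : ∀ k, Ω k → Matrix (Fin (N k)) (Fin (N k)) ℝ),
      (∀ k, SparseRM.Admissible (P k) a₀ A₀ Cm Cq Cf ε₀ (N k) (ξ k) (q k) (f k) (H k)) →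
      (∀ k, C₀ * (Real.log (N k)) ^ (2 * ξ k) ≤ f k ∧ 2 ≤ ξ k) →
      TendstoInDistribution
        (fun k ω => Real.sqrt (N k / 2) *
          (SparseRM.maxEigenvalue (SparseRM.perturbed (f k) (H k ω)) -
            ∫ ω', SparseRM.maxEigenvalue (SparseRM.perturbed (f k) (H k ω')) ∂(P k)))
        atTop (fun x : ℝ => x) P (gaussianReal 0 1)) := by
  refine ⟨fun ε₀ => ε₀ ^ 2 / (2 * (1 + ε₀)), fun ε₀ h => by positivity, fun Cm Cq hCm hCq =>
    ⟨1 / 2, by norm_num, fun a₀ A₀ Cf ε₀ ha₀ hA₀ _ hε₀ => ?_⟩⟩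
  obtain ⟨N₀, δ, hδ, h⟩ :=
    SparseRM.exists_maxEigenvalue_estimates (Cf := Cf) ha₀ hA₀ hCm hCq hε₀ rfl
  -- The value `200` is the threshold at which the moment series becomes geometric in
  -- `fluctuationSum_momentScale_le`.
  exact ⟨_, 200, N₀, δ, by positivity, by norm_num, hδ, h,
    fun N hN Ω _ P _ ξ q f H hA hf => SparseRM.tendstoInDistribution_maxEigenvalue ha₀ hA₀ hCm hCq
      hN Ω P ξ q f H hA fun k => (hf k).1⟩
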